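/- **Setting.** Let $\sigma=\operatorname{diag}(-1,1,1)$, $e^{w\,\mathrm{ad}\,\sigma}B=e^{w\sigma}Be^{-w\sigma}$, let $*$ denote complex conjugation, and let $H^{1,1}(\mathbb R)=\{f\in L^2: f'\in L^2,\ xf\in L^2\}$. For $u,v\in H^{1,1}(\mathbb R)$ put $$U=\begin{pmatrix}0&u&v\\-u^*&0&0\\-v^*&0&0\end{pmatrix}$$ (focusing case). Let $m^\pm(x,z)$ be the Jost functions, i.e. the bounded solutions of $m^\pm(x,z)=I+\int_{\pm\infty}^x e^{iz(x-y)\mathrm{ad}\,\sigma}\,U(y)m^\pm(y,z)\,dy$ (all columns exist for $z\in\mathbb R$; the columns $m^-_1,m^+_2,m^+_3$ for $\operatorname{Im}z\ge0$, and $m^+_1,m^-_2,m^-_3$ for $\operatorname{Im}z\le0$). For $\lambda\in\mathbb R$ let $S(\lambda)=m^+(0,\lambda)^{-1}m^-(0,\lambda)=(s_{ij})$ be the transition matrix and $\rho_1=s_{21}/s_{11}$, $\rho_2=s_{31}/s_{11}$. The entry $s_{11}$ extends to $\operatorname{Im} z\ge 0$ by $s_{11}=\det(m^-_1,m^+_2,m^+_3)(0,z)$,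 and the entry $t_{11}$ of $S^{-1}$ extends to $\operatorname{Im}z\le0$ by $t_{11}=\det(m^+_1,m^-_2,m^-_3)(0,z)$. The Beals–Coifman solution normalized at $x\to+\infty$ is $$M=\Big(\tfrac{m_1^-}{s_{11}},m_2^+,m_3^+\Big)\ (\operatorname{Im}z\ge0),\qquad M=\Big(m_1^+,\ -\tfrac{(m_1^-\times m_3^+)^*(x,z^*)}{t_{11}(z)},\ \tfrac{(m_1^-\times m_2^+)^*(x,z^*)}{t_{11}(z)}\Big)\ (\operatorname{Im}z\le0),$$ and the one normalized at $x\to-\infty$ is $$\tilde M=\Big(m_1^-,\ -\tfrac{(m_1^+\times m_3^-)^*(x,z^*)}{s_{11}(z)},\ \tfrac{(m_1^+\times m_2^-)^*(x,z^*)}{s_{11}(z)}\Big)\ (\operatorname{Im}z\ge0),\qquad \tilde M=\Big(\tfrac{m_1^+}{t_{11}},m_2^-,m_3^-\Big)\ (\operatorname{Im}z\le0).$$ The zeros of $s_{11}$ in $\{\operatorname{Im}z\ge0\}$ are arbitrary (possibly infinitely many, of arbitrary order, possibly real). Let $S_\infty>0$ be such that $s_{11}(z)\ne0$ whenever $\operatorname{Im}z\ge0$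 and $|z|\ge S_\infty$. Let $\Sigma_\infty=\{|z|=S_\infty\}$, $\Sigma_\infty^\pm=\Sigma_\infty\cap\{\pm\operatorname{Im}z>0\}$, $\Sigma=\mathbb R\cup\Sigma_\infty$, and $\Omega_1=\{|z|>S_\infty,\operatorname{Im}z>0\}$, $\Omega_2=\{|z|>S_\infty,\operatorname{Im}z<0\}$, $\Omega_3=\{|z|<S_\infty,\operatorname{Im}z>0\}$, $\Omega_4=\{|z|<S_\infty,\operatorname{Im}z<0\}$. Orient $\Sigma$ so that $\Omega_1,\Omega_4$ lie on its $+$ side and $\Omega_2,\Omega_3$ on its $-$ side; $\Sigma_+=\partial\Omega_1\cup\partial\Omega_4$, $\Sigma_-=\partial\Omega_2\cup\partial\Omega_3$. Given $x_0\in\mathbb R$, let $M^{(0)}$ and $r_1,r_2$ be the matrix $M$ and the coefficients $\rho_1,\rho_2$ of the cut-off potential $U\chi_{(x_0,\infty)}$. Let $M^{(1)}(x,z)=I+\int_{x_0}^xe^{iz(x-y)\mathrm{ad}\,\sigma}UM^{(1)}dy$ and $M^{(2)}(x,z)=M^{(1)}(x,z)\,e^{i(x-x_0)z\,\mathrm{ad}\,\sigma}M^{(0)}(x_0,z)$.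 Set $\mathbf M=M$ on $\Omega_1\cup\Omega_2$ and $\mathbf M=M^{(2)}$ on $\Omega_3\cup\Omega_4$. The jump matrix $V$ on $\Sigma\setminus\{\pm S_\infty\}$ is $$V=\begin{pmatrix}1+|\rho_1|^2+|\rho_2|^2&\rho_1^*&\rho_2^*\\\rho_1&1&0\\\rho_2&0&1\end{pmatrix}\ (\lambda\in\mathbb R,|\lambda|>S_\infty),\qquad V=\begin{pmatrix}1&-r_1^*&-r_2^*\\-r_1&1+|r_1|^2&r_1r_2^*\\-r_2&r_1^*r_2&1+|r_2|^2\end{pmatrix}\ (\lambda\in\mathbb R,|\lambda|<S_\infty),$$ and on the circle $e^{ix_0\lambda\,\mathrm{ad}\,\sigma}V(\lambda)=M^{(2)}(x_0,\lambda)^{-1}M(x_0,\lambda)$ on $\Sigma_\infty^+$, $e^{ix_0\lambda\,\mathrm{ad}\,\sigma}V(\lambda)=M(x_0,\lambda)^{-1}M^{(2)}(x_0,\lambda)$ on $\Sigma_\infty^-$. Let $\tilde{\mathbf M}$ be the analogous matrix normalized at $x\to-\infty$: $\tilde{\mathbf M}=\tilde M$ on $\Omega_1\cup\Omega_2$; on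 $\Omega_3\cup\Omega_4$ it is built in the same way from the matrix $\tilde M$ of $U\chi_{(-\infty,-x_0)}$, with $-x_0$ in place of $x_0$ as base point. Let $A(z)=e^{-ixz\,\mathrm{ad}\,\sigma}\big(\mathbf M(x,z)^{-1}\tilde{\mathbf M}(x,z)\big)$, which is independent of $x$ (and is taken at $x=x_0$), and $\tilde V=A_-^{-1}VA_+$, with $A_\pm$ the boundary values from the $\pm$ side. For a function $f$ on $\partial\Omega_j$, $f\in H^{1,1}(\partial\Omega_j)$ means that on each smooth piece of $\partial\Omega_j\setminus\{\pm S_\infty\}$ one has $f\in L^2$, $f'\in L^2$ (distributional derivative), $\lambda f\in L^2$, and that at each of the points $\pm S_\infty$ the one-sided limits of $f$ along $\partial\Omega_j$ exist and match. Functions in $H^{1,1}(\Sigma_+)$ are those in $H^{1,1}(\partial\Omega_1)$ and $H^{1,1}(\partial\Omega_4)$, functions in $H^{1,1}(\Sigma_-)$ those in $H^{1,1}(\partial\Omega_2)$ and $H^{1,1}(\partial\Omega_3)$. **Proposition 5.4 (scattering data), with Proposition 5.5.** There is an absolute constant $\delta>0$ such that for all $u,v\in H^{1,1}(\mathbb R)$,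 all $S_\infty$ as above and all $x_0\in\mathbb R$ with $\int_{x_0}^\infty(|u|+|v|)\,dx<\delta$, the function $s_{11}$ of $U\chi_{(x_0,\infty)}$ has no zeros in $\{\operatorname{Im}z\ge0\}$, and $V$ admits a factorization $V=V_-^{-1}V_+$ on $\Sigma\setminus\{\pm S_\infty\}$ where 1. $V_\pm-I\in H^{1,1}(\Sigma_\pm)$; 2. $V_+\restriction_{\partial\Omega_1}-I$ and $V_-\restriction_{\partial\Omega_3}-I$ are strictly lower triangular, while $V_-\restriction_{\partial\Omega_2}-I$ and $V_+\restriction_{\partial\Omega_4}-I$ are strictly upper triangular. If moreover $\int_{-\infty}^{-x_0}(|u|+|v|)\,dx<\delta$, then the function $s_{11}$ of $U\chi_{(-\infty,-x_0)}$ has no zeros in $\{\operatorname{Im}z\ge0\}$, and $\tilde V$ admits a factorization $\tilde V=\tilde V_-^{-1}\tilde V_+$ on $\Sigma\setminus\{\pm S_\infty\}$ with $\tilde V_\pm-I\in H^{1,1}(\Sigma_\pm)$, where $\tilde V_+\restriction_{\partial\Omega_1}-I$ and $\tilde V_-\restriction_{\partial\Omega_3}-I$ are strictly upper triangular, while $\tilde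 V_-\restriction_{\partial\Omega_2}-I$ and $\tilde V_+\restriction_{\partial\Omega_4}-I$ are strictly lower triangular. -/

import Mathlib

open Set Filter Topology MeasureTheory

noncomputable section

namespace AKNS

/-! ### Sobolev spaces on the line and on the contour -/

/-- `f ∈ H¹(I)` for an open set `I ⊆ ℝ`: `f ∈ L²(I)` and the distributional derivative of `f` on
`I` is (given by) a function `g ∈ L²(I)`. -/
def MemH1On (I : Set ℝ) (f : ℝ → ℂ) : Prop :=
  MemLp f 2 (volume.restrict I) ∧
    ∃ g : ℝ → ℂ, MemLp g 2 (volume.restrict I) ∧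
      ∀ φ : ℝ → ℝ, ContDiff ℝ (⊤ : ℕ∞) φ → HasCompactSupport φ → tsupport φ ⊆ I →
        ∫ t in I, ((deriv φ t : ℝ) : ℂ) * f t = -∫ t in I, ((φ t : ℝ) : ℂ) * g t

/-- `H^{1,1}` on the curve `γ` parametrized by the open set `I`; `f` is the function in the
parameter, so that the requirements are `f ∈ H¹` and `z f ∈ L²` where `z = γ t` is the position. -/
def MemH11On (I : Set ℝ) (γ : ℝ → ℂ) (f : ℝ → ℂ) : Prop :=
  MemH1On I f ∧ MemLp (fun t => γ t * f t) 2 (volume.restrict I)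

/-- The weighted Sobolev space `H^{1,1}(ℝ)`. -/
def MemH11 (f : ℝ → ℂ) : Prop := MemH11On univ (fun x => (x : ℂ)) f

/-! ### The augmented contour -/

/-- The four components of the complement of the contour `ℝ ∪ {|z| = S}`:
`Ω₁ = {|z| > S, Im z > 0}`, `Ω₂ = {|z| > S, Im z < 0}`,
`Ω₃ = {|z| < S, Im z > 0}`, `Ω₄ = {|z| < S, Im z < 0}`. -/
inductive Region
  | Ω₁ | Ω₂ | Ω₃ | Ω₄

open Region

/-- The part `(-∞, -S) ∪ (S, ∞)` of the real line. -/
def outerLine (S : ℝ) : Set ℂ := {z | z.im = 0 ∧ S < |z.re|}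

/-- The part `(-S, S)` of the real line. -/
def innerLine (S : ℝ) : Set ℂ := {z | z.im = 0 ∧ |z.re| < S}

/-- The open upper half circle of radius `S`. -/
def upperArc (S : ℝ) : Set ℂ := {z | ‖z‖ = S ∧ 0 < z.im}

/-- The open lower half circle of radius `S`. -/
def lowerArc (S : ℝ) : Set ℂ := {z | ‖z‖ = S ∧ z.im < 0}

/-- The contour `ℝ ∪ {|z| = S}` without the two self-intersection points `± S`. -/
def contour (S : ℝ) : Set ℂ := outerLine S ∪ innerLine S ∪ upperArc S ∪ lowerArc S

/-- The boundary of a region without the two corners `± S`. -/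
def smoothBdry (S : ℝ) : Region → Set ℂ
  | Ω₁ => outerLine S ∪ upperArc S
  | Ω₂ => outerLine S ∪ lowerArc S
  | Ω₃ => innerLine S ∪ upperArc S
  | Ω₄ => innerLine S ∪ lowerArc S

/-- The part of the boundary of a region that lies on the real line, as a subset of `ℝ`. -/
def lineParam (S : ℝ) : Region → Set ℝ
  | Ω₁ => {t | S < |t|}
  | Ω₂ => {t | S < |t|}
  | Ω₃ => {t | |t| < S}
  | Ω₄ => {t | |t| < S}

/-- The angles `θ` for which `S e^{iθ}` lies on the boundary arc of a region. -/
def arcParam : Region → Set ℝ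
  | Ω₁ => Ioo 0 Real.pi
  | Ω₂ => Ioo (-Real.pi) 0
  | Ω₃ => Ioo 0 Real.pi
  | Ω₄ => Ioo (-Real.pi) 0

/-- The parametrization of the circle of radius `S` by the angle. -/
def arcMap (S : ℝ) (θ : ℝ) : ℂ := S * Complex.exp (Complex.I * θ)

/-- `f ∈ H^{1,1}(∂Ω)`: `f` is in `H^{1,1}` of every smooth piece of `∂Ω`, and at each of the two
corners `± S` it matches from two sides, i.e. it has a limit along `∂Ω`. -/
structure MemH11Bdry (S : ℝ) (R : Region) (f : ℂ → ℂ) : Prop where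
  line : MemH11On (lineParam S R) (fun t => (t : ℂ)) (fun t => f (t : ℂ))
  arc : MemH11On (arcParam R) (arcMap S) (fun θ => f (arcMap S θ))
  match_right : ∃ l : ℂ, Tendsto f (𝓝[smoothBdry S R] (S : ℂ)) (𝓝 l)
  match_left : ∃ l : ℂ, Tendsto f (𝓝[smoothBdry S R] (-S : ℂ)) (𝓝 l)

open Classical in
/-- The region on the `+` side of the oriented contour: the contour is the positively oriented
boundary of `Ω₁ ∪ Ω₄`. -/
def plusRegion (S : ℝ) (z : ℂ) : Region := if z ∈ smoothBdry S Ω₁ then Ω₁ else Ω₄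

open Classical in
/-- The region on the `-` side of the oriented contour, one of `Ω₂`, `Ω₃`. -/
def minusRegion (S : ℝ) (z : ℂ) : Region := if z ∈ smoothBdry S Ω₂ then Ω₂ else Ω₃

/-! ### Jost solutions -/

/-- `3 × 3` complex matrices; row and column `0, 1, 2` here are `1, 2, 3` on paper. -/
abbrev Mat := Matrix (Fin 3) (Fin 3) ℂ

/-- The diagonal of `σ = diag(-1, 1, 1)`. -/
def sig : Fin 3 → ℂ := ![-1, 1, 1]

/-- The potential matrix `U(x)` in the focusing case. -/
def potential (u v : ℝ → ℂ) (x : ℝ) : Mat :=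
  !![0, u x, v x; -star (u x), 0, 0; -star (v x), 0, 0]

/-- `e^{w ad σ} B = e^{w σ} B e^{-w σ}`. -/
def expAd (w : ℂ) (B : Mat) : Mat :=
  Matrix.diagonal (fun i => Complex.exp (w * sig i)) * B *
    Matrix.diagonal (fun i => Complex.exp (-(w * sig i)))

/-- The `j`-th column of `e^{w ad σ} B` as a function of the `j`-th column `b` of `B`. -/
def expAdCol (j : Fin 3) (w : ℂ) (b : Fin 3 → ℂ) : Fin 3 → ℂ :=
  fun i => Complex.exp (w * (sig i - sig j)) * b i

/-- `expAdCol` does compute the columns of `expAd`. -/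
theorem expAd_col (w : ℂ) (B : Mat) (i j : Fin 3) :
    expAd w B i j = expAdCol j w (fun k => B k j) i := by
  simp only [expAd, expAdCol, Matrix.mul_diagonal, Matrix.diagonal_mul]
  rw [mul_sub, sub_eq_add_neg, Complex.exp_add]
  ring

/-- `f` is the `j`-th column of the Jost function `m⁻(·, z)`: the bounded continuous solution of
`f(x) = e_j + ∫_{-∞}^x (e^{iz(x-y) ad σ} U f)(y) dy`. -/
def IsJostMinus (u v : ℝ → ℂ) (j : Fin 3) (z : ℂ) (f : ℝ → Fin 3 → ℂ) : Prop :=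
  Continuous f ∧ (∃ C : ℝ, ∀ x, ‖f x‖ ≤ C) ∧
    ∀ x : ℝ, f x = Pi.single j 1 +
      ∫ y in Iic x, expAdCol j (Complex.I * z * (x - y)) ((potential u v y).mulVec (f y))

/-- `f` is the `j`-th column of the Jost function `m⁺(·, z)`: the bounded continuous solution of
`f(x) = e_j + ∫_{+∞}^x (e^{iz(x-y) ad σ} U f)(y) dy`. -/
def IsJostPlus (u v : ℝ → ℂ) (j : Fin 3) (z : ℂ) (f : ℝ → Fin 3 → ℂ) : Prop :=
  Continuous f ∧ (∃ C : ℝ, ∀ x, ‖f x‖ ≤ C) ∧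
    ∀ x : ℝ, f x = Pi.single j 1 -
      ∫ y in Ioi x, expAdCol j (Complex.I * z * (x - y)) ((potential u v y).mulVec (f y))

/-- The column `m⁻_j(x, z)`. For `U ∈ L¹` it exists and is unique for `Im z ≥ 0` if `j` is the
first column, and for `Im z ≤ 0` if `j` is the second or third one. -/
def jostMinus (u v : ℝ → ℂ) (j : Fin 3) (x : ℝ) (z : ℂ) : Fin 3 → ℂ :=
  Classical.epsilon (IsJostMinus u v j z) x

/-- The column `m⁺_j(x, z)`. For `U ∈ L¹` it exists and is unique for `Im z ≤ 0` if `j` is the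
first column, and for `Im z ≥ 0` if `j` is the second or third one. -/
def jostPlus (u v : ℝ → ℂ) (j : Fin 3) (x : ℝ) (z : ℂ) : Fin 3 → ℂ :=
  Classical.epsilon (IsJostPlus u v j z) x

/-- The matrix with the given columns. -/
def ofCols (a b c : Fin 3 → ℂ) : Mat := Matrix.of fun i j => (![a, b, c] j) i

/-- The matrix `m⁻(x, z)` (all columns exist for real `z`). -/
def mMinus (u v : ℝ → ℂ) (x : ℝ) (z : ℂ) : Mat :=
  ofCols (jostMinus u v 0 x z) (jostMinus u v 1 x z) (jostMinus u v 2 x z)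

/-- The matrix `m⁺(x, z)` (all columns exist for real `z`). -/
def mPlus (u v : ℝ → ℂ) (x : ℝ) (z : ℂ) : Mat :=
  ofCols (jostPlus u v 0 x z) (jostPlus u v 1 x z) (jostPlus u v 2 x z)

/-! ### Scattering matrix and Beals-Coifman solutions -/

/-- The transition matrix `S(t)`, `t ∈ ℝ`: `ψ⁻ = ψ⁺ S` with `ψ^± = m^± e^{itxσ}`,
read off at `x = 0`. -/
def scatMat (u v : ℝ → ℂ) (t : ℝ) : Mat := (mPlus u v 0 t)⁻¹ * mMinus u v 0 t

/-- The reflection coefficient `ρ₁ = s₂₁ / s₁₁` on the real line. -/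
def rho₁ (u v : ℝ → ℂ) (t : ℝ) : ℂ := scatMat u v t 1 0 / scatMat u v t 0 0

/-- The reflection coefficient `ρ₂ = s₃₁ / s₁₁` on the real line. -/
def rho₂ (u v : ℝ → ℂ) (t : ℝ) : ℂ := scatMat u v t 2 0 / scatMat u v t 0 0

/-- The analytic extension of `s₁₁` to `Im z ≥ 0`, by Cramer's rule for `ψ⁻ = ψ⁺ S`:
`s₁₁ = det (m⁻₁, m⁺₂, m⁺₃)`, where the right-hand side does not depend on `x`. -/
def s₁₁ (u v : ℝ → ℂ) (z : ℂ) : ℂ :=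
  (ofCols (jostMinus u v 0 0 z) (jostPlus u v 1 0 z) (jostPlus u v 2 0 z)).det

/-- The analytic extension to `Im z ≤ 0` of the entry `t₁₁` of `T = S⁻¹`, by Cramer's rule for
`ψ⁺ = ψ⁻ T`: `t₁₁ = det (m⁺₁, m⁻₂, m⁻₃)`. -/
def t₁₁ (u v : ℝ → ℂ) (z : ℂ) : ℂ :=
  (ofCols (jostPlus u v 0 0 z) (jostMinus u v 1 0 z) (jostMinus u v 2 0 z)).det

/-- The Beals-Coifman solution normalized at `x → +∞`, for `Im z ≥ 0`. -/
def bcUpper (u v : ℝ → ℂ) (x : ℝ) (z : ℂ) : Mat :=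
  ofCols ((s₁₁ u v z)⁻¹ • jostMinus u v 0 x z) (jostPlus u v 1 x z) (jostPlus u v 2 x z)

/-- The Beals-Coifman solution normalized at `x → +∞`, for `Im z ≤ 0`. Its second and third column
are `- (m⁻₁ × m⁺₃)^*(x, z^*) / t₁₁(z)` and `(m⁻₁ × m⁺₂)^*(x, z^*) / t₁₁(z)`. -/
def bcLower (u v : ℝ → ℂ) (x : ℝ) (z : ℂ) : Mat :=
  ofCols (jostPlus u v 0 x z)
    ((t₁₁ u v z)⁻¹ • -star (crossProduct (jostMinus u v 0 x (star z)) (jostPlus u v 2 x (star z))))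
    ((t₁₁ u v z)⁻¹ • star (crossProduct (jostMinus u v 0 x (star z)) (jostPlus u v 1 x (star z))))

/-- The Beals-Coifman solution normalized at `x → -∞`, for `Im z ≥ 0`. -/
def bcUpper' (u v : ℝ → ℂ) (x : ℝ) (z : ℂ) : Mat :=
  ofCols (jostMinus u v 0 x z)
    ((s₁₁ u v z)⁻¹ • -star (crossProduct (jostPlus u v 0 x (star z)) (jostMinus u v 2 x (star z))))
    ((s₁₁ u v z)⁻¹ • star (crossProduct (jostPlus u v 0 x (star z)) (jostMinus u v 1 x (star z))))

/-- The Beals-Coifman solution normalized at `x → -∞`, for `Im z ≤ 0`. -/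
def bcLower' (u v : ℝ → ℂ) (x : ℝ) (z : ℂ) : Mat :=
  ofCols ((t₁₁ u v z)⁻¹ • jostPlus u v 0 x z) (jostMinus u v 1 x z) (jostMinus u v 2 x z)

/-- The potential cut off to `(a, ∞)`. -/
def cutRight (a : ℝ) (u : ℝ → ℂ) : ℝ → ℂ := (Ioi a).indicator u

/-- The potential cut off to `(-∞, a)`. -/
def cutLeft (a : ℝ) (u : ℝ → ℂ) : ℝ → ℂ := (Iio a).indicator u

/-- `f` is the `j`-th column of the solution of the Volterra equation started at `a`:
`f(x) = e_j + ∫_a^x (e^{iz(x-y) ad σ} U f)(y) dy`. -/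
def IsVolterra (u v : ℝ → ℂ) (a : ℝ) (j : Fin 3) (z : ℂ) (f : ℝ → Fin 3 → ℂ) : Prop :=
  Continuous f ∧ ∀ x : ℝ, f x = Pi.single j 1 +
    ∫ y in a..x, expAdCol j (Complex.I * z * (x - y)) ((potential u v y).mulVec (f y))

/-- The matrix solution of the Volterra equation started at `a`; it is defined for all `z`. -/
def volterra (u v : ℝ → ℂ) (a : ℝ) (x : ℝ) (z : ℂ) : Mat :=
  ofCols (Classical.epsilon (IsVolterra u v a 0 z) x) (Classical.epsilon (IsVolterra u v a 1 z) x)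
    (Classical.epsilon (IsVolterra u v a 2 z) x)

/-- The piecewise analytic matrix `𝐌(x, z)`, with its continuous extension to the closure of each
region: the Beals-Coifman solution outside the circle; inside the circle, the Beals-Coifman
solution at `x₀` of the potential cut off to `(x₀, ∞)`, propagated from `x₀` to `x`. -/
def bigM (u v : ℝ → ℂ) (x₀ : ℝ) (R : Region) (x : ℝ) (z : ℂ) : Mat :=
  match R with
  | Ω₁ => bcUpper u v x z
  | Ω₂ => bcLower u v x z
  | Ω₃ => volterra u v x₀ x z *
      expAd (Complex.I * z * (x - x₀)) (bcUpper (cutRight x₀ u) (cutRight x₀ v) x₀ z)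
  | Ω₄ => volterra u v x₀ x z *
      expAd (Complex.I * z * (x - x₀)) (bcLower (cutRight x₀ u) (cutRight x₀ v) x₀ z)

/-- The analogue of `𝐌(x, z)` with normalization at `x → -∞`; inside the circle it is built from
the potential cut off to `(-∞, -x₀)` and propagated from `-x₀` to `x`. -/
def bigM' (u v : ℝ → ℂ) (x₀ : ℝ) (R : Region) (x : ℝ) (z : ℂ) : Mat :=
  match R with
  | Ω₁ => bcUpper' u v x z
  | Ω₂ => bcLower' u v x z
  | Ω₃ => volterra u v (-x₀) x z *
      expAd (Complex.I * z * (x + x₀)) (bcUpper' (cutLeft (-x₀) u) (cutLeft (-x₀) v) (-x₀) z)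
  | Ω₄ => volterra u v (-x₀) x z *
      expAd (Complex.I * z * (x + x₀)) (bcLower' (cutLeft (-x₀) u) (cutLeft (-x₀) v) (-x₀) z)

/-! ### Jump matrices -/

/-- The jump matrix on `|t| > S`, in terms of the reflection coefficients. -/
def outerJump (a b : ℂ) : Mat :=
  !![1 + a * star a + b * star b, star a, star b; a, 1, 0; b, 0, 1]

/-- The jump matrix on `|t| < S`, in terms of the reflection coefficients of the cut-off
potential. -/
def innerJump (a b : ℂ) : Mat :=
  !![1, -star a, -star b; -a, 1 + a * star a, a * star b; -b, star a * b, 1 + b * star b]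

open Classical in
/-- The jump matrix `V` on the contour: explicit on the real line; on the circle it is
`e^{-ixz ad σ} (𝐌₋(x, z)⁻¹ 𝐌₊(x, z))`, which does not depend on `x` and is taken at `x = x₀`. -/
def jumpV (u v : ℝ → ℂ) (S x₀ : ℝ) (z : ℂ) : Mat :=
  if z ∈ outerLine S then outerJump (rho₁ u v z.re) (rho₂ u v z.re)
  else if z ∈ innerLine S then
    innerJump (rho₁ (cutRight x₀ u) (cutRight x₀ v) z.re)
      (rho₂ (cutRight x₀ u) (cutRight x₀ v) z.re)
  else expAd (-(Complex.I * z * x₀))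
    ((bigM u v x₀ (minusRegion S z) x₀ z)⁻¹ * bigM u v x₀ (plusRegion S z) x₀ z)

/-- The auxiliary matrix `A` of a region: `𝐌' = 𝐌 e^{ixz ad σ} A`, where `𝐌'` is the analogue of
`𝐌` normalized at `x → -∞`; `A` does not depend on `x`, and is read off at `x = x₀`. -/
def auxA (u v : ℝ → ℂ) (x₀ : ℝ) (R : Region) (z : ℂ) : Mat :=
  expAd (-(Complex.I * z * x₀)) ((bigM u v x₀ R x₀ z)⁻¹ * bigM' u v x₀ R x₀ z)

/-- The conjugated jump matrix `A₋⁻¹ V A₊`. -/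
def jumpV' (u v : ℝ → ℂ) (S x₀ : ℝ) (z : ℂ) : Mat :=
  (auxA u v x₀ (minusRegion S z) z)⁻¹ * jumpV u v S x₀ z * auxA u v x₀ (plusRegion S z) z

/-! ### Triangular factorizations -/

/-- Strictly lower triangular. -/
def StrictLower (B : Mat) : Prop := ∀ i j : Fin 3, i ≤ j → B i j = 0

/-- Strictly upper triangular. -/
def StrictUpper (B : Mat) : Prop := ∀ i j : Fin 3, j ≤ i → B i j = 0

/-- `V = V₋⁻¹ V₊` on the contour, where `V₊ - I ∈ H^{1,1}(∂Ω₁ ∪ ∂Ω₄)` and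
`V₋ - I ∈ H^{1,1}(∂Ω₂ ∪ ∂Ω₃)` (each boundary with its own matching conditions), the restrictions of
`V₊ - I` to `∂Ω₁` and of `V₋ - I` to `∂Ω₃` have the triangularity `P`, and the restrictions of
`V₋ - I` to `∂Ω₂` and of `V₊ - I` to `∂Ω₄` have the triangularity `Q`. -/
structure IsTriangularFactorization (S : ℝ) (P Q : Mat → Prop) (V Vm Vp : ℂ → Mat) : Prop where
  factor : ∀ z ∈ contour S, V z = (Vm z)⁻¹ * Vp z
  sobolev₁ : ∀ i j, MemH11Bdry S Ω₁ (fun z => (Vp z - 1) i j)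
  sobolev₂ : ∀ i j, MemH11Bdry S Ω₂ (fun z => (Vm z - 1) i j)
  sobolev₃ : ∀ i j, MemH11Bdry S Ω₃ (fun z => (Vm z - 1) i j)
  sobolev₄ : ∀ i j, MemH11Bdry S Ω₄ (fun z => (Vp z - 1) i j)
  triangular₁ : ∀ z ∈ smoothBdry S Ω₁, P (Vp z - 1)
  triangular₂ : ∀ z ∈ smoothBdry S Ω₂, Q (Vm z - 1)
  triangular₃ : ∀ z ∈ smoothBdry S Ω₃, P (Vm z - 1)
  triangular₄ : ∀ z ∈ smoothBdry S Ω₄, Q (Vp z - 1)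

end AKNS

end

open AKNS

/-! ### Calculus of absolutely continuous functions, as primitives of locally integrable functions.
-/

noncomputable section
namespace AKNS

/-! On the real line the factorization is algebra: `outerJump_eq` and `innerJump_eq` are Gauss
decompositions. On the upper arc V is itself unipotent lower triangular. Indeed m⁺₂ and m⁺₃ at `x₀`
depend only on the potential on (x₀, ∞), so the Beals-Coifman matrices of U and of the cut-off
potential share their last two columns there and their quotient changes only the first column
(`bcUpper_eq_mul`). The lower half plane follows from the Schwarz symmetry M(z*)^* M(z) = I
(`bcLower_mul_bcUpper`).

Everything thus reduces to pairs of scalar functions p on ∂Ω₁ and q on ∂Ω₃ (`ScalarData`): p = ρ on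
the outer line, q = r on the inner line, and p - q = arcV on the upper arc, where arcV stands for
the entries `arcV₁`, `arcV₂` of V. The factors on ∂Ω₂ and ∂Ω₄ are obtained by conjugation. At the
corners arcV = ρ - r (`Zeros.arcV_real`). Hence q may be continued to the arc by the affine function
of Re z interpolating r(±S), with p = q + arcV, and both functions match at ±S.

The analytic part is H¹ regularity in the spectral parameter. It is obtained without differentiating
in that parameter: the increments over a step h are shown to be O(h) in L² (`BLip`). This class is
stable under products and under inverses bounded away from zero, and weak compactness of difference
quotients then produces a weak derivative (`BLip.memH1On`). By Gronwall, increments of a Jost column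
are controlled by oscillatory integrals of U times that column. Since U couples only oscillating
with non-oscillating components, and the latter are a constant plus a plain primitive, one exchange
of integrals (`enorm_iterated_le`) replaces the column by functions independent of the spectral
parameter. Minkowski's inequality then combines with Plancherel on the line (`kerBound_line_diff`)
and with an L² bound for the Laplace transform on the arc (`kerBound_arc_diff`). The weighted bound
for λρ comes from an integration by parts using u', v' ∈ L² (`AdmD.memLp_mul_scatMat`). Division by
s₁₁ is harmless because s₁₁ → 1 along ℝ by the Riemann-Lebesgue lemma and s₁₁ is continuous and
nonzero on the remaining compact sets.

For the normalization at -∞, the reflection x ↦ -x, U(x) ↦ -U(-x), z ↦ -z exchanges the two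
normalizations and the two sides of the contour. So the conjugated jump at z is the inverse of the
jump of the reflected potential at -z (`Zeros.jumpV'_eq`), and the first half applies with the
factors interchanged.

The cut-off potentials have no zeros of s₁₁ because s₁₁ is the Hermitian pairing of two Jost
columns, both close to e₁ when the potential is small in L¹ (`s₁₁_ne_zero_of_small`). Finally, u and
v are replaced by absolutely continuous representatives, which changes none of the objects involved.
-/

/-- `F` is a primitive of the locally integrable function `f`. -/
structure Prim (F f : ℝ → ℂ) : Prop where
  int : ∀ a b, IntervalIntegrable f volume a b
  sub : ∀ a b, F b - F a = ∫ t in a..b, f t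

namespace Prim

variable {F G f g : ℝ → ℂ}

theorem cont (h : Prim F f) : Continuous F := by
  have : F = fun x => F 0 + ∫ t in (0:ℝ)..x, f t := by
    funext x; rw [← h.sub]; ring
  rw [this]
  exact continuous_const.add (intervalIntegral.continuous_primitive h.int 0)

theorem const (c : ℂ) : Prim (fun _ => c) (fun _ => 0) :=
  ⟨fun _ _ => by simp, fun _ _ => by simp⟩

theorem add (hF : Prim F f) (hG : Prim G g) : Prim (fun x => F x + G x) (fun x => f x + g x) :=
  ⟨fun a b => (hF.int a b).add (hG.int a b), fun a b => by
    rw [intervalIntegral.integral_add (hF.int a b) (hG.int a b), ← hF.sub, ← hG.sub]; ring⟩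

theorem const_mul (c : ℂ) (hF : Prim F f) : Prim (fun x => c * F x) (fun x => c * f x) :=
  ⟨fun a b => (hF.int a b).const_mul c, fun a b => by
    rw [intervalIntegral.integral_const_mul, ← hF.sub]; ring⟩

theorem star' (hF : Prim F f) : Prim (fun x => star (F x)) (fun x => star (f x)) := by
  refine ⟨fun a b => ?_, fun a b => ?_⟩
  · exact ⟨Complex.conjCLE.toContinuousLinearMap.integrable_comp (hF.int a b).1,
      Complex.conjCLE.toContinuousLinearMap.integrable_comp (hF.int a b).2⟩
  · rw [← star_sub, hF.sub]
    exact (intervalIntegral.intervalIntegral_conj (f := f)).symm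

theorem congr_deriv (hF : Prim F f) (h : ∀ x, f x = g x) : Prim F g := by
  have : f = g := funext h
  exact this ▸ hF

theorem congr_fun (hF : Prim F f) (h : ∀ x, F x = G x) : Prim G f := by
  have : F = G := funext h
  exact this ▸ hF

theorem of_hasDerivAt (h : ∀ x, HasDerivAt F (f x) x) (hf : Continuous f) : Prim F f :=
  ⟨fun a b => hf.intervalIntegrable a b, fun a b =>
    (intervalIntegral.integral_eq_sub_of_hasDerivAt (fun x _ => h x)
      (hf.intervalIntegrable a b)).symm⟩

/-- Each factor is a constant plus a primitive, hence absolutely continuous with the expected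
derivative almost everywhere, and integration by parts for absolutely continuous functions applies.
-/
theorem mul_real {F G f g : ℝ → ℝ} (hfi : ∀ a b, IntervalIntegrable f volume a b)
    (hgi : ∀ a b, IntervalIntegrable g volume a b)
    (hF : ∀ a b, F b - F a = ∫ t in a..b, f t) (hG : ∀ a b, G b - G a = ∫ t in a..b, g t)
    (a b : ℝ) : F b * G b - F a * G a = ∫ t in a..b, (f t * G t + F t * g t) := by
  have key : ∀ {F f : ℝ → ℝ}, (∀ a b, IntervalIntegrable f volume a b) →
      (∀ a b, F b - F a = ∫ t in a..b, f t) → AbsolutelyContinuousOnInterval F a b ∧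
        ∀ᵐ x, x ∈ uIcc a b → HasDerivAt F (f x) x := by
    intro F f hfi hF
    have e : F = fun x => (∫ t in a..x, f t) + F a := by
      funext x; rw [← hF]; ring
    have e' : AbsolutelyContinuousOnInterval (fun _ : ℝ => F a) a b :=
      (LipschitzOnWith.absolutelyContinuousOnInterval (K := 0)
        (LipschitzWith.const (F a)).lipschitzOnWith)
    constructor
    · rw [e]
      exact ((hfi a b).absolutelyContinuousOnInterval_intervalIntegral (c := a) (by simp)).add e'
    · filter_upwards [(hfi a b).ae_hasDerivAt_integral] with x hx hxm
      have := (hx hxm a (by simp)).add_const (F a)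
      rwa [← e] at this
  obtain ⟨hF1, hF2⟩ := key hfi hF
  obtain ⟨hG1, hG2⟩ := key hgi hG
  rw [← hF1.integral_deriv_mul_eq_sub hG1]
  apply intervalIntegral.integral_congr_ae
  filter_upwards [hF2, hG2] with x h1 h2 hx
  have hx' := uIoc_subset_uIcc hx
  rw [(h1 hx').deriv, (h2 hx').deriv]

theorem re (hF : Prim F f) : (∀ a b, IntervalIntegrable (fun t => (f t).re) volume a b) ∧
    ∀ a b, (F b).re - (F a).re = ∫ t in a..b, (f t).re := by
  refine ⟨fun a b => ⟨(hF.int a b).1.re, (hF.int a b).2.re⟩, fun a b => ?_⟩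
  rw [← Complex.sub_re, hF.sub]
  exact ((Complex.reCLM.intervalIntegral_comp_comm (hF.int a b))).symm

theorem im (hF : Prim F f) : (∀ a b, IntervalIntegrable (fun t => (f t).im) volume a b) ∧
    ∀ a b, (F b).im - (F a).im = ∫ t in a..b, (f t).im := by
  refine ⟨fun a b => ⟨(hF.int a b).1.im, (hF.int a b).2.im⟩, fun a b => ?_⟩
  rw [← Complex.sub_im, hF.sub]
  exact ((Complex.imCLM.intervalIntegral_comp_comm (hF.int a b))).symm

/-- The product rule. -/
theorem mul (hF : Prim F f) (hG : Prim G g) :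
    Prim (fun x => F x * G x) (fun x => f x * G x + F x * g x) := by
  have hi : ∀ a b, IntervalIntegrable (fun x => f x * G x + F x * g x) volume a b := fun a b =>
    ((hF.int a b).mul_continuousOn hG.cont.continuousOn).add
      ((hG.int a b).continuousOn_mul hF.cont.continuousOn)
  refine ⟨hi, fun a b => ?_⟩
  -- Real and imaginary parts of F G are combinations of these four real products.
  have rr := mul_real hF.re.1 hG.re.1 hF.re.2 hG.re.2 a b
  have ii := mul_real hF.im.1 hG.im.1 hF.im.2 hG.im.2 a b
  have ri := mul_real hF.re.1 hG.im.1 hF.re.2 hG.im.2 a b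
  have ir := mul_real hF.im.1 hG.re.1 hF.im.2 hG.re.2 a b
  have c {F : ℝ → ℂ} (h : Continuous F) : Continuous (fun x => (F x).re) ∧
    Continuous (fun x => (F x).im) := ⟨Complex.continuous_re.comp h, Complex.continuous_im.comp h⟩
  have int {H k K h : ℝ → ℝ} (h1 : ∀ a b, IntervalIntegrable h volume a b) (hK : Continuous K)
      (hH : Continuous H) (h2 : ∀ a b, IntervalIntegrable k volume a b) :
      IntervalIntegrable (fun t => h t * K t + H t * k t) volume a b :=
    ((h1 a b).mul_continuousOn hK.continuousOn).add ((h2 a b).continuousOn_mul hH.continuousOn)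
  apply Complex.ext
  · have := Complex.reCLM.intervalIntegral_comp_comm (hi a b)
    simp only [Complex.reCLM_apply] at this
    rw [← this]
    have e : (F b * G b - F a * G a).re = ((F b).re * (G b).re - (F a).re * (G a).re) -
      ((F b).im * (G b).im - (F a).im * (G a).im) := by
      simp only [Complex.sub_re, Complex.mul_re]; ring
    rw [e, rr, ii, ← intervalIntegral.integral_sub
      (int hF.re.1 (c hG.cont).1 (c hF.cont).1 hG.re.1)
      (int hF.im.1 (c hG.cont).2 (c hF.cont).2 hG.im.1)]
    congr 1; funext t
    simp only [Complex.add_re, Complex.mul_re]; ring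
  · have := Complex.imCLM.intervalIntegral_comp_comm (hi a b)
    simp only [Complex.imCLM_apply] at this
    rw [← this]
    have e : (F b * G b - F a * G a).im = ((F b).re * (G b).im - (F a).re * (G a).im) +
      ((F b).im * (G b).re - (F a).im * (G a).re) := by
      simp only [Complex.sub_im, Complex.mul_im]; ring
    rw [e, ri, ir, ← intervalIntegral.integral_add
      (int hF.re.1 (c hG.cont).2 (c hF.cont).1 hG.im.1)
      (int hF.im.1 (c hG.cont).1 (c hF.cont).2 hG.re.1)]
    congr 1; funext t
    simp only [Complex.add_im, Complex.mul_im]; ring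

theorem sum {ι : Type*} (s : Finset ι) {F f : ι → ℝ → ℂ} (h : ∀ i ∈ s, Prim (F i) (f i)) :
    Prim (fun x => ∑ i ∈ s, F i x) (fun x => ∑ i ∈ s, f i x) := by
  classical
  induction s using Finset.induction_on with
  | empty => simpa using const 0
  | insert a s ha ih =>
    have h1 := (h a (by simp)).add (ih fun i hi => h i (by simp [hi]))
    simpa [Finset.sum_insert ha] using h1

theorem eq_of_zero (hF : Prim F f) (h : ∀ x, f x = 0) (a b : ℝ) : F a = F b := by
  have := hF.sub a b
  simp only [h, intervalIntegral.integral_zero] at this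
  exact (sub_eq_zero.1 this).symm

theorem cexp (c : ℂ) : Prim (fun x => Complex.exp (c * x)) (fun x => c * Complex.exp (c * x)) := by
  refine of_hasDerivAt (fun x => ?_) (by fun_prop)
  have h1 : HasDerivAt (fun y : ℝ => c * (y : ℂ)) c x := by
    simpa using (Complex.ofRealCLM.hasDerivAt (x := x)).const_mul c
  simpa [mul_comm] using h1.cexp

end Prim

end AKNS
end

/-! ### Gronwall's inequality in extended nonnegative reals. -/

noncomputable section
namespace AKNS

open scoped ENNReal NNReal BoundedContinuousFunction

/-! ### Gronwall's inequality on `(-∞, x]` -/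

/-- The primitive of `q` vanishing at `-∞`. -/
def cumul (q : ℝ → ℝ) (x : ℝ) : ℝ := ∫ y in Iic x, q y

variable {q : ℝ → ℝ}

theorem cumul_nonneg (h0 : ∀ y, 0 ≤ q y) (x : ℝ) : 0 ≤ cumul q x :=
  integral_nonneg h0

theorem cumul_le (hq : Integrable q) (h0 : ∀ y, 0 ≤ q y) (x : ℝ) : cumul q x ≤ ∫ y, q y :=
  setIntegral_le_integral hq (Eventually.of_forall h0)

theorem cumul_sub (hq : Integrable q) (a b : ℝ) : cumul q b - cumul q a = ∫ t in a..b, q t :=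
  (intervalIntegral.integral_Iic_sub_Iic hq.integrableOn hq.integrableOn)

theorem cumul_continuous (hq : Integrable q) : Continuous (cumul q) := by
  have : cumul q = fun x => cumul q 0 + ∫ t in (0:ℝ)..x, q t := by
    funext x; rw [← cumul_sub hq]; ring
  rw [this]
  exact continuous_const.add
    (intervalIntegral.continuous_primitive (fun a b => hq.intervalIntegrable) 0)

/-- `cumul q` is only absolutely continuous, so the derivative of its powers comes by induction on
`n` from the product rule. -/
theorem cumul_pow_sub (hq : Integrable q) (n : ℕ) (a b : ℝ) :
    cumul q b ^ (n + 1) - cumul q a ^ (n + 1) = ∫ t in a..b, (n + 1) * (q t * cumul q t ^ n) := by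
  have hi : ∀ n a b, IntervalIntegrable (fun t => ((n : ℕ) + 1 : ℝ) * (q t * cumul q t ^ n))
      volume a b := fun n a b =>
    ((hq.intervalIntegrable (a := a) (b := b)).mul_continuousOn
      ((cumul_continuous hq).pow n).continuousOn).const_mul _
  induction n generalizing a b with
  | zero => simpa using cumul_sub hq a b
  | succ n ih =>
    have := Prim.mul_real (hi n) (fun a b => hq.intervalIntegrable) ih (cumul_sub hq) a b
    rw [pow_succ _ (n + 1), pow_succ _ (n + 1), this]
    congr 1; funext t; push_cast; ring

/-- The normalized powers of `cumul`. -/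
def cumulPow (q : ℝ → ℝ) (n : ℕ) (x : ℝ) : ℝ≥0∞ := ENNReal.ofReal (cumul q x ^ n / n.factorial)

theorem measurable_cumulPow (hq : Integrable q) (n : ℕ) : Measurable (cumulPow q n) :=
  ENNReal.measurable_ofReal.comp (((cumul_continuous hq).pow n).div_const _).measurable

/-- On [a, x] the integral is exact up to the term Q(a)^(n+1)/(n+1)! ≥ 0. That term is dropped
before letting a → -∞, since an inequality is all the iteration needs. -/
theorem lintegral_cumulPow_le (hq : Integrable q) (h0 : ∀ y, 0 ≤ q y) (n : ℕ) (x : ℝ) :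
    ∫⁻ y in Iic x, ENNReal.ofReal (q y) * cumulPow q n y ≤ cumulPow q (n + 1) x := by
  have hnn : ∀ y, 0 ≤ q y * (cumul q y ^ n / n.factorial) := fun y =>
    mul_nonneg (h0 y) (div_nonneg (pow_nonneg (cumul_nonneg h0 y) n) (Nat.cast_nonneg _))
  have hi : Integrable (fun y => q y * (cumul q y ^ n / n.factorial)) := by
    refine hq.mul_bdd (c := (∫ y, q y) ^ n / n.factorial)
      (((cumul_continuous hq).pow n).div_const _).aestronglyMeasurable
      (Eventually.of_forall fun y => ?_)
    rw [Real.norm_of_nonneg (div_nonneg (pow_nonneg (cumul_nonneg h0 y) n) (Nat.cast_nonneg _))]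
    gcongr
    · exact cumul_nonneg h0 y
    · exact cumul_le hq h0 y
  have e : ∀ y, ENNReal.ofReal (q y) * cumulPow q n y =
      ENNReal.ofReal (q y * (cumul q y ^ n / n.factorial)) := fun y =>
    (ENNReal.ofReal_mul (h0 y)).symm
  simp_rw [e]
  rw [← ofReal_integral_eq_lintegral_ofReal hi.integrableOn (Eventually.of_forall hnn)]
  apply ENNReal.ofReal_le_ofReal
  refine le_of_tendsto (intervalIntegral_tendsto_integral_Iic x hi.integrableOn tendsto_id) ?_
  refine Eventually.of_forall fun a => ?_
  have h1 := cumul_pow_sub hq n a x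
  have e2 : ∫ t in (id a)..x, q t * (cumul q t ^ n / n.factorial) =
      (∫ t in a..x, ((n : ℝ) + 1) * (q t * cumul q t ^ n)) / (n + 1).factorial := by
    rw [← intervalIntegral.integral_div]
    congr 1; funext t
    rw [Nat.factorial_succ]; push_cast
    have : (n.factorial : ℝ) ≠ 0 := by positivity
    field_simp
  rw [e2, ← h1]
  gcongr
  have := pow_nonneg (cumul_nonneg h0 a) (n + 1)
  linarith

theorem tendsto_pow_factorial (M : ℝ≥0∞) (hM : M ≠ ∞) (c : ℝ) :
    Tendsto (fun n : ℕ => M * ENNReal.ofReal (c ^ n / n.factorial)) atTop (𝓝 0) := by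
  have h := FloorSemiring.tendsto_pow_div_factorial_atTop c
  have h2 := ENNReal.Tendsto.const_mul (a := M) (ENNReal.tendsto_ofReal h) (Or.inr hM)
  simpa using h2

/-- Iterating n times bounds d by β ∑_{k<n} Q^k/k! + M Q^n/n!. The a priori bound `M` does not
appear in the conclusion: it only makes the remainder vanish. Measurability of `d` is not needed, as
its lower integral is only compared with integrals of measurable functions. -/
theorem gronwall_const (hq : Integrable q) (h0 : ∀ y, 0 ≤ q y) {d : ℝ → ℝ≥0∞} {β M : ℝ≥0∞}
    (hM : M ≠ ∞) {X : ℝ} (hd : ∀ x ≤ X, d x ≤ β + ∫⁻ y in Iic x, ENNReal.ofReal (q y) * d y)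
    (hdM : ∀ x ≤ X, d x ≤ M) {x : ℝ} (hx : x ≤ X) :
    d x ≤ β * ENNReal.ofReal (Real.exp (∫ y, q y)) := by
  have hmq : AEMeasurable (fun y => ENNReal.ofReal (q y)) := hq.aemeasurable.ennreal_ofReal
  have key : ∀ n : ℕ, ∀ x ≤ X, d x ≤ β * (∑ k ∈ Finset.range n, cumulPow q k x) +
      M * cumulPow q n x := by
    intro n
    induction n with
    | zero => intro x hx; simpa [cumulPow] using hdM x hx
    | succ n ih =>
      intro x hx
      refine (hd x hx).trans ?_
      have h1 : ∫⁻ y in Iic x, ENNReal.ofReal (q y) * d y ≤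
          ∫⁻ y in Iic x, ((∑ k ∈ Finset.range n, β * (ENNReal.ofReal (q y) * cumulPow q k y)) +
            M * (ENNReal.ofReal (q y) * cumulPow q n y)) := by
        refine setLIntegral_mono_ae' measurableSet_Iic (Eventually.of_forall fun y hy => ?_)
        refine (mul_le_mul_right (ih y (le_trans hy hx)) _).trans (le_of_eq ?_)
        rw [mul_add, Finset.mul_sum, Finset.mul_sum]
        congr 1
        · exact Finset.sum_congr rfl fun k _ => by ring
        · ring
      have hm : ∀ k (c : ℝ≥0∞), AEMeasurable
          (fun y => c * (ENNReal.ofReal (q y) * cumulPow q k y)) (volume.restrict (Iic x)) :=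
        fun k c => ((hmq.mul (measurable_cumulPow hq k).aemeasurable).const_mul c).restrict
      rw [lintegral_add_right' _ (hm n M), lintegral_finsetSum' _ (fun k _ => hm k β)] at h1
      have hc : ∀ k (c : ℝ≥0∞), ∫⁻ y in Iic x, c * (ENNReal.ofReal (q y) * cumulPow q k y) ≤
          c * cumulPow q (k + 1) x := fun k c => by
        rw [lintegral_const_mul'' (f := fun y => ENNReal.ofReal (q y) * cumulPow q k y) _
          ((hmq.mul (measurable_cumulPow hq k).aemeasurable).restrict)]
        gcongr
        exact lintegral_cumulPow_le hq h0 k x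
      calc β + ∫⁻ y in Iic x, ENNReal.ofReal (q y) * d y
          ≤ β + ((∑ k ∈ Finset.range n, β * cumulPow q (k + 1) x) + M * cumulPow q (n + 1) x) := by
            gcongr
            refine h1.trans ?_
            gcongr with k _
            · exact hc k β
            · exact hc n M
        _ = _ := by
            rw [Finset.sum_range_succ', mul_add, Finset.mul_sum]
            have : cumulPow q 0 x = 1 := by simp [cumulPow]
            rw [this, mul_one]; ring
  have hle : ∀ n : ℕ, d x ≤ β * ENNReal.ofReal (Real.exp (∫ y, q y)) +
      M * ENNReal.ofReal (cumul q x ^ n / n.factorial) := by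
    intro n
    refine (key n x hx).trans ?_
    gcongr
    · have : ∑ k ∈ Finset.range n, cumulPow q k x =
          ENNReal.ofReal (∑ k ∈ Finset.range n, cumul q x ^ k / k.factorial) := by
        rw [ENNReal.ofReal_sum_of_nonneg]
        · rfl
        · intro k _
          exact div_nonneg (pow_nonneg (cumul_nonneg h0 x) _) (Nat.cast_nonneg _)
      rw [this]
      apply ENNReal.ofReal_le_ofReal
      exact (Real.sum_le_exp_of_nonneg (cumul_nonneg h0 x) n).trans
        (Real.exp_le_exp.2 (cumul_le hq h0 x))
    · exact le_rfl
  have hlim := (tendsto_pow_factorial M hM (cumul q x)).const_add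
    (β * ENNReal.ofReal (Real.exp (∫ y, q y)))
  rw [add_zero] at hlim
  exact ge_of_tendsto' hlim hle

/-- The integral term x ↦ ∫_{-∞}^x q d satisfies the hypothesis of `gronwall_const`, its
inhomogeneity being at most ∫_{-∞}^X q α for x ≤ X. -/
theorem gronwall (hq : Integrable q) (h0 : ∀ y, 0 ≤ q y) {d α : ℝ → ℝ≥0∞} {M : ℝ≥0∞}
    (hM : M ≠ ∞) {X : ℝ} (hα : AEMeasurable α)
    (hd : ∀ x ≤ X, d x ≤ α x + ∫⁻ y in Iic x, ENNReal.ofReal (q y) * d y)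
    (hdM : ∀ x ≤ X, d x ≤ M) :
    d X ≤ α X + ENNReal.ofReal (Real.exp (∫ y, q y)) *
      ∫⁻ y in Iic X, ENNReal.ofReal (q y) * α y := by
  have hmq : AEMeasurable (fun y => ENNReal.ofReal (q y)) := hq.aemeasurable.ennreal_ofReal
  refine (hd X le_rfl).trans ?_
  gcongr
  rw [mul_comm]
  refine gronwall_const hq h0 (d := fun x => ∫⁻ y in Iic x, ENNReal.ofReal (q y) * d y)
    (M := (∫⁻ y, ENNReal.ofReal (q y)) * M) (X := X) ?_ ?_ ?_ le_rfl
  · refine ENNReal.mul_ne_top ?_ hM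
    rw [← ofReal_integral_eq_lintegral_ofReal hq (Eventually.of_forall h0)]
    exact ENNReal.ofReal_ne_top
  · intro x hx
    calc ∫⁻ y in Iic x, ENNReal.ofReal (q y) * d y
        ≤ ∫⁻ y in Iic x, (ENNReal.ofReal (q y) * α y +
            ENNReal.ofReal (q y) * ∫⁻ w in Iic y, ENNReal.ofReal (q w) * d w) := by
          refine setLIntegral_mono_ae' measurableSet_Iic (Eventually.of_forall fun y hy => ?_)
          rw [← mul_add]
          gcongr
          exact hd y (le_trans hy hx)
      _ = (∫⁻ y in Iic x, ENNReal.ofReal (q y) * α y) + _ :=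
          lintegral_add_left' (hmq.mul hα).restrict _
      _ ≤ _ := by
          gcongr
  · intro x hx
    calc ∫⁻ y in Iic x, ENNReal.ofReal (q y) * d y
        ≤ ∫⁻ y in Iic x, ENNReal.ofReal (q y) * M :=
          setLIntegral_mono_ae' measurableSet_Iic (Eventually.of_forall fun y hy => by
            gcongr; exact hdM y (le_trans hy hx))
      _ ≤ ∫⁻ y, ENNReal.ofReal (q y) * M := setLIntegral_le_lintegral _ _
      _ = _ := lintegral_mul_const'' _ hmq

end AKNS
end

/-! ### Volterra equations from -∞: uniqueness, and existence with a parameter. -/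

noncomputable section
namespace AKNS

open scoped ENNReal NNReal BoundedContinuousFunction

/-! ### Volterra equations on `(-∞, x]` -/

/-- A measurable integrable potential. -/
structure Pot (u v : ℝ → ℂ) : Prop where
  mu : Measurable u
  mv : Measurable v
  iu : Integrable u
  iv : Integrable v

/-- The size of the potential. -/
def wt (u v : ℝ → ℂ) (y : ℝ) : ℝ := ‖u y‖ + ‖v y‖

theorem wt_nonneg (u v : ℝ → ℂ) (y : ℝ) : 0 ≤ wt u v y := add_nonneg (norm_nonneg _) (norm_nonneg _)

variable {u v : ℝ → ℂ}

theorem Pot.wt_int (h : Pot u v) : Integrable (wt u v) := h.iu.norm.add h.iv.norm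

theorem Pot.wt_meas (h : Pot u v) : Measurable (wt u v) := h.mu.norm.add h.mv.norm

theorem potential_mulVec (u v : ℝ → ℂ) (y : ℝ) (w : Fin 3 → ℂ) :
    (potential u v y).mulVec w =
      ![u y * w 1 + v y * w 2, -star (u y) * w 0, -star (v y) * w 0] := by
  funext i
  fin_cases i <;> simp [potential, Matrix.mulVec, dotProduct, Fin.sum_univ_three]

theorem norm_potential_mulVec_le (u v : ℝ → ℂ) (y : ℝ) (w : Fin 3 → ℂ) (i : Fin 3) :
    ‖(potential u v y).mulVec w i‖ ≤ wt u v y * ‖w‖ := by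
  rw [potential_mulVec]
  have h := fun i => norm_le_pi_norm w i
  have hu := norm_nonneg (u y)
  have hv := norm_nonneg (v y)
  have hw := norm_nonneg w
  fin_cases i
  · change ‖u y * w 1 + v y * w 2‖ ≤ (‖u y‖ + ‖v y‖) * ‖w‖
    refine (norm_add_le _ _).trans ?_
    rw [norm_mul, norm_mul, add_mul]
    gcongr
    · exact h 1
    · exact h 2
  · change ‖-star (u y) * w 0‖ ≤ (‖u y‖ + ‖v y‖) * ‖w‖
    rw [norm_mul, norm_neg, norm_star]
    exact mul_le_mul (le_add_of_nonneg_right hv) (h 0) (norm_nonneg _) (by positivity)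
  · change ‖-star (v y) * w 0‖ ≤ (‖u y‖ + ‖v y‖) * ‖w‖
    rw [norm_mul, norm_neg, norm_star]
    exact mul_le_mul (le_add_of_nonneg_left hu) (h 0) (norm_nonneg _) (by positivity)

/-- The integrand of the Volterra equation with multiplier `E`. -/
def vker (u v : ℝ → ℂ) (E : ℝ → Fin 3 → ℂ) (f : ℝ → Fin 3 → ℂ) (x y : ℝ) : Fin 3 → ℂ :=
  fun i => E (x - y) i * (potential u v y).mulVec (f y) i

theorem norm_vker_le {E : ℝ → Fin 3 → ℂ} (hE : ∀ t, 0 ≤ t → ∀ i, ‖E t i‖ ≤ 1) (f : ℝ → Fin 3 → ℂ)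
    {x y : ℝ} (h : y ≤ x) : ‖vker u v E f x y‖ ≤ wt u v y * ‖f y‖ := by
  refine (pi_norm_le_iff_of_nonneg (mul_nonneg (wt_nonneg _ _ _) (norm_nonneg _))).2 fun i => ?_
  rw [vker, norm_mul]
  calc _ ≤ 1 * (wt u v y * ‖f y‖) := mul_le_mul (hE _ (sub_nonneg.2 h) i)
        (norm_potential_mulVec_le u v y _ i) (norm_nonneg _) zero_le_one
    _ = _ := one_mul _

theorem measurable_vker (hP : Pot u v) {E : ℝ → Fin 3 → ℂ} (hE : ∀ i, Continuous fun t => E t i)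
    {f : ℝ → Fin 3 → ℂ} (hf : Continuous f) (x : ℝ) : Measurable (vker u v E f x) := by
  refine measurable_pi_iff.2 fun i => ?_
  refine Measurable.mul ((hE i).comp (continuous_const.sub continuous_id)).measurable ?_
  have hu := hP.mu
  have hv := hP.mv
  have hfi : ∀ i, Measurable fun y => f y i := fun i => ((continuous_apply i).comp hf).measurable
  have h0 := hfi 0
  have h1 := hfi 1
  have h2 := hfi 2
  have hs : Measurable (star : ℂ → ℂ) := continuous_star.measurable
  simp_rw [potential_mulVec]
  fin_cases i
  · exact (hu.mul h1).add (hv.mul h2)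
  · exact (hs.comp hu).neg.mul h0
  · exact (hs.comp hv).neg.mul h0

theorem integrableOn_vker (hP : Pot u v) {E : ℝ → Fin 3 → ℂ} (hE : ∀ i, Continuous fun t => E t i)
    (hE1 : ∀ t, 0 ≤ t → ∀ i, ‖E t i‖ ≤ 1)
    {f : ℝ → Fin 3 → ℂ} (hf : Continuous f) {C : ℝ} (hC : ∀ x, ‖f x‖ ≤ C) (x : ℝ) :
    IntegrableOn (vker u v E f x) (Iic x) := by
  refine Integrable.mono' (hP.wt_int.integrableOn.mul_const C)
    (measurable_vker hP hE hf x).aestronglyMeasurable ?_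
  refine (ae_restrict_mem measurableSet_Iic).mono fun y hy => ?_
  refine (norm_vker_le hE1 f hy).trans ?_
  gcongr
  · exact wt_nonneg _ _ _
  · exact hC y

theorem vker_sub (E : ℝ → Fin 3 → ℂ) (f g : ℝ → Fin 3 → ℂ) (x y : ℝ) :
    vker u v E f x y - vker u v E g x y = vker u v E (fun y => f y - g y) x y := by
  funext i
  simp only [vker, Pi.sub_apply, Matrix.mulVec_sub]; ring

theorem enorm_integral_vker_le {E : ℝ → Fin 3 → ℂ} (hE : ∀ t, 0 ≤ t → ∀ i, ‖E t i‖ ≤ 1)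
    (f : ℝ → Fin 3 → ℂ) (x : ℝ) : ‖∫ y in Iic x, vker u v E f x y‖ₑ ≤
      ∫⁻ y in Iic x, ENNReal.ofReal (wt u v y) * ‖f y‖ₑ := by
  refine (enorm_integral_le_lintegral_enorm _).trans ?_
  refine setLIntegral_mono_ae' measurableSet_Iic (Eventually.of_forall fun y hy => ?_)
  rw [← ofReal_norm, ← ofReal_norm, ← ENNReal.ofReal_mul (wt_nonneg _ _ _)]
  exact ENNReal.ofReal_le_ofReal (norm_vker_le hE f hy)

theorem enorm_integral_vker_sub_le (hP : Pot u v) {E : ℝ → Fin 3 → ℂ}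
    (hE : ∀ i, Continuous fun t => E t i) (hE1 : ∀ t, 0 ≤ t → ∀ i, ‖E t i‖ ≤ 1)
    {f g : ℝ → Fin 3 → ℂ} (hf : Continuous f) (hg : Continuous g)
    {C D : ℝ} (hC : ∀ x, ‖f x‖ ≤ C) (hD : ∀ x, ‖g x‖ ≤ D) (x : ℝ) :
    ‖(∫ y in Iic x, vker u v E f x y) - ∫ y in Iic x, vker u v E g x y‖ₑ ≤
      ∫⁻ y in Iic x, ENNReal.ofReal (wt u v y) * ‖f y - g y‖ₑ := by
  rw [← integral_sub (integrableOn_vker hP hE hE1 hf hC x) (integrableOn_vker hP hE hE1 hg hD x)]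
  simp_rw [vker_sub]
  exact enorm_integral_vker_le hE1 _ x

/-- The difference satisfies Gronwall's inequality with β = 0, boundedness of both solutions
supplying the a priori constant. -/
theorem volterra_unique (hP : Pot u v) {E : ℝ → Fin 3 → ℂ}
    (hE : ∀ i, Continuous fun t => E t i) (hE1 : ∀ t, 0 ≤ t → ∀ i, ‖E t i‖ ≤ 1)
    {f g h : ℝ → Fin 3 → ℂ} (hf : Continuous f) (hg : Continuous g)
    {C D : ℝ} (hC : ∀ x, ‖f x‖ ≤ C) (hD : ∀ x, ‖g x‖ ≤ D)
    (ef : ∀ x, f x = h x + ∫ y in Iic x, vker u v E f x y)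
    (eg : ∀ x, g x = h x + ∫ y in Iic x, vker u v E g x y) : f = g := by
  funext x
  have := gronwall_const hP.wt_int (wt_nonneg u v) (d := fun x => ‖f x - g x‖ₑ) (β := 0)
    (M := ENNReal.ofReal (C + D)) ENNReal.ofReal_ne_top (X := x) (fun x _ => ?_) (fun x _ => ?_)
    le_rfl
  · rw [zero_mul, nonpos_iff_eq_zero, enorm_eq_zero, sub_eq_zero] at this
    exact this
  · have e : f x - g x = (∫ y in Iic x, vker u v E f x y) - ∫ y in Iic x, vker u v E g x y := by
      rw [ef x, eg x]; abel
    simp only [zero_add]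
    rw [e]
    exact enorm_integral_vker_sub_le hP hE hE1 hf hg hC hD x
  · rw [← ofReal_norm]
    exact ENNReal.ofReal_le_ofReal ((norm_sub_le _ _).trans (add_le_add (hC x) (hD x)))

section Existence

variable {Z : Type*} [TopologicalSpace Z] [FirstCountableTopology Z] {E : ℝ → Z → Fin 3 → ℂ}

/-- Dominated convergence with majorant `wt u v y * ‖F‖`: for y different from the first coordinate
of the limit point, the indicator of the half line is locally constant there. First countability of
`Z` allows dominated convergence along neighbourhood filters. -/
theorem continuous_volterra (hP : Pot u v)
    (hE : ∀ i, Continuous fun p : ℝ × Z => E p.1 p.2 i)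
    (hE1 : ∀ t, 0 ≤ t → ∀ z i, ‖E t z i‖ ≤ 1) (F : ℝ × Z →ᵇ (Fin 3 → ℂ)) :
    Continuous fun p : ℝ × Z =>
      ∫ y in Iic p.1, vker u v (fun t => E t p.2) (fun y => F (y, p.2)) p.1 y := by
  refine continuous_iff_continuousAt.2 fun p₀ => ?_
  simp_rw [← integral_indicator (measurableSet_Iic (α := ℝ))]
  have hF : ∀ z, Continuous fun y => F (y, z) := fun z => by fun_prop
  have hEz : ∀ z i, Continuous fun t => E t z i := fun z i =>
    (hE i).comp (f := fun t : ℝ => (t, z)) (by fun_prop)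
  refine continuousAt_of_dominated (bound := fun y => wt u v y * ‖F‖) ?_ ?_
    (hP.wt_int.mul_const _) ?_
  · exact Eventually.of_forall fun p =>
      ((measurable_vker hP (hEz p.2) (hF p.2) p.1).indicator measurableSet_Iic).aestronglyMeasurable
  · refine Eventually.of_forall fun p => Eventually.of_forall fun y => ?_
    by_cases hy : y ∈ Iic p.1
    · rw [indicator_of_mem hy]
      refine (norm_vker_le (fun t ht i => hE1 t ht p.2 i) _ hy).trans ?_
      gcongr
      · exact wt_nonneg _ _ _
      · exact F.norm_coe_le_norm _
    · rw [indicator_of_notMem hy, norm_zero]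
      exact mul_nonneg (wt_nonneg _ _ _) (norm_nonneg _)
  · have : ∀ᵐ y : ℝ, y ≠ p₀.1 := by simp [ae_iff]
    refine this.mono fun y hy => ?_
    have hc : ContinuousAt (fun p : ℝ × Z =>
        vker u v (fun t => E t p.2) (fun y => F (y, p.2)) p.1 y) p₀ := by
      refine (continuous_pi fun i => ?_).continuousAt
      refine ((hE i).comp (f := fun p : ℝ × Z => (p.1 - y, p.2)) (by fun_prop)).mul ?_
      exact (continuous_apply i).comp (Continuous.matrix_mulVec continuous_const
        (F.continuous.comp (by fun_prop)))
    rcases lt_or_gt_of_ne hy with h | h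
    · refine hc.congr ?_
      have : ∀ᶠ p : ℝ × Z in 𝓝 p₀, y < p.1 :=
        continuous_fst.continuousAt.eventually (lt_mem_nhds h)
      exact this.mono fun p hp => (indicator_of_mem (mem_Iic.2 hp.le) _).symm
    · refine (continuousAt_const (y := (0 : Fin 3 → ℂ))).congr ?_
      have : ∀ᶠ p : ℝ × Z in 𝓝 p₀, p.1 < y :=
        continuous_fst.continuousAt.eventually (gt_mem_nhds h)
      exact this.mono fun p hp => (indicator_of_notMem (by simpa using hp) _).symm

/-- The Volterra operator on bounded continuous functions. -/
def volterraOp (hP : Pot u v) (hE : ∀ i, Continuous fun p : ℝ × Z => E p.1 p.2 i)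
    (hE1 : ∀ t, 0 ≤ t → ∀ z i, ‖E t z i‖ ≤ 1) (h F : ℝ × Z →ᵇ (Fin 3 → ℂ)) :
    ℝ × Z →ᵇ (Fin 3 → ℂ) :=
  h + BoundedContinuousFunction.ofNormedAddCommGroup
    (fun p : ℝ × Z => ∫ y in Iic p.1, vker u v (fun t => E t p.2) (fun y => F (y, p.2)) p.1 y)
    (continuous_volterra hP hE hE1 F) (∫ y, wt u v y * ‖F‖) (fun p => by
      refine (norm_integral_le_of_norm_le (hP.wt_int.mul_const ‖F‖).integrableOn
        ((ae_restrict_mem measurableSet_Iic).mono fun y hy =>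
          (norm_vker_le (fun t ht i => hE1 t ht p.2 i) _ hy).trans
            (mul_le_mul_of_nonneg_left (F.norm_coe_le_norm _) (wt_nonneg _ _ _)))).trans ?_
      exact setIntegral_le_integral (hP.wt_int.mul_const _)
        (Eventually.of_forall fun y => mul_nonneg (wt_nonneg _ _ _) (norm_nonneg _)))

/-- Each application costs one more integration against `wt`, and `lintegral_cumulPow_le` produces
the factorial. This is what dispenses with any smallness of the potential. -/
theorem volterraOp_iterate_le (hP : Pot u v) (hE : ∀ i, Continuous fun p : ℝ × Z => E p.1 p.2 i)
    (hE1 : ∀ t, 0 ≤ t → ∀ z i, ‖E t z i‖ ≤ 1) (h F G : ℝ × Z →ᵇ (Fin 3 → ℂ)) (n : ℕ) (p : ℝ × Z) :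
    ‖((volterraOp hP hE hE1 h)^[n] F) p - ((volterraOp hP hE hE1 h)^[n] G) p‖ₑ ≤
      ENNReal.ofReal (dist F G) * cumulPow (wt u v) n p.1 := by
  have hmq : AEMeasurable (fun y => ENNReal.ofReal (wt u v y)) :=
    hP.wt_int.aemeasurable.ennreal_ofReal
  induction n generalizing p with
  | zero =>
    rw [Function.iterate_zero, id, id, cumulPow]
    simp only [pow_zero, Nat.factorial_zero, Nat.cast_one, div_one, ENNReal.ofReal_one, mul_one]
    rw [← ofReal_norm, ← dist_eq_norm]
    exact ENNReal.ofReal_le_ofReal (BoundedContinuousFunction.dist_coe_le_dist p)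
  | succ n ih =>
    rw [Function.iterate_succ_apply', Function.iterate_succ_apply']
    set F' := (volterraOp hP hE hE1 h)^[n] F
    set G' := (volterraOp hP hE hE1 h)^[n] G
    have e : volterraOp hP hE hE1 h F' p - volterraOp hP hE hE1 h G' p =
      (∫ y in Iic p.1, vker u v (fun t => E t p.2) (fun y => F' (y, p.2)) p.1 y) -
      ∫ y in Iic p.1, vker u v (fun t => E t p.2) (fun y => G' (y, p.2)) p.1 y :=
        add_sub_add_left_eq_sub _ _ _
    rw [e]
    refine (enorm_integral_vker_sub_le hP
      (fun i => (hE i).comp (f := fun t : ℝ => (t, p.2)) (by fun_prop))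
      (fun t ht i => hE1 t ht p.2 i) (by fun_prop) (by fun_prop)
      (fun x => F'.norm_coe_le_norm _) (fun x => G'.norm_coe_le_norm _) p.1).trans ?_
    calc _ ≤ ∫⁻ y in Iic p.1, ENNReal.ofReal (dist F G) *
          (ENNReal.ofReal (wt u v y) * cumulPow (wt u v) n y) := by
          refine lintegral_mono fun y => ?_
          refine (mul_le_mul_right (ih (y, p.2)) _).trans (le_of_eq ?_)
          ring
      _ = ENNReal.ofReal (dist F G) *
          ∫⁻ y in Iic p.1, ENNReal.ofReal (wt u v y) * cumulPow (wt u v) n y :=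
          lintegral_const_mul'' (f := fun y => ENNReal.ofReal (wt u v y) * cumulPow (wt u v) n y) _
            ((hmq.mul (measurable_cumulPow hP.wt_int n).aemeasurable).restrict)
      _ ≤ _ := by
          gcongr
          exact lintegral_cumulPow_le hP.wt_int (wt_nonneg u v) n p.1

/-- Some iterate of `volterraOp` contracts, and its fixed point is fixed by the operator itself.
Working on bounded continuous functions of (x, z) yields joint continuity in the parameter together
with existence. -/
theorem volterra_exists (hP : Pot u v) (hE : ∀ i, Continuous fun p : ℝ × Z => E p.1 p.2 i)
    (hE1 : ∀ t, 0 ≤ t → ∀ z i, ‖E t z i‖ ≤ 1) (h : ℝ × Z →ᵇ (Fin 3 → ℂ)) :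
    ∃ F : ℝ × Z →ᵇ (Fin 3 → ℂ), ∀ x z, F (x, z) = h (x, z) +
      ∫ y in Iic x, vker u v (fun t => E t z) (fun y => F (y, z)) x y := by
  set Q := ∫ y, wt u v y
  obtain ⟨n, hn⟩ : ∃ n : ℕ, Q ^ n / n.factorial < 1 / 2 :=
    ((FloorSemiring.tendsto_pow_div_factorial_atTop Q).eventually
      (gt_mem_nhds (by norm_num))).exists
  have hc : ContractingWith (1 / 2 : ℝ≥0) (volterraOp hP hE hE1 h)^[n] := by
    refine ⟨by rw [← NNReal.coe_lt_coe]; norm_num, LipschitzWith.of_dist_le_mul fun F G => ?_⟩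
    refine (BoundedContinuousFunction.dist_le (by positivity)).2 fun p => ?_
    have h1 := volterraOp_iterate_le hP hE hE1 h F G n p
    rw [← ofReal_norm, cumulPow, ← ENNReal.ofReal_mul dist_nonneg,
      ENNReal.ofReal_le_ofReal_iff (mul_nonneg dist_nonneg (div_nonneg
        (pow_nonneg (cumul_nonneg (wt_nonneg u v) _) _) (Nat.cast_nonneg _)))] at h1
    rw [dist_eq_norm]
    refine h1.trans ?_
    rw [mul_comm]
    have h2 : cumul (wt u v) p.1 ^ n / n.factorial ≤ Q ^ n / n.factorial := by
      gcongr
      · exact cumul_nonneg (wt_nonneg u v) _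
      · exact cumul_le hP.wt_int (wt_nonneg u v) _
    refine mul_le_mul_of_nonneg_right (h2.trans (hn.le.trans ?_)) dist_nonneg
    simp
  have hfix := hc.isFixedPt_fixedPoint_iterate
  exact ⟨_, fun x z => (DFunLike.congr_fun hfix (x, z)).symm⟩

end Existence

end AKNS
end

/-! ### Jost solutions: construction, bounds, limits, and reflection to pass from m⁻ to m⁺. -/

noncomputable section
namespace AKNS

open scoped ENNReal NNReal BoundedContinuousFunction

variable {u v : ℝ → ℂ} {j : Fin 3} {z : ℂ}

/-! ### Existence and uniqueness of the Jost solutions -/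

/-- The diagonal of `σ` as real numbers. -/
def sigR : Fin 3 → ℝ := ![-1, 1, 1]

theorem sig_eq (i : Fin 3) : sig i = (sigR i : ℂ) := by fin_cases i <;> simp [sig, sigR]

/-- The half plane in which the `j`-th column of `m⁻` is defined. -/
def Good (j : Fin 3) (z : ℂ) : Prop := ∀ i, 0 ≤ z.im * (sigR i - sigR j)

theorem good_zero : Good 0 z ↔ 0 ≤ z.im := by
  refine ⟨fun h => ?_, fun h i => mul_nonneg h ?_⟩
  · have := h 1
    simp only [sigR, Matrix.cons_val_one, Matrix.cons_val_zero] at this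
    linarith
  · fin_cases i <;> simp [sigR]

theorem good_of_ne (hj : j ≠ 0) : Good j z ↔ z.im ≤ 0 := by
  have hs : sigR j = 1 := by fin_cases j <;> simp_all [sigR]
  refine ⟨fun h => ?_, fun h i => mul_nonneg_of_nonpos_of_nonpos h ?_⟩
  · have := h 0
    have h0 : sigR 0 = -1 := rfl
    rw [hs, h0] at this
    linarith
  · rw [hs]; fin_cases i <;> simp [sigR]

theorem good_real (j : Fin 3) (t : ℝ) : Good j t := fun i => by simp

/-- The multiplier `e^{izt(σ_i - σ_j)}`. -/
def jE (j : Fin 3) (z : ℂ) (t : ℝ) (i : Fin 3) : ℂ :=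
  Complex.exp (Complex.I * z * t * (sig i - sig j))

theorem norm_jE (j : Fin 3) (z : ℂ) (t : ℝ) (i : Fin 3) :
    ‖jE j z t i‖ = Real.exp (-(t * (z.im * (sigR i - sigR j)))) := by
  rw [jE, Complex.norm_exp, sig_eq, sig_eq]
  congr 1
  have : Complex.I * z * t * (sigR i - sigR j : ℂ) =
    Complex.I * z * ((t * (sigR i - sigR j) : ℝ) : ℂ) := by push_cast; ring
  rw [this, Complex.re_mul_ofReal]
  simp; ring

theorem norm_jE_le (hz : Good j z) (t : ℝ) (ht : 0 ≤ t) (i : Fin 3) : ‖jE j z t i‖ ≤ 1 := by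
  rw [norm_jE, Real.exp_le_one_iff, neg_nonpos]
  exact mul_nonneg ht (hz i)

theorem continuous_jE (j : Fin 3) (z : ℂ) (i : Fin 3) : Continuous fun t => jE j z t i := by
  unfold jE; fun_prop

theorem expAdCol_eq_vker (f : ℝ → Fin 3 → ℂ) (x y : ℝ) :
    expAdCol j (Complex.I * z * (x - y)) ((potential u v y).mulVec (f y)) =
      vker u v (jE j z) f x y := by
  funext i
  simp [expAdCol, vker, jE]

theorem isJostMinus_iff (f : ℝ → Fin 3 → ℂ) : IsJostMinus u v j z f ↔
    Continuous f ∧ (∃ C : ℝ, ∀ x, ‖f x‖ ≤ C) ∧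
    ∀ x : ℝ, f x = Pi.single j 1 + ∫ y in Iic x, vker u v (jE j z) f x y := by
  simp only [IsJostMinus, expAdCol_eq_vker]

theorem IsJostMinus.unique (hP : Pot u v) (hz : Good j z) {f g : ℝ → Fin 3 → ℂ}
    (hf : IsJostMinus u v j z f) (hg : IsJostMinus u v j z g) : f = g := by
  rw [isJostMinus_iff] at hf hg
  obtain ⟨hf, ⟨C, hC⟩, ef⟩ := hf
  obtain ⟨hg, ⟨D, hD⟩, eg⟩ := hg
  exact volterra_unique hP (continuous_jE j z) (norm_jE_le hz) hf hg hC hD ef eg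

/-- The parameter space is the whole closed half plane in which the multipliers are bounded by 1, so
that continuity of the columns up to the real axis comes with the construction. -/
theorem exists_jostMinus (hP : Pot u v) (j : Fin 3) :
    ∃ F : ℝ × {z // Good j z} →ᵇ (Fin 3 → ℂ),
      ∀ z, IsJostMinus u v j z.1 (fun x => F (x, z)) := by
  obtain ⟨F, hF⟩ := volterra_exists (Z := {z // Good j z}) (E := fun t z => jE j z.1 t) hP
    (fun i => by unfold jE; fun_prop) (fun t ht z i => norm_jE_le z.2 t ht i)
    (BoundedContinuousFunction.const _ (Pi.single j 1))
  refine ⟨F, fun z => (isJostMinus_iff _).2 ⟨by fun_prop, ⟨‖F‖, fun x => F.norm_coe_le_norm _⟩,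
    fun x => hF x z⟩⟩

theorem jostMinus_spec (hP : Pot u v) (hz : Good j z) :
    IsJostMinus u v j z (fun x => jostMinus u v j x z) := by
  obtain ⟨F, hF⟩ := exists_jostMinus hP j
  exact Classical.epsilon_spec (p := IsJostMinus u v j z) ⟨_, hF ⟨z, hz⟩⟩

/-- `jostMinus` is a choice by `Classical.epsilon`; existence and uniqueness identify it with any
solution at hand. -/
theorem IsJostMinus.eq (hP : Pot u v) (hz : Good j z) {f : ℝ → Fin 3 → ℂ}
    (hf : IsJostMinus u v j z f) (x : ℝ) : jostMinus u v j x z = f x :=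
  congrFun ((jostMinus_spec hP hz).unique hP hz hf) x

theorem continuous_jostMinus (hP : Pot u v) (j : Fin 3) :
    Continuous fun p : ℝ × {z // Good j z} => jostMinus u v j p.1 p.2 := by
  obtain ⟨F, hF⟩ := exists_jostMinus hP j
  have : (fun p : ℝ × {z // Good j z} => jostMinus u v j p.1 p.2) = F := by
    funext p
    exact (hF p.2).eq hP p.2.2 p.1
  rw [this]
  exact F.continuous

theorem continuousOn_jostMinus (hP : Pot u v) (j : Fin 3) (x : ℝ) :
    ContinuousOn (fun z => jostMinus u v j x z) {z | Good j z} := by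
  rw [continuousOn_iff_continuous_domRestrict]
  exact (continuous_jostMinus hP j).comp (f := fun z : {z | Good j z} => (x, z)) (by fun_prop)

theorem enorm_single_sub_le (hz : Good j z) {f : ℝ → Fin 3 → ℂ}
    (hf : IsJostMinus u v j z f) (x : ℝ) : ‖f x - Pi.single j 1‖ₑ ≤
      ∫⁻ y in Iic x, ENNReal.ofReal (wt u v y) * ‖f y‖ₑ := by
  have h := ((isJostMinus_iff _).1 hf).2.2 x
  have : f x - Pi.single j 1 = ∫ y in Iic x, vker u v (jE j z) f x y := by
    nth_rewrite 1 [h]; abel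
  rw [this]
  exact enorm_integral_vker_le (norm_jE_le hz) f x

theorem norm_single_one (j : Fin 3) : ‖(Pi.single j 1 : Fin 3 → ℂ)‖ = 1 := by
  rw [Pi.norm_single, norm_one]

theorem norm_jostMinus_le (hP : Pot u v) (hz : Good j z) (x : ℝ) :
    ‖jostMinus u v j x z‖ ≤ Real.exp (∫ y, wt u v y) := by
  have hf := jostMinus_spec hP hz
  obtain ⟨C, hC⟩ := hf.2.1
  have := gronwall_const hP.wt_int (wt_nonneg u v) (d := fun x => ‖jostMinus u v j x z‖ₑ) (β := 1)
    (M := ENNReal.ofReal C) ENNReal.ofReal_ne_top (X := x) (fun x _ => ?_) (fun x _ => ?_)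
    le_rfl
  · rw [one_mul, ← ofReal_norm, ENNReal.ofReal_le_ofReal_iff (Real.exp_pos _).le] at this
    exact this
  · have h1 := enorm_single_sub_le hz hf x
    have h2 : ‖(Pi.single j 1 : Fin 3 → ℂ)‖ₑ = 1 := by
      rw [← ofReal_norm, norm_single_one, ENNReal.ofReal_one]
    calc ‖jostMinus u v j x z‖ₑ = ‖Pi.single j 1 + (jostMinus u v j x z - Pi.single j 1)‖ₑ := by
          congr 1; abel
      _ ≤ ‖(Pi.single j 1 : Fin 3 → ℂ)‖ₑ + ‖jostMinus u v j x z - Pi.single j 1‖ₑ := enorm_add_le _ _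
      _ ≤ _ := by rw [h2]; gcongr
  · rw [← ofReal_norm]
    exact ENNReal.ofReal_le_ofReal (hC x)

/-- The uniform bound is inserted once in the Volterra equation. The factor `cumul` gives the limit
at -∞ and, through the total mass, the closeness to e_j for small potentials. -/
theorem norm_jostMinus_sub_le (hP : Pot u v) (hz : Good j z) (x : ℝ) :
    ‖jostMinus u v j x z - Pi.single j 1‖ ≤
      cumul (wt u v) x * Real.exp (∫ y, wt u v y) := by
  have h := enorm_single_sub_le hz (jostMinus_spec hP hz) x
  have h2 : ∫⁻ y in Iic x, ENNReal.ofReal (wt u v y) * ‖jostMinus u v j y z‖ₑ ≤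
      ∫⁻ y in Iic x, ENNReal.ofReal (wt u v y) * ENNReal.ofReal (Real.exp (∫ y, wt u v y)) := by
    refine lintegral_mono fun y => ?_
    gcongr
    rw [← ofReal_norm]
    exact ENNReal.ofReal_le_ofReal (norm_jostMinus_le hP hz y)
  rw [lintegral_mul_const _ hP.wt_meas.ennreal_ofReal, ← ofReal_integral_eq_lintegral_ofReal
    hP.wt_int.integrableOn (Eventually.of_forall (wt_nonneg u v)),
    ← ENNReal.ofReal_mul (integral_nonneg (wt_nonneg u v))] at h2
  have h3 := h.trans h2
  rw [← ofReal_norm] at h3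
  exact (ENNReal.ofReal_le_ofReal_iff
    (mul_nonneg (cumul_nonneg (wt_nonneg u v) x) (Real.exp_pos _).le)).1 h3

theorem tendsto_cumul (hP : Pot u v) : Tendsto (cumul (wt u v)) atBot (𝓝 0) := by
  have h := intervalIntegral_tendsto_integral_Iic 0 hP.wt_int.integrableOn tendsto_id
  have h2 : Tendsto (fun i => cumul (wt u v) 0 - ∫ x in (id i)..0, wt u v x) atBot
      (𝓝 (cumul (wt u v) 0 - ∫ x in Iic 0, wt u v x)) := h.const_sub _
  rw [show cumul (wt u v) 0 = ∫ x in Iic 0, wt u v x from rfl, sub_self] at h2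
  refine h2.congr fun i => ?_
  have := cumul_sub hP.wt_int i 0
  simp only [id]
  rw [← this]
  simp [cumul]

theorem tendsto_jostMinus (hP : Pot u v) (hz : Good j z) :
    Tendsto (fun x => jostMinus u v j x z) atBot (𝓝 (Pi.single j 1)) := by
  rw [tendsto_iff_norm_sub_tendsto_zero]
  refine squeeze_zero (fun _ => norm_nonneg _) (fun x => norm_jostMinus_sub_le hP hz x) ?_
  simpa using (tendsto_cumul hP).mul_const (Real.exp (∫ y, wt u v y))

/-! ### Reflection -/

/-- The reflected potential. -/
def refl (u : ℝ → ℂ) (x : ℝ) : ℂ := -u (-x)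

theorem refl_refl (u : ℝ → ℂ) : refl (refl u) = u := by funext x; simp [refl]

theorem Pot.refl (hP : Pot u v) : Pot (refl u) (refl v) :=
  ⟨(hP.mu.comp measurable_neg).neg, (hP.mv.comp measurable_neg).neg, hP.iu.comp_neg.neg,
    hP.iv.comp_neg.neg⟩

theorem wt_refl (u v : ℝ → ℂ) (y : ℝ) : wt (refl u) (refl v) y = wt u v (-y) := by
  simp [wt, refl]

theorem integral_wt_refl (u v : ℝ → ℂ) : ∫ y, wt (refl u) (refl v) y = ∫ y, wt u v y := by
  simp_rw [wt_refl]
  exact integral_neg_eq_self (wt u v) volume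

theorem potential_refl (u v : ℝ → ℂ) (y : ℝ) :
    potential (refl u) (refl v) y = -potential u v (-y) := by
  ext i k; fin_cases i <;> fin_cases k <;> simp [potential, refl]

/-- Under y ↦ -y the half lines are exchanged, the product z(x - y) is preserved, and the sign in
front of the integral is the one built into `refl`. All statements about m⁺ are deduced from those
about m⁻ in this way. -/
theorem isJostPlus_iff (f : ℝ → Fin 3 → ℂ) : IsJostPlus u v j z f ↔
    IsJostMinus (refl u) (refl v) j (-z) (fun x => f (-x)) := by
  unfold IsJostPlus IsJostMinus
  have e : ∀ x : ℝ, ∫ y in Iic x, expAdCol j (Complex.I * -z * (x - y))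
      ((potential (refl u) (refl v) y).mulVec (f (-y))) =
      -∫ y in Ioi (-x), expAdCol j (Complex.I * z * ((-x : ℝ) - y))
        ((potential u v y).mulVec (f y)) := by
    intro x
    rw [← integral_comp_neg_Iic, ← integral_neg]
    congr 1; funext y i
    rw [potential_refl, Matrix.neg_mulVec]
    simp only [expAdCol, Pi.neg_apply]
    rw [mul_neg, show Complex.I * -z * ((x : ℂ) - y) = Complex.I * z * (((-x : ℝ) : ℂ) - ((-y : ℝ) : ℂ)) by
      push_cast; ring]
  simp_rw [e]
  refine and_congr ⟨fun h => h.comp continuous_neg, fun h => ?_⟩ (and_congr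
    ⟨fun ⟨C, h⟩ => ⟨C, fun x => h _⟩, fun ⟨C, h⟩ => ⟨C, fun x => by simpa using h (-x)⟩⟩
    ⟨fun h x => ?_, fun h x => ?_⟩)
  · simpa [Function.comp_def] using h.comp continuous_neg
  · rw [h (-x)]; abel
  · have := h (-x)
    rw [neg_neg] at this
    rw [this]; abel

/-- `m⁺` is `m⁻` of the reflected potential. -/
theorem jostPlus_eq (hP : Pot u v) (hz : Good j (-z)) (x : ℝ) :
    jostPlus u v j x z = jostMinus (refl u) (refl v) j (-x) (-z) := by
  have h := jostMinus_spec hP.refl hz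
  have h2 : IsJostPlus u v j z (fun x => jostMinus (refl u) (refl v) j (-x) (-z)) := by
    rw [isJostPlus_iff]; simpa using h
  have h3 : IsJostPlus u v j z (fun x => jostPlus u v j x z) :=
    Classical.epsilon_spec (p := IsJostPlus u v j z) ⟨_, h2⟩
  rw [isJostPlus_iff] at h3
  have := h3.unique hP.refl hz h
  simpa using congrFun this (-x)

theorem jostPlus_spec (hP : Pot u v) (hz : Good j (-z)) :
    IsJostPlus u v j z (fun x => jostPlus u v j x z) := by
  have h := jostMinus_spec hP.refl hz
  simp_rw [jostPlus_eq hP hz]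
  rw [isJostPlus_iff]; simpa using h

theorem IsJostPlus.eq (hP : Pot u v) (hz : Good j (-z)) {f : ℝ → Fin 3 → ℂ}
    (hf : IsJostPlus u v j z f) (x : ℝ) : jostPlus u v j x z = f x := by
  rw [isJostPlus_iff] at hf
  rw [jostPlus_eq hP hz, hf.eq hP.refl hz, neg_neg]

theorem jostMinus_eq (hP : Pot u v) (hz : Good j z) (x : ℝ) :
    jostMinus u v j x z = jostPlus (refl u) (refl v) j (-x) (-z) := by
  rw [jostPlus_eq hP.refl (by rwa [neg_neg]), refl_refl, refl_refl, neg_neg, neg_neg]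

theorem norm_jostPlus_le (hP : Pot u v) (hz : Good j (-z)) (x : ℝ) :
    ‖jostPlus u v j x z‖ ≤ Real.exp (∫ y, wt u v y) := by
  rw [jostPlus_eq hP hz, ← integral_wt_refl]
  exact norm_jostMinus_le hP.refl hz _

theorem tendsto_jostPlus (hP : Pot u v) (hz : Good j (-z)) :
    Tendsto (fun x => jostPlus u v j x z) atTop (𝓝 (Pi.single j 1)) := by
  simp_rw [jostPlus_eq hP hz]
  exact (tendsto_jostMinus hP.refl hz).comp tendsto_neg_atTop_atBot

theorem continuousOn_jostPlus (hP : Pot u v) (j : Fin 3) (x : ℝ) :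
    ContinuousOn (fun z => jostPlus u v j x z) {z | Good j (-z)} :=
  ((continuousOn_jostMinus hP.refl j (-x)).comp continuous_neg.continuousOn fun _ h => h).congr
    fun _ h => jostPlus_eq hP h x

end AKNS
end

/-! ### The Volterra equation from a finite point, and the differential equation ψ' = (izσ + U)ψ. -/

noncomputable section
namespace AKNS

open scoped ENNReal NNReal BoundedContinuousFunction

variable {u v : ℝ → ℂ} {j : Fin 3} {z : ℂ}

/-! ### The Volterra equation started at a finite point -/

theorem Pot.cutRight (hP : Pot u v) (a : ℝ) : Pot (cutRight a u) (cutRight a v) :=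
  ⟨hP.mu.indicator measurableSet_Ioi, hP.mv.indicator measurableSet_Ioi,
    hP.iu.indicator measurableSet_Ioi, hP.iv.indicator measurableSet_Ioi⟩

theorem vker_cutRight (a : ℝ) (E : ℝ → Fin 3 → ℂ) (f : ℝ → Fin 3 → ℂ) (x : ℝ) :
    vker (cutRight a u) (cutRight a v) E f x = (Ioi a).indicator (vker u v E f x) := by
  funext y
  by_cases hy : y ∈ Ioi a
  · rw [indicator_of_mem hy]
    funext i
    simp only [vker, potential, cutRight, indicator_of_mem hy]
  · rw [indicator_of_notMem hy]
    funext i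
    simp only [vker, potential_mulVec, cutRight, indicator_of_notMem hy]
    fin_cases i <;> simp

theorem integral_vker_cutRight {a x : ℝ} (h : a ≤ x) (E : ℝ → Fin 3 → ℂ) (f : ℝ → Fin 3 → ℂ) :
    ∫ y in Iic x, vker (cutRight a u) (cutRight a v) E f x y = ∫ y in a..x, vker u v E f x y := by
  rw [vker_cutRight, setIntegral_indicator measurableSet_Ioi, intervalIntegral.integral_of_le h,
    inter_comm, Ioi_inter_Iic]

theorem vker_refl (f : ℝ → Fin 3 → ℂ) (x y : ℝ) :
    vker (refl u) (refl v) (jE j (-z)) (fun y => f (-y)) (-x) (-y) =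
      -vker u v (jE j z) f x y := by
  funext i
  simp only [vker, potential_refl, Matrix.neg_mulVec, neg_neg, Pi.neg_apply, mul_neg, jE]
  congr 3
  push_cast; ring

theorem abs_sigR_sub_le (i j : Fin 3) : |sigR i - sigR j| ≤ 2 := by
  fin_cases i <;> fin_cases j <;> simp [sigR] <;> norm_num

/-- Damping by e^{-κ(x-a)} with κ = 2|Im z| makes every multiplier bounded by 1, whatever z is,
because |σ_i - σ_j| ≤ 2. Cutting the potential to (a, ∞) turns the integral from `a` into one from
-∞, and `volterra_exists` applies. -/
theorem exists_volterra_right (hP : Pot u v) (a : ℝ) (j : Fin 3) (z : ℂ) :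
    ∃ f : ℝ → Fin 3 → ℂ, Continuous f ∧ ∀ x, a ≤ x →
      f x = Pi.single j 1 + ∫ y in a..x, vker u v (jE j z) f x y := by
  set κ : ℝ := 2 * |z.im|
  set E : ℝ → Unit → Fin 3 → ℂ := fun t _ i => Complex.exp (-(κ * t : ℝ)) * jE j z t i with hE
  have hE1 : ∀ t, 0 ≤ t → ∀ w i, ‖E t w i‖ ≤ 1 := by
    intro t ht w i
    rw [hE]
    simp only [norm_mul, norm_jE, Complex.norm_exp]
    rw [← Complex.ofReal_neg, Complex.ofReal_re, ← Real.exp_add, Real.exp_le_one_iff]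
    have h1 : -(z.im * (sigR i - sigR j)) ≤ |z.im| * 2 := by
      refine (neg_le_abs _).trans ?_
      rw [abs_mul]
      exact mul_le_mul_of_nonneg_left (abs_sigR_sub_le i j) (abs_nonneg _)
    nlinarith
  have hEc : ∀ i, Continuous fun p : ℝ × Unit => E p.1 p.2 i := fun i => by
    simp only [hE, jE]; fun_prop
  -- The inhomogeneity is the damped e_j; the maximum keeps it bounded to the left of `a`, where the
  -- equation is not used.
  set h : ℝ × Unit →ᵇ (Fin 3 → ℂ) := BoundedContinuousFunction.ofNormedAddCommGroup
    (fun p => Complex.exp (-(κ * max (p.1 - a) 0 : ℝ)) • Pi.single j 1) (by fun_prop) 1 (by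
      intro p
      rw [norm_smul, norm_single_one, mul_one, Complex.norm_exp, ← Complex.ofReal_neg,
        Complex.ofReal_re, Real.exp_le_one_iff, neg_nonpos]
      positivity)
  obtain ⟨F, hF⟩ := volterra_exists (hP.cutRight a) hEc hE1 h
  refine ⟨fun x => Complex.exp ((κ * (x - a) : ℝ)) • F (x, ()), by fun_prop, fun x hx => ?_⟩
  have h1 := hF x ()
  rw [integral_vker_cutRight hx] at h1
  simp only
  rw [h1, smul_add]
  congr 1
  · change Complex.exp _ • (Complex.exp (-(κ * max (x - a) 0 : ℝ)) • Pi.single j (1 : ℂ)) = _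
    rw [max_eq_left (sub_nonneg.2 hx), smul_smul, ← Complex.exp_add, add_neg_cancel,
      Complex.exp_zero, one_smul]
  · rw [← intervalIntegral.integral_smul]
    congr 1; funext y i
    simp only [hE, vker, Matrix.mulVec_smul, Pi.smul_apply, smul_eq_mul]
    rw [← mul_assoc, ← mul_assoc, ← Complex.exp_add,
      show ((κ * (x - a) : ℝ) : ℂ) + -((κ * (x - y) : ℝ) : ℂ) = ((κ * (y - a) : ℝ) : ℂ) by
        push_cast; ring]
    ring

theorem isVolterra_iff (a : ℝ) (f : ℝ → Fin 3 → ℂ) : IsVolterra u v a j z f ↔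
    Continuous f ∧
    ∀ x : ℝ, f x = Pi.single j 1 + ∫ y in a..x, vker u v (jE j z) f x y := by
  simp only [IsVolterra, expAdCol_eq_vker]

/-- To the left of `a` the solution is the reflection of a rightward solution for the reflected
potential; the two pieces agree at `a`, where both equal e_j. -/
theorem exists_volterra (hP : Pot u v) (a : ℝ) (j : Fin 3) (z : ℂ) :
    ∃ f : ℝ → Fin 3 → ℂ, IsVolterra u v a j z f := by
  obtain ⟨f, hf, ef⟩ := exists_volterra_right hP a j z
  obtain ⟨g, hg, eg⟩ := exists_volterra_right hP.refl (-a) j (-z)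
  have fa : f a = Pi.single j 1 := by simpa using ef a le_rfl
  have ga : g (-a) = Pi.single j 1 := by simpa using eg (-a) le_rfl
  refine ⟨fun x => if a ≤ x then f x else g (-x), (isVolterra_iff _ _).2 ⟨?_, fun x => ?_⟩⟩
  · exact Continuous.if_le hf (hg.comp continuous_neg) continuous_const continuous_id
      (fun x hx => by rw [← hx, fa, ← ga])
  · rcases le_or_gt a x with h | h
    · rw [if_pos h, ef x h]
      congr 1
      refine intervalIntegral.integral_congr fun y hy => ?_
      rw [uIcc_of_le h] at hy
      funext i
      simp only [vker]
      rw [if_pos hy.1]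
    · rw [if_neg (not_le.2 h), eg (-x) (neg_le_neg h.le)]
      congr 1
      rw [← intervalIntegral.integral_comp_neg, intervalIntegral.integral_symm,
        ← intervalIntegral.integral_neg]
      refine intervalIntegral.integral_congr fun y hy => ?_
      rw [uIcc_of_ge h.le] at hy
      have e := vker_refl (u := u) (v := v) (j := j) (z := z) (fun y => g (-y)) x y
      simp only [neg_neg] at e
      refine (neg_eq_iff_eq_neg.2 e).trans ?_
      funext i
      simp only [vker]
      rcases eq_or_lt_of_le hy.2 with h2 | h2
      · rw [if_pos h2.ge, h2, ga, fa]
      · rw [if_neg (not_le.2 h2)]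

/-- The columns of the Volterra matrix. -/
def volterraCol (u v : ℝ → ℂ) (a : ℝ) (j : Fin 3) (z : ℂ) (x : ℝ) : Fin 3 → ℂ :=
  Classical.epsilon (IsVolterra u v a j z) x

theorem volterraCol_spec (hP : Pot u v) (a : ℝ) (j : Fin 3) (z : ℂ) :
    IsVolterra u v a j z (volterraCol u v a j z) :=
  Classical.epsilon_spec (exists_volterra hP a j z)

theorem volterraCol_base (hP : Pot u v) (a : ℝ) (j : Fin 3) (z : ℂ) :
    volterraCol u v a j z a = Pi.single j 1 := by
  simpa using (volterraCol_spec hP a j z).2 a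

theorem ofCols_apply (a b c : Fin 3 → ℂ) (i k : Fin 3) : ofCols a b c i k = (![a, b, c] k) i := rfl

theorem volterra_apply (a x : ℝ) (z : ℂ) (i k : Fin 3) :
    volterra u v a x z i k = volterraCol u v a k z x i := by
  fin_cases k <;> rfl

theorem volterra_base (hP : Pot u v) (a : ℝ) (z : ℂ) : volterra u v a a z = 1 := by
  ext i k
  rw [volterra_apply, volterraCol_base hP, Matrix.one_apply, Pi.single_apply]

/-! ### The differential equation -/

theorem Prim.refl {F f : ℝ → ℂ} (h : Prim F f) : Prim (fun x => F (-x)) (fun x => -f (-x)) := by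
  refine ⟨fun a b => ?_, fun a b => ?_⟩
  · have := (IntervalIntegrable.iff_comp_neg (f := f) enorm_ne_top).1 (h.int (-a) (-b))
    rw [neg_neg, neg_neg] at this
    exact this.neg
  · rw [h.sub, intervalIntegral.integral_neg, intervalIntegral.integral_comp_neg,
      intervalIntegral.integral_symm]

/-- `ψ' = (iz σ + U) ψ`. -/
def IsSol (u v : ℝ → ℂ) (z : ℂ) (ψ : ℝ → Fin 3 → ℂ) : Prop :=
  ∀ i, Prim (fun x => ψ x i)
    (fun x => Complex.I * z * sig i * ψ x i + (potential u v x).mulVec (ψ x) i)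

theorem IsSol.continuous {ψ : ℝ → Fin 3 → ℂ} (h : IsSol u v z ψ) : Continuous ψ :=
  continuous_pi fun i => (h i).cont

theorem IsSol.refl {ψ : ℝ → Fin 3 → ℂ} (h : IsSol (refl u) (refl v) (-z) ψ) :
    IsSol u v z (fun x => ψ (-x)) := fun i => (h i).refl.congr_deriv fun x => by
  rw [potential_refl, Matrix.neg_mulVec, neg_neg]; simp; ring

/-- Multiplication of the columns by `e^{izxσ_j}`. -/
def tw (j : Fin 3) (z : ℂ) (f : ℝ → Fin 3 → ℂ) (x : ℝ) : Fin 3 → ℂ :=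
  Complex.exp (Complex.I * z * sig j * x) • f x

theorem prim_of_integral {F f : ℝ → ℂ} {a : ℝ} (hf : ∀ a b, IntervalIntegrable f volume a b)
    (h : ∀ x, F x = F a + ∫ t in a..x, f t) : Prim F f :=
  ⟨hf, fun c d => by
    rw [h d, h c, ← intervalIntegral.integral_add_adjacent_intervals (hf c a) (hf a d),
      intervalIntegral.integral_symm a c]; ring⟩

theorem intervalIntegrable_mulVec (hP : Pot u v) {f : ℝ → Fin 3 → ℂ} (hf : Continuous f) (i : Fin 3)
    (a b : ℝ) : IntervalIntegrable (fun y => (potential u v y).mulVec (f y) i) volume a b := by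
  have hu : IntervalIntegrable u volume a b := hP.iu.intervalIntegrable
  have hv : IntervalIntegrable v volume a b := hP.iv.intervalIntegrable
  have hs : ∀ {w : ℝ → ℂ}, IntervalIntegrable w volume a b →
      IntervalIntegrable (fun y => -star (w y)) volume a b := fun h =>
    IntervalIntegrable.neg ⟨Complex.conjCLE.toContinuousLinearMap.integrable_comp h.1,
      Complex.conjCLE.toContinuousLinearMap.integrable_comp h.2⟩
  have hc : ∀ i, ContinuousOn (fun y => f y i) (uIcc a b) := fun i =>
    ((continuous_apply i).comp hf).continuousOn
  simp_rw [potential_mulVec]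
  fin_cases i
  · exact (hu.mul_continuousOn (hc 1)).add (hv.mul_continuousOn (hc 2))
  · exact (hs hu).mul_continuousOn (hc 0)
  · exact (hs hv).mul_continuousOn (hc 0)

theorem intervalIntegrable_vker (hP : Pot u v) {f : ℝ → Fin 3 → ℂ} (hf : Continuous f) (x a b : ℝ) :
    IntervalIntegrable (vker u v (jE j z) f x) volume a b := by
  have h : ∀ i, IntervalIntegrable (fun y => vker u v (jE j z) f x y i) volume a b := fun i =>
    (intervalIntegrable_mulVec hP hf i a b).continuousOn_mul
      (((continuous_jE j z i).comp (continuous_const.sub continuous_id)).continuousOn)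
  exact ⟨Integrable.of_eval fun i => (h i).1, Integrable.of_eval fun i => (h i).2⟩

theorem jE_mul (j : Fin 3) (z : ℂ) (s t : ℝ) (i : Fin 3) : jE j z s i * jE j z t i = jE j z (s + t) i := by
  rw [jE, jE, jE, ← Complex.exp_add]
  congr 1; push_cast; ring

theorem jE_self (j : Fin 3) (z : ℂ) (t : ℝ) : jE j z t j = 1 := by simp [jE]

theorem jE_zero (j : Fin 3) (z : ℂ) (i : Fin 3) : jE j z 0 i = 1 := by simp [jE]

theorem interval_vker_apply (hP : Pot u v) {f : ℝ → Fin 3 → ℂ} (hf : Continuous f) (a x : ℝ)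
    (i : Fin 3) : (∫ y in a..x, vker u v (jE j z) f x y) i =
      jE j z x i * ∫ y in a..x, jE j z (-y) i * (potential u v y).mulVec (f y) i := by
  have hint : ∀ a b, IntervalIntegrable (vker u v (jE j z) f x) volume a b :=
    fun a b => intervalIntegrable_vker hP hf x a b
  have := (ContinuousLinearMap.proj (R := ℂ) (φ := fun _ : Fin 3 => ℂ) i).intervalIntegral_comp_comm
    (hint a x)
  simp only [ContinuousLinearMap.proj_apply] at this
  rw [← this, ← intervalIntegral.integral_const_mul]
  congr 1; funext y
  rw [← mul_assoc, jE_mul]; rfl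

/-- Multiplying the i-th component by `jE j z (-x) i` removes x from the integrand and leaves a
primitive; restoring e^{izσ_i x} by the product rule produces the differential equation. -/
theorem isSol_of_eq (hP : Pot u v) {f : ℝ → Fin 3 → ℂ} (hf : Continuous f) (a : ℝ)
    (h : ∀ x i, f x i = jE j z (x - a) i * f a i + (∫ y in a..x, vker u v (jE j z) f x y) i) :
    IsSol u v z (tw j z f) := by
  intro i
  have hi : ∀ c d, IntervalIntegrable
      (fun y => jE j z (-y) i * (potential u v y).mulVec (f y) i) volume c d := fun c d =>
    (intervalIntegrable_mulVec hP hf i c d).continuousOn_mul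
      (((continuous_jE j z i).comp continuous_neg).continuousOn)
  have h1 : Prim (fun x => jE j z (-x) i * f x i)
      (fun y => jE j z (-y) i * (potential u v y).mulVec (f y) i) := by
    refine prim_of_integral (a := a) hi fun x => ?_
    rw [h x i, interval_vker_apply hP hf, mul_add, ← mul_assoc, ← mul_assoc, jE_mul, jE_mul,
      neg_add_cancel, jE_zero, one_mul]
    congr 3; ring
  have h2 := (Prim.cexp (Complex.I * z * sig i)).mul h1
  have e : ∀ x : ℝ, Complex.exp (Complex.I * z * sig i * x) * jE j z (-x) i =
      Complex.exp (Complex.I * z * sig j * x) := fun x => by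
    rw [jE, ← Complex.exp_add]; congr 1; push_cast; ring
  refine (h2.congr_fun fun x => ?_).congr_deriv fun x => ?_
  · rw [← mul_assoc, e]; rfl
  · simp only [tw, Matrix.mulVec_smul, Pi.smul_apply, smul_eq_mul]
    linear_combination (Complex.I * z * sig i * f x i + (potential u v x).mulVec (f x) i) * e x

/-- Variation of constants from an arbitrary base point, converse to `isSol_of_eq`. -/
theorem IsSol.eq (hP : Pot u v) {f : ℝ → Fin 3 → ℂ} (h : IsSol u v z (tw j z f)) (a x : ℝ)
    (i : Fin 3) : f x i = jE j z (x - a) i * f a i + (∫ y in a..x, vker u v (jE j z) f x y) i := by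
  have hf : Continuous f := by
    have : f = fun x : ℝ => Complex.exp (-(Complex.I * z * sig j * x)) • tw j z f x := by
      funext x; rw [tw, smul_smul, ← Complex.exp_add, neg_add_cancel, Complex.exp_zero, one_smul]
    rw [this]
    have := h.continuous
    fun_prop
  have e : ∀ x : ℝ, Complex.exp (-(Complex.I * z * sig i) * x) *
      Complex.exp (Complex.I * z * sig j * x) = jE j z (-x) i := fun x => by
    rw [jE, ← Complex.exp_add]; congr 1; push_cast; ring
  have h2 := (((Prim.cexp (-(Complex.I * z * sig i))).mul (h i)).congr_fun
    (G := fun x => jE j z (-x) i * f x i) fun x => by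
      rw [← e]; simp only [tw, Pi.smul_apply, smul_eq_mul]; ring).congr_deriv
      (g := fun y => jE j z (-y) i * (potential u v y).mulVec (f y) i) fun x => by
      rw [← e]; simp only [tw, Matrix.mulVec_smul, Pi.smul_apply, smul_eq_mul]; ring
  have h3 := h2.sub a x
  rw [interval_vker_apply hP hf, ← h3, mul_sub, ← mul_assoc, ← mul_assoc, jE_mul, jE_mul,
    add_neg_cancel, jE_zero, sub_eq_add_neg x a]
  ring

theorem integral_Iic_vker_apply (hP : Pot u v) (hz : Good j z) {f : ℝ → Fin 3 → ℂ}
    (hf : Continuous f) {C : ℝ} (hC : ∀ x, ‖f x‖ ≤ C) (x : ℝ) (i : Fin 3) :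
    (∫ y in Iic x, vker u v (jE j z) f x y) i = ∫ y in Iic x, vker u v (jE j z) f x y i :=
  ((ContinuousLinearMap.proj (R := ℂ) (φ := fun _ : Fin 3 => ℂ) i).integral_comp_comm
    (integrableOn_vker hP (continuous_jE j z) (norm_jE_le hz) hf hC x)).symm

theorem IsJostMinus.isSol (hP : Pot u v) (hz : Good j z) {f : ℝ → Fin 3 → ℂ}
    (h : IsJostMinus u v j z f) : IsSol u v z (tw j z f) := by
  rw [isJostMinus_iff] at h
  obtain ⟨hf, ⟨C, hC⟩, ef⟩ := h
  refine isSol_of_eq hP hf 0 fun x i => ?_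
  have hint : ∀ x, IntegrableOn (vker u v (jE j z) f x) (Iic x) :=
    integrableOn_vker hP (continuous_jE j z) (norm_jE_le hz) hf hC
  have e2 : ∀ y, jE j z x i * vker u v (jE j z) f 0 y i = vker u v (jE j z) f x y i := fun y => by
    simp only [vker]; rw [← mul_assoc, jE_mul]; congr 2; ring
  have hint0 : IntegrableOn (fun y => vker u v (jE j z) f x y i) (Iic 0) := by
    simp_rw [← e2]
    exact ((hint 0).eval i).const_mul _
  have hintx : IntegrableOn (fun y => vker u v (jE j z) f x y i) (Iic x) := (hint x).eval i
  rw [interval_vker_apply hP hf, ← intervalIntegral.integral_const_mul]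
  have e3 : ∀ y, jE j z x i * (jE j z (-y) i * (potential u v y).mulVec (f y) i) =
      vker u v (jE j z) f x y i := fun y => by
    rw [← mul_assoc, jE_mul]; rfl
  simp_rw [e3]
  rw [← intervalIntegral.integral_Iic_sub_Iic hint0 hintx]
  have h0 := congrFun (ef 0) i
  have hx := congrFun (ef x) i
  rw [Pi.add_apply, integral_Iic_vker_apply hP hz hf hC] at h0 hx
  rw [hx, h0, sub_zero, mul_add, ← integral_const_mul]
  simp_rw [e2]
  have e4 : jE j z x i * (Pi.single j 1 : Fin 3 → ℂ) i = (Pi.single j 1 : Fin 3 → ℂ) i := by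
    by_cases hij : i = j
    · subst hij; simp [jE_self]
    · simp [Pi.single_eq_of_ne hij]
  rw [e4]; ring

theorem IsVolterra.isSol (hP : Pot u v) {a : ℝ} {f : ℝ → Fin 3 → ℂ}
    (h : IsVolterra u v a j z f) : IsSol u v z (tw j z f) := by
  rw [isVolterra_iff] at h
  have hfa : f a = Pi.single j 1 := by simpa using h.2 a
  refine isSol_of_eq hP h.1 a fun x i => ?_
  have := congrFun (h.2 x) i
  rw [this, Pi.add_apply, hfa]
  congr 1
  by_cases hij : i = j
  · subst hij; simp [jE_self]
  · simp [Pi.single_eq_of_ne hij]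

theorem IsJostPlus.isSol (hP : Pot u v) (hz : Good j (-z)) {f : ℝ → Fin 3 → ℂ}
    (h : IsJostPlus u v j z f) : IsSol u v z (tw j z f) := by
  have := (((isJostPlus_iff f).1 h).isSol hP.refl hz).refl
  convert this using 2 with x
  simp [tw]

/-- Let a → -∞ in `IsSol.eq`. The j-th component has multiplier 1; the other components of f(a) tend
to 0 and their multipliers are bounded by 1 for a ≤ x. With uniqueness, this is how algebraic
combinations of Jost columns are recognized as Jost columns. -/
theorem IsSol.isJostMinus (hP : Pot u v) (hz : Good j z) {f : ℝ → Fin 3 → ℂ}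
    (h : IsSol u v z (tw j z f)) (hf : Continuous f) {C : ℝ} (hC : ∀ x, ‖f x‖ ≤ C)
    (hl : Tendsto f atBot (𝓝 (Pi.single j 1))) : IsJostMinus u v j z f := by
  refine (isJostMinus_iff _).2 ⟨hf, ⟨C, hC⟩, fun x => ?_⟩
  have hint := integrableOn_vker hP (continuous_jE j z) (norm_jE_le hz) hf hC x
  have h1 : Tendsto (fun a => f x - ∫ y in a..x, vker u v (jE j z) f x y) atBot
      (𝓝 (f x - ∫ y in Iic x, vker u v (jE j z) f x y)) :=
    (intervalIntegral_tendsto_integral_Iic x hint tendsto_id).const_sub _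
  have h2 : Tendsto (fun a => f x - ∫ y in a..x, vker u v (jE j z) f x y) atBot
      (𝓝 (Pi.single j 1)) := by
    refine tendsto_pi_nhds.2 fun i => ?_
    have e : ∀ a, (f x - ∫ y in a..x, vker u v (jE j z) f x y) i = jE j z (x - a) i * f a i :=
      fun a => by rw [Pi.sub_apply, h.eq hP a x i]; ring
    simp_rw [e]
    have hli := tendsto_pi_nhds.1 hl i
    by_cases hij : i = j
    · subst hij; simpa [jE_self] using hli
    · rw [Pi.single_eq_of_ne hij] at hli ⊢
      refine squeeze_zero_norm' ?_ (tendsto_zero_iff_norm_tendsto_zero.1 hli)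
      filter_upwards [eventually_le_atBot x] with a ha
      rw [norm_mul]
      exact mul_le_of_le_one_left (norm_nonneg _) (norm_jE_le hz _ (sub_nonneg.2 ha) i)
  have := tendsto_nhds_unique h1 h2
  rw [← this]; abel

theorem IsSol.isJostPlus (hP : Pot u v) (hz : Good j (-z)) {f : ℝ → Fin 3 → ℂ}
    (h : IsSol u v z (tw j z f)) (hf : Continuous f) {C : ℝ} (hC : ∀ x, ‖f x‖ ≤ C)
    (hl : Tendsto f atTop (𝓝 (Pi.single j 1))) : IsJostPlus u v j z f := by
  rw [isJostPlus_iff]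
  refine IsSol.isJostMinus hP.refl hz ?_ (hf.comp continuous_neg) (fun x => hC _)
    (hl.comp tendsto_neg_atBot_atTop)
  have h' : IsSol (AKNS.refl (AKNS.refl u)) (AKNS.refl (AKNS.refl v)) (- -z) (tw j z f) := by
    rwa [refl_refl, refl_refl, neg_neg]
  convert h'.refl using 2 with x
  simp [tw]

end AKNS
end

/-! ### Conserved pairings, Schwarz symmetry, Beals-Coifman matrices and their jump on ℝ. -/

noncomputable section
namespace AKNS

variable {u v : ℝ → ℂ} {j k : Fin 3} {z : ℂ}

/-! ### Pairings and cross products of solutions -/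

/-- The Hermitian pairing. -/
def pr (f g : Fin 3 → ℂ) : ℂ := ∑ i, star (f i) * g i

theorem pr_eq (f g : Fin 3 → ℂ) : pr f g = star (f 0) * g 0 + star (f 1) * g 1 + star (f 2) * g 2 :=
  Fin.sum_univ_three _

theorem star_sig (i : Fin 3) : star (sig i) = sig i := by rw [sig_eq]; exact Complex.conj_ofReal _

/-- The matrix σ is real and U(x) is anti-Hermitian (the focusing sign), so the derivative of φ^* ψ
cancels when the two spectral parameters are conjugate. -/
theorem IsSol.pr_const {φ ψ : ℝ → Fin 3 → ℂ} (hφ : IsSol u v (star z) φ) (hψ : IsSol u v z ψ)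
    (x y : ℝ) : pr (φ x) (ψ x) = pr (φ y) (ψ y) := by
  have h := Prim.sum Finset.univ fun i _ => (hφ i).star'.mul (hψ i)
  refine h.eq_of_zero (fun x => ?_) x y
  simp only [potential_mulVec, Fin.sum_univ_three, star_add, star_mul', star_star, star_sig]
  have hI : star Complex.I = -Complex.I := Complex.conj_I
  simp only [hI, Matrix.cons_val_zero, Matrix.cons_val_one, Matrix.cons_val, star_add, star_mul',
    star_neg, star_star]
  ring

theorem cross_eq (a b : Fin 3 → ℂ) : crossProduct a b =
    ![a 1 * b 2 - a 2 * b 1, a 2 * b 0 - a 0 * b 2, a 0 * b 1 - a 1 * b 0] := cross_apply a b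

/-- With A = izσ + U one has (φ × ψ)' = (tr A - Aᵀ)(φ × ψ). Conjugation turns -Aᵀ into iz*σ + U, and
the exponential factor removes the trace, tr A = iz. -/
theorem IsSol.cross {φ ψ : ℝ → Fin 3 → ℂ} (hφ : IsSol u v z φ) (hψ : IsSol u v z ψ) :
    IsSol u v (star z)
      (fun x => Complex.exp (Complex.I * star z * x) • star (crossProduct (φ x) (ψ x))) := by
  have hp : ∀ i k, Prim (fun x => φ x i * ψ x k) _ := fun i k => (hφ i).mul (hψ k)
  have hs : ∀ p q r s, Prim (fun x => φ x p * ψ x q - φ x r * ψ x s) _ := fun p q r s =>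
    ((hp p q).add ((hp r s).const_mul (-1))).congr_fun
      (G := fun x => φ x p * ψ x q - φ x r * ψ x s) fun x => by ring
  have hI : star Complex.I = -Complex.I := Complex.conj_I
  have he := Prim.cexp (Complex.I * star z)
  intro i
  fin_cases i
  · refine ((he.mul (hs 1 2 2 1).star').congr_fun fun x => ?_).congr_deriv fun x => ?_
    · simp [cross_eq]
    · simp only [potential_mulVec, cross_eq, star_add, star_sub, star_mul', star_neg, star_star,
        hI, Pi.smul_apply, Pi.star_apply, smul_eq_mul, Matrix.cons_val_zero,
        Matrix.cons_val_one, Matrix.cons_val, Fin.zero_eta, sig, star_one]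
      ring
  · refine ((he.mul (hs 2 0 0 2).star').congr_fun fun x => ?_).congr_deriv fun x => ?_
    · simp [cross_eq]
    · simp only [potential_mulVec, cross_eq, star_add, star_sub, star_mul', star_neg, star_star,
        hI, Pi.smul_apply, Pi.star_apply, smul_eq_mul, Matrix.cons_val_zero,
        Matrix.cons_val_one, Matrix.cons_val, Fin.mk_one, sig, star_one]
      ring
  · refine ((he.mul (hs 0 1 1 0).star').congr_fun fun x => ?_).congr_deriv fun x => ?_
    · simp [cross_eq]
    · simp only [potential_mulVec, cross_eq, star_add, star_sub, star_mul', star_neg, star_star,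
        hI, Pi.smul_apply, Pi.star_apply, smul_eq_mul, Matrix.cons_val_zero,
        Matrix.cons_val_one, Matrix.cons_val, Fin.reduceFinMk, sig, star_one]
      ring

theorem pr_tw (f g : ℝ → Fin 3 → ℂ) (x : ℝ) : pr (tw j (star z) f x) (tw k z g x) =
    Complex.exp (Complex.I * z * (sig k - sig j) * x) * pr (f x) (g x) := by
  have e : star (Complex.exp (Complex.I * star z * sig j * x)) =
      Complex.exp (-(Complex.I * z * sig j * x)) := by
    have h1 : star (Complex.exp (Complex.I * star z * sig j * x)) =
      Complex.exp (star (Complex.I * star z * sig j * x)) := (Complex.exp_conj _).symm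
    have h2 : star (x : ℂ) = x := Complex.conj_ofReal x
    have h3 : star Complex.I = -Complex.I := Complex.conj_I
    rw [h1, star_mul', star_mul', star_mul', star_sig, star_star, h2, h3]
    congr 1; ring
  simp only [pr_eq, tw, Pi.smul_apply, smul_eq_mul, star_mul', e]
  rw [show Complex.I * z * (sig k - sig j) * x =
    -(Complex.I * z * sig j * x) + Complex.I * z * sig k * x by ring, Complex.exp_add]
  ring

theorem IsSol.pr_tw_const {f g : ℝ → Fin 3 → ℂ} (hf : IsSol u v (star z) (tw j (star z) f))
    (hg : IsSol u v z (tw k z g)) (x y : ℝ) :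
    pr (f x) (g x) = Complex.exp (Complex.I * z * (sig k - sig j) * (y - x)) * pr (f y) (g y) := by
  have h := hf.pr_const hg x y
  rw [pr_tw, pr_tw] at h
  have e : pr (f x) (g x) = Complex.exp (-(Complex.I * z * (sig k - sig j) * x)) *
      (Complex.exp (Complex.I * z * (sig k - sig j) * x) * pr (f x) (g x)) := by
    rw [← mul_assoc, ← Complex.exp_add, neg_add_cancel, Complex.exp_zero, one_mul]
  rw [e, h, ← mul_assoc, ← Complex.exp_add]
  congr 2; ring

/-- The condition `hl` counts exponents: the cross product carries σ_j + σ_k, conjugation reverses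
its sign, and the scalar factor contributes 1. -/
theorem tw_cross {l : Fin 3} (hl : sig l = 1 - sig j - sig k) (f g : ℝ → Fin 3 → ℂ) (x : ℝ) :
    Complex.exp (Complex.I * star z * x) • star (crossProduct (tw j z f x) (tw k z g x)) =
      tw l (star z) (fun x => star (crossProduct (f x) (g x))) x := by
  have e : ∀ i, star (Complex.exp (Complex.I * z * sig i * x)) =
      Complex.exp (-(Complex.I * star z * sig i * x)) := fun i => by
    have h1 : star (Complex.exp (Complex.I * z * sig i * x)) =
      Complex.exp (star (Complex.I * z * sig i * x)) := (Complex.exp_conj _).symm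
    have h2 : star (x : ℂ) = x := Complex.conj_ofReal x
    have h3 : star Complex.I = -Complex.I := Complex.conj_I
    rw [h1, star_mul', star_mul', star_mul', star_sig, h2, h3]
    congr 1; ring
  have e2 : Complex.exp (Complex.I * star z * sig l * x) = Complex.exp (Complex.I * star z * x) *
      (star (Complex.exp (Complex.I * z * sig j * x)) *
        star (Complex.exp (Complex.I * z * sig k * x))) := by
    rw [e, e, ← Complex.exp_add, ← Complex.exp_add, hl]
    congr 1; ring
  simp only [tw, map_smul, LinearMap.smul_apply, star_smul, smul_smul, e2]
  congr 1
  rw [← star_mul']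
  congr 2
  ring

theorem im_star (z : ℂ) : (star z).im = -z.im := Complex.conj_im z

theorem good_neg_zero : Good 0 (-z) ↔ z.im ≤ 0 := by rw [good_zero, Complex.neg_im, neg_nonneg]

theorem good_neg_of_ne (hj : j ≠ 0) : Good j (-z) ↔ 0 ≤ z.im := by
  rw [good_of_ne hj, Complex.neg_im, neg_nonpos]

theorem norm_cross_le {a b : Fin 3 → ℂ} {C : ℝ} (ha : ‖a‖ ≤ C) (hb : ‖b‖ ≤ C) :
    ‖star (crossProduct a b)‖ ≤ 2 * (C * C) := by
  have hC : 0 ≤ C := (norm_nonneg _).trans ha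
  have h : ∀ p q r s, ‖a p * b q - a r * b s‖ ≤ 2 * (C * C) := fun p q r s => by
    refine (norm_sub_le _ _).trans ?_
    rw [norm_mul, norm_mul, two_mul]
    have h1 := fun i => (norm_le_pi_norm a i).trans ha
    have h2 := fun i => (norm_le_pi_norm b i).trans hb
    gcongr <;> first | exact h1 _ | exact h2 _
  refine (pi_norm_le_iff_of_nonneg (by positivity)).2 fun i => ?_
  rw [Pi.star_apply, norm_star, cross_eq]
  fin_cases i
  · exact h _ _ _ _
  · exact h _ _ _ _
  · exact h _ _ _ _

theorem continuous_cross {f g : ℝ → Fin 3 → ℂ} (hf : Continuous f) (hg : Continuous g) :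
    Continuous fun x => star (crossProduct (f x) (g x)) := by
  have h1 := fun i => (continuous_apply i).comp hf
  have h2 := fun i => (continuous_apply i).comp hg
  simp only [Function.comp_def] at h1 h2
  refine continuous_pi fun i => ?_
  simp only [Pi.star_apply, cross_eq]
  refine continuous_star.comp ?_
  fin_cases i
  · exact ((h1 1).mul (h2 2)).sub ((h1 2).mul (h2 1))
  · exact ((h1 2).mul (h2 0)).sub ((h1 0).mul (h2 2))
  · exact ((h1 0).mul (h2 1)).sub ((h1 1).mul (h2 0))

theorem cross_single : star (crossProduct (Pi.single 1 1 : Fin 3 → ℂ) (Pi.single 2 1)) =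
    Pi.single 0 1 := by
  funext i
  rw [cross_eq]; fin_cases i <;> simp

theorem tendsto_cross {l : Filter ℝ} {f g : ℝ → Fin 3 → ℂ} {a b : Fin 3 → ℂ}
    (hf : Tendsto f l (𝓝 a)) (hg : Tendsto g l (𝓝 b)) :
    Tendsto (fun x => star (crossProduct (f x) (g x))) l (𝓝 (star (crossProduct a b))) := by
  have h1 := tendsto_pi_nhds.1 hf
  have h2 := tendsto_pi_nhds.1 hg
  refine tendsto_pi_nhds.2 fun i => ?_
  simp only [Pi.star_apply, cross_eq]
  refine (continuous_star.tendsto _).comp ?_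
  fin_cases i
  · exact ((h1 1).mul (h2 2)).sub ((h1 2).mul (h2 1))
  · exact ((h1 2).mul (h2 0)).sub ((h1 0).mul (h2 2))
  · exact ((h1 0).mul (h2 1)).sub ((h1 1).mul (h2 0))

/-- The conjugated cross product is a bounded solution at z* with limit e₁ at +∞, so uniqueness
identifies it. The relation between the two half planes rests on this identity. -/
theorem jostPlus_zero_eq (hP : Pot u v) (hz : 0 ≤ z.im) (x : ℝ) :
    jostPlus u v 0 x (star z) =
      star (crossProduct (jostPlus u v 1 x z) (jostPlus u v 2 x z)) := by
  have g1 : Good 1 (-z) := (good_neg_of_ne (by decide)).2 hz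
  have g2 : Good 2 (-z) := (good_neg_of_ne (by decide)).2 hz
  have g0 : Good 0 (-star z) := good_neg_zero.2 (by rw [im_star]; linarith)
  have h1 := jostPlus_spec hP g1
  have h2 := jostPlus_spec hP g2
  have hs := (h1.isSol hP g1).cross (h2.isSol hP g2)
  simp_rw [tw_cross (l := 0) (j := 1) (k := 2) (z := z) (by simp [sig])] at hs
  refine IsJostPlus.eq hP g0 (f := fun x =>
    star (crossProduct (jostPlus u v 1 x z) (jostPlus u v 2 x z))) ?_ x
  refine IsSol.isJostPlus hP g0 hs (continuous_cross h1.1 h2.1)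
    (fun x => norm_cross_le (norm_jostPlus_le hP g1 x) (norm_jostPlus_le hP g2 x)) ?_
  rw [← cross_single]
  exact tendsto_cross (tendsto_jostPlus hP g1) (tendsto_jostPlus hP g2)

theorem jostMinus_zero_eq (hP : Pot u v) (hz : 0 ≤ z.im) (x : ℝ) :
    jostMinus u v 0 x z =
      star (crossProduct (jostMinus u v 1 x (star z)) (jostMinus u v 2 x (star z))) := by
  have hz' : (star z).im ≤ 0 := by rw [im_star]; linarith
  have h := jostPlus_zero_eq hP.refl (z := -star z) (by simpa using hz) (-x)
  rw [jostMinus_eq hP (good_zero.2 hz), jostMinus_eq hP ((good_of_ne (by decide)).2 hz'),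
    jostMinus_eq hP ((good_of_ne (by decide)).2 hz'), ← h]
  simp

theorem ofCols_det (a b c : Fin 3 → ℂ) : (ofCols a b c).det =
    a 0 * crossProduct b c 0 + a 1 * crossProduct b c 1 + a 2 * crossProduct b c 2 := by
  rw [Matrix.det_fin_three, cross_eq]
  simp only [ofCols_apply, Matrix.cons_val_zero, Matrix.cons_val_one, Matrix.cons_val]
  ring

theorem ofCols_det_eq_pr {a b c d : Fin 3 → ℂ} (hd : d = star (crossProduct b c)) :
    (ofCols a b c).det = pr d a := by
  rw [ofCols_det, pr_eq, hd]; simp only [Pi.star_apply, star_star]; ring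

/-- The determinant is a triple product, hence a pairing by `jostPlus_zero_eq`. Both columns have
index 0, so no exponential appears and the pairing does not depend on x. -/
theorem s₁₁_eq_pr (hP : Pot u v) (hz : 0 ≤ z.im) (x : ℝ) :
    s₁₁ u v z = pr (jostPlus u v 0 x (star z)) (jostMinus u v 0 x z) := by
  rw [s₁₁, ofCols_det_eq_pr (jostPlus_zero_eq hP hz 0)]
  have g0 : Good 0 (-star z) := good_neg_zero.2 (by rw [im_star]; linarith)
  have := ((jostPlus_spec hP g0).isSol hP g0).pr_tw_const
    ((jostMinus_spec hP (good_zero.2 hz)).isSol hP (good_zero.2 hz)) 0 x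
  rw [this]; simp

theorem s₁₁_eq_det (hP : Pot u v) (hz : 0 ≤ z.im) (x : ℝ) :
    s₁₁ u v z = (ofCols (jostMinus u v 0 x z) (jostPlus u v 1 x z) (jostPlus u v 2 x z)).det := by
  rw [s₁₁_eq_pr hP hz x, ofCols_det_eq_pr (jostPlus_zero_eq hP hz x)]

theorem t₁₁_eq (hP : Pot u v) (hz : 0 ≤ z.im) : t₁₁ u v (star z) = star (s₁₁ u v z) := by
  rw [s₁₁_eq_pr hP hz 0, t₁₁, ofCols_det_eq_pr (jostMinus_zero_eq hP hz 0), pr_eq, pr_eq]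
  simp only [star_add, star_mul', star_star]; ring

/-! ### Triangular matrices -/

/-- Unipotent lower triangular matrices with entries in the first column. -/
def low (p q : ℂ) : Mat := !![1, 0, 0; p, 1, 0; q, 0, 1]

/-- Unipotent upper triangular matrices with entries in the first row. -/
def up (p q : ℂ) : Mat := !![1, p, q; 0, 1, 0; 0, 0, 1]

theorem low_conjTranspose (p q : ℂ) : (low p q).conjTranspose = up (star p) (star q) := by
  ext i k; fin_cases i <;> fin_cases k <;> simp [low, up]

theorem low_mul (p q r s : ℂ) : low p q * low r s = low (p + r) (q + s) := by
  ext i k; fin_cases i <;> fin_cases k <;> simp [low, Matrix.mul_apply, Fin.sum_univ_three]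

theorem up_mul (p q r s : ℂ) : up p q * up r s = up (p + r) (q + s) := by
  ext i k; fin_cases i <;> fin_cases k <;> simp [up, Matrix.mul_apply, Fin.sum_univ_three, add_comm]

theorem low_zero : low 0 0 = 1 := by
  ext i k; fin_cases i <;> fin_cases k <;> simp [low]

theorem up_zero : up 0 0 = 1 := by
  ext i k; fin_cases i <;> fin_cases k <;> simp [up]

theorem low_inv (p q : ℂ) : (low p q)⁻¹ = low (-p) (-q) :=
  Matrix.inv_eq_right_inv (by rw [low_mul, add_neg_cancel, add_neg_cancel, low_zero])

theorem up_inv (p q : ℂ) : (up p q)⁻¹ = up (-p) (-q) :=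
  Matrix.inv_eq_right_inv (by rw [up_mul, add_neg_cancel, add_neg_cancel, up_zero])

theorem outerJump_eq (p q : ℂ) : outerJump p q = up (star p) (star q) * low p q := by
  ext i k; fin_cases i <;> fin_cases k <;>
    simp [up, low, outerJump, Matrix.mul_apply, Fin.sum_univ_three, mul_comm]

theorem innerJump_eq (p q : ℂ) : innerJump p q = low (-p) (-q) * up (-star p) (-star q) := by
  ext i k; fin_cases i <;> fin_cases k <;>
    simp [up, low, innerJump, Matrix.mul_apply, Fin.sum_univ_three, mul_comm, add_comm]

theorem expAd_apply (w : ℂ) (B : Mat) (i k : Fin 3) :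
    expAd w B i k = Complex.exp (w * (sig i - sig k)) * B i k := by
  rw [expAd_col]; rfl

theorem expAd_low (w p q : ℂ) : expAd w (low p q) =
    low (Complex.exp (2 * w) * p) (Complex.exp (2 * w) * q) := by
  ext i k; rw [expAd_apply]
  fin_cases i <;> fin_cases k <;> simp [low, sig]
  all_goals left; ring_nf

theorem expAd_up (w p q : ℂ) : expAd w (up p q) =
    up (Complex.exp (-(2 * w)) * p) (Complex.exp (-(2 * w)) * q) := by
  ext i k; rw [expAd_apply]
  fin_cases i <;> fin_cases k <;> simp [up, sig]
  all_goals left; ring_nf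

theorem expAd_mul (w : ℂ) (A B : Mat) : expAd w (A * B) = expAd w A * expAd w B := by
  ext i k
  simp only [expAd_apply, Matrix.mul_apply, Finset.mul_sum]
  refine Finset.sum_congr rfl fun l _ => ?_
  rw [show w * (sig i - sig k) = w * (sig i - sig l) + w * (sig l - sig k) by ring, Complex.exp_add]
  ring

theorem expAd_one (w : ℂ) : expAd w 1 = 1 := by
  ext i k
  rw [expAd_apply]
  by_cases h : i = k
  · subst h; simp
  · simp [Matrix.one_apply_ne h]

theorem expAd_zero (B : Mat) : expAd 0 B = B := by
  ext i k; rw [expAd_apply]; simp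

theorem expAd_expAd (w w' : ℂ) (B : Mat) : expAd w (expAd w' B) = expAd (w + w') B := by
  ext i k; rw [expAd_apply, expAd_apply, expAd_apply, add_mul, Complex.exp_add]; ring

theorem expAd_inv (w : ℂ) {B : Mat} (hB : IsUnit B.det) : expAd w B⁻¹ = (expAd w B)⁻¹ := by
  refine (Matrix.inv_eq_right_inv ?_).symm
  rw [← expAd_mul, Matrix.mul_nonsing_inv _ hB, expAd_one]

/-! ### The Beals-Coifman matrices -/

theorem bcUpper_det (hP : Pot u v) (hz : 0 ≤ z.im) (hs : s₁₁ u v z ≠ 0) (x : ℝ) :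
    (bcUpper u v x z).det = 1 := by
  have h := s₁₁_eq_det hP hz x
  rw [ofCols_det] at h
  rw [bcUpper, ofCols_det]
  simp only [Pi.smul_apply, smul_eq_mul, mul_assoc]
  rw [← mul_add, ← mul_add, ← h, inv_mul_cancel₀ hs]

/-- After m⁺₁(z*) is replaced by a cross product, every entry is a triple product of m⁻₁, m⁺₂, m⁺₃
at z: either it has a repeated factor or it equals s₁₁ up to sign, which the normalization removes.
-/
theorem bcLower_mul_bcUpper (hP : Pot u v) (hz : 0 ≤ z.im) (hs : s₁₁ u v z ≠ 0) (x : ℝ) :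
    (bcLower u v x (star z)).conjTranspose * bcUpper u v x z = 1 := by
  have h := s₁₁_eq_det hP hz x
  rw [ofCols_det, cross_eq] at h
  rw [bcLower, bcUpper, jostPlus_zero_eq hP hz x, t₁₁_eq hP hz, star_star]
  generalize s₁₁ u v z = s at *
  generalize jostMinus u v 0 x z = a at *
  generalize jostPlus u v 1 x z = b at *
  generalize jostPlus u v 2 x z = c at *
  simp only [Matrix.cons_val_zero, Matrix.cons_val_one, Matrix.cons_val] at h
  ext i k
  rw [Matrix.mul_apply, Fin.sum_univ_three]
  simp only [Matrix.conjTranspose_apply, ofCols_apply, cross_eq]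
  fin_cases i <;> fin_cases k <;>
    simp only [Fin.zero_eta, Fin.mk_one, Fin.reduceFinMk, Matrix.cons_val_zero, Matrix.cons_val_one,
      Matrix.cons_val, Pi.smul_apply, Pi.star_apply, Pi.neg_apply, smul_eq_mul, star_mul', star_inv₀,
      star_star, star_neg, Matrix.one_apply_eq, Matrix.one_apply, Fin.reduceEq,
      if_false] <;> field_simp <;> first | ring1 | linear_combination -h

theorem bcLower_inv (hP : Pot u v) (hz : 0 ≤ z.im) (hs : s₁₁ u v z ≠ 0) (x : ℝ) :
    (bcLower u v x (star z))⁻¹ = (bcUpper u v x z).conjTranspose := by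
  refine Matrix.inv_eq_left_inv ?_
  have := congrArg Matrix.conjTranspose (bcLower_mul_bcUpper hP hz hs x)
  simpa using this

theorem isUnit_bcUpper (hP : Pot u v) (hz : 0 ≤ z.im) (hs : s₁₁ u v z ≠ 0) (x : ℝ) :
    IsUnit (bcUpper u v x z).det := by
  rw [bcUpper_det hP hz hs]; exact isUnit_one

theorem bcLower_eq (hP : Pot u v) (hz : 0 ≤ z.im) (hs : s₁₁ u v z ≠ 0) (x : ℝ) :
    bcLower u v x (star z) = ((bcUpper u v x z)⁻¹).conjTranspose := by
  rw [Matrix.inv_eq_left_inv (bcLower_mul_bcUpper hP hz hs x), Matrix.conjTranspose_conjTranspose]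

theorem isUnit_bcLower (hP : Pot u v) (hz : 0 ≤ z.im) (hs : s₁₁ u v z ≠ 0) (x : ℝ) :
    IsUnit (bcLower u v x (star z)).det := by
  rw [bcLower_eq hP hz hs, Matrix.det_conjTranspose, Matrix.det_nonsing_inv, bcUpper_det hP hz hs]
  simp

/-! ### The real line -/

/-- Pairings at x and y differ by the factor e^{it(σ_k-σ_j)(y-x)} of modulus 1, so the limit at +∞
decides: it gives the value 1 on the diagonal and the modulus 0 off it. -/
theorem pr_jostPlus (hP : Pot u v) (t x : ℝ) (j k : Fin 3) :
    pr (jostPlus u v j x t) (jostPlus u v k x t) = if j = k then 1 else 0 := by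
  have hg : ∀ j, Good j (-(t : ℂ)) := fun j => by simpa using good_real j (-t)
  have hst : star (t : ℂ) = t := Complex.conj_ofReal t
  have hsol : ∀ j, IsSol u v t (tw j t (fun x => jostPlus u v j x t)) := fun j =>
    (jostPlus_spec hP (hg j)).isSol hP (hg j)
  have hc := fun y => IsSol.pr_tw_const (z := t) (j := j) (k := k)
    (f := fun x => jostPlus u v j x t) (g := fun x => jostPlus u v k x t)
    (by rw [hst]; exact hsol j) (hsol k) x y
  have hl : Tendsto (fun y => pr (jostPlus u v j y t) (jostPlus u v k y t)) atTop
      (𝓝 (pr (Pi.single j 1) (Pi.single k 1))) := by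
    have h1 := fun j => tendsto_pi_nhds.1 (tendsto_jostPlus hP (hg j))
    exact tendsto_finsetSum _ fun i _ => ((continuous_star.tendsto _).comp (h1 j i)).mul (h1 k i)
  have hd : pr (Pi.single j 1) (Pi.single k 1) = if j = k then 1 else 0 := by
    fin_cases j <;> fin_cases k <;> simp [pr_eq]
  rw [hd] at hl
  by_cases hjk : j = k
  · subst hjk
    rw [if_pos rfl] at hl ⊢
    have : ∀ y, pr (jostPlus u v j x t) (jostPlus u v j x t) =
        pr (jostPlus u v j y t) (jostPlus u v j y t) := fun y => by
      rw [hc y]; simp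
    exact tendsto_nhds_unique (tendsto_const_nhds.congr this) hl
  · rw [if_neg hjk] at hl ⊢
    have : ∀ y, ‖pr (jostPlus u v j x t) (jostPlus u v k x t)‖ =
        ‖pr (jostPlus u v j y t) (jostPlus u v k y t)‖ := fun y => by
      rw [hc y, norm_mul, sig_eq, sig_eq]
      have : Complex.I * t * (sigR k - sigR j : ℂ) * (y - x) =
        ((t * (sigR k - sigR j) * (y - x) : ℝ) : ℂ) * Complex.I := by push_cast; ring
      rw [this, Complex.norm_exp_ofReal_mul_I, one_mul]
    have h2 := tendsto_nhds_unique (tendsto_const_nhds.congr this) hl.norm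
    rwa [norm_zero, norm_eq_zero] at h2

theorem mPlus_apply (x : ℝ) (z : ℂ) (i k : Fin 3) : mPlus u v x z i k = jostPlus u v k x z i := by
  fin_cases k <;> rfl

theorem mMinus_apply (x : ℝ) (z : ℂ) (i k : Fin 3) : mMinus u v x z i k = jostMinus u v k x z i := by
  fin_cases k <;> rfl

theorem mPlus_unitary (hP : Pot u v) (t x : ℝ) :
    (mPlus u v x t).conjTranspose * mPlus u v x t = 1 := by
  ext i k
  rw [Matrix.mul_apply, Matrix.one_apply, ← pr_jostPlus hP t x i k, pr]
  simp only [Matrix.conjTranspose_apply, mPlus_apply]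

theorem scatMat_apply (hP : Pot u v) (t : ℝ) (i k : Fin 3) :
    scatMat u v t i k = pr (jostPlus u v i 0 t) (jostMinus u v k 0 t) := by
  rw [scatMat, Matrix.inv_eq_left_inv (mPlus_unitary hP t 0), Matrix.mul_apply, pr]
  simp only [Matrix.conjTranspose_apply, mPlus_apply, mMinus_apply]

theorem scatMat_zero_zero (hP : Pot u v) (t : ℝ) : scatMat u v t 0 0 = s₁₁ u v t := by
  rw [scatMat_apply hP, s₁₁_eq_pr hP (by simp) 0, show star (t : ℂ) = t from Complex.conj_ofReal t]

theorem pr_jostPlus_jostMinus (hP : Pot u v) (t x : ℝ) (i k : Fin 3) :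
    pr (jostPlus u v i x t) (jostMinus u v k x t) =
      Complex.exp (Complex.I * t * (sig i - sig k) * x) * scatMat u v t i k := by
  have hst : star (t : ℂ) = t := Complex.conj_ofReal t
  have hg : Good i (-(t : ℂ)) := by simpa using good_real i (-t)
  rw [scatMat_apply hP]
  have := IsSol.pr_tw_const (u := u) (v := v) (z := t) (j := i) (k := k)
    (f := fun x => jostPlus u v i x t) (g := fun x => jostMinus u v k x t)
    (by rw [hst]; exact (jostPlus_spec hP hg).isSol hP hg)
    ((jostMinus_spec hP (good_real k t)).isSol hP (good_real k t)) x 0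
  rw [this]
  congr 2
  push_cast; ring

/-- Expand the columns of M in the orthonormal basis formed by those of m⁺: the last two are basis
vectors, and the first has coordinates s_{k1}/s₁₁ up to the exponentials in x. -/
theorem bcUpper_real (hP : Pot u v) (t x : ℝ) (hs : s₁₁ u v t ≠ 0) :
    bcUpper u v x t =
      mPlus u v x t * expAd (Complex.I * t * x) (low (rho₁ u v t) (rho₂ u v t)) := by
  have hU := mPlus_unitary hP t x
  have hU' := mul_eq_one_comm.1 hU
  have key : (mPlus u v x t).conjTranspose * bcUpper u v x t =
      expAd (Complex.I * t * x) (low (rho₁ u v t) (rho₂ u v t)) := by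
    have e : ∀ i k, ((mPlus u v x t).conjTranspose * bcUpper u v x t) i k =
        pr (jostPlus u v i x t) (fun l => bcUpper u v x t l k) := fun i k => by
      rw [Matrix.mul_apply, pr]; simp only [Matrix.conjTranspose_apply, mPlus_apply]
    have c0 : ∀ i, pr (jostPlus u v i x t) (fun l => bcUpper u v x t l 0) = (s₁₁ u v t)⁻¹ *
        (Complex.exp (Complex.I * t * (sig i - sig 0) * x) * scatMat u v t i 0) := fun i => by
      rw [← pr_jostPlus_jostMinus hP, pr, pr, Finset.mul_sum]
      refine Finset.sum_congr rfl fun l _ => ?_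
      simp only [bcUpper, ofCols_apply, Matrix.cons_val_zero, Pi.smul_apply, smul_eq_mul]; ring
    have c1 : ∀ i, pr (jostPlus u v i x t) (fun l => bcUpper u v x t l 1) = if i = 1 then 1 else 0 :=
      fun i => pr_jostPlus hP t x i 1
    have c2 : ∀ i, pr (jostPlus u v i x t) (fun l => bcUpper u v x t l 2) = if i = 2 then 1 else 0 :=
      fun i => pr_jostPlus hP t x i 2
    rw [expAd_low, rho₁, rho₂, scatMat_zero_zero hP]
    ext i k
    rw [e]
    fin_cases k
    · simp only [Fin.zero_eta, c0]
      fin_cases i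
      · simp [low, scatMat_zero_zero hP, hs]
      · simp only [low, sig, Fin.mk_one, Matrix.of_apply, Matrix.cons_val_zero, Matrix.cons_val_one]
        rw [show Complex.I * t * (1 - -1) * x = 2 * (Complex.I * t * x) by ring]
        ring
      · simp only [low, sig, Fin.reduceFinMk, Matrix.of_apply, Matrix.cons_val_zero, Matrix.cons_val]
        rw [show Complex.I * t * (1 - -1) * x = 2 * (Complex.I * t * x) by ring]
        ring
    · simp only [Fin.mk_one, c1]
      fin_cases i <;> simp [low]
    · simp only [Fin.reduceFinMk, c2]
      fin_cases i <;> simp [low]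
  rw [← key, ← Matrix.mul_assoc, hU', Matrix.one_mul]

theorem star_exp_I_mul (z : ℂ) (x : ℝ) :
    star (Complex.exp (2 * (Complex.I * z * x))) = Complex.exp (-(2 * (Complex.I * star z * x))) := by
  have h1 : star (Complex.exp (2 * (Complex.I * z * x))) =
    Complex.exp (star (2 * (Complex.I * z * x))) := (Complex.exp_conj _).symm
  have h2 : star (x : ℂ) = x := Complex.conj_ofReal x
  have h3 : star Complex.I = -Complex.I := Complex.conj_I
  have h4 : star (2 : ℂ) = 2 := Complex.conj_ofNat 2
  rw [h1, star_mul', star_mul', star_mul', h2, h3, h4]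
  congr 1; ring

theorem conjTranspose_expAd (z : ℂ) (x : ℝ) (p q : ℂ) :
    (expAd (Complex.I * z * x) (low p q)).conjTranspose =
      expAd (Complex.I * star z * x) (up (star p) (star q)) := by
  rw [expAd_low, low_conjTranspose, expAd_up, star_mul', star_mul', star_exp_I_mul]

/-- Schwarz symmetry turns the inverse of the lower matrix into the adjoint of the upper one, and
the unitary matrix m⁺ cancels between them, leaving an upper times a lower unipotent factor. -/
theorem real_jump (hP : Pot u v) (t x : ℝ) (hs : s₁₁ u v t ≠ 0) :
    (bcLower u v x t)⁻¹ * bcUpper u v x t =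
      expAd (Complex.I * t * x) (outerJump (rho₁ u v t) (rho₂ u v t)) := by
  have hst : star (t : ℂ) = t := Complex.conj_ofReal t
  have h := bcLower_inv hP (z := t) (by simp) hs x
  rw [hst] at h
  rw [h, bcUpper_real hP t x hs, Matrix.conjTranspose_mul, Matrix.mul_assoc,
    ← Matrix.mul_assoc _ (mPlus u v x t), mPlus_unitary hP, Matrix.one_mul, conjTranspose_expAd, hst,
    ← expAd_mul, outerJump_eq]

theorem outerJump_inv (p q : ℂ) : (outerJump p q)⁻¹ = innerJump p q := by
  rw [outerJump_eq, innerJump_eq, Matrix.mul_inv_rev, low_inv, up_inv]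

theorem isUnit_outerJump (p q : ℂ) : IsUnit (outerJump p q).det := by
  refine (Matrix.isUnit_iff_isUnit_det _).1 (IsUnit.of_mul_eq_one (innerJump p q) ?_)
  rw [outerJump_eq, innerJump_eq, Matrix.mul_assoc, ← Matrix.mul_assoc (low p q), low_mul,
    add_neg_cancel, add_neg_cancel, low_zero, Matrix.one_mul, up_mul, add_neg_cancel,
    add_neg_cancel, up_zero]

theorem real_jump_inv (hP : Pot u v) (t x : ℝ) (hs : s₁₁ u v t ≠ 0) :
    (bcUpper u v x t)⁻¹ * bcLower u v x t =
      expAd (Complex.I * t * x) (innerJump (rho₁ u v t) (rho₂ u v t)) := by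
  have hst : star (t : ℂ) = t := Complex.conj_ofReal t
  have hl := isUnit_bcLower hP (z := t) (by simp) hs x
  rw [hst] at hl
  rw [← outerJump_inv, expAd_inv _ (isUnit_outerJump _ _), ← real_jump hP t x hs,
    Matrix.mul_inv_rev, Matrix.nonsing_inv_nonsing_inv _ hl]

end AKNS
end

/-! ### Cut-off potentials, propagation in x, and reflection of the matrices M. -/

noncomputable section
namespace AKNS
open scoped ENNReal
open Region

variable {u v u' v' : ℝ → ℂ} {j k : Fin 3} {z : ℂ} {S x₀ : ℝ}

/-! ### Cut-off potentials -/

/-- At x ≤ X the Volterra equation sees only the potential to the left of x, so Gronwall with β = 0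
applies to the difference; the endpoint is a null set. -/
theorem jostMinus_congr_on (hP : Pot u v) (hP' : Pot u' v') (hz : Good j z) {X : ℝ}
    (h : ∀ y < X, u y = u' y ∧ v y = v' y) {x : ℝ} (hx : x ≤ X) :
    jostMinus u v j x z = jostMinus u' v' j x z := by
  have hf := jostMinus_spec hP hz
  have hg := jostMinus_spec hP' hz
  rw [isJostMinus_iff] at hf hg
  obtain ⟨hf, ⟨C, hC⟩, ef⟩ := hf
  obtain ⟨hg, ⟨D, hD⟩, eg⟩ := hg
  have := gronwall_const hP.wt_int (wt_nonneg u v)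
    (d := fun x => ‖jostMinus u v j x z - jostMinus u' v' j x z‖ₑ) (β := 0)
    (M := ENNReal.ofReal (C + D)) ENNReal.ofReal_ne_top (X := X) (fun x hx => ?_) (fun x _ => ?_)
    hx
  · rw [zero_mul, nonpos_iff_eq_zero, enorm_eq_zero, sub_eq_zero] at this
    exact this
  · have e1 : ∫ y in Iic x, vker u' v' (jE j z) (fun x => jostMinus u' v' j x z) x y =
        ∫ y in Iic x, vker u v (jE j z) (fun x => jostMinus u' v' j x z) x y := by
      rw [integral_Iic_eq_integral_Iio, integral_Iic_eq_integral_Iio]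
      refine setIntegral_congr_fun measurableSet_Iio fun y hy => ?_
      obtain ⟨h1, h2⟩ := h y (lt_of_lt_of_le hy hx)
      funext i
      simp only [vker, potential, h1, h2]
    have e : jostMinus u v j x z - jostMinus u' v' j x z =
        (∫ y in Iic x, vker u v (jE j z) (fun x => jostMinus u v j x z) x y) -
        ∫ y in Iic x, vker u v (jE j z) (fun x => jostMinus u' v' j x z) x y := by
      rw [← e1, ef x, eg x]; abel
    simp only [zero_add]
    rw [e]
    exact enorm_integral_vker_sub_le hP (continuous_jE j z) (norm_jE_le hz) hf hg hC hD x
  · rw [← ofReal_norm]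
    exact ENNReal.ofReal_le_ofReal ((norm_sub_le _ _).trans (add_le_add (hC x) (hD x)))

theorem pot_zero : Pot 0 0 :=
  ⟨measurable_zero, measurable_zero, integrable_zero _ _ _, integrable_zero _ _ _⟩

theorem jostMinus_zero_pot (hz : Good j z) (x : ℝ) : jostMinus 0 0 j x z = Pi.single j 1 := by
  refine IsJostMinus.eq pot_zero hz (f := fun _ => Pi.single j 1) ?_ x
  refine (isJostMinus_iff _).2 ⟨continuous_const, ⟨_, fun _ => le_rfl⟩, fun x => ?_⟩
  have : ∀ y, vker 0 0 (jE j z) (fun _ => Pi.single j 1) x y = 0 := fun y => by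
    funext i
    simp only [vker, potential_mulVec]
    fin_cases i <;> simp
  simp [this]

theorem jostMinus_cutRight (hP : Pot u v) (hz : Good j z) (a : ℝ) :
    jostMinus (cutRight a u) (cutRight a v) j a z = Pi.single j 1 := by
  rw [← jostMinus_zero_pot hz a]
  refine jostMinus_congr_on (hP.cutRight a) pot_zero hz (X := a) (fun y hy => ?_) le_rfl
  simp [cutRight, indicator_of_notMem, hy.le]

theorem jostPlus_cutRight (hP : Pot u v) (hz : Good j (-z)) (a : ℝ) :
    jostPlus (cutRight a u) (cutRight a v) j a z = jostPlus u v j a z := by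
  rw [jostPlus_eq (hP.cutRight a) hz, jostPlus_eq hP hz]
  refine jostMinus_congr_on (hP.cutRight a).refl hP.refl hz (X := -a) (fun y hy => ?_) le_rfl
  have : -y ∈ Ioi a := by simp; linarith
  simp only [refl, cutRight, indicator_of_mem this, and_self]

/-- The first entry of the jump matrix on the upper arc. -/
def arcV₁ (u v : ℝ → ℂ) (x₀ : ℝ) (z : ℂ) : ℂ :=
  Complex.exp (-(2 * (Complex.I * z * x₀))) *
    ((jostMinus u v 0 x₀ z 1 * jostPlus u v 2 x₀ z 2 - jostMinus u v 0 x₀ z 2 * jostPlus u v 2 x₀ z 1) /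
      (s₁₁ u v z * s₁₁ (cutRight x₀ u) (cutRight x₀ v) z))

/-- The second entry of the jump matrix on the upper arc. -/
def arcV₂ (u v : ℝ → ℂ) (x₀ : ℝ) (z : ℂ) : ℂ :=
  Complex.exp (-(2 * (Complex.I * z * x₀))) *
    ((jostPlus u v 1 x₀ z 1 * jostMinus u v 0 x₀ z 2 - jostPlus u v 1 x₀ z 2 * jostMinus u v 0 x₀ z 1) /
      (s₁₁ u v z * s₁₁ (cutRight x₀ u) (cutRight x₀ v) z))

/-- At `x₀` the last two columns of the two matrices coincide, and m⁻₁ of the cut-off potential is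
e₁. Hence the quotient differs from I only below the diagonal in the first column. The entries come
from Cramer's rule in the last two rows, whose determinant is s₁₁ of the cut-off potential. -/
theorem bcUpper_eq_mul (hP : Pot u v) (hz : 0 ≤ z.im) (hs : s₁₁ u v z ≠ 0)
    (hs0 : s₁₁ (cutRight x₀ u) (cutRight x₀ v) z ≠ 0) :
    bcUpper u v x₀ z = bcUpper (cutRight x₀ u) (cutRight x₀ v) x₀ z *
      expAd (Complex.I * z * x₀) (low (arcV₁ u v x₀ z) (arcV₂ u v x₀ z)) := by
  have h := s₁₁_eq_det hP hz x₀
  have h0 := s₁₁_eq_det (hP.cutRight x₀) hz x₀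
  rw [jostMinus_cutRight hP (good_zero.2 hz),
    jostPlus_cutRight hP ((good_neg_of_ne (by decide)).2 hz),
    jostPlus_cutRight hP ((good_neg_of_ne (by decide)).2 hz), ofCols_det, cross_eq] at h0
  rw [ofCols_det, cross_eq] at h
  have e : ∀ X, Complex.exp (2 * (Complex.I * z * x₀)) *
      (Complex.exp (-(2 * (Complex.I * z * x₀))) * X) = X := fun X => by
    rw [← mul_assoc, ← Complex.exp_add, add_neg_cancel, Complex.exp_zero, one_mul]
  rw [expAd_low, arcV₁, arcV₂, e, e, bcUpper, bcUpper, jostMinus_cutRight hP (good_zero.2 hz),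
    jostPlus_cutRight hP ((good_neg_of_ne (by decide)).2 hz),
    jostPlus_cutRight hP ((good_neg_of_ne (by decide)).2 hz)]
  generalize s₁₁ u v z = s at *
  generalize s₁₁ (cutRight x₀ u) (cutRight x₀ v) z = s0 at *
  generalize jostMinus u v 0 x₀ z = a at *
  generalize jostPlus u v 1 x₀ z = b at *
  generalize jostPlus u v 2 x₀ z = c at *
  simp only [Matrix.cons_val_zero, Matrix.cons_val_one, Matrix.cons_val, Pi.single_eq_same, one_mul,
    Pi.single_eq_of_ne (show (1 : Fin 3) ≠ 0 by decide),
    Pi.single_eq_of_ne (show (2 : Fin 3) ≠ 0 by decide), zero_mul, add_zero] at h h0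
  ext i k
  rw [Matrix.mul_apply, Fin.sum_univ_three]
  fin_cases i <;> fin_cases k <;> simp [ofCols_apply, low]
  -- The first row is the cofactor expansion of s₁₁ along its first column.
  · field_simp
    linear_combination -h + a 0 * h0
  · field_simp
    linear_combination (a 1) * h0
  · field_simp
    linear_combination (a 2) * h0

/-! ### Transport of matrix solutions -/

/-- All columns of the matrix are solutions. -/
def IsSolM (u v : ℝ → ℂ) (z : ℂ) (B : ℝ → Mat) : Prop :=
  ∀ k, IsSol u v z (tw k z (fun x i => B x i k))

theorem IsSol.smul {ψ : ℝ → Fin 3 → ℂ} (h : IsSol u v z ψ) (c : ℂ) :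
    IsSol u v z (fun x => c • ψ x) := fun i =>
  ((h i).const_mul c).congr_deriv fun x => by
    simp only [Matrix.mulVec_smul, Pi.smul_apply, smul_eq_mul]; ring

theorem tw_smul (c : ℂ) (f : ℝ → Fin 3 → ℂ) :
    tw j z (fun x => c • f x) = fun x => c • tw j z f x := by
  funext x; rw [tw, tw, smul_comm]

theorem isSolM_volterra (hP : Pot u v) (a : ℝ) (z : ℂ) : IsSolM u v z (fun x => volterra u v a x z) :=
  fun k => by
    have := (volterraCol_spec hP a k z).isSol hP
    simpa only [volterra_apply] using this

/-- Entrywise this is the conserved pairing of columns at z* and z, evaluated at `a`, where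
`volterra` is the identity. -/
theorem IsSolM.pairing (hP : Pot u v) {B : ℝ → Mat} (hB : IsSolM u v z B) (a x : ℝ) :
    (volterra u v a x (star z)).conjTranspose * B x = expAd (Complex.I * z * (x - a)) (B a) := by
  ext i k
  have h := IsSol.pr_tw_const (isSolM_volterra hP a (star z) i) (hB k) x a
  rw [Matrix.mul_apply]
  simp only [Matrix.conjTranspose_apply]
  rw [pr] at h
  rw [h, expAd_apply]
  have : pr (fun l => volterra u v a a (star z) l i) (fun l => B a l k) = B a i k := by
    rw [volterra_base hP, pr_eq]
    simp only [Matrix.one_apply]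
    fin_cases i <;> simp
  rw [this]
  congr 2; ring

theorem volterra_star_mul (hP : Pot u v) (a x : ℝ) (z : ℂ) :
    (volterra u v a x (star z)).conjTranspose * volterra u v a x z = 1 := by
  rw [(isSolM_volterra hP a z).pairing hP, volterra_base hP, expAd_one]

/-- The inverse of `volterra` at z is its adjoint at z*, so `IsSolM.pairing` can be solved for B(x).
It carries the matrix normalized at -∞ from -x₀ to x₀. -/
theorem IsSolM.transport (hP : Pot u v) {B : ℝ → Mat} (hB : IsSolM u v z B) (a x : ℝ) :
    B x = volterra u v a x z * expAd (Complex.I * z * (x - a)) (B a) := by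
  rw [← hB.pairing hP, ← Matrix.mul_assoc, mul_eq_one_comm.1 (volterra_star_mul hP a x z),
    Matrix.one_mul]

theorem isSolM_bcUpper (hP : Pot u v) (hz : 0 ≤ z.im) : IsSolM u v z (fun x => bcUpper u v x z) := by
  intro k
  have g1 : Good 1 (-z) := (good_neg_of_ne (by decide)).2 hz
  have g2 : Good 2 (-z) := (good_neg_of_ne (by decide)).2 hz
  have g0 := good_zero.2 hz
  fin_cases k
  · have := ((jostMinus_spec hP g0).isSol hP g0).smul (s₁₁ u v z)⁻¹
    rw [← tw_smul] at this
    exact this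
  · exact (jostPlus_spec hP g1).isSol hP g1
  · exact (jostPlus_spec hP g2).isSol hP g2

theorem isSolM_bcLower (hP : Pot u v) (hz : 0 ≤ z.im) :
    IsSolM u v (star z) (fun x => bcLower u v x (star z)) := by
  intro k
  have g1 : Good 1 (-z) := (good_neg_of_ne (by decide)).2 hz
  have g2 : Good 2 (-z) := (good_neg_of_ne (by decide)).2 hz
  have g0 := good_zero.2 hz
  have g0' : Good 0 (-star z) := good_neg_zero.2 (by rw [im_star]; linarith)
  have ha := (jostMinus_spec hP g0).isSol hP g0
  have hb := (jostPlus_spec hP g1).isSol hP g1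
  have hc := (jostPlus_spec hP g2).isSol hP g2
  fin_cases k
  · exact (jostPlus_spec hP g0').isSol hP g0'
  · have := ha.cross hc
    simp_rw [tw_cross (l := 1) (j := 0) (k := 2) (z := z) (by simp [sig])] at this
    have := this.smul (-(t₁₁ u v (star z))⁻¹)
    rw [← tw_smul] at this
    have e : (fun x i => bcLower u v x (star z) i 1) = fun x => -(t₁₁ u v (star z))⁻¹ •
        star (crossProduct (jostMinus u v 0 x z) (jostPlus u v 2 x z)) := by
      funext x i
      simp [bcLower, ofCols_apply]
    rw [← e] at this
    exact this
  · have := ha.cross hb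
    simp_rw [tw_cross (l := 2) (j := 0) (k := 1) (z := z) (by simp [sig])] at this
    have := this.smul ((t₁₁ u v (star z))⁻¹)
    rw [← tw_smul] at this
    have e : (fun x i => bcLower u v x (star z) i 2) = fun x => (t₁₁ u v (star z))⁻¹ •
        star (crossProduct (jostMinus u v 0 x z) (jostPlus u v 1 x z)) := by
      funext x i
      simp [bcLower, ofCols_apply]
    rw [← e] at this
    exact this

theorem IsSolM.refl {B : ℝ → Mat} (h : IsSolM (refl u) (refl v) (-z) B) :
    IsSolM u v z (fun x => B (-x)) := fun k => by
  have := (h k).refl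
  convert this using 2 with x
  simp [tw]

/-! ### Reflection of the scattering data -/

theorem s₁₁_refl (hP : Pot u v) (hz : z.im ≤ 0) : s₁₁ (refl u) (refl v) (-z) = t₁₁ u v z := by
  rw [s₁₁, t₁₁, jostPlus_eq hP (good_neg_zero.2 hz),
    jostMinus_eq hP ((good_of_ne (by decide)).2 hz), jostMinus_eq hP ((good_of_ne (by decide)).2 hz),
    neg_zero]

theorem t₁₁_refl (hP : Pot u v) (hz : 0 ≤ z.im) : t₁₁ (refl u) (refl v) (-z) = s₁₁ u v z := by
  have := s₁₁_refl hP.refl (z := -z) (by simpa using hz)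
  rw [refl_refl, refl_refl, neg_neg] at this
  exact this.symm

/-- Reflection gives t₁₁(-z), which is the conjugate of s₁₁(-z*); the points z and -z* lie in the
same half plane and have equal modulus. -/
theorem s₁₁_refl_ne (hP : Pot u v) (hz : 0 ≤ z.im) (h : s₁₁ u v (-star z) ≠ 0) :
    s₁₁ (refl u) (refl v) z ≠ 0 := by
  have hz' : 0 ≤ (-star z).im := by rw [Complex.neg_im, im_star, neg_neg]; exact hz
  have h1 := s₁₁_refl hP (z := -z) (by simpa using hz)
  have h2 := t₁₁_eq hP hz'
  rw [neg_neg] at h1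
  rw [star_neg, star_star] at h2
  rw [h1, h2]
  exact star_ne_zero.2 h

/-- Reflection exchanges m⁺ with m⁻ and the two half planes, so normalization at -∞ becomes
normalization at +∞ in the opposite half plane. -/
theorem bcUpper'_eq (hP : Pot u v) (hz : 0 ≤ z.im) (x : ℝ) :
    bcUpper' u v x z = bcLower (refl u) (refl v) (-x) (-z) := by
  have hz' : (star z).im ≤ 0 := by rw [im_star]; linarith
  rw [bcUpper', bcLower, t₁₁_refl hP hz, jostMinus_eq hP (good_zero.2 hz),
    jostMinus_eq hP ((good_of_ne (by decide)).2 hz'), jostMinus_eq hP ((good_of_ne (by decide)).2 hz'),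
    jostPlus_eq hP (good_neg_zero.2 hz'), star_neg]

theorem bcLower'_eq (hP : Pot u v) (hz : z.im ≤ 0) (x : ℝ) :
    bcLower' u v x z = bcUpper (refl u) (refl v) (-x) (-z) := by
  rw [bcLower', bcUpper, s₁₁_refl hP hz, 
    jostMinus_eq hP ((good_of_ne (by decide)).2 hz), jostMinus_eq hP ((good_of_ne (by decide)).2 hz),
    jostPlus_eq hP (good_neg_zero.2 hz)]

theorem refl_cutLeft (a : ℝ) (u : ℝ → ℂ) : refl (cutLeft (-a) u) = cutRight a (refl u) := by
  funext x
  by_cases hx : x ∈ Ioi a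
  · have : -x ∈ Iio (-a) := neg_lt_neg (mem_Ioi.1 hx)
    simp only [refl, cutLeft, cutRight, indicator_of_mem this, indicator_of_mem hx]
  · have : -x ∉ Iio (-a) := fun h => hx (by simpa using h)
    simp only [refl, cutLeft, cutRight, indicator_of_notMem this, indicator_of_notMem hx, neg_zero]

theorem Pot.cutLeft (hP : Pot u v) (a : ℝ) : Pot (cutLeft a u) (cutLeft a v) :=
  ⟨hP.mu.indicator measurableSet_Iio, hP.mv.indicator measurableSet_Iio,
    hP.iu.indicator measurableSet_Iio, hP.iv.indicator measurableSet_Iio⟩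

/-! ### The jump matrices -/

/-- The regions exchanged by `z ↦ -z`, and by complex conjugation. -/
def Region.neg : Region → Region
  | Ω₁ => Ω₂
  | Ω₂ => Ω₁
  | Ω₃ => Ω₄
  | Ω₄ => Ω₃

/-- The closed upper or lower half plane containing a region, with `|z| ≥ S` for unbounded regions. -/
def Reg (S : ℝ) : Region → ℂ → Prop
  | Ω₁, z => 0 ≤ z.im ∧ S ≤ ‖z‖
  | Ω₂, z => z.im ≤ 0 ∧ S ≤ ‖z‖
  | Ω₃, z => 0 ≤ z.im
  | Ω₄, z => z.im ≤ 0

theorem Reg.neg {R : Region} (h : Reg S R z) : Reg S R.neg (-z) := by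
  cases R <;> simpa [Reg, Region.neg] using h

/-- The hypotheses on the zeros of `s₁₁`. -/
structure Zeros (u v : ℝ → ℂ) (S x₀ : ℝ) : Prop where
  pot : Pot u v
  pos : 0 < S
  s_ne : ∀ z : ℂ, 0 ≤ z.im → S ≤ ‖z‖ → s₁₁ u v z ≠ 0
  s0_ne : ∀ z : ℂ, 0 ≤ z.im → s₁₁ (cutRight x₀ u) (cutRight x₀ v) z ≠ 0

theorem bigM_base (hP : Pot u v) (R : Region) (x₀ : ℝ) (z : ℂ) : bigM u v x₀ R x₀ z = match R with
  | Ω₁ => bcUpper u v x₀ z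
  | Ω₂ => bcLower u v x₀ z
  | Ω₃ => bcUpper (cutRight x₀ u) (cutRight x₀ v) x₀ z
  | Ω₄ => bcLower (cutRight x₀ u) (cutRight x₀ v) x₀ z := by
  cases R <;> simp [bigM, volterra_base hP, expAd_zero]

theorem Zeros.isUnit_bigM (h : Zeros u v S x₀) {R : Region} (hR : Reg S R z) :
    IsUnit (bigM u v x₀ R x₀ z).det := by
  have hl : ∀ {z : ℂ}, z.im ≤ 0 → 0 ≤ (star z).im := fun hz => by rw [im_star]; linarith
  rw [bigM_base h.pot]
  cases R
  · exact isUnit_bcUpper h.pot hR.1 (h.s_ne z hR.1 hR.2) _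
  · have := isUnit_bcLower h.pot (hl hR.1) (h.s_ne (star z) (hl hR.1) (by simpa using hR.2)) x₀
    rwa [star_star] at this
  · exact isUnit_bcUpper (h.pot.cutRight x₀) hR (h.s0_ne z hR) _
  · have := isUnit_bcLower (h.pot.cutRight x₀) (hl hR) (h.s0_ne (star z) (hl hR)) x₀
    rwa [star_star] at this

theorem bigM'_base (hP : Pot u v) {R : Region} (hR : Reg S R z) (x₀ : ℝ) :
    bigM' u v x₀ R (-x₀) z = bigM (refl u) (refl v) x₀ R.neg x₀ (-z) := by
  rw [bigM_base hP.refl]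
  cases R
  · have := bcUpper'_eq hP hR.1 (-x₀)
    rw [neg_neg] at this
    exact this
  · have := bcLower'_eq hP hR.1 (-x₀)
    rw [neg_neg] at this
    exact this
  · have := bcUpper'_eq (hP.cutLeft (-x₀)) hR (-x₀)
    simp only [bigM', Region.neg, volterra_base hP, Matrix.one_mul]
    rw [show Complex.I * z * (((-x₀ : ℝ) : ℂ) + x₀) = 0 by push_cast; ring, expAd_zero, this,
      refl_cutLeft, refl_cutLeft, neg_neg]
  · have := bcLower'_eq (hP.cutLeft (-x₀)) hR (-x₀)
    simp only [bigM', Region.neg, volterra_base hP, Matrix.one_mul]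
    rw [show Complex.I * z * (((-x₀ : ℝ) : ℂ) + x₀) = 0 by push_cast; ring, expAd_zero, this,
      refl_cutLeft, refl_cutLeft, neg_neg]

/-- The prefactor does not depend on the region, so it will cancel in quotients across the contour.
-/
theorem bigM'_transport (hP : Pot u v) {R : Region} (hR : Reg S R z) (x₀ : ℝ) :
    bigM' u v x₀ R x₀ z = volterra u v (-x₀) x₀ z *
      expAd (Complex.I * z * (x₀ + x₀)) (bigM' u v x₀ R (-x₀) z) := by
  have e : (x₀ : ℂ) + x₀ = x₀ - ((-x₀ : ℝ) : ℂ) := by push_cast; ring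
  cases R
  · have h := isSolM_bcLower hP.refl (z := -star z) (by simpa using hR.1)
    rw [star_neg, star_star] at h
    have := h.refl.transport hP (-x₀) x₀
    rw [← e] at this
    simp only [bigM', bcUpper'_eq hP hR.1]
    exact this
  · have h := isSolM_bcUpper hP.refl (z := -z) (by simpa using hR.1)
    have := h.refl.transport hP (-x₀) x₀
    rw [← e] at this
    simp only [bigM', bcLower'_eq hP hR.1]
    exact this
  · simp only [bigM', volterra_base hP, Matrix.one_mul]
    rw [show Complex.I * z * (((-x₀ : ℝ) : ℂ) + x₀) = 0 by push_cast; ring, expAd_zero]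
  · simp only [bigM', volterra_base hP, Matrix.one_mul]
    rw [show Complex.I * z * (((-x₀ : ℝ) : ℂ) + x₀) = 0 by push_cast; ring, expAd_zero]

end AKNS
end

/-! ### The jump matrices on the contour and their algebraic factorization. -/

noncomputable section
namespace AKNS
open scoped ENNReal
open Region

variable {u v : ℝ → ℂ} {z : ℂ} {S x₀ : ℝ}

theorem eq_re_of_im (hz : z.im = 0) : z = (z.re : ℂ) := by
  apply Complex.ext <;> simp [hz]

theorem norm_of_im (hz : z.im = 0) : ‖z‖ = |z.re| := by
  rw [eq_re_of_im hz, Complex.norm_real, Complex.ofReal_re, Real.norm_eq_abs]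

theorem upperArc_notMem (h : z ∈ upperArc S) : z ∉ outerLine S ∧ z ∉ innerLine S ∧
    z ∉ lowerArc S := by
  obtain ⟨_, h2⟩ := h
  refine ⟨fun h' => ?_, fun h' => ?_, fun h' => ?_⟩
  · exact absurd h'.1 h2.ne'
  · exact absurd h'.1 h2.ne'
  · exact absurd h'.2 (not_lt.2 h2.le)

theorem lowerArc_notMem (h : z ∈ lowerArc S) : z ∉ outerLine S ∧ z ∉ innerLine S ∧
    z ∉ upperArc S := by
  obtain ⟨_, h2⟩ := h
  refine ⟨fun h' => ?_, fun h' => ?_, fun h' => ?_⟩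
  · exact absurd h'.1 h2.ne
  · exact absurd h'.1 h2.ne
  · exact absurd h'.2 (not_lt.2 h2.le)

theorem innerLine_notMem (h : z ∈ innerLine S) : z ∉ outerLine S ∧ z ∉ upperArc S ∧
    z ∉ lowerArc S := by
  obtain ⟨h1, h2⟩ := h
  refine ⟨fun h' => ?_, fun h' => ?_, fun h' => ?_⟩
  · exact absurd h'.2 (not_lt.2 h2.le)
  · exact absurd h1 h'.2.ne'
  · exact absurd h1 h'.2.ne

theorem plusRegion_outer (h : z ∈ outerLine S) : plusRegion S z = Ω₁ := if_pos (Or.inl h)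

theorem minusRegion_outer (h : z ∈ outerLine S) : minusRegion S z = Ω₂ := if_pos (Or.inl h)

theorem plusRegion_inner (h : z ∈ innerLine S) : plusRegion S z = Ω₄ :=
  if_neg fun h' => h'.elim (innerLine_notMem h).1 (innerLine_notMem h).2.1

theorem minusRegion_inner (h : z ∈ innerLine S) : minusRegion S z = Ω₃ :=
  if_neg fun h' => h'.elim (innerLine_notMem h).1 (innerLine_notMem h).2.2

theorem plusRegion_upper (h : z ∈ upperArc S) : plusRegion S z = Ω₁ := if_pos (Or.inr h)

theorem minusRegion_upper (h : z ∈ upperArc S) : minusRegion S z = Ω₃ :=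
  if_neg fun h' => h'.elim (upperArc_notMem h).1 (upperArc_notMem h).2.2

theorem plusRegion_lower (h : z ∈ lowerArc S) : plusRegion S z = Ω₄ :=
  if_neg fun h' => h'.elim (lowerArc_notMem h).1 (lowerArc_notMem h).2.2

theorem minusRegion_lower (h : z ∈ lowerArc S) : minusRegion S z = Ω₂ := if_pos (Or.inr h)

theorem contour_cases (h : z ∈ contour S) :
    z ∈ outerLine S ∨ z ∈ innerLine S ∨ z ∈ upperArc S ∨ z ∈ lowerArc S := by
  rcases h with ((h | h) | h) | h <;> simp [h]

theorem neg_mem_outerLine : -z ∈ outerLine S ↔ z ∈ outerLine S := by simp [outerLine]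

theorem neg_mem_innerLine : -z ∈ innerLine S ↔ z ∈ innerLine S := by simp [innerLine]

theorem neg_mem_upperArc : -z ∈ upperArc S ↔ z ∈ lowerArc S := by simp [upperArc, lowerArc]

theorem neg_mem_lowerArc : -z ∈ lowerArc S ↔ z ∈ upperArc S := by simp [upperArc, lowerArc]

theorem star_mem_outerLine : star z ∈ outerLine S ↔ z ∈ outerLine S := by simp [outerLine]

theorem star_mem_innerLine : star z ∈ innerLine S ↔ z ∈ innerLine S := by simp [innerLine]

theorem star_mem_upperArc : star z ∈ upperArc S ↔ z ∈ lowerArc S := by simp [upperArc, lowerArc]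

theorem star_mem_lowerArc : star z ∈ lowerArc S ↔ z ∈ upperArc S := by simp [upperArc, lowerArc]

theorem neg_mem_contour (h : z ∈ contour S) : -z ∈ contour S := by
  rcases contour_cases h with h | h | h | h
  · exact Or.inl (Or.inl (Or.inl (neg_mem_outerLine.2 h)))
  · exact Or.inl (Or.inl (Or.inr (neg_mem_innerLine.2 h)))
  · exact Or.inr (neg_mem_lowerArc.2 h)
  · exact Or.inl (Or.inr (neg_mem_upperArc.2 h))

theorem reg_plus (h : z ∈ contour S) : Reg S (plusRegion S z) z := by
  rcases contour_cases h with h | h | h | h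
  · rw [plusRegion_outer h]; exact ⟨h.1.ge, by rw [norm_of_im h.1]; exact h.2.le⟩
  · rw [plusRegion_inner h]; exact h.1.le
  · rw [plusRegion_upper h]; exact ⟨h.2.le, h.1.ge⟩
  · rw [plusRegion_lower h]; exact h.2.le

theorem reg_minus (h : z ∈ contour S) : Reg S (minusRegion S z) z := by
  rcases contour_cases h with h | h | h | h
  · rw [minusRegion_outer h]; exact ⟨h.1.le, by rw [norm_of_im h.1]; exact h.2.le⟩
  · rw [minusRegion_inner h]; exact h.1.ge
  · rw [minusRegion_upper h]; exact h.2.le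
  · rw [minusRegion_lower h]; exact ⟨h.2.le, h.1.ge⟩

theorem neg_minusRegion (h : z ∈ contour S) :
    (minusRegion S z).neg = plusRegion S (-z) := by
  rcases contour_cases h with h | h | h | h
  · rw [minusRegion_outer h, plusRegion_outer (neg_mem_outerLine.2 h)]; rfl
  · rw [minusRegion_inner h, plusRegion_inner (neg_mem_innerLine.2 h)]; rfl
  · rw [minusRegion_upper h, plusRegion_lower (neg_mem_lowerArc.2 h)]; rfl
  · rw [minusRegion_lower h, plusRegion_upper (neg_mem_upperArc.2 h)]; rfl

theorem neg_plusRegion (h : z ∈ contour S) :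
    (plusRegion S z).neg = minusRegion S (-z) := by
  rcases contour_cases h with h | h | h | h
  · rw [plusRegion_outer h, minusRegion_outer (neg_mem_outerLine.2 h)]; rfl
  · rw [plusRegion_inner h, minusRegion_inner (neg_mem_innerLine.2 h)]; rfl
  · rw [plusRegion_upper h, minusRegion_lower (neg_mem_lowerArc.2 h)]; rfl
  · rw [plusRegion_lower h, minusRegion_upper (neg_mem_upperArc.2 h)]; rfl

theorem expAd_neg_expAd (w : ℂ) (B : Mat) : expAd (-w) (expAd w B) = B := by
  rw [expAd_expAd, neg_add_cancel, expAd_zero]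

theorem jumpV_outer (h : z ∈ outerLine S) :
    jumpV u v S x₀ z = outerJump (rho₁ u v z.re) (rho₂ u v z.re) := if_pos h

theorem jumpV_inner (h : z ∈ innerLine S) : jumpV u v S x₀ z =
    innerJump (rho₁ (cutRight x₀ u) (cutRight x₀ v) z.re)
      (rho₂ (cutRight x₀ u) (cutRight x₀ v) z.re) := by
  rw [jumpV, if_neg (innerLine_notMem h).1, if_pos h]

/-- On the whole contour `V` is the conjugated quotient of the boundary values. -/
theorem Zeros.jumpV_eq (H : Zeros u v S x₀) (h : z ∈ contour S) : jumpV u v S x₀ z =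
    expAd (-(Complex.I * z * x₀))
      ((bigM u v x₀ (minusRegion S z) x₀ z)⁻¹ * bigM u v x₀ (plusRegion S z) x₀ z) := by
  rcases contour_cases h with h | h | h | h
  · rw [jumpV_outer h, minusRegion_outer h, plusRegion_outer h, bigM_base H.pot, bigM_base H.pot]
    have hz := eq_re_of_im h.1
    have := real_jump H.pot z.re x₀ (by
      rw [← hz]; exact H.s_ne z h.1.ge (by rw [norm_of_im h.1]; exact h.2.le))
    rw [← hz] at this
    simp only [this, expAd_neg_expAd]
  · rw [jumpV_inner h, minusRegion_inner h, plusRegion_inner h, bigM_base H.pot, bigM_base H.pot]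
    have hz := eq_re_of_im h.1
    have := real_jump_inv (H.pot.cutRight x₀) z.re x₀ (by rw [← hz]; exact H.s0_ne z h.1.ge)
    rw [← hz] at this
    simp only [this, expAd_neg_expAd]
  · have := upperArc_notMem h
    rw [jumpV, if_neg this.1, if_neg this.2.1]
  · have := lowerArc_notMem h
    rw [jumpV, if_neg this.1, if_neg this.2.1]

theorem Zeros.bcUpper_inv_mul (H : Zeros u v S x₀) (hz : 0 ≤ z.im) (hS : S ≤ ‖z‖) :
    (bcUpper (cutRight x₀ u) (cutRight x₀ v) x₀ z)⁻¹ * bcUpper u v x₀ z =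
      expAd (Complex.I * z * x₀) (low (arcV₁ u v x₀ z) (arcV₂ u v x₀ z)) := by
  rw [bcUpper_eq_mul H.pot hz (H.s_ne z hz hS) (H.s0_ne z hz), ← Matrix.mul_assoc,
    Matrix.nonsing_inv_mul _ (isUnit_bcUpper (H.pot.cutRight x₀) hz (H.s0_ne z hz) x₀),
    Matrix.one_mul]

theorem Zeros.jumpV_upper (H : Zeros u v S x₀) (h : z ∈ upperArc S) :
    jumpV u v S x₀ z = low (arcV₁ u v x₀ z) (arcV₂ u v x₀ z) := by
  rw [H.jumpV_eq (Or.inl (Or.inr h)), minusRegion_upper h, plusRegion_upper h,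
    bigM_base H.pot, bigM_base H.pot]
  simp only [H.bcUpper_inv_mul h.2.le h.1.ge, expAd_neg_expAd]

/-- The orientation inverts the exterior matrix on this arc, and Schwarz symmetry makes the quotient
the adjoint of the one at z* on the upper arc. -/
theorem Zeros.jumpV_lower (H : Zeros u v S x₀) (h : z ∈ lowerArc S) : jumpV u v S x₀ z =
    up (star (arcV₁ u v x₀ (star z))) (star (arcV₂ u v x₀ (star z))) := by
  have h' := star_mem_upperArc.2 h
  rw [H.jumpV_eq (Or.inr h), minusRegion_lower h, plusRegion_lower h,
    bigM_base H.pot, bigM_base H.pot]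
  have e1 := bcLower_inv H.pot h'.2.le (H.s_ne _ h'.2.le h'.1.ge) x₀
  have e2 := bcLower_eq (H.pot.cutRight x₀) h'.2.le (H.s0_ne _ h'.2.le) x₀
  rw [star_star] at e1 e2
  simp only
  rw [e1, e2, ← Matrix.conjTranspose_mul, H.bcUpper_inv_mul h'.2.le h'.1.ge, conjTranspose_expAd,
    star_star, expAd_neg_expAd]

/-- On the real line the entries of the jump on the arc are differences of reflection
coefficients. -/
theorem Zeros.arcV_real (H : Zeros u v S x₀) {t : ℝ} (ht : S ≤ |t|) :
    arcV₁ u v x₀ t = rho₁ u v t - rho₁ (cutRight x₀ u) (cutRight x₀ v) t ∧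
    arcV₂ u v x₀ t = rho₂ u v t - rho₂ (cutRight x₀ u) (cutRight x₀ v) t := by
  have hz : 0 ≤ (t : ℂ).im := by simp
  have hS : S ≤ ‖(t : ℂ)‖ := by simpa using ht
  have h1 := bcUpper_real H.pot t x₀ (H.s_ne t hz hS)
  have h2 := bcUpper_real (H.pot.cutRight x₀) t x₀ (H.s0_ne t hz)
  have hm : mPlus (cutRight x₀ u) (cutRight x₀ v) x₀ t = mPlus u v x₀ t := by
    ext i k
    rw [mPlus_apply, mPlus_apply, jostPlus_cutRight H.pot]
    simpa using good_real k (-t)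
  rw [bcUpper_eq_mul H.pot hz (H.s_ne t hz hS) (H.s0_ne t hz), h2, hm, Matrix.mul_assoc,
    ← expAd_mul, low_mul] at h1
  have h3 := congrArg (fun B => expAd (-(Complex.I * t * x₀)) ((mPlus u v x₀ t).conjTranspose * B)) h1
  simp only [← Matrix.mul_assoc, mPlus_unitary H.pot, Matrix.one_mul, expAd_neg_expAd] at h3
  have e1 := congrFun (congrFun h3 1) 0
  have e2 := congrFun (congrFun h3 2) 0
  simp only [low, Matrix.of_apply, Matrix.cons_val_zero, Matrix.cons_val_one, Matrix.cons_val] at e1 e2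
  exact ⟨by rw [← e1]; ring, by rw [← e2]; ring⟩

/-! ### The conjugated jump matrix -/

/-- A₋⁻¹ V A₊ telescopes to the quotient of the boundary values of 𝐌', from which the common
propagator cancels. Passing to -z interchanges the plus and minus regions, and this inverts the
quotient of the reflected matrices. -/
theorem Zeros.jumpV'_eq (H : Zeros u v S x₀) (H' : Zeros (refl u) (refl v) S x₀)
    (h : z ∈ contour S) : jumpV' u v S x₀ z = (jumpV (refl u) (refl v) S x₀ (-z))⁻¹ := by
  have hm := reg_minus h
  have hp := reg_plus h
  have im := H.isUnit_bigM hm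
  have ip := H.isUnit_bigM hp
  have im' := H'.isUnit_bigM hm.neg
  have ip' := H'.isUnit_bigM hp.neg
  rw [H'.jumpV_eq (neg_mem_contour h), jumpV', auxA, auxA, H.jumpV_eq h,
    ← neg_minusRegion h, ← neg_plusRegion h, bigM'_transport H.pot hm,
    bigM'_transport H.pot hp, bigM'_base H.pot hm, bigM'_base H.pot hp]
  generalize bigM u v x₀ (minusRegion S z) x₀ z = A at *
  generalize bigM u v x₀ (plusRegion S z) x₀ z = B at *
  generalize bigM (refl u) (refl v) x₀ (minusRegion S z).neg x₀ (-z) = A' at *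
  generalize bigM (refl u) (refl v) x₀ (plusRegion S z).neg x₀ (-z) = B' at *
  have hΦ : IsUnit (volterra u v (-x₀) x₀ z).det :=
    (Matrix.isUnit_iff_isUnit_det _).1
      (IsUnit.of_mul_eq_one _ (mul_eq_one_comm.1 (volterra_star_mul H.pot (-x₀) x₀ z)))
  generalize volterra u v (-x₀) x₀ z = Φ at *
  have cancel : ∀ {P : Mat}, IsUnit P.det → ∀ Q : Mat, P * (P⁻¹ * Q) = Q := fun hP Q => by
    rw [← Matrix.mul_assoc, Matrix.mul_nonsing_inv _ hP, Matrix.one_mul]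
  have cancel' : ∀ {P : Mat}, IsUnit P.det → ∀ Q : Mat, P⁻¹ * (P * Q) = Q := fun hP Q => by
    rw [← Matrix.mul_assoc, Matrix.nonsing_inv_mul _ hP, Matrix.one_mul]
  have isu : ∀ {P Q : Mat}, IsUnit P.det → IsUnit Q.det → IsUnit (P * Q).det := fun hP hQ => by
    rw [Matrix.det_mul]; exact hP.mul hQ
  have isi : ∀ {P : Mat}, IsUnit P.det → IsUnit (P⁻¹).det := fun hP => by
    rwa [Matrix.isUnit_nonsing_inv_det_iff]
  have ise : ∀ {P : Mat} (w : ℂ), IsUnit P.det → IsUnit (expAd w P).det := fun {P} w hP =>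
    (Matrix.isUnit_iff_isUnit_det _).1 (IsUnit.of_mul_eq_one (expAd w P⁻¹) (by
      rw [← expAd_mul, Matrix.mul_nonsing_inv _ hP, expAd_one]))
  have he := ise (Complex.I * z * (x₀ + x₀)) im'
  rw [← expAd_inv _ (isu (isi im) (isu hΦ he)), ← expAd_mul, ← expAd_mul,
    ← expAd_inv _ (isu (isi ip') im'), Matrix.mul_inv_rev, Matrix.mul_inv_rev, Matrix.mul_inv_rev,
    Matrix.nonsing_inv_nonsing_inv _ im, Matrix.nonsing_inv_nonsing_inv _ ip']
  simp only [Matrix.mul_assoc]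
  rw [cancel im, cancel ip, cancel' hΦ, ← expAd_inv _ im', ← expAd_mul, expAd_expAd]
  -- The exponent -izx₀ of the jump and 2izx₀ of the propagation from -x₀ to x₀ add up to izx₀, the
  -- exponent of the reflected jump at -z.
  congr 1
  ring

/-! ### The factorization -/

open Classical in
/-- The factor `V₊`, in terms of its lower triangular parts on `∂Ω₁` and (by symmetry) `∂Ω₄`. -/
def facP (S : ℝ) (p₁ p₂ q₁ q₂ : ℂ → ℂ) (z : ℂ) : Mat :=
  if z ∈ smoothBdry S Ω₁ then low (p₁ z) (p₂ z) else up (-star (q₁ (star z))) (-star (q₂ (star z)))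

open Classical in
/-- The factor `V₋`. -/
def facM (S : ℝ) (p₁ p₂ q₁ q₂ : ℂ → ℂ) (z : ℂ) : Mat :=
  if z ∈ smoothBdry S Ω₂ then up (-star (p₁ (star z))) (-star (p₂ (star z))) else low (q₁ z) (q₂ z)

/-- The scalar functions from which the factorization is built. -/
structure ScalarData (u v : ℝ → ℂ) (S x₀ : ℝ) (p₁ p₂ q₁ q₂ : ℂ → ℂ) : Prop where
  outer : ∀ z ∈ outerLine S, p₁ z = rho₁ u v z.re ∧ p₂ z = rho₂ u v z.re
  inner : ∀ z ∈ innerLine S, q₁ z = rho₁ (cutRight x₀ u) (cutRight x₀ v) z.re ∧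
    q₂ z = rho₂ (cutRight x₀ u) (cutRight x₀ v) z.re
  arc : ∀ z ∈ upperArc S, p₁ z = q₁ z + arcV₁ u v x₀ z ∧ p₂ z = q₂ z + arcV₂ u v x₀ z
  sob₁ : MemH11Bdry S Ω₁ p₁
  sob₂ : MemH11Bdry S Ω₁ p₂
  sob₃ : MemH11Bdry S Ω₃ q₁
  sob₄ : MemH11Bdry S Ω₃ q₂

/-- On the line these are the two Gauss decompositions, with z* = z. On the upper arc two lower
factors combine additively to p - q, and the lower arc is the conjugate of this. -/
theorem Zeros.factor (H : Zeros u v S x₀) {p₁ p₂ q₁ q₂ : ℂ → ℂ}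
    (D : ScalarData u v S x₀ p₁ p₂ q₁ q₂) (h : z ∈ contour S) :
    jumpV u v S x₀ z = (facM S p₁ p₂ q₁ q₂ z)⁻¹ * facP S p₁ p₂ q₁ q₂ z := by
  have hst : z.im = 0 → star z = z := fun hz => Complex.conj_eq_iff_im.2 hz
  rcases contour_cases h with h | h | h | h
  · rw [jumpV_outer h, facM, if_pos (show z ∈ smoothBdry S Ω₂ from Or.inl h), facP,
      if_pos (show z ∈ smoothBdry S Ω₁ from Or.inl h), hst h.1, (D.outer z h).1,
      (D.outer z h).2, up_inv, neg_neg, neg_neg, outerJump_eq]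
  · have := innerLine_notMem h
    rw [jumpV_inner h, facM, if_neg (fun h' => h'.elim this.1 this.2.2), facP,
      if_neg (fun h' => h'.elim this.1 this.2.1), hst h.1, (D.inner z h).1,
      (D.inner z h).2, low_inv, innerJump_eq]
  · have := upperArc_notMem h
    rw [H.jumpV_upper h, facM, if_neg (fun h' => h'.elim this.1 this.2.2), facP,
      if_pos (show z ∈ smoothBdry S Ω₁ from Or.inr h), (D.arc z h).1, (D.arc z h).2, low_inv, low_mul]
    congr 1 <;> ring
  · have := lowerArc_notMem h
    have h' := star_mem_upperArc.2 h
    rw [H.jumpV_lower h, facM, if_pos (show z ∈ smoothBdry S Ω₂ from Or.inr h), facP,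
      if_neg (fun h' => h'.elim this.1 this.2.2), (D.arc _ h').1, (D.arc _ h').2, up_inv, up_mul,
      star_add, star_add]
    congr 1 <;> ring

end AKNS
end

/-! ### Symmetries of H^{1,1} on the boundaries, and assembly of the factorizations. -/

noncomputable section
namespace AKNS
open scoped ENNReal
open Region

variable {u v : ℝ → ℂ} {z : ℂ} {S x₀ : ℝ}

/-! ### Symmetries of the Sobolev spaces -/

theorem MemH1On.congr {I : Set ℝ} (hI : MeasurableSet I) {f f' : ℝ → ℂ} (h : MemH1On I f)
    (e : ∀ t ∈ I, f t = f' t) : MemH1On I f' := by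
  obtain ⟨h1, g, h2, h3⟩ := h
  refine ⟨(memLp_congr_ae ((ae_restrict_mem hI).mono e)).1 h1, g, h2, fun φ a b c => ?_⟩
  rw [← h3 φ a b c]
  exact setIntegral_congr_fun hI fun t ht => by simp only [e t ht]

theorem MemH11On.congr {I : Set ℝ} (hI : MeasurableSet I) {γ f f' : ℝ → ℂ} (h : MemH11On I γ f)
    (e : ∀ t ∈ I, f t = f' t) : MemH11On I γ f' :=
  ⟨h.1.congr hI e, (memLp_congr_ae ((ae_restrict_mem hI).mono fun t ht => by
    simp only [e t ht])).1 h.2⟩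

theorem MemH1On.neg_star {I : Set ℝ} {f : ℝ → ℂ} (h : MemH1On I f) :
    MemH1On I (fun t => -star (f t)) := by
  obtain ⟨h1, g, h2, h3⟩ := h
  refine ⟨h1.star.neg, fun t => -star (g t), h2.star.neg, fun φ a b c => ?_⟩
  have := congrArg (fun w : ℂ => -star w) (h3 φ a b c)
  have hc : ∀ F : ℝ → ℂ, star (∫ t in I, F t) = ∫ t in I, star (F t) := fun F =>
    (integral_conj (f := F)).symm
  simp only [star_neg, hc, star_mul'] at this
  have hr : ∀ r : ℝ, star (r : ℂ) = r := Complex.conj_ofReal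
  simp only [hr] at this
  simp only [mul_neg, integral_neg]
  rw [this]

theorem MemH11On.neg_star {I : Set ℝ} {γ f : ℝ → ℂ} (hγ : Continuous γ) (h : MemH11On I γ f) :
    MemH11On I γ (fun t => -star (f t)) :=
  ⟨h.1.neg_star, MemLp.of_le h.2 (hγ.aestronglyMeasurable.mul h.1.1.star.neg.1)
    (Eventually.of_forall fun t => by simp)⟩

/-- The test function is reflected together with f, and the change of variables is made on both
sides of the weak derivative identity; the chain rule gives the sign of the new derivative. -/
theorem MemH1On.reflect {I J : Set ℝ} {f : ℝ → ℂ} (h : MemH1On I f) (c : ℝ)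
    (hJ : ∀ t, t ∈ J ↔ c - t ∈ I) : MemH1On J (fun t => f (c - t)) := by
  have hJ' : J = (fun t => c - t) ⁻¹' I := Set.ext hJ
  have hmp : MeasurePreserving (fun t : ℝ => c - t) := volume.measurePreserving_sub_left c
  have hemb : MeasurableEmbedding (fun t : ℝ => c - t) :=
    (Homeomorph.subLeft c).measurableEmbedding
  have hr : MeasurePreserving (fun t : ℝ => c - t) (volume.restrict J) (volume.restrict I) := by
    rw [hJ']; exact hmp.restrict_preimage_emb hemb I
  obtain ⟨h1, g, h2, h3⟩ := h
  refine ⟨h1.comp_measurePreserving hr, fun t => -g (c - t),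
    (h2.comp_measurePreserving hr).neg, fun φ a b d => ?_⟩
  have key := h3 (fun s => φ (c - s)) (a.comp (contDiff_const.sub contDiff_id))
    (b.comp_homeomorph (Homeomorph.subLeft c)) (by
      intro s hs
      have h4 : tsupport (fun s => φ (c - s)) = (Homeomorph.subLeft c) ⁻¹' tsupport φ :=
        tsupport_comp_eq_preimage φ (Homeomorph.subLeft c)
      rw [h4] at hs
      have := (hJ _).1 (d hs)
      simpa using this)
  have e1 : ∀ s, deriv (fun s => φ (c - s)) s = -deriv φ (c - s) := fun s => by
    rw [deriv_comp_const_sub]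
  have i1 := hr.integral_comp hemb (fun s => ((deriv (fun s => φ (c - s)) s : ℝ) : ℂ) * f s)
  have i2 := hr.integral_comp hemb (fun s => ((φ (c - s) : ℝ) : ℂ) * g s)
  rw [← i1, ← i2] at key
  simp only [e1, sub_sub_cancel, Complex.ofReal_neg, neg_mul, integral_neg] at key
  simp only [mul_neg, integral_neg, neg_neg]
  have := congrArg (fun w => -w) key
  simpa using this

theorem MemH11On.reflect {I J : Set ℝ} {γ γ' f : ℝ → ℂ} (h : MemH11On I γ f) (c : ℝ)
    (hJ : ∀ t, t ∈ J ↔ c - t ∈ I) (hγ : Continuous γ') (e : ∀ t, ‖γ' t‖ = ‖γ (c - t)‖) :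
    MemH11On J γ' (fun t => f (c - t)) := by
  have hJ' : J = (fun t => c - t) ⁻¹' I := Set.ext hJ
  have hmp : MeasurePreserving (fun t : ℝ => c - t) := volume.measurePreserving_sub_left c
  have hemb : MeasurableEmbedding (fun t : ℝ => c - t) :=
    (Homeomorph.subLeft c).measurableEmbedding
  have hr : MeasurePreserving (fun t : ℝ => c - t) (volume.restrict J) (volume.restrict I) := by
    rw [hJ']; exact hmp.restrict_preimage_emb hemb I
  have h1 := h.1.reflect c hJ
  refine ⟨h1, (h.2.comp_measurePreserving hr).of_le (hγ.aestronglyMeasurable.mul h1.1.1)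
    (Eventually.of_forall fun t => by simp [e])⟩

theorem continuous_arcMap (S : ℝ) : Continuous (arcMap S) := by unfold arcMap; fun_prop

theorem norm_arcMap (hS : 0 < S) (θ : ℝ) : ‖arcMap S θ‖ = S := by
  rw [arcMap, norm_mul, mul_comm Complex.I, Complex.norm_exp_ofReal_mul_I, mul_one,
    Complex.norm_real, Real.norm_of_nonneg hS.le]

theorem arcMap_im (S θ : ℝ) : (arcMap S θ).im = S * Real.sin θ := by
  rw [arcMap, mul_comm Complex.I, Complex.im_ofReal_mul, Complex.exp_ofReal_mul_I_im]

theorem arcMap_re (S θ : ℝ) : (arcMap S θ).re = S * Real.cos θ := by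
  rw [arcMap, mul_comm Complex.I, Complex.re_ofReal_mul, Complex.exp_ofReal_mul_I_re]

theorem star_arcMap (S θ : ℝ) : star (arcMap S θ) = arcMap S (-θ) := by
  have h1 : ∀ z : ℂ, (star z).re = z.re := Complex.conj_re
  apply Complex.ext
  · rw [h1, arcMap_re, arcMap_re, Real.cos_neg]
  · rw [im_star, arcMap_im, arcMap_im, Real.sin_neg]; ring

theorem neg_star_arcMap (S θ : ℝ) : -star (arcMap S θ) = arcMap S (Real.pi - θ) := by
  have h1 : ∀ z : ℂ, (star z).re = z.re := Complex.conj_re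
  apply Complex.ext
  · rw [Complex.neg_re, h1, arcMap_re, arcMap_re, Real.cos_pi_sub]; ring
  · rw [Complex.neg_im, im_star, arcMap_im, arcMap_im, Real.sin_pi_sub]; ring

theorem measurableSet_lineParam (S : ℝ) (R : Region) : MeasurableSet (lineParam S R) := by
  cases R
  · exact measurableSet_lt measurable_const continuous_abs.measurable
  · exact measurableSet_lt measurable_const continuous_abs.measurable
  · exact measurableSet_lt continuous_abs.measurable measurable_const
  · exact measurableSet_lt continuous_abs.measurable measurable_const

theorem measurableSet_arcParam (R : Region) : MeasurableSet (arcParam R) := by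
  cases R <;> exact measurableSet_Ioo

theorem ofReal_mem_outerLine {t : ℝ} : (t : ℂ) ∈ outerLine S ↔ S < |t| := by simp [outerLine]

theorem ofReal_mem_innerLine {t : ℝ} : (t : ℂ) ∈ innerLine S ↔ |t| < S := by simp [innerLine]

theorem arcMap_mem_upperArc (hS : 0 < S) {θ : ℝ} (h : θ ∈ Ioo 0 Real.pi) :
    arcMap S θ ∈ upperArc S :=
  ⟨norm_arcMap hS θ, by rw [arcMap_im]; exact mul_pos hS (Real.sin_pos_of_mem_Ioo h)⟩

theorem arcMap_mem_lowerArc (hS : 0 < S) {θ : ℝ} (h : θ ∈ Ioo (-Real.pi) 0) :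
    arcMap S θ ∈ lowerArc S := by
  rw [← star_mem_upperArc, star_arcMap]
  exact arcMap_mem_upperArc hS ⟨by linarith [h.2], by linarith [h.1]⟩

theorem line_mem_smoothBdry {R : Region} {t : ℝ} (h : t ∈ lineParam S R) :
    (t : ℂ) ∈ smoothBdry S R := by
  cases R
  · exact Or.inl (ofReal_mem_outerLine.2 h)
  · exact Or.inl (ofReal_mem_outerLine.2 h)
  · exact Or.inl (ofReal_mem_innerLine.2 h)
  · exact Or.inl (ofReal_mem_innerLine.2 h)

theorem arc_mem_smoothBdry (hS : 0 < S) {R : Region} {θ : ℝ} (h : θ ∈ arcParam R) :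
    arcMap S θ ∈ smoothBdry S R := by
  cases R
  · exact Or.inr (arcMap_mem_upperArc hS h)
  · exact Or.inr (arcMap_mem_lowerArc hS h)
  · exact Or.inr (arcMap_mem_upperArc hS h)
  · exact Or.inr (arcMap_mem_lowerArc hS h)

theorem MemH11Bdry.congr (hS : 0 < S) {R : Region} {f g : ℂ → ℂ} (h : MemH11Bdry S R f)
    (e : ∀ z ∈ smoothBdry S R, f z = g z) : MemH11Bdry S R g where
  line := h.line.congr (measurableSet_lineParam S R) fun _ ht => e _ (line_mem_smoothBdry ht)
  arc := h.arc.congr (measurableSet_arcParam R) fun _ ht => e _ (arc_mem_smoothBdry hS ht)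
  match_right := h.match_right.imp fun _ hl => hl.congr' (eventually_mem_nhdsWithin.mono e)
  match_left := h.match_left.imp fun _ hl => hl.congr' (eventually_mem_nhdsWithin.mono e)

theorem MemH1On.zero (I : Set ℝ) : MemH1On I (fun _ => 0) :=
  ⟨MemLp.zero', fun _ => 0, MemLp.zero', fun φ _ _ _ => by simp⟩

theorem MemH11Bdry.zero (S : ℝ) (R : Region) : MemH11Bdry S R (fun _ => 0) where
  line := ⟨MemH1On.zero _, by simp⟩
  arc := ⟨MemH1On.zero _, by simp⟩
  match_right := ⟨0, tendsto_const_nhds⟩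
  match_left := ⟨0, tendsto_const_nhds⟩

theorem MemH11Bdry.neg_star {R : Region} {f : ℂ → ℂ} (h : MemH11Bdry S R f) :
    MemH11Bdry S R (fun z => -star (f z)) where
  line := h.line.neg_star Complex.continuous_ofReal
  arc := h.arc.neg_star (continuous_arcMap S)
  match_right := h.match_right.imp' (fun l => -star l) fun l hl =>
    ((continuous_star.neg).tendsto l).comp hl
  match_left := h.match_left.imp' (fun l => -star l) fun l hl =>
    ((continuous_star.neg).tendsto l).comp hl

theorem star_mem_smoothBdry {R : Region} : star z ∈ smoothBdry S R.neg ↔ z ∈ smoothBdry S R := by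
  cases R <;> simp only [smoothBdry, Region.neg, mem_union, star_mem_outerLine, star_mem_innerLine,
    star_mem_upperArc, star_mem_lowerArc]

theorem neg_mem_smoothBdry {R : Region} : -z ∈ smoothBdry S R.neg ↔ z ∈ smoothBdry S R := by
  cases R <;> simp only [smoothBdry, Region.neg, mem_union, neg_mem_outerLine, neg_mem_innerLine,
    neg_mem_upperArc, neg_mem_lowerArc]

theorem Region.neg_neg_eq (R : Region) : R.neg.neg = R := by cases R <;> rfl

/-- Conjugation fixes the line and both corners and is θ ↦ -θ on the circle. -/
theorem MemH11Bdry.comp_star (hS : 0 < S) {R : Region} {f : ℂ → ℂ} (h : MemH11Bdry S R f) :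
    MemH11Bdry S R.neg (fun z => f (star z)) := by
  have hst : ∀ t : ℝ, star (t : ℂ) = t := Complex.conj_ofReal
  have hb : ∀ z, z ∈ smoothBdry S R.neg → star z ∈ smoothBdry S R := fun z hz => by
    have := star_mem_smoothBdry.2 hz
    rwa [R.neg_neg_eq] at this
  have ht : ∀ w : ℂ, star w = w → Tendsto (star : ℂ → ℂ) (𝓝[smoothBdry S R.neg] w)
      (𝓝[smoothBdry S R] w) := fun w hw =>
    tendsto_nhdsWithin_of_tendsto_nhds_of_eventually_within _
      (((continuous_star.tendsto w).mono_left nhdsWithin_le_nhds).trans (by rw [hw]))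
      (eventually_mem_nhdsWithin.mono hb)
  refine ⟨?_, ?_, ?_, ?_⟩
  · have hl : lineParam S R.neg = lineParam S R := by cases R <;> rfl
    rw [hl]
    simpa only [hst] using h.line
  · have := h.arc.reflect (J := arcParam R.neg) (γ' := arcMap S) 0 (fun t => by
      cases R <;> simp only [arcParam, Region.neg, mem_Ioo, zero_sub] <;>
        constructor <;> rintro ⟨h1, h2⟩ <;> constructor <;> linarith) (continuous_arcMap S)
      (fun t => by rw [norm_arcMap hS, norm_arcMap hS])
    simpa only [zero_sub, star_arcMap] using this
  · exact h.match_right.imp fun l hl => hl.comp (ht _ (hst S))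
  · exact h.match_left.imp fun l hl => hl.comp (ht _ (by rw [star_neg, hst S]))

/-- The map z ↦ -z* preserves the upper half plane; it is t ↦ -t on the line and θ ↦ π - θ on the
arc. It swaps the corners, hence the exchange of the two matching conditions. -/
theorem MemH11Bdry.comp_neg_star (hS : 0 < S) {R : Region} (hR : R = Ω₁ ∨ R = Ω₃) {f : ℂ → ℂ}
    (h : MemH11Bdry S R f) : MemH11Bdry S R (fun z => f (-star z)) := by
  have hst : ∀ t : ℝ, star (t : ℂ) = t := Complex.conj_ofReal
  have hb : ∀ z, z ∈ smoothBdry S R → -star z ∈ smoothBdry S R := fun z hz => by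
    have := neg_mem_smoothBdry.2 (star_mem_smoothBdry.2 hz)
    rwa [R.neg_neg_eq] at this
  have ht : ∀ w w' : ℂ, -star w = w' → Tendsto (fun z : ℂ => -star z) (𝓝[smoothBdry S R] w)
      (𝓝[smoothBdry S R] w') := fun w w' hw =>
    tendsto_nhdsWithin_of_tendsto_nhds_of_eventually_within _
      ((((show Tendsto (fun z : ℂ => -star z) (𝓝 w) (𝓝 (-star w)) from
        continuous_star.neg.tendsto w)).mono_left nhdsWithin_le_nhds).trans (by rw [hw]))
      (eventually_mem_nhdsWithin.mono hb)
  refine ⟨?_, ?_, ?_, ?_⟩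
  · have := h.line.reflect (J := lineParam S R) (γ' := fun t => (t : ℂ)) 0 (fun t => by
      cases R <;> simp [lineParam]) Complex.continuous_ofReal (fun t => by simp)
    simpa only [zero_sub, hst, Complex.ofReal_neg] using this
  · have := h.arc.reflect (J := arcParam R) (γ' := arcMap S) Real.pi (fun t => by
      rcases hR with rfl | rfl <;> simp only [arcParam, mem_Ioo] <;>
        constructor <;> rintro ⟨h1, h2⟩ <;> constructor <;> linarith) (continuous_arcMap S)
      (fun t => by rw [norm_arcMap hS, norm_arcMap hS])
    simpa only [neg_star_arcMap] using this
  · exact h.match_left.imp fun l hl => hl.comp (ht _ _ (by rw [hst S]))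
  · exact h.match_right.imp fun l hl => hl.comp (ht _ _ (by rw [star_neg, hst S, neg_neg]))

/-! ### Assembling the factorization -/

theorem strictLower_low (p q : ℂ) : StrictLower (low p q - 1) := by
  intro i j hij
  fin_cases i <;> fin_cases j <;> first | (simp [low]; done) | exact absurd hij (by decide)

theorem strictUpper_up (p q : ℂ) : StrictUpper (up p q - 1) := by
  intro i j hij
  fin_cases i <;> fin_cases j <;> first | (simp [up]; done) | exact absurd hij (by decide)

theorem memH11Bdry_low {R : Region} {p q : ℂ → ℂ} (hp : MemH11Bdry S R p) (hq : MemH11Bdry S R q)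
    (i j : Fin 3) : MemH11Bdry S R (fun z => (low (p z) (q z) - 1) i j) := by
  fin_cases i <;> fin_cases j <;> simp [low]
  all_goals first | exact hp | exact hq | exact MemH11Bdry.zero S R

theorem memH11Bdry_up {R : Region} {p q : ℂ → ℂ} (hp : MemH11Bdry S R p) (hq : MemH11Bdry S R q)
    (i j : Fin 3) : MemH11Bdry S R (fun z => (up (p z) (q z) - 1) i j) := by
  fin_cases i <;> fin_cases j <;> simp [up]
  all_goals first | exact hp | exact hq | exact MemH11Bdry.zero S R

theorem notMem_smoothBdry_four (h : z ∈ smoothBdry S Ω₄) : z ∉ smoothBdry S Ω₁ := by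
  rintro (h' | h') <;> rcases h with h | h
  · exact (innerLine_notMem h).1 h'
  · exact (lowerArc_notMem h).1 h'
  · exact (innerLine_notMem h).2.1 h'
  · exact (lowerArc_notMem h).2.2 h'

theorem notMem_smoothBdry_three (h : z ∈ smoothBdry S Ω₃) : z ∉ smoothBdry S Ω₂ := by
  rintro (h' | h') <;> rcases h with h | h
  · exact (innerLine_notMem h).1 h'
  · exact (upperArc_notMem h).1 h'
  · exact (innerLine_notMem h).2.2 h'
  · exact (upperArc_notMem h).2.2 h'

theorem Zeros.isTriangularFactorization (H : Zeros u v S x₀) {p₁ p₂ q₁ q₂ : ℂ → ℂ}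
    (D : ScalarData u v S x₀ p₁ p₂ q₁ q₂) :
    IsTriangularFactorization S StrictLower StrictUpper (jumpV u v S x₀)
      (facM S p₁ p₂ q₁ q₂) (facP S p₁ p₂ q₁ q₂) := by
  have e₁ : ∀ z ∈ smoothBdry S Ω₁, low (p₁ z) (p₂ z) = facP S p₁ p₂ q₁ q₂ z :=
    fun z hz => (if_pos hz).symm
  have e₂ : ∀ z ∈ smoothBdry S Ω₂, up (-star (p₁ (star z))) (-star (p₂ (star z))) =
      facM S p₁ p₂ q₁ q₂ z := fun z hz => (if_pos hz).symm
  have e₃ : ∀ z ∈ smoothBdry S Ω₃, low (q₁ z) (q₂ z) = facM S p₁ p₂ q₁ q₂ z :=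
    fun z hz => (if_neg (notMem_smoothBdry_three hz)).symm
  have e₄ : ∀ z ∈ smoothBdry S Ω₄, up (-star (q₁ (star z))) (-star (q₂ (star z))) =
      facP S p₁ p₂ q₁ q₂ z := fun z hz => (if_neg (notMem_smoothBdry_four hz)).symm
  have c := fun {R : Region} {f : ℂ → ℂ} (h : MemH11Bdry S R f) =>
    (h.comp_star H.pos).neg_star
  exact
    { factor := fun z hz => H.factor D hz
      sobolev₁ := fun i j => (memH11Bdry_low D.sob₁ D.sob₂ i j).congr H.pos fun z hz => by
        rw [e₁ z hz]
      sobolev₂ := fun i j => (memH11Bdry_up (c D.sob₁) (c D.sob₂) i j).congr H.pos fun z hz => by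
        rw [e₂ z hz]
      sobolev₃ := fun i j => (memH11Bdry_low D.sob₃ D.sob₄ i j).congr H.pos fun z hz => by
        rw [e₃ z hz]
      sobolev₄ := fun i j => (memH11Bdry_up (c D.sob₃) (c D.sob₄) i j).congr H.pos fun z hz => by
        rw [e₄ z hz]
      triangular₁ := fun z hz => by rw [← e₁ z hz]; exact strictLower_low _ _
      triangular₂ := fun z hz => by rw [← e₂ z hz]; exact strictUpper_up _ _
      triangular₃ := fun z hz => by rw [← e₃ z hz]; exact strictLower_low _ _
      triangular₄ := fun z hz => by rw [← e₄ z hz]; exact strictUpper_up _ _ }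

theorem isUnit_low (p q : ℂ) : IsUnit (low p q).det := by
  simp [low, Matrix.det_fin_three]

theorem isUnit_up (p q : ℂ) : IsUnit (up p q).det := by
  simp [up, Matrix.det_fin_three]

theorem isUnit_facM (S : ℝ) (p₁ p₂ q₁ q₂ : ℂ → ℂ) (z : ℂ) : IsUnit (facM S p₁ p₂ q₁ q₂ z).det := by
  rw [facM]; split_ifs
  · exact isUnit_up _ _
  · exact isUnit_low _ _

/-- The inverse of V₋⁻¹ V₊ is V₊⁻¹ V₋, so the two factors of the reflected jump exchange roles; z ↦
-z carries ∂Ω₁ to ∂Ω₂ and ∂Ω₃ to ∂Ω₄, and the triangularity is exchanged accordingly. -/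
theorem Zeros.isTriangularFactorization' (H : Zeros u v S x₀)
    (H' : Zeros (refl u) (refl v) S x₀) {p₁ p₂ q₁ q₂ : ℂ → ℂ}
    (D : ScalarData (refl u) (refl v) S x₀ p₁ p₂ q₁ q₂) :
    IsTriangularFactorization S StrictUpper StrictLower (jumpV' u v S x₀)
      (fun z => facP S p₁ p₂ q₁ q₂ (-z)) (fun z => facM S p₁ p₂ q₁ q₂ (-z)) := by
  have hn : ∀ {z : ℂ} {R : Region}, z ∈ smoothBdry S R → -z ∈ smoothBdry S R.neg :=
    fun h => neg_mem_smoothBdry.2 h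
  -- The arguments are written through `-star z` so that the Sobolev conditions follow from
  -- `comp_neg_star`, `neg_star` and `comp_star`.
  have e₁ : ∀ z ∈ smoothBdry S Ω₁, up (-star (p₁ (-star z))) (-star (p₂ (-star z))) =
      facM S p₁ p₂ q₁ q₂ (-z) := fun z hz => by
    rw [← star_neg]; exact (if_pos (hn hz)).symm
  have e₂ : ∀ z ∈ smoothBdry S Ω₂, low (p₁ (-star (star z))) (p₂ (-star (star z))) =
      facP S p₁ p₂ q₁ q₂ (-z) := fun z hz => by
    rw [star_star]; exact (if_pos (hn hz)).symm
  have e₃ : ∀ z ∈ smoothBdry S Ω₃, up (-star (q₁ (-star z))) (-star (q₂ (-star z))) =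
      facP S p₁ p₂ q₁ q₂ (-z) := fun z hz => by
    rw [← star_neg]; exact (if_neg (notMem_smoothBdry_four (hn hz))).symm
  have e₄ : ∀ z ∈ smoothBdry S Ω₄, low (q₁ (-star (star z))) (q₂ (-star (star z))) =
      facM S p₁ p₂ q₁ q₂ (-z) := fun z hz => by
    rw [star_star]; exact (if_neg (notMem_smoothBdry_three (hn hz))).symm
  have c := fun {f : ℂ → ℂ} (h : MemH11Bdry S Ω₁ f) => h.comp_neg_star H.pos (Or.inl rfl)
  have d := fun {f : ℂ → ℂ} (h : MemH11Bdry S Ω₃ f) => h.comp_neg_star H.pos (Or.inr rfl)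
  exact
    { factor := fun z hz => by
        rw [H.jumpV'_eq H' hz, H'.factor D (neg_mem_contour hz), Matrix.mul_inv_rev,
          Matrix.nonsing_inv_nonsing_inv _ (isUnit_facM _ _ _ _ _ _)]
      sobolev₁ := fun i j => (memH11Bdry_up (c D.sob₁).neg_star (c D.sob₂).neg_star i j).congr H.pos
        fun z hz => by rw [e₁ z hz]
      sobolev₂ := fun i j => (memH11Bdry_low ((c D.sob₁).comp_star H.pos)
        ((c D.sob₂).comp_star H.pos) i j).congr H.pos fun z hz => by rw [e₂ z hz]
      sobolev₃ := fun i j => (memH11Bdry_up (d D.sob₃).neg_star (d D.sob₄).neg_star i j).congr H.pos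
        fun z hz => by rw [e₃ z hz]
      sobolev₄ := fun i j => (memH11Bdry_low ((d D.sob₃).comp_star H.pos)
        ((d D.sob₄).comp_star H.pos) i j).congr H.pos fun z hz => by rw [e₄ z hz]
      triangular₁ := fun z hz => by rw [← e₁ z hz]; exact strictUpper_up _ _
      triangular₂ := fun z hz => by rw [← e₂ z hz]; exact strictLower_low _ _
      triangular₃ := fun z hz => by rw [← e₃ z hz]; exact strictUpper_up _ _
      triangular₄ := fun z hz => by rw [← e₄ z hz]; exact strictLower_low _ _ }

end AKNS
end

/-! ### L² bounds, Plancherel, and oscillatory integrals with real spectral parameter. -/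

noncomputable section
namespace AKNS

open scoped ENNReal NNReal FourierTransform SchwartzMap

/-! ### Square integrals -/

/-- The `L²` norm of a nonnegative function is at most `R`. -/
structure SqLe {α : Type*} [MeasurableSpace α] (μ : Measure α) (f : α → ℝ≥0∞) (R : ℝ≥0∞) :
    Prop where
  meas : AEMeasurable f μ
  le : ∫⁻ s, f s ^ 2 ∂μ ≤ R ^ 2

section SqLe

variable {α : Type*} [MeasurableSpace α] {μ : Measure α} {f g : α → ℝ≥0∞} {R T : ℝ≥0∞}

theorem sqrt_sq (R : ℝ≥0∞) : (R ^ 2) ^ (1 / 2 : ℝ) = R := by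
  rw [← ENNReal.rpow_natCast, ← ENNReal.rpow_mul]; norm_num

theorem sq_sqrt (R : ℝ≥0∞) : (R ^ (1 / 2 : ℝ)) ^ 2 = R := by
  rw [← ENNReal.rpow_natCast, ← ENNReal.rpow_mul]; norm_num

theorem SqLe.mono (h : SqLe μ g R) (hf : AEMeasurable f μ) (hfg : ∀ᵐ s ∂μ, f s ≤ g s)
    (hR : R ≤ T) : SqLe μ f T :=
  ⟨hf, (lintegral_mono_ae (hfg.mono fun _ hs => pow_le_pow_left' hs 2)).trans
    (h.le.trans (pow_le_pow_left' hR 2))⟩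

theorem SqLe.add (h : SqLe μ f R) (h' : SqLe μ g T) : SqLe μ (fun s => f s + g s) (R + T) := by
  refine ⟨h.meas.add h'.meas, ?_⟩
  have := ENNReal.lintegral_Lp_add_le h.meas h'.meas (p := 2) one_le_two
  have e : ∀ f : α → ℝ≥0∞, ∫⁻ s, f s ^ (2 : ℝ) ∂μ = ∫⁻ s, f s ^ 2 ∂μ := fun f => by
    simp_rw [ENNReal.rpow_two]
  rw [e, e, e] at this
  have h1 := ENNReal.rpow_le_rpow h.le (z := 1 / 2) (by norm_num)
  have h2 := ENNReal.rpow_le_rpow h'.le (z := 1 / 2) (by norm_num)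
  rw [sqrt_sq] at h1 h2
  have h3 := this.trans (add_le_add h1 h2)
  have h4 := pow_le_pow_left' h3 2
  rwa [sq_sqrt] at h4

theorem SqLe.const_mul (h : SqLe μ f R) (c : ℝ≥0∞) : SqLe μ (fun s => c * f s) (c * R) := by
  refine ⟨h.meas.const_mul c, ?_⟩
  simp_rw [mul_pow]
  rw [lintegral_const_mul'' _ (h.meas.pow_const 2)]
  exact mul_le_mul_right h.le _

theorem SqLe.zero : SqLe μ (fun _ => 0) 0 := ⟨aemeasurable_const, by simp⟩

theorem SqLe.sum {ι : Type*} (t : Finset ι) {f : ι → α → ℝ≥0∞} {R : ι → ℝ≥0∞}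
    (h : ∀ i ∈ t, SqLe μ (f i) (R i)) : SqLe μ (fun s => ∑ i ∈ t, f i s) (∑ i ∈ t, R i) := by
  classical
  induction t using Finset.induction_on with
  | empty => simpa using SqLe.zero
  | insert a t ha ih =>
    simp only [Finset.sum_insert ha]
    exact (h a (Finset.mem_insert_self _ _)).add (ih fun i hi => h i (Finset.mem_insert_of_mem hi))

/-- Cauchy-Schwarz for the measure q dν. -/
theorem lintegral_mul_sq_le {β : Type*} [MeasurableSpace β] {ν : Measure β} {q k : β → ℝ≥0∞}
    (hq : AEMeasurable q ν) (hk : AEMeasurable k ν) :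
    (∫⁻ y, q y * k y ∂ν) ^ 2 ≤ (∫⁻ y, q y ∂ν) * ∫⁻ y, q y * k y ^ 2 ∂ν := by
  have h := ENNReal.lintegral_mul_le_Lp_mul_Lq ν (p := 2) (q := 2)
    (by constructor <;> norm_num) (hq.pow_const (1 / 2 : ℝ))
    ((hq.pow_const (1 / 2 : ℝ)).mul hk)
  simp only [Pi.mul_apply, ENNReal.rpow_two, mul_pow, sq_sqrt] at h
  have h1 := pow_le_pow_left' h 2
  rw [mul_pow, sq_sqrt, sq_sqrt] at h1
  refine le_trans (le_of_eq ?_) h1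
  congr 2
  funext y
  rw [← mul_assoc, ← sq, sq_sqrt]

/-- Minkowski's inequality for integrals. -/
theorem SqLe.lintegral [SFinite μ] {β : Type*} [MeasurableSpace β] {ν : Measure β} [SFinite ν]
    {q : β → ℝ≥0∞} (hq : AEMeasurable q ν)
    {k : α × β → ℝ≥0∞} (hk : Measurable k)
    (h : ∀ᵐ y ∂ν, SqLe μ (fun s => k (s, y)) R) :
    SqLe μ (fun s => ∫⁻ y, q y * k (s, y) ∂ν) ((∫⁻ y, q y ∂ν) * R) := by
  have hqk : AEMeasurable (fun p : α × β => q p.2 * k p) (μ.prod ν) := (hq.comp_snd).mul hk.aemeasurable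
  refine ⟨hqk.lintegral_prod_right', ?_⟩
  have hq2 : AEMeasurable (fun p : α × β => q p.2 * k p ^ 2) (μ.prod ν) :=
    (hq.comp_snd).mul (hk.pow_const 2).aemeasurable
  calc ∫⁻ s, (∫⁻ y, q y * k (s, y) ∂ν) ^ 2 ∂μ
      ≤ ∫⁻ s, (∫⁻ y, q y ∂ν) * ∫⁻ y, q y * k (s, y) ^ 2 ∂ν ∂μ := by
        exact lintegral_mono fun s =>
          lintegral_mul_sq_le hq (hk.comp measurable_prodMk_left).aemeasurable
    _ = (∫⁻ y, q y ∂ν) * ∫⁻ y, ∫⁻ s, q y * k (s, y) ^ 2 ∂μ ∂ν := by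
        rw [lintegral_const_mul'' _ hq2.lintegral_prod_right', lintegral_lintegral_swap hq2]
    _ ≤ (∫⁻ y, q y ∂ν) * ∫⁻ y, q y * R ^ 2 ∂ν := by
        refine mul_le_mul_right (lintegral_mono_ae (h.mono fun y hy => ?_)) _
        rw [lintegral_const_mul'' _ (hy.meas.pow_const 2)]
        exact mul_le_mul_right hy.le _
    _ = _ := by rw [lintegral_mul_const'' _ hq]; ring

theorem SqLe.memLp {E : Type*} [NormedAddCommGroup E] {f : α → E} (h : SqLe μ (fun s => ‖f s‖ₑ) R)
    (hR : R ≠ ∞) (hf : AEStronglyMeasurable f μ) : MemLp f 2 μ := by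
  refine ⟨hf, ?_⟩
  rw [eLpNorm_lt_top_iff_lintegral_rpow_enorm_lt_top (by norm_num) (by norm_num)]
  simp only [ENNReal.toReal_ofNat, ENNReal.rpow_two]
  exact h.le.trans_lt (ENNReal.pow_lt_top hR.lt_top)

theorem SqLe.of_memLp {E : Type*} [NormedAddCommGroup E] {f : α → E} (h : MemLp f 2 μ) :
    SqLe μ (fun s => ‖f s‖ₑ) (eLpNorm f 2 μ) := by
  refine ⟨h.1.enorm, le_of_eq ?_⟩
  rw [eLpNorm_eq_lintegral_rpow_enorm_toReal (by norm_num) (by norm_num)]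
  simp only [ENNReal.toReal_ofNat, ENNReal.rpow_two, sq_sqrt]

/-- Fatou's lemma for the squares. -/
theorem SqLe.of_tendsto {F : ℕ → α → ℝ≥0∞} (h : ∀ n, SqLe μ (F n) R)
    (hf : ∀ᵐ s ∂μ, Tendsto (fun n => F n s) atTop (𝓝 (f s))) : SqLe μ f R := by
  have hm : AEMeasurable f μ := aemeasurable_of_tendsto_metrizable_ae _ (fun n => (h n).meas) hf
  refine ⟨hm, ?_⟩
  calc ∫⁻ s, f s ^ 2 ∂μ = ∫⁻ s, liminf (fun n => F n s ^ 2) atTop ∂μ := by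
        refine lintegral_congr_ae (hf.mono fun s hs => ?_)
        exact (((ENNReal.continuous_pow 2).tendsto _).comp hs).liminf_eq.symm
    _ ≤ liminf (fun n => ∫⁻ s, F n s ^ 2 ∂μ) atTop :=
        lintegral_liminf_le' fun n => (h n).meas.pow_const 2
    _ ≤ R ^ 2 := by
        refine liminf_le_of_le (by isBoundedDefault) fun b hb => ?_
        obtain ⟨n, hn⟩ := hb.exists
        exact hn.trans (h n).le

end SqLe

/-! ### The theorem of Plancherel for integrable functions -/

/-- Tested against a smooth compactly supported function, viewed as a Schwartz function, both
transforms move to the test function: the L² one by its distributional definition, the integral one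
by Fubini. -/
theorem fourier_ae_eq {f : ℝ → ℂ} (h1 : Integrable f) (h2 : MemLp f 2) :
    ((𝓕 (h2.toLp f) : Lp ℂ 2 (volume : Measure ℝ)) : ℝ → ℂ) =ᵐ[volume] 𝓕 f := by
  have hc : Continuous (𝓕 f) := VectorFourier.fourierIntegral_continuous
    Real.continuous_fourierChar (by fun_prop) h1
  refine ae_eq_of_integral_contDiff_smul_eq
    ((Lp.memLp (𝓕 (h2.toLp f))).locallyIntegrable one_le_two)
    hc.locallyIntegrable fun φ hφ hs => ?_
  have hs' : HasCompactSupport (fun x => (φ x : ℂ)) := hs.comp_left Complex.ofReal_zero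
  have hφ' : ContDiff ℝ (⊤ : ℕ∞) (fun x => (φ x : ℂ)) := Complex.ofRealCLM.contDiff.comp hφ
  let g : 𝓢(ℝ, ℂ) := hs'.toSchwartzMap hφ'
  have hg : ∀ x, g x = φ x := fun x => rfl
  have e1 := DFunLike.congr_fun (Lp.fourier_toTemperedDistribution_eq (h2.toLp f)) g
  rw [TemperedDistribution.fourier_apply, Lp.toTemperedDistribution_apply,
    Lp.toTemperedDistribution_apply] at e1
  have e2 := VectorFourier.integral_fourierIntegral_smul_eq_flip (L := innerₗ ℝ)
    Real.continuous_fourierChar (by fun_prop) h1 (g.integrable (μ := volume))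
  rw [flip_innerₗ] at e2
  have e3 : ∫ x, (𝓕 g) x • (h2.toLp f) x = ∫ x, f x • (𝓕 (g : ℝ → ℂ)) x := by
    refine integral_congr_ae (h2.coeFn_toLp.mono fun x hx => ?_)
    simp only [hx, SchwartzMap.fourier_coe, smul_eq_mul, mul_comm]
  have e4 : ∫ x, (𝓕 f) x • g x = ∫ x, f x • (𝓕 (g : ℝ → ℂ)) x := e2
  rw [e3, ← e4] at e1
  calc _ = ∫ x, g x • ((𝓕 (h2.toLp f) : Lp ℂ 2 (volume : Measure ℝ)) : ℝ → ℂ) x :=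
        integral_congr_ae (Eventually.of_forall fun x => by simp [hg])
    _ = _ := e1.symm
    _ = _ := integral_congr_ae (Eventually.of_forall fun x => by simp [hg, mul_comm])

theorem lintegral_fourier_sq {f : ℝ → ℂ} (h1 : Integrable f) (h2 : MemLp f 2) :
    eLpNorm (𝓕 f) 2 volume = eLpNorm f 2 volume := by
  have h := Lp.norm_fourier_eq (h2.toLp f)
  rw [Lp.norm_def, Lp.norm_def, ENNReal.toReal_eq_toReal_iff' (Lp.eLpNorm_ne_top _)
    (Lp.eLpNorm_ne_top _), eLpNorm_congr_ae (fourier_ae_eq h1 h2),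
    eLpNorm_congr_ae h2.coeFn_toLp] at h
  exact h

/-! ### Oscillatory integrals on the real line -/

/-- The oscillatory factor `e^{2iγt}`. -/
def kerE (γ : ℂ) (t : ℝ) : ℂ := Complex.exp (2 * Complex.I * γ * t)

theorem norm_kerE (γ : ℂ) (t : ℝ) : ‖kerE γ t‖ = Real.exp (-(2 * γ.im * t)) := by
  rw [kerE, Complex.norm_exp]
  congr 1
  rw [Complex.re_mul_ofReal]
  simp

theorem norm_kerE_ofReal (s t : ℝ) : ‖kerE s t‖ = 1 := by simp [norm_kerE]

theorem kerE_add (γ γ' : ℂ) (t : ℝ) : kerE (γ + γ') t = kerE γ t * kerE γ' t := by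
  rw [kerE, kerE, kerE, ← Complex.exp_add]; congr 1; ring

theorem kerE_sub_right (γ : ℂ) (x y : ℝ) : kerE γ (x - y) = kerE γ x * kerE γ (-y) := by
  rw [kerE, kerE, kerE, ← Complex.exp_add]; congr 1; push_cast; ring

theorem norm_kerE_ofReal_sub_one_le (s t : ℝ) : ‖kerE s t - 1‖ ≤ 2 * |s| * |t| := by
  have := Real.norm_exp_I_mul_ofReal_sub_one_le (x := 2 * s * t)
  rw [kerE, show 2 * Complex.I * (s : ℂ) * t = Complex.I * ((2 * s * t : ℝ) : ℂ) by
    push_cast; ring]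
  refine this.trans (le_of_eq ?_)
  rw [Real.norm_eq_abs, abs_mul, abs_mul, abs_two]

theorem integral_kerE_eq_fourier (c s : ℝ) (f : ℝ → ℂ) :
    ∫ y, kerE (c * s : ℝ) (-y) * f y = 𝓕 f (c / Real.pi * s) := by
  rw [Real.fourier_eq']
  refine integral_congr_ae (Eventually.of_forall fun y => ?_)
  simp only [kerE, smul_eq_mul, RCLike.inner_apply, conj_trivial]
  congr 2
  push_cast
  have := Real.pi_ne_zero
  have : (Real.pi : ℂ) ≠ 0 := by exact_mod_cast this
  field_simp

/-- Plancherel after the rescaling of frequencies by c/π, which multiplies the squared norm by π ≤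
4; hence the factor 2. -/
theorem sqLe_line {c : ℝ} (hc : |c| = 1) {f : ℝ → ℂ} (h1 : Integrable f) (h2 : MemLp f 2) :
    SqLe volume (fun s : ℝ => ‖∫ y, kerE (c * s : ℝ) (-y) * f y‖ₑ) (2 * eLpNorm f 2) := by
  have hcont : Continuous (𝓕 f) := VectorFourier.fourierIntegral_continuous
    Real.continuous_fourierChar (by fun_prop) h1
  simp_rw [integral_kerE_eq_fourier]
  have hc0 : c / Real.pi ≠ 0 := div_ne_zero (by rintro rfl; simp at hc) Real.pi_ne_zero
  refine ⟨by fun_prop, ?_⟩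
  have hs := (SqLe.of_memLp (f := 𝓕 f) (μ := volume)
    ⟨hcont.aestronglyMeasurable, by rw [lintegral_fourier_sq h1 h2]; exact h2.2⟩).le
  rw [lintegral_fourier_sq h1 h2] at hs
  have hm := lintegral_map (μ := volume) (f := fun t => ‖𝓕 f t‖ₑ ^ 2)
    (g := fun s => c / Real.pi * s) (by fun_prop) (by fun_prop)
  rw [← hm, Real.map_volume_mul_left hc0, lintegral_smul_measure, smul_eq_mul, mul_pow]
  refine mul_le_mul' ?_ hs
  rw [abs_inv, abs_div, hc, abs_of_pos Real.pi_pos, one_div, inv_inv]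
  calc ENNReal.ofReal Real.pi ≤ ENNReal.ofReal 4 := ENNReal.ofReal_le_ofReal Real.pi_le_four
    _ = 2 ^ 2 := by norm_num

/-- The operators `φ ↦ ∫_{-∞}^x K_s(x - y) φ(y) dy`, `x ≤ X`, are bounded by `R` as maps from
functions dominated by `q` to square integrable functions of `s ∈ J`. -/
def KerBound (J : Set ℝ) (K : ℝ → ℝ → ℂ) (q : ℝ → ℝ) (X : ℝ) (R : ℝ≥0∞) : Prop :=
  ∀ φ : ℝ → ℂ, Measurable φ → (∀ y, ‖φ y‖ ≤ q y) → ∀ x ≤ X,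
    SqLe (volume.restrict J) (fun s => ‖∫ y in Iic x, K s (x - y) * φ y‖ₑ) R

variable {q : ℝ → ℝ} {c X : ℝ}

/-- For a real parameter the factor depending on x is a phase, so only the transform of the
truncated function remains. -/
theorem enorm_integral_Iic_kerE (c s x : ℝ) (f : ℝ → ℂ) :
    ‖∫ y in Iic x, kerE (c * s : ℝ) (x - y) * f y‖ₑ =
      ‖∫ y, kerE (c * s : ℝ) (-y) * (Iic x).indicator f y‖ₑ := by
  rw [← integral_indicator measurableSet_Iic]
  have : ∀ y, (Iic x).indicator (fun y => kerE (c * s : ℝ) (x - y) * f y) y =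
      kerE (c * s : ℝ) x * (kerE (c * s : ℝ) (-y) * (Iic x).indicator f y) := fun y => by
    by_cases hy : y ∈ Iic x
    · simp only [indicator_of_mem hy, kerE_sub_right]; ring
    · simp only [indicator_of_notMem hy, mul_zero]
  simp_rw [this]
  rw [integral_const_mul, enorm_mul, ← ofReal_norm, norm_kerE_ofReal, ENNReal.ofReal_one, one_mul]

theorem kerBound_line_aux (hc : |c| = 1) {f : ℝ → ℂ} (h1 : Integrable f) (h2 : MemLp f 2) (x : ℝ) :
    SqLe volume (fun s : ℝ => ‖∫ y in Iic x, kerE (c * s : ℝ) (x - y) * f y‖ₑ)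
      (2 * eLpNorm f 2) := by
  have h := sqLe_line hc (h1.indicator (measurableSet_Iic (a := x)))
    (h2.indicator (measurableSet_Iic (a := x)))
  simp_rw [enorm_integral_Iic_kerE]
  exact h.mono h.meas (Eventually.of_forall fun _ => le_rfl)
    (mul_le_mul_right (eLpNorm_indicator_le f) _)

theorem kerBound_line (hc : |c| = 1) (h1 : Integrable q) (h2 : MemLp q 2) (X : ℝ) :
    KerBound univ (fun s => kerE (c * s : ℝ)) q X (2 * eLpNorm q 2) := by
  intro φ hφ hφq x _
  have i1 : Integrable φ := h1.mono' hφ.aestronglyMeasurable (Eventually.of_forall hφq)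
  have i2 : MemLp φ 2 := h2.mono' hφ.aestronglyMeasurable (Eventually.of_forall hφq)
  rw [Measure.restrict_univ]
  have h := kerBound_line_aux hc i1 i2 x
  exact h.mono h.meas (Eventually.of_forall fun _ => le_rfl)
    (mul_le_mul_right (eLpNorm_mono_real hφq) _)

/-- The increment of the kernel is the kernel times e^{2icht} - 1, so the same operator acts on a
modified function. With t = x - y ≤ |X| + |y|, the bound 2ht costs one weight in y and gives the
factor h, while the bound 2 keeps the modified function integrable. -/
theorem kerBound_line_diff (hc : |c| = 1) (h1 : Integrable q)
    (h2 : MemLp (fun y => (|X| + |y|) * q y) 2) {h : ℝ} (hh : 0 ≤ h) :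
    KerBound univ (fun s t => kerE (c * (s + h) : ℝ) t - kerE (c * s : ℝ) t) q X
      (ENNReal.ofReal h * (4 * eLpNorm (fun y => (|X| + |y|) * q y) 2)) := by
  intro φ hφ hφq x hx
  rw [Measure.restrict_univ]
  let f : ℝ → ℂ := (Iic x).indicator fun y => (kerE (c * h : ℝ) (x - y) - 1) * φ y
  have hfm : Measurable f := by
    have : Continuous fun y => kerE (c * h : ℝ) (x - y) - 1 := by unfold kerE; fun_prop
    exact (this.measurable.mul hφ).indicator measurableSet_Iic
  have hf1 : ∀ y, ‖f y‖ ≤ 2 * q y := fun y => by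
    refine (norm_indicator_le_norm_self _ _).trans ?_
    rw [norm_mul]
    refine mul_le_mul ((norm_sub_le _ _).trans ?_) (hφq y) (norm_nonneg _) zero_le_two
    rw [norm_kerE_ofReal, norm_one]; norm_num
  have hf2 : ∀ y, ‖f y‖ ≤ 2 * h * ((|X| + |y|) * q y) := fun y => by
    have hq := (norm_nonneg _).trans (hφq y)
    by_cases hy : y ∈ Iic x
    · simp only [f, indicator_of_mem hy, norm_mul]
      rw [← mul_assoc]
      refine mul_le_mul ((norm_kerE_ofReal_sub_one_le _ _).trans ?_) (hφq y) (norm_nonneg _)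
        (by positivity)
      rw [abs_mul, hc, one_mul, abs_of_nonneg hh]
      gcongr
      rw [abs_of_nonneg (sub_nonneg.2 hy)]
      have := le_abs_self X
      have := neg_abs_le y
      linarith
    · simp only [f, indicator_of_notMem hy, norm_zero]
      positivity
  have i1 : Integrable f := (h1.const_mul 2).mono' hfm.aestronglyMeasurable
    (Eventually.of_forall hf1)
  have i2 : MemLp f 2 := (h2.const_mul (2 * h)).mono' hfm.aestronglyMeasurable
    (Eventually.of_forall hf2)
  have key := kerBound_line_aux hc i1 i2 x
  have e : ∀ s : ℝ, ∫ y in Iic x, (kerE (c * (s + h) : ℝ) (x - y) - kerE (c * s : ℝ) (x - y)) * φ y =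
      ∫ y in Iic x, kerE (c * s : ℝ) (x - y) * f y := fun s => by
    refine setIntegral_congr_fun measurableSet_Iic fun y hy => ?_
    simp only [f, indicator_of_mem hy]
    rw [mul_add, Complex.ofReal_add, kerE_add]; ring
  simp_rw [e]
  refine key.mono key.meas (Eventually.of_forall fun _ => le_rfl) ?_
  have hle : eLpNorm f 2 volume ≤
      ENNReal.ofReal (2 * h) * eLpNorm (fun y => (|X| + |y|) * q y) 2 volume :=
    eLpNorm_le_mul_eLpNorm_of_ae_le_mul (Eventually.of_forall fun y => (hf2 y).trans
      (mul_le_mul_of_nonneg_left (Real.le_norm_self _) (by positivity))) 2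
  rw [ENNReal.ofReal_mul zero_le_two, ENNReal.ofReal_ofNat] at hle
  refine (mul_le_mul_right hle 2).trans (le_of_eq ?_)
  rw [show (4 : ℝ≥0∞) = 2 * 2 by norm_num]
  ring

end AKNS
end

/-! ### The Laplace transform on L², and oscillatory integrals on the half circle. -/

noncomputable section
namespace AKNS

open scoped ENNReal NNReal

/-! ### The Laplace transform on square integrable functions -/

theorem lintegral_Iic_eq (g : ℝ → ℝ≥0∞) (x : ℝ) :
    ∫⁻ y in Iic x, g y = ∫⁻ t in Ioi 0, g (x - t) := by
  have hmp : MeasurePreserving (fun t : ℝ => x - t) := volume.measurePreserving_sub_left x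
  have hemb : MeasurableEmbedding (fun t : ℝ => x - t) :=
    (Homeomorph.subLeft x).measurableEmbedding
  rw [← setLIntegral_congr (Iio_ae_eq_Iic (a := x)),
    ← hmp.setLIntegral_comp_preimage_emb hemb g (Iio x)]
  congr 2
  ext t; simp

theorem lintegral_rpow_mul_exp {r : ℝ} (hr : 0 < r) :
    ∫⁻ t in Ioi 0, ENNReal.ofReal (t ^ (-(1 / 2) : ℝ) * Real.exp (-(r * t))) =
      ENNReal.ofReal (√Real.pi * r ^ (-(1 / 2) : ℝ)) := by
  have h := Real.integral_rpow_mul_exp_neg_mul_Ioi (a := 1 / 2) (by norm_num) hr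
  rw [show (1 / 2 - 1 : ℝ) = -(1 / 2) by norm_num, Real.Gamma_one_half_eq, one_div r,
    Real.inv_rpow hr.le, ← Real.rpow_neg hr.le, mul_comm] at h
  rw [← h, ofReal_integral_eq_lintegral_ofReal]
  -- Without integrability the Bochner integral would be 0, whereas its value is positive.
  · by_contra hc
    rw [integral_undef hc] at h
    have : 0 < √Real.pi * r ^ (-(1 / 2) : ℝ) :=
      mul_pos (Real.sqrt_pos.2 Real.pi_pos) (Real.rpow_pos_of_pos hr _)
    exact this.ne h
  · refine (ae_restrict_mem measurableSet_Ioi).mono fun t ht => ?_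
    exact mul_nonneg (Real.rpow_nonneg (le_of_lt ht) _) (Real.exp_pos _).le

/-- Schur's test. Cauchy-Schwarz with the weight t^{1/2} produces √π (κθ)^{-1/2}; integration in θ
then produces √π (κt)^{-1/2}, which cancels the weight, and the two constants multiply to π/κ. On
the arc this bound takes the place of Plancherel: the exponentials decay there, but at a rate
degenerating at the corners. -/
theorem sqLe_laplace {κ : ℝ} (hκ : 0 < κ) {ψ : ℝ → ℝ≥0∞} (hψ : Measurable ψ) :
    SqLe (volume.restrict (Ioi 0))
      (fun θ => ∫⁻ t in Ioi 0, ψ t * ENNReal.ofReal (Real.exp (-(κ * θ * t))))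
      (ENNReal.ofReal (√(Real.pi / κ)) * (∫⁻ t in Ioi 0, ψ t ^ 2) ^ (1 / 2 : ℝ)) := by
  have hme : Measurable fun p : ℝ × ℝ => ψ p.2 * ENNReal.ofReal (Real.exp (-(κ * p.1 * p.2))) :=
    (hψ.comp measurable_snd).mul
      (ENNReal.measurable_ofReal.comp (by fun_prop : Continuous fun p : ℝ × ℝ =>
        Real.exp (-(κ * p.1 * p.2))).measurable)
  refine ⟨hme.lintegral_prod_right'.aemeasurable, ?_⟩
  have hrm : Measurable fun t : ℝ => t ^ (-(1 / 2) : ℝ) := by fun_prop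
  have hrm' : Measurable fun t : ℝ => t ^ (1 / 2 : ℝ) := by fun_prop
  -- the Schur test with the weight `t ^ (1 / 2)`
  have step : ∀ θ ∈ Ioi (0 : ℝ), (∫⁻ t in Ioi 0, ψ t * ENNReal.ofReal (Real.exp (-(κ * θ * t)))) ^ 2 ≤
      ∫⁻ t in Ioi 0, ENNReal.ofReal (√Real.pi * (κ * θ) ^ (-(1 / 2) : ℝ)) *
        (ψ t ^ 2 * ENNReal.ofReal (t ^ (1 / 2 : ℝ) * Real.exp (-(κ * θ * t)))) := fun θ hθ => by
    have h := lintegral_mul_sq_le (ν := volume.restrict (Ioi (0 : ℝ)))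
      (q := fun t => ENNReal.ofReal (t ^ (-(1 / 2) : ℝ) * Real.exp (-(κ * θ * t))))
      (k := fun t => ψ t * ENNReal.ofReal (t ^ (1 / 2 : ℝ)))
      (ENNReal.measurable_ofReal.comp (hrm.mul (by fun_prop))).aemeasurable
      (hψ.mul (ENNReal.measurable_ofReal.comp hrm')).aemeasurable
    rw [lintegral_rpow_mul_exp (mul_pos hκ hθ)] at h
    rw [lintegral_const_mul' _ _ ENNReal.ofReal_ne_top]
    convert h using 2
    · refine setLIntegral_congr_fun measurableSet_Ioi fun t ht => ?_
      have ht0 : (0 : ℝ) < t := ht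
      have : t ^ (-(1 / 2) : ℝ) * t ^ (1 / 2 : ℝ) = 1 := by
        rw [← Real.rpow_add ht0]; norm_num
      rw [mul_left_comm, ← ENNReal.ofReal_mul (mul_nonneg (Real.rpow_nonneg ht0.le _) (Real.exp_pos _).le),
        mul_right_comm (t ^ (-(1 / 2) : ℝ)), this, one_mul]
    · refine setLIntegral_congr_fun measurableSet_Ioi fun t ht => ?_
      have ht0 : (0 : ℝ) < t := ht
      have : t ^ (-(1 / 2) : ℝ) * (t ^ (1 / 2 : ℝ)) ^ 2 = t ^ (1 / 2 : ℝ) := by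
        rw [← Real.rpow_natCast, ← Real.rpow_mul ht0.le, ← Real.rpow_add ht0]; norm_num
      rw [mul_pow, mul_left_comm, ← ENNReal.ofReal_pow (Real.rpow_nonneg ht0.le _),
        ← ENNReal.ofReal_mul (mul_nonneg (Real.rpow_nonneg ht0.le _) (Real.exp_pos _).le),
        mul_right_comm (t ^ (-(1 / 2) : ℝ)), this]
  have hm2 : Measurable fun p : ℝ × ℝ => ENNReal.ofReal (√Real.pi * (κ * p.1) ^ (-(1 / 2) : ℝ)) *
        (ψ p.2 ^ 2 * ENNReal.ofReal (p.2 ^ (1 / 2 : ℝ) * Real.exp (-(κ * p.1 * p.2)))) := by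
    refine Measurable.mul (by fun_prop) (((hψ.comp measurable_snd).pow_const 2).mul (by fun_prop))
  calc _ ≤ ∫⁻ θ in Ioi 0, ∫⁻ t in Ioi 0, ENNReal.ofReal (√Real.pi * (κ * θ) ^ (-(1 / 2) : ℝ)) *
        (ψ t ^ 2 * ENNReal.ofReal (t ^ (1 / 2 : ℝ) * Real.exp (-(κ * θ * t)))) :=
        setLIntegral_mono' measurableSet_Ioi step
    _ = ∫⁻ t in Ioi 0, ∫⁻ θ in Ioi 0, ENNReal.ofReal (√Real.pi * (κ * θ) ^ (-(1 / 2) : ℝ)) *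
        (ψ t ^ 2 * ENNReal.ofReal (t ^ (1 / 2 : ℝ) * Real.exp (-(κ * θ * t)))) :=
        lintegral_lintegral_swap hm2.aemeasurable
    _ = ∫⁻ t in Ioi 0, ENNReal.ofReal (Real.pi / κ) * ψ t ^ 2 := by
        refine setLIntegral_congr_fun measurableSet_Ioi fun t ht => ?_
        have ht0 : (0 : ℝ) < t := ht
        have e : ∀ θ ∈ Ioi (0 : ℝ), ENNReal.ofReal (√Real.pi * (κ * θ) ^ (-(1 / 2) : ℝ)) *
            (ψ t ^ 2 * ENNReal.ofReal (t ^ (1 / 2 : ℝ) * Real.exp (-(κ * θ * t)))) =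
            (ψ t ^ 2 * ENNReal.ofReal (√Real.pi * κ ^ (-(1 / 2) : ℝ) * t ^ (1 / 2 : ℝ))) *
              ENNReal.ofReal (θ ^ (-(1 / 2) : ℝ) * Real.exp (-((κ * t) * θ))) := fun θ hθ => by
          have hθ0 : (0 : ℝ) < θ := hθ
          rw [mul_left_comm, mul_assoc (ψ t ^ 2)]
          congr 1
          rw [← ENNReal.ofReal_mul (by positivity), ← ENNReal.ofReal_mul (by positivity),
            Real.mul_rpow hκ.le hθ0.le]
          congr 1
          rw [show κ * t * θ = κ * θ * t by ring]
          ring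
        rw [setLIntegral_congr_fun measurableSet_Ioi e, lintegral_const_mul _ (by fun_prop),
          lintegral_rpow_mul_exp (mul_pos hκ ht0), mul_assoc, mul_comm]
        congr 1
        rw [← ENNReal.ofReal_mul (by positivity), Real.mul_rpow hκ.le ht0.le]
        congr 1
        have h1 : t ^ (-(1 / 2) : ℝ) * t ^ (1 / 2 : ℝ) = 1 := by
          rw [← Real.rpow_add ht0]; norm_num
        have h2 : κ ^ (-(1 / 2) : ℝ) * κ ^ (-(1 / 2) : ℝ) = κ⁻¹ := by
          rw [← Real.rpow_add hκ, ← Real.rpow_neg_one]; norm_num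
        have h3 := Real.mul_self_sqrt Real.pi_pos.le
        calc _ = (√Real.pi * √Real.pi) * (κ ^ (-(1 / 2) : ℝ) * κ ^ (-(1 / 2) : ℝ)) *
              (t ^ (-(1 / 2) : ℝ) * t ^ (1 / 2 : ℝ)) := by ring
          _ = _ := by rw [h1, h2, h3, mul_one, div_eq_mul_inv]
    _ = _ := by
        rw [lintegral_const_mul' _ _ ENNReal.ofReal_ne_top, mul_pow, sq_sqrt,
          ← ENNReal.ofReal_pow (Real.sqrt_nonneg _),
          Real.sq_sqrt (div_nonneg Real.pi_pos.le hκ.le)]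

/-! ### Oscillatory integrals on the arc -/

variable {S : ℝ}

/-- The increment is the integral of the derivative in θ, whose modulus is 2St e^{-2St sin θ}. -/
theorem kerE_arcMap_sub_le (S : ℝ) (hS : 0 < S) {s h t : ℝ} (hh : 0 ≤ h) (ht : 0 ≤ t) :
    ‖kerE (arcMap S (s + h)) t - kerE (arcMap S s) t‖ₑ ≤
      ∫⁻ θ in Ioc s (s + h), ENNReal.ofReal (2 * S * t * Real.exp (-(2 * S * t * Real.sin θ))) := by
  have hd : ∀ θ : ℝ, HasDerivAt (fun θ : ℝ => kerE (arcMap S θ) t)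
      (2 * Complex.I * t * (arcMap S θ * Complex.I) * kerE (arcMap S θ) t) θ := fun θ => by
    have h1 : HasDerivAt (fun θ : ℝ => arcMap S θ) (arcMap S θ * Complex.I) θ := by
      have := ((((Complex.ofRealCLM.hasDerivAt (x := θ)).const_mul Complex.I).cexp).const_mul (S : ℂ))
      refine this.congr_deriv ?_
      simp [arcMap]; ring
    have h2 := ((h1.const_mul (2 * Complex.I)).mul_const (t : ℂ)).cexp
    refine h2.congr_deriv ?_
    rw [kerE]; ring
  have hc : Continuous fun θ => 2 * Complex.I * t * (arcMap S θ * Complex.I) * kerE (arcMap S θ) t := by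
    unfold kerE arcMap; fun_prop
  rw [← intervalIntegral.integral_eq_sub_of_hasDerivAt (fun θ _ => hd θ) (hc.intervalIntegrable _ _),
    intervalIntegral.integral_of_le (by linarith)]
  refine (enorm_integral_le_lintegral_enorm _).trans (lintegral_mono fun θ => ?_)
  rw [← ofReal_norm]
  refine ENNReal.ofReal_le_ofReal (le_of_eq ?_)
  rw [norm_mul, norm_kerE, norm_mul, norm_mul, norm_mul (arcMap S θ), norm_arcMap hS, arcMap_im]
  simp only [norm_mul, Complex.norm_ofNat, Complex.norm_I, Complex.norm_real, Real.norm_eq_abs,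
    abs_of_nonneg ht, mul_one]
  rw [show 2 * (S * Real.sin θ) * t = 2 * S * t * Real.sin θ by ring]
  ring

/-- Jordan's inequality, used from 0 on the first half of the arc and from π on the second. -/
theorem exp_sin_le {a θ : ℝ} (ha : 0 ≤ a) (h0 : 0 < θ) (h1 : θ < Real.pi) :
    Real.exp (-(a * Real.sin θ)) ≤ Real.exp (-(2 / Real.pi * a * θ)) +
      Real.exp (-(2 / Real.pi * a * (Real.pi - θ))) := by
  rcases le_total θ (Real.pi / 2) with h | h
  · refine le_add_of_le_of_nonneg (Real.exp_le_exp.2 (neg_le_neg ?_)) (Real.exp_pos _).le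
    have := mul_le_mul_of_nonneg_left (Real.mul_le_sin h0.le h) ha
    linarith
  · refine le_add_of_nonneg_of_le (Real.exp_pos _).le (Real.exp_le_exp.2 (neg_le_neg ?_))
    have := mul_le_mul_of_nonneg_left (Real.mul_le_sin (x := Real.pi - θ) (by linarith)
      (by linarith)) ha
    rw [Real.sin_pi_sub] at this
    linarith

/-- The increment is dominated by the integral over 0 < τ ≤ h of L(s + τ) + L(π - s - τ), where L is
the Laplace transform of 2St q(x - t). Minkowski in τ and `sqLe_laplace` for each shift give h times
twice the norm of L; the factor t is absorbed by the weight |X| + |y|. -/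
theorem kerBound_arc_diff (hS : 0 < S) {q : ℝ → ℝ} {X : ℝ} (hq : Measurable q)
    {h : ℝ} (hh : 0 ≤ h) :
    KerBound (Ioo 0 (Real.pi - h)) (fun s t => kerE (arcMap S (s + h)) t - kerE (arcMap S s) t) q X
      (ENNReal.ofReal h * (ENNReal.ofReal (4 * S * √(Real.pi / (4 * S / Real.pi))) *
        eLpNorm (fun y => (|X| + |y|) * q y) 2)) := by
  intro φ hφ hφq x hx
  -- Jordan's constant 2/π times the rate 2S.
  set κ : ℝ := 4 * S / Real.pi with hκd
  have hκ : 0 < κ := by have := Real.pi_pos; positivity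
  have hqn : ∀ y, 0 ≤ q y := fun y => (norm_nonneg _).trans (hφq y)
  set ψ : ℝ → ℝ≥0∞ := fun t => ENNReal.ofReal (2 * S * (|t| * q (x - t))) with hψd
  have hψ : Measurable ψ := by fun_prop
  set L : ℝ → ℝ≥0∞ := fun θ => ∫⁻ t in Ioi 0, ψ t * ENNReal.ofReal (Real.exp (-(κ * θ * t))) with hL
  have hLm : Measurable L := by
    have hme : Measurable fun p : ℝ × ℝ => ψ p.2 * ENNReal.ofReal (Real.exp (-(κ * p.1 * p.2))) := by
      fun_prop
    exact hme.lintegral_prod_right'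
  have hLs := sqLe_laplace hκ hψ
  set R := ENNReal.ofReal (√(Real.pi / κ)) * (∫⁻ t in Ioi 0, ψ t ^ 2) ^ (1 / 2 : ℝ) with hR
  have hRle : R ≤ ENNReal.ofReal (2 * S * √(Real.pi / κ)) *
      eLpNorm (fun y => (|X| + |y|) * q y) 2 := by
    rw [hR, mul_comm (2 * S), ENNReal.ofReal_mul (Real.sqrt_nonneg _), mul_assoc]
    gcongr
    rw [← sqrt_sq (ENNReal.ofReal (2 * S) * _)]
    refine ENNReal.rpow_le_rpow ?_ (by norm_num)
    rw [mul_pow, eLpNorm_eq_lintegral_rpow_enorm_toReal (by norm_num) (by norm_num)]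
    simp only [ENNReal.toReal_ofNat, ENNReal.rpow_two, sq_sqrt]
    rw [← lintegral_const_mul' _ _ (ENNReal.pow_ne_top ENNReal.ofReal_ne_top)]
    calc ∫⁻ t in Ioi 0, ψ t ^ 2 = ∫⁻ t in Ioi 0,
          ENNReal.ofReal (2 * S * (|x - (x - t)| * q (x - t))) ^ 2 := by simp [hψd]
      _ = ∫⁻ y in Iic x, ENNReal.ofReal (2 * S * (|x - y| * q y)) ^ 2 :=
          (lintegral_Iic_eq (fun y => ENNReal.ofReal (2 * S * (|x - y| * q y)) ^ 2) x).symm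
      _ ≤ ∫⁻ y in Iic x, ENNReal.ofReal (2 * S) ^ 2 * ‖(|X| + |y|) * q y‖ₑ ^ 2 := by
          refine setLIntegral_mono' measurableSet_Iic fun y hy => ?_
          rw [← mul_pow, Real.enorm_of_nonneg (mul_nonneg (by positivity) (hqn y)),
            ← ENNReal.ofReal_mul (by positivity)]
          gcongr
          · exact hqn y
          · rw [abs_of_nonneg (sub_nonneg.2 hy)]
            have := le_abs_self X
            have := neg_abs_le y
            linarith
      _ ≤ _ := setLIntegral_le_lintegral _ _
  -- the pointwise bound
  have hpt : ∀ s ∈ Ioo 0 (Real.pi - h),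
      ‖∫ y in Iic x, (kerE (arcMap S (s + h)) (x - y) - kerE (arcMap S s) (x - y)) * φ y‖ₑ ≤
        ∫⁻ τ in Ioc 0 h, (1 : ℝ≥0∞) * (L (s + τ) + L (Real.pi - (s + τ))) := by
    intro s hs
    have hmeas : Measurable fun p : ℝ × ℝ => ENNReal.ofReal
        (2 * S * p.1 * Real.exp (-(2 * S * p.1 * Real.sin p.2))) * ENNReal.ofReal (q (x - p.1)) := by
      fun_prop
    calc _ ≤ ∫⁻ y in Iic x, ‖(kerE (arcMap S (s + h)) (x - y) - kerE (arcMap S s) (x - y)) * φ y‖ₑ :=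
          enorm_integral_le_lintegral_enorm _
      _ = ∫⁻ t in Ioi 0, ‖(kerE (arcMap S (s + h)) (x - (x - t) : ℝ) -
            kerE (arcMap S s) (x - (x - t) : ℝ)) * φ (x - t)‖ₑ := by
          rw [lintegral_Iic_eq]
      _ ≤ ∫⁻ t in Ioi 0, ∫⁻ θ in Ioc s (s + h), ENNReal.ofReal
            (2 * S * t * Real.exp (-(2 * S * t * Real.sin θ))) * ENNReal.ofReal (q (x - t)) := by
          refine setLIntegral_mono' measurableSet_Ioi fun t ht => ?_
          rw [lintegral_mul_const' _ _ ENNReal.ofReal_ne_top, enorm_mul, sub_sub_cancel]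
          refine mul_le_mul' (kerE_arcMap_sub_le S hS hh (le_of_lt ht)) ?_
          rw [← ofReal_norm]
          exact ENNReal.ofReal_le_ofReal (hφq _)
      _ = ∫⁻ θ in Ioc s (s + h), ∫⁻ t in Ioi 0, ENNReal.ofReal
            (2 * S * t * Real.exp (-(2 * S * t * Real.sin θ))) * ENNReal.ofReal (q (x - t)) :=
          lintegral_lintegral_swap hmeas.aemeasurable
      _ ≤ ∫⁻ θ in Ioc s (s + h), (L θ + L (Real.pi - θ)) := by
          refine setLIntegral_mono' measurableSet_Ioc fun θ hθ => ?_
          rw [hL, ← lintegral_add_left (by fun_prop)]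
          refine setLIntegral_mono' measurableSet_Ioi fun t ht => ?_
          have ht0 : (0 : ℝ) < t := ht
          have hq0 := hqn (x - t)
          simp only [hψd]
          rw [← mul_add, ← ENNReal.ofReal_add (Real.exp_pos _).le (Real.exp_pos _).le,
            ← ENNReal.ofReal_mul (by positivity), ← ENNReal.ofReal_mul (by positivity),
            abs_of_pos ht0]
          refine ENNReal.ofReal_le_ofReal ?_
          have := exp_sin_le (a := 2 * S * t) (θ := θ) (by positivity) (hs.1.trans hθ.1)
            (by linarith [hθ.2, hs.2])
          rw [show 2 / Real.pi * (2 * S * t) * θ = κ * θ * t by rw [hκd]; ring,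
            show 2 / Real.pi * (2 * S * t) * (Real.pi - θ) = κ * (Real.pi - θ) * t by
              rw [hκd]; ring] at this
          calc _ = 2 * S * (t * q (x - t)) * Real.exp (-(2 * S * t * Real.sin θ)) := by ring
            _ ≤ _ := mul_le_mul_of_nonneg_left this (by positivity)
      _ = _ := by
          have hmp : MeasurePreserving (fun t : ℝ => s + t) := measurePreserving_add_left volume s
          have hemb : MeasurableEmbedding (fun t : ℝ => s + t) := measurableEmbedding_addLeft s
          rw [← hmp.setLIntegral_comp_preimage_emb hemb (fun θ => L θ + L (Real.pi - θ))]
          simp only [one_mul]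
          congr 2
          ext t; simp
  have hshift : ∀ τ ∈ Ioc 0 h, SqLe (volume.restrict (Ioo 0 (Real.pi - h)))
      (fun s => L (s + τ) + L (Real.pi - (s + τ))) (R + R) := by
    intro τ hτ
    refine SqLe.add ⟨by fun_prop, ?_⟩ ⟨by fun_prop, ?_⟩
    · refine le_trans ?_ hLs.le
      have hmp : MeasurePreserving (fun t : ℝ => t + τ) := measurePreserving_add_right volume τ
      have hemb : MeasurableEmbedding (fun t : ℝ => t + τ) := measurableEmbedding_addRight τ
      rw [← hmp.setLIntegral_comp_preimage_emb hemb (fun θ => L θ ^ 2) (Ioi 0)]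
      refine lintegral_mono_set fun s hs => ?_
      simp only [mem_preimage, mem_Ioi]; linarith [hs.1, hτ.1]
    · refine le_trans ?_ hLs.le
      have hmp : MeasurePreserving (fun t : ℝ => Real.pi - τ - t) :=
        volume.measurePreserving_sub_left (Real.pi - τ)
      have hemb : MeasurableEmbedding (fun t : ℝ => Real.pi - τ - t) :=
        (Homeomorph.subLeft (Real.pi - τ)).measurableEmbedding
      rw [← hmp.setLIntegral_comp_preimage_emb hemb (fun θ => L θ ^ 2) (Ioi 0)]
      have e : ∀ s, Real.pi - (s + τ) = Real.pi - τ - s := fun s => by ring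
      simp_rw [e]
      refine lintegral_mono_set fun s hs => ?_
      simp only [mem_preimage, mem_Ioi]; linarith [hs.2, hτ.2]
  have key := SqLe.lintegral (μ := volume.restrict (Ioo 0 (Real.pi - h)))
    (ν := volume.restrict (Ioc 0 h)) (q := fun _ => 1)
    (k := fun p : ℝ × ℝ => L (p.1 + p.2) + L (Real.pi - (p.1 + p.2))) aemeasurable_const
    (by fun_prop) ((ae_restrict_mem measurableSet_Ioc).mono hshift)
  refine key.mono ?_ ((ae_restrict_mem measurableSet_Ioo).mono hpt) ?_
  · have : StronglyMeasurable fun s => ∫ y in Iic x,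
        (kerE (arcMap S (s + h)) (x - y) - kerE (arcMap S s) (x - y)) * φ y := by
      have hc : Continuous fun p : ℝ × ℝ =>
          kerE (arcMap S (p.1 + h)) (x - p.2) - kerE (arcMap S p.1) (x - p.2) := by
        unfold kerE arcMap; fun_prop
      have hm : Measurable fun p : ℝ × ℝ =>
          (kerE (arcMap S (p.1 + h)) (x - p.2) - kerE (arcMap S p.1) (x - p.2)) * φ p.2 :=
        hc.measurable.mul (hφ.comp measurable_snd)
      exact hm.stronglyMeasurable.integral_prod_right'
    exact this.measurable.enorm.aemeasurable
  · rw [lintegral_const, one_mul, Measure.restrict_apply_univ, Real.volume_Ioc, sub_zero]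
    gcongr
    calc R + R = 2 * R := (two_mul R).symm
      _ ≤ 2 * (ENNReal.ofReal (2 * S * √(Real.pi / κ)) *
          eLpNorm (fun y => (|X| + |y|) * q y) 2) := by gcongr
      _ = _ := by
        rw [← mul_assoc, show (4 : ℝ) * S * √(Real.pi / κ) = 2 * (2 * S * √(Real.pi / κ)) by ring,
          ENNReal.ofReal_mul zero_le_two (q := 2 * S * √(Real.pi / κ)), ENNReal.ofReal_ofNat]

end AKNS
end

/-! ### L²-Lipschitz functions and their weak derivatives. -/

noncomputable section
namespace AKNS

open scoped ENNReal NNReal InnerProductSpace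

/-! ### Functions with `L²` bounded difference quotients -/

/-- A bounded continuous function on `I` whose increments `f (t + h) - f t` are `O(h)` in `L²`. -/
structure BLip (I : Set ℝ) (f : ℝ → ℂ) : Prop where
  cont : ContinuousOn f I
  bdd : ∃ B : ℝ, ∀ t ∈ I, ‖f t‖ ≤ B
  lip : ∃ C : ℝ≥0, ∀ h : ℝ, 0 < h →
    SqLe (volume.restrict (I ∩ (fun t => t + h) ⁻¹' I)) (fun t => ‖f (t + h) - f t‖ₑ)
      (ENNReal.ofReal h * C)

section BLip

variable {I J : Set ℝ} {f g : ℝ → ℂ}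

theorem measurableSet_inter_preimage_add (hI : MeasurableSet I) (h : ℝ) :
    MeasurableSet (I ∩ (fun t => t + h) ⁻¹' I) := hI.inter (measurable_add_const h hI)

theorem aemeasurable_diff (hI : MeasurableSet I) (hf : ContinuousOn f I) (h : ℝ) :
    AEMeasurable (fun t => ‖f (t + h) - f t‖ₑ)
      (volume.restrict (I ∩ (fun t => t + h) ⁻¹' I)) := by
  have hc : ContinuousOn (fun t => f (t + h) - f t) (I ∩ (fun t => t + h) ⁻¹' I) :=
    (hf.comp (by fun_prop) fun t ht => ht.2).sub (hf.mono inter_subset_left)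
  exact (hc.aestronglyMeasurable (measurableSet_inter_preimage_add hI h)).enorm

/-- A pointwise bound of the increments in terms of those of two other functions. -/
theorem BLip.of_le {f₁ f₂ : ℝ → ℂ} (hI : MeasurableSet I) (h₁ : BLip I f₁) (h₂ : BLip I f₂)
    (hf : ContinuousOn f I) (hb : ∃ B : ℝ, ∀ t ∈ I, ‖f t‖ ≤ B) (a b : ℝ≥0)
    (h : ∀ s ∈ I, ∀ t ∈ I, ‖f t - f s‖ ≤ a * ‖f₁ t - f₁ s‖ + b * ‖f₂ t - f₂ s‖) : BLip I f := by
  refine ⟨hf, hb, ?_⟩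
  obtain ⟨C₁, hC₁⟩ := h₁.lip
  obtain ⟨C₂, hC₂⟩ := h₂.lip
  refine ⟨a * C₁ + b * C₂, fun k hk => ?_⟩
  refine (((hC₁ k hk).const_mul a).add ((hC₂ k hk).const_mul b)).mono (aemeasurable_diff hI hf k)
    ((ae_restrict_mem (measurableSet_inter_preimage_add hI k)).mono fun t ht => ?_) ?_
  · have := ENNReal.ofReal_le_ofReal (h t ht.1 (t + k) ht.2)
    rw [ENNReal.ofReal_add (by positivity) (by positivity), ENNReal.ofReal_mul a.coe_nonneg,
      ENNReal.ofReal_mul b.coe_nonneg] at this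
    simpa only [ofReal_norm, ENNReal.ofReal_coe_nnreal] using this
  · push_cast
    exact le_of_eq (by ring)

theorem BLip.const (I : Set ℝ) (c : ℂ) : BLip I (fun _ => c) :=
  ⟨continuousOn_const, ⟨‖c‖, fun _ _ => le_rfl⟩, 0, fun h _ => ⟨by fun_prop, by simp⟩⟩

theorem BLip.add (hI : MeasurableSet I) (hf : BLip I f) (hg : BLip I g) :
    BLip I (fun t => f t + g t) := by
  obtain ⟨B, hB⟩ := hf.bdd
  obtain ⟨D, hD⟩ := hg.bdd
  refine BLip.of_le hI hf hg (hf.cont.add hg.cont)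
    ⟨B + D, fun t ht => (norm_add_le _ _).trans (add_le_add (hB t ht) (hD t ht))⟩ 1 1
    fun s _ t _ => ?_
  rw [add_sub_add_comm, NNReal.coe_one, one_mul, one_mul]
  exact norm_add_le _ _

theorem BLip.mul (hI : MeasurableSet I) (hf : BLip I f) (hg : BLip I g) :
    BLip I (fun t => f t * g t) := by
  obtain ⟨B, hB⟩ := hf.bdd
  obtain ⟨D, hD⟩ := hg.bdd
  have hB' : ∀ t ∈ I, ‖f t‖ ≤ B.toNNReal := fun t ht => (hB t ht).trans (Real.le_coe_toNNReal B)
  have hD' : ∀ t ∈ I, ‖g t‖ ≤ D.toNNReal := fun t ht => (hD t ht).trans (Real.le_coe_toNNReal D)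
  refine BLip.of_le hI hf hg (hf.cont.mul hg.cont)
    ⟨B.toNNReal * D.toNNReal, fun t ht => (norm_mul_le _ _).trans
      (mul_le_mul (hB' t ht) (hD' t ht) (norm_nonneg _) (NNReal.coe_nonneg _))⟩ D.toNNReal B.toNNReal
    fun s hs t ht => ?_
  calc ‖f t * g t - f s * g s‖ = ‖(f t - f s) * g t + f s * (g t - g s)‖ := by congr 1; ring
    _ ≤ ‖f t - f s‖ * ‖g t‖ + ‖f s‖ * ‖g t - g s‖ := by
        refine (norm_add_le _ _).trans ?_
        rw [norm_mul, norm_mul]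
    _ ≤ ‖f t - f s‖ * D.toNNReal + B.toNNReal * ‖g t - g s‖ := by
        gcongr
        · exact hD' t ht
        · exact hB' s hs
    _ = _ := by ring

theorem BLip.const_mul (hI : MeasurableSet I) (c : ℂ) (hf : BLip I f) :
    BLip I (fun t => c * f t) := (BLip.const I c).mul hI hf

theorem BLip.sub (hI : MeasurableSet I) (hf : BLip I f) (hg : BLip I g) :
    BLip I (fun t => f t - g t) := by
  have := hf.add hI (hg.const_mul hI (-1))
  simpa only [neg_mul, one_mul, ← sub_eq_add_neg] using this

theorem BLip.star (hI : MeasurableSet I) (hf : BLip I f) : BLip I (fun t => star (f t)) := by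
  obtain ⟨B, hB⟩ := hf.bdd
  refine BLip.of_le hI hf hf (continuous_star.comp_continuousOn hf.cont)
    ⟨B, fun t ht => by rw [norm_star]; exact hB t ht⟩ 1 0 fun s _ t _ => ?_
  rw [← star_sub, norm_star]
  simp

theorem BLip.inv (hI : MeasurableSet I) (hf : BLip I f) {c : ℝ} (hc : 0 < c)
    (h : ∀ t ∈ I, c ≤ ‖f t‖) : BLip I (fun t => (f t)⁻¹) := by
  have h0 : ∀ t ∈ I, f t ≠ 0 := fun t ht => norm_pos_iff.1 (hc.trans_le (h t ht))
  refine BLip.of_le hI hf hf (hf.cont.inv₀ h0) ⟨c⁻¹, fun t ht => ?_⟩ (c⁻¹ * c⁻¹).toNNReal 0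
    fun s hs t ht => ?_
  · rw [norm_inv]; exact inv_anti₀ hc (h t ht)
  · rw [Real.coe_toNNReal _ (by positivity), NNReal.coe_zero, zero_mul, add_zero,
      inv_sub_inv (h0 t ht) (h0 s hs), norm_div, norm_mul, norm_sub_rev, div_eq_mul_inv, mul_comm,
      mul_inv]
    gcongr
    · exact h t ht
    · exact h s hs

theorem BLip.mono (hJ : J ⊆ I) (hf : BLip I f) (hJm : MeasurableSet J) :
    BLip J f := by
  obtain ⟨B, hB⟩ := hf.bdd
  obtain ⟨C, hC⟩ := hf.lip
  have hsub : ∀ h : ℝ, J ∩ (fun t => t + h) ⁻¹' J ⊆ I ∩ (fun t => t + h) ⁻¹' I := fun h =>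
    inter_subset_inter hJ (preimage_mono hJ)
  exact ⟨hf.cont.mono hJ, ⟨B, fun t ht => hB t (hJ ht)⟩, C, fun h hh =>
    ⟨aemeasurable_diff hJm (hf.cont.mono hJ) h, (lintegral_mono_set (hsub h)).trans (hC h hh).le⟩⟩

theorem BLip.of_lipschitz (hI : MeasurableSet I) (hv : volume I ≠ ∞) {K : ℝ≥0}
    (hb : ∃ B : ℝ, ∀ t ∈ I, ‖f t‖ ≤ B) (hf : LipschitzOnWith K f I) : BLip I f := by
  refine ⟨hf.continuousOn, hb, K * NNReal.sqrt (volume I).toNNReal, fun h hh =>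
    ⟨aemeasurable_diff hI hf.continuousOn h, ?_⟩⟩
  calc _ ≤ ∫⁻ _ in I ∩ (fun t => t + h) ⁻¹' I, (ENNReal.ofReal h * K) ^ 2 := by
        refine setLIntegral_mono' (measurableSet_inter_preimage_add hI h) fun t ht => ?_
        gcongr
        have := hf ht.2 ht.1
        rw [edist_eq_enorm_sub, edist_dist, Real.dist_eq, add_sub_cancel_left, abs_of_pos hh,
          mul_comm] at this
        exact this
    _ ≤ (ENNReal.ofReal h * K) ^ 2 * volume I := by
        rw [setLIntegral_const]
        gcongr
        exact inter_subset_left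
    _ = _ := by
        push_cast
        rw [← mul_assoc, mul_pow _ ((NNReal.sqrt _ : ℝ≥0) : ℝ≥0∞), ← ENNReal.coe_pow (NNReal.sqrt _),
          NNReal.sq_sqrt, ENNReal.coe_toNNReal hv]

theorem BLip.memLp (hI : MeasurableSet I) (hv : volume I ≠ ∞) (hf : BLip I f) :
    MemLp f 2 (volume.restrict I) := by
  obtain ⟨B, hB⟩ := hf.bdd
  have : IsFiniteMeasure (volume.restrict I) := ⟨by rwa [Measure.restrict_apply_univ, lt_top_iff_ne_top]⟩
  exact MemLp.of_bound (hf.cont.aestronglyMeasurable hI) B ((ae_restrict_mem hI).mono hB)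

/-! ### Difference quotients and weak derivatives -/

/-- L² is a separable Hilbert space, so balls in its dual are weak-* sequentially compact, and the
Riesz representation brings the limit back to L². -/
theorem exists_weak_limit (G : ℕ → Lp ℂ 2 (volume : Measure ℝ)) {C : ℝ} (hG : ∀ n, ‖G n‖ ≤ C) :
    ∃ (g : Lp ℂ 2 (volume : Measure ℝ)) (κ : ℕ → ℕ), StrictMono κ ∧
      ∀ ψ, Tendsto (fun n => ⟪G (κ n), ψ⟫_ℂ) atTop (𝓝 ⟪g, ψ⟫_ℂ) := by
  have : Fact ((2 : ℝ≥0∞) ≠ ∞) := ⟨by norm_num⟩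
  let T : ℕ → WeakDual ℂ (Lp ℂ 2 (volume : Measure ℝ)) := fun n =>
    StrongDual.toWeakDual (InnerProductSpace.toDual ℂ _ (G n))
  obtain ⟨Λ, -, κ, hκ, hlim⟩ := WeakDual.isSeqCompact_closedBall ℂ _ 0 C
    (x := T) fun n => by
      simp only [mem_preimage, mem_closedBall_zero_iff]
      exact ((InnerProductSpace.toDual ℂ _).norm_map (G n)).le.trans (hG n)
  refine ⟨(InnerProductSpace.toDual ℂ _).symm (WeakDual.toStrongDual Λ), κ, hκ, fun ψ => ?_⟩
  rw [InnerProductSpace.toDual_symm_apply]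
  exact ((WeakDual.eval_continuous ψ).tendsto Λ).comp hlim

/-- Difference quotients, extended by zero where t or t + h leaves I, are bounded in L²(ℝ). A weak
limit along a subsequence is the weak derivative, since for a test function supported in I and small
h the quotient can be moved onto the test function. -/
theorem BLip.memH1On (hI : IsOpen I) (hf : BLip I f) (h2 : MemLp f 2 (volume.restrict I)) :
    MemH1On I f := by
  have hIm := hI.measurableSet
  obtain ⟨C, hC⟩ := hf.lip
  let F : ℝ → ℂ := I.indicator f
  have hF : MemLp F 2 := (memLp_indicator_iff_restrict hIm).2 h2
  let h : ℕ → ℝ := fun n => 1 / ((n : ℝ) + 1)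
  have hpos : ∀ n, 0 < h n := fun n => Nat.one_div_pos_of_nat
  have hlim : Tendsto h atTop (𝓝 0) := tendsto_one_div_add_atTop_nhds_zero_nat
  let A : ℕ → Set ℝ := fun n => I ∩ (fun t => t + h n) ⁻¹' I
  have hA : ∀ n, MeasurableSet (A n) := fun n => measurableSet_inter_preimage_add hIm _
  let G : ℕ → ℝ → ℂ := fun n => (A n).indicator fun t => ((h n : ℝ) : ℂ)⁻¹ * (f (t + h n) - f t)
  have hGm : ∀ n, MemLp (fun t => f (t + h n) - f t) 2 (volume.restrict (A n)) := fun n =>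
    (hC (h n) (hpos n)).memLp (ENNReal.mul_ne_top ENNReal.ofReal_ne_top ENNReal.coe_ne_top)
      (((hf.cont.comp (by fun_prop) fun t ht => ht.2).sub
        (hf.cont.mono inter_subset_left)).aestronglyMeasurable (hA n))
  have hG : ∀ n, MemLp (G n) 2 := fun n =>
    (memLp_indicator_iff_restrict (hA n)).2 ((hGm n).const_mul _)
  have hGn : ∀ n, ‖(hG n).toLp (G n)‖ ≤ C := fun n => by
    rw [Lp.norm_toLp]
    refine ENNReal.toReal_le_of_le_ofReal C.coe_nonneg ?_
    rw [ENNReal.ofReal_coe_nnreal, eLpNorm_indicator_eq_eLpNorm_restrict (hA n),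
      eLpNorm_eq_lintegral_rpow_enorm_toReal (by norm_num) (by norm_num), ← sqrt_sq (C : ℝ≥0∞)]
    refine ENNReal.rpow_le_rpow ?_ (by norm_num)
    have := ((hC (h n) (hpos n)).const_mul ‖((h n : ℝ) : ℂ)⁻¹‖ₑ).le
    simp only [ENNReal.toReal_ofNat, ENNReal.rpow_two, enorm_mul]
    refine this.trans (le_of_eq ?_)
    rw [← mul_assoc, ← ofReal_norm, norm_inv, Complex.norm_real, Real.norm_of_nonneg (hpos n).le,
      ← ENNReal.ofReal_mul (inv_nonneg.2 (hpos n).le), inv_mul_cancel₀ (hpos n).ne',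
      ENNReal.ofReal_one, one_mul]
  obtain ⟨g, κ, hκ, hg⟩ := exists_weak_limit (fun n => (hG n).toLp (G n)) hGn
  refine ⟨h2, g, (Lp.memLp g).restrict I, fun φ hφ hφs hφI => ?_⟩
  have hφc : Continuous φ := hφ.continuous
  have hψ : MemLp (fun t => (φ t : ℂ)) 2 :=
    (Complex.continuous_ofReal.comp hφc).memLp_of_hasCompactSupport
      (hφs.comp_left Complex.ofReal_zero)
  -- passing to the limit on the side of the weak derivative
  have e1 : ∀ u : Lp ℂ 2 (volume : Measure ℝ), (starRingEnd ℂ) ⟪u, hψ.toLp _⟫_ℂ = ∫ t, (φ t : ℂ) * u t := by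
    intro u
    rw [L2.inner_def]
    rw [← integral_conj]
    refine integral_congr_ae (hψ.coeFn_toLp.mono fun t ht => ?_)
    simp [ht, RCLike.inner_apply]
  have l1 : Tendsto (fun n => ∫ t, (φ t : ℂ) * G (κ n) t) atTop (𝓝 (∫ t, (φ t : ℂ) * g t)) := by
    have := (Complex.continuous_conj.tendsto _).comp (hg (hψ.toLp _))
    rw [e1] at this
    refine this.congr fun n => ?_
    simp only [Function.comp_apply, e1]
    refine integral_congr_ae ((hG (κ n)).coeFn_toLp.mono fun t ht => ?_)
    simp only [ht]
  have hφ0 : ∀ t, t ∉ I → φ t = 0 := fun t ht => image_eq_zero_of_notMem_tsupport fun h => ht (hφI h)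
  have r1 : ∫ t in I, (φ t : ℂ) * g t = ∫ t, (φ t : ℂ) * g t :=
    setIntegral_eq_integral_of_forall_compl_eq_zero fun t ht => by simp [hφ0 t ht]
  have r2 : ∫ t in I, ((deriv φ t : ℝ) : ℂ) * f t = ∫ t, ((deriv φ t : ℝ) : ℂ) * F t := by
    rw [← integral_indicator hIm]
    refine integral_congr_ae (Eventually.of_forall fun t => ?_)
    by_cases ht : t ∈ I <;> simp [F, ht]
  -- summation by parts
  obtain ⟨r, hr, hrI⟩ := hφs.isCompact.exists_thickening_subset_open hI hφI
  have hev : ∀ᶠ n in atTop, ∫ t, (φ t : ℂ) * G n t =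
      ∫ t, (((h n)⁻¹ * (φ (t - h n) - φ t) : ℝ) : ℂ) * F t := by
    filter_upwards [hlim.eventually_lt_const hr] with n hn
    have s1 : ∀ t, (φ t : ℂ) * G n t = ((h n : ℝ) : ℂ)⁻¹ * (φ t * F (t + h n)) -
        ((h n : ℝ) : ℂ)⁻¹ * (φ t * F t) := fun t => by
      by_cases ht : t ∈ tsupport φ
      · have h3 : t + h n ∈ I := hrI (Metric.mem_thickening_iff.2 ⟨t, ht, by
          rw [Real.dist_eq, add_sub_cancel_left, abs_of_pos (hpos n)]; exact hn⟩)
        have h4 : t ∈ A n := ⟨hφI ht, h3⟩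
        simp only [G, F, indicator_of_mem h4, indicator_of_mem h3, indicator_of_mem (hφI ht)]
        ring
      · simp [image_eq_zero_of_notMem_tsupport ht]
    have hF' : MemLp (fun t => F (t + h n)) 2 :=
      hF.comp_measurePreserving (measurePreserving_add_right volume (h n))
    have hψ' : MemLp (fun t => (φ (t - h n) : ℂ)) 2 :=
      hψ.comp_measurePreserving (measurePreserving_sub_right volume (h n))
    have i1 : Integrable (fun t => (φ t : ℂ) * F (t + h n)) := hψ.integrable_mul hF'
    have i2 : Integrable (fun t => (φ t : ℂ) * F t) := hψ.integrable_mul hF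
    have i3 : Integrable (fun t => (φ (t - h n) : ℂ) * F t) := hψ'.integrable_mul hF
    have s2 : ∫ t, (φ t : ℂ) * F (t + h n) = ∫ t, (φ (t - h n) : ℂ) * F t := by
      rw [← integral_add_right_eq_self (fun t => (φ (t - h n) : ℂ) * F t) (h n)]
      simp
    simp_rw [s1]
    rw [integral_sub (i1.const_mul _) (i2.const_mul _), integral_const_mul, s2,
      ← integral_const_mul, ← integral_sub (i3.const_mul _) (i2.const_mul _)]
    refine integral_congr_ae (Eventually.of_forall fun t => ?_)
    push_cast
    ring
  -- The quotients of φ are bounded by its Lipschitz constant and, since h n ≤ 1, vanish off the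
  -- unit thickening K of its support; F is integrable on K, so dominated convergence applies.
  have l2 : Tendsto (fun n => ∫ t, (((h n)⁻¹ * (φ (t - h n) - φ t) : ℝ) : ℂ) * F t) atTop
      (𝓝 (∫ t, ((-deriv φ t : ℝ) : ℂ) * F t)) := by
    obtain ⟨L, hL⟩ := hφ.lipschitzWith_of_hasCompactSupport hφs (by simp)
    let K : Set ℝ := Metric.cthickening 1 (tsupport φ)
    have hK : IsCompact K := hφs.isCompact.cthickening
    have hFK : IntegrableOn F K := by
      have : IsFiniteMeasure (volume.restrict K) := ⟨by
        rw [Measure.restrict_apply_univ]; exact hK.measure_lt_top⟩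
      exact (hF.restrict K).integrable one_le_two
    refine tendsto_integral_of_dominated_convergence (fun t => K.indicator (fun t => L * ‖F t‖) t)
      (fun n => ?_) ((integrable_indicator_iff hK.measurableSet).2 (hFK.norm.const_mul L))
      (fun n => Eventually.of_forall fun t => ?_) (Eventually.of_forall fun t => ?_)
    · exact (Complex.continuous_ofReal.comp (by fun_prop : Continuous fun t =>
        (h n)⁻¹ * (φ (t - h n) - φ t))).aestronglyMeasurable.mul hF.1
    · by_cases ht : t ∈ K
      · rw [indicator_of_mem ht, norm_mul, Complex.norm_real, norm_mul, norm_inv,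
          Real.norm_of_nonneg (hpos n).le]
        gcongr
        have := hL.dist_le_mul (t - h n) t
        rw [dist_eq_norm, dist_eq_norm, sub_sub_cancel_left, norm_neg,
          Real.norm_of_nonneg (hpos n).le] at this
        rw [inv_mul_le_iff₀ (hpos n), mul_comm]
        exact this
      · have h1 : t ∉ tsupport φ := fun h => ht (Metric.self_subset_cthickening _ h)
        have h2 : t - h n ∉ tsupport φ := fun h' => ht (Metric.mem_cthickening_of_dist_le t (t - h n) 1 _ h' (by
          rw [Real.dist_eq, sub_sub_cancel, abs_of_pos (hpos n)]
          exact (div_le_one (by positivity)).2 (by linarith [(Nat.cast_nonneg n : (0 : ℝ) ≤ n)])))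
        simp [indicator_of_notMem ht, image_eq_zero_of_notMem_tsupport h1,
          image_eq_zero_of_notMem_tsupport h2]
    · refine Tendsto.mul_const _ ((Complex.continuous_ofReal.tendsto _).comp ?_)
      have hd : HasDerivAt φ (deriv φ t) t := (hφ.differentiable (by simp)).differentiableAt.hasDerivAt
      have hs := hd.tendsto_slope
      have hn : Tendsto (fun n => t - h n) atTop (𝓝[≠] t) :=
        tendsto_nhdsWithin_iff.2 ⟨by simpa using hlim.const_sub t, Eventually.of_forall fun n => by
          simpa using (hpos n).ne'⟩
      refine ((hs.comp hn).neg).congr fun n => ?_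
      simp only [Function.comp_apply, slope_def_field, sub_sub_cancel_left]
      rw [div_neg, neg_neg, div_eq_inv_mul]
  have hev' : ∀ᶠ n in atTop, ∫ t, (φ t : ℂ) * G (κ n) t =
      ∫ t, (((h (κ n))⁻¹ * (φ (t - h (κ n)) - φ t) : ℝ) : ℂ) * F t :=
    hκ.tendsto_atTop.eventually hev
  have l3 := l1.congr' hev'
  have l4 := tendsto_nhds_unique l3 (l2.comp hκ.tendsto_atTop)
  rw [r1, r2, l4, ← integral_neg]
  refine integral_congr_ae (Eventually.of_forall fun t => ?_)
  simp

end BLip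
end AKNS
end

/-! ### One iteration of the Volterra equation, and L² bounds in the spectral parameter. -/

noncomputable section
namespace AKNS

open scoped ENNReal NNReal

/-! ### Iterating the Volterra equation -/

variable {u v : ℝ → ℂ} {j : Fin 3} {z : ℂ}

theorem enorm_pi_le (w : Fin 3 → ℂ) : ‖w‖ₑ ≤ ∑ i, ‖w i‖ₑ := by
  have h : ‖w‖ ≤ ∑ i, ‖w i‖ := (pi_norm_le_iff_of_nonneg (by positivity)).2 fun i =>
    Finset.single_le_sum (f := fun i => ‖w i‖) (fun i _ => norm_nonneg _) (Finset.mem_univ i)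
  calc ‖w‖ₑ = ENNReal.ofReal ‖w‖ := (ofReal_norm w).symm
    _ ≤ ENNReal.ofReal (∑ i, ‖w i‖) := ENNReal.ofReal_le_ofReal h
    _ = _ := by
      rw [ENNReal.ofReal_sum_of_nonneg fun i _ => norm_nonneg _]
      simp_rw [ofReal_norm]

theorem enorm_apply_le (w : Fin 3 → ℂ) (i : Fin 3) : ‖w i‖ₑ ≤ ‖w‖ₑ := by
  rw [← ofReal_norm, ← ofReal_norm]
  exact ENNReal.ofReal_le_ofReal (norm_le_pi_norm w i)

/-- Exchanging the order of integration in an iterated Volterra integral. -/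
theorem enorm_iterated_le {K : ℝ → ℂ} {φ G : ℝ → ℂ} (c : ℂ) {x : ℝ}
    (h1 : IntegrableOn (fun y => K (x - y) * φ y) (Iic x)) (hG : Integrable G) :
    ‖∫ y in Iic x, K (x - y) * (φ y * (c + ∫ w in Iic y, G w))‖ₑ ≤
      ‖c‖ₑ * ‖∫ y in Iic x, K (x - y) * φ y‖ₑ +
        ∫⁻ w, ‖G w‖ₑ * ‖∫ y in Iic x, K (x - y) * (Ici w).indicator φ y‖ₑ := by
  have hset : MeasurableSet {p : ℝ × ℝ | p.2 ≤ p.1} := measurableSet_le measurable_snd measurable_fst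
  have h2 : Integrable (fun p : ℝ × ℝ => {p : ℝ × ℝ | p.2 ≤ p.1}.indicator
      (fun p => (K (x - p.1) * φ p.1) * G p.2) p) ((volume.restrict (Iic x)).prod volume) :=
    (h1.mul_prod hG).indicator hset
  have e1 : ∀ y, ∫ w, {p : ℝ × ℝ | p.2 ≤ p.1}.indicator
      (fun p => (K (x - p.1) * φ p.1) * G p.2) (y, w) = (K (x - y) * φ y) * ∫ w in Iic y, G w := by
    intro y
    rw [← integral_indicator measurableSet_Iic, ← integral_const_mul]
    refine integral_congr_ae (Eventually.of_forall fun w => ?_)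
    by_cases hw : w ≤ y
    · simp [indicator, hw]
    · simp [indicator, hw]
  have e2 : ∀ w, ∫ y in Iic x, {p : ℝ × ℝ | p.2 ≤ p.1}.indicator
      (fun p => (K (x - p.1) * φ p.1) * G p.2) (y, w) =
      G w * ∫ y in Iic x, K (x - y) * (Ici w).indicator φ y := by
    intro w
    rw [← integral_const_mul]
    refine integral_congr_ae (Eventually.of_forall fun y => ?_)
    by_cases hw : w ≤ y
    · simp [indicator, hw]; ring
    · simp [indicator, hw]
  have h3 : ∫ y in Iic x, (K (x - y) * φ y) * ∫ w in Iic y, G w =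
      ∫ w, G w * ∫ y in Iic x, K (x - y) * (Ici w).indicator φ y := by
    simp_rw [← e1, ← e2]
    exact integral_integral_swap h2
  have h4 : IntegrableOn (fun y => (K (x - y) * φ y) * ∫ w in Iic y, G w) (Iic x) := by
    simp_rw [← e1]
    exact h2.integral_prod_left
  have e : ∫ y in Iic x, K (x - y) * (φ y * (c + ∫ w in Iic y, G w)) =
      c * (∫ y in Iic x, K (x - y) * φ y) +
        ∫ w, G w * ∫ y in Iic x, K (x - y) * (Ici w).indicator φ y := by
    rw [← h3, ← integral_const_mul, ← integral_add (h1.const_mul c) h4]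
    refine integral_congr_ae (Eventually.of_forall fun y => ?_)
    ring
  rw [e]
  refine (enorm_add_le _ _).trans ?_
  rw [enorm_mul]
  refine add_le_add le_rfl ((enorm_integral_le_lintegral_enorm _).trans (le_of_eq ?_))
  simp_rw [enorm_mul]

theorem measurable_potential (hP : Pot u v) (i k : Fin 3) : Measurable fun y => potential u v y i k := by
  have hu := hP.mu
  have hv := hP.mv
  have hs : Measurable (star : ℂ → ℂ) := continuous_star.measurable
  have hsu : Measurable fun y => -star (u y) := (hs.comp hu).neg
  have hsv : Measurable fun y => -star (v y) := (hs.comp hv).neg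
  fin_cases i <;> fin_cases k <;> simp [potential] <;> first | assumption | exact hs.comp hu | exact hs.comp hv

theorem norm_potential_le (u v : ℝ → ℂ) (y : ℝ) (i k : Fin 3) :
    ‖potential u v y i k‖ ≤ wt u v y := by
  have hu := norm_nonneg (u y)
  have hv := norm_nonneg (v y)
  fin_cases i <;> fin_cases k <;> simp [potential, wt]
  all_goals linarith

/-- U is off-diagonal for the eigenspaces of σ: an oscillating component is driven only by
non-oscillating ones, and conversely. This is why a single iteration suffices. -/
theorem potential_eq_zero (u v : ℝ → ℂ) (y : ℝ) {i k : Fin 3} (h : sigR i = sigR k) :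
    potential u v y i k = 0 := by
  fin_cases i <;> fin_cases k <;> simp_all [potential, sigR] <;> norm_num at h

/-- The rate of the oscillations of the `j`-th column. -/
def osc (j : Fin 3) : ℝ := -sigR j

theorem abs_osc (j : Fin 3) : |osc j| = 1 := by fin_cases j <;> simp [osc, sigR]

theorem jE_osc {i : Fin 3} (h : sigR i ≠ sigR j) (z : ℂ) (t : ℝ) :
    jE j z t i = kerE (osc j * z) t := by
  rw [jE, kerE, sig_eq, sig_eq]
  congr 1
  fin_cases i <;> fin_cases j <;> simp_all [osc, sigR] <;> ring

theorem jE_not_osc {i : Fin 3} (h : sigR i = sigR j) (z : ℂ) (t : ℝ) : jE j z t i = 1 := by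
  simp [jE, sig_eq, h]

theorem jostMinus_apply (hP : Pot u v) (hz : Good j z) (x : ℝ) (i : Fin 3) :
    jostMinus u v j x z i = (Pi.single j 1 : Fin 3 → ℂ) i + ∫ y in Iic x,
      jE j z (x - y) i * (potential u v y).mulVec (jostMinus u v j y z) i := by
  have hf := (isJostMinus_iff _).1 (jostMinus_spec hP hz)
  obtain ⟨hc, ⟨C, hC⟩, e⟩ := hf
  have hi := integrableOn_vker hP (continuous_jE j z) (norm_jE_le hz) hc hC x
  conv_lhs => rw [e x]
  rw [Pi.add_apply, eval_integral fun i => hi.eval i]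
  rfl

/-- The iterated bound for oscillatory integrals against the potential. -/
def oscBound (u v : ℝ → ℂ) (K : ℝ → ℂ) (x : ℝ) : ℝ≥0∞ :=
  ∑ i, ∑ k, (‖∫ y in Iic x, K (x - y) * potential u v y i k‖ₑ +
    ∫⁻ w, ENNReal.ofReal (Real.exp (∫ y, wt u v y) * wt u v w) *
      ‖∫ y in Iic x, K (x - y) * (Ici w).indicator (fun y => potential u v y i k) y‖ₑ)

theorem integrable_mulVec_jost (hP : Pot u v) (hz : Good j z) (k : Fin 3) :
    Integrable fun w => (potential u v w).mulVec (jostMinus u v j w z) k := by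
  have hf := (jostMinus_spec hP hz).1
  have hm : ∀ i, Measurable fun y => jostMinus u v j y z i := fun i =>
    ((continuous_apply i).comp hf).measurable
  refine (hP.wt_int.mul_const (Real.exp (∫ y, wt u v y))).mono' ?_ (Eventually.of_forall fun w =>
    (norm_potential_mulVec_le u v w _ k).trans
      (mul_le_mul_of_nonneg_left (norm_jostMinus_le hP hz w) (wt_nonneg u v w)))
  simp only [Matrix.mulVec, dotProduct]
  exact (Finset.measurable_sum _ fun i _ => (measurable_potential hP k i).mul (hm i)).aestronglyMeasurable

theorem integrableOn_ker {K : ℝ → ℂ} (hK : Continuous K) {C : ℝ} (hC : ∀ t, 0 ≤ t → ‖K t‖ ≤ C)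
    {φ : ℝ → ℂ} (hφ : Integrable φ) (x : ℝ) :
    IntegrableOn (fun y => K (x - y) * φ y) (Iic x) :=
  hφ.integrableOn.bdd_mul (hK.comp (by fun_prop)).aestronglyMeasurable
    ((ae_restrict_mem measurableSet_Iic).mono fun y hy => hC _ (sub_nonneg.2 hy))

theorem Pot.integrable_potential (hP : Pot u v) (i k : Fin 3) :
    Integrable fun y => potential u v y i k :=
  hP.wt_int.mono' (measurable_potential hP i k).aestronglyMeasurable
    (Eventually.of_forall fun y => norm_potential_le u v y i k)

/-- Row i involves only components m_k with σ_k = σ_j, and these satisfy m_k = δ_{jk} + ∫ (U m)_k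
without any exponential. Inserting this and exchanging integrals leaves K tested against U_{ik} cut
to y ≥ w, which no longer depends on z; the dependence on z survives only in a weight bounded by
e^{‖U‖₁} times `wt`. -/
theorem enorm_ker_mulVec_le (hP : Pot u v) (hz : Good j z) {K : ℝ → ℂ} (hK : Continuous K) {C : ℝ}
    (hC : ∀ t, 0 ≤ t → ‖K t‖ ≤ C) {i : Fin 3} (hi : sigR i ≠ sigR j) (x : ℝ) :
    ‖∫ y in Iic x, K (x - y) * (potential u v y).mulVec (jostMinus u v j y z) i‖ₑ ≤
      ∑ k, (‖∫ y in Iic x, K (x - y) * potential u v y i k‖ₑ +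
        ∫⁻ w, ENNReal.ofReal (Real.exp (∫ y, wt u v y) * wt u v w) *
          ‖∫ y in Iic x, K (x - y) * (Ici w).indicator (fun y => potential u v y i k) y‖ₑ) := by
  have hf := (jostMinus_spec hP hz).1
  have hm : ∀ i, Continuous fun y => jostMinus u v j y z i := fun i => (continuous_apply i).comp hf
  have hint : ∀ k, IntegrableOn (fun y => K (x - y) *
      (potential u v y i k * jostMinus u v j y z k)) (Iic x) := fun k => by
    refine integrableOn_ker hK hC ?_ x
    exact (hP.integrable_potential i k).mul_bdd (hm k).aestronglyMeasurable
      (Eventually.of_forall fun y => (norm_le_pi_norm _ k).trans (norm_jostMinus_le hP hz y))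
  have e : ∫ y in Iic x, K (x - y) * (potential u v y).mulVec (jostMinus u v j y z) i =
      ∑ k, ∫ y in Iic x, K (x - y) * (potential u v y i k * jostMinus u v j y z k) := by
    rw [← integral_finsetSum _ fun k _ => hint k]
    refine integral_congr_ae (Eventually.of_forall fun y => ?_)
    simp only [Matrix.mulVec, dotProduct, Finset.mul_sum]
  rw [e]
  refine (enorm_sum_le _ _).trans (Finset.sum_le_sum fun k _ => ?_)
  by_cases hk : sigR k = sigR j
  · have e2 : ∀ y, jostMinus u v j y z k = (Pi.single j 1 : Fin 3 → ℂ) k + ∫ w in Iic y,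
        (potential u v w).mulVec (jostMinus u v j w z) k := fun y => by
      rw [jostMinus_apply hP hz]
      simp_rw [jE_not_osc hk, one_mul]
    simp_rw [e2]
    refine (enorm_iterated_le _ (integrableOn_ker hK hC (hP.integrable_potential i k) x)
      (integrable_mulVec_jost hP hz k)).trans (add_le_add ?_ (lintegral_mono fun w => ?_))
    · refine (mul_le_mul_left ?_ _).trans (one_mul _).le
      refine (enorm_apply_le _ k).trans (le_of_eq ?_)
      rw [← ofReal_norm, norm_single_one, ENNReal.ofReal_one]
    · refine mul_le_mul_left ?_ _
      rw [← ofReal_norm]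
      refine ENNReal.ofReal_le_ofReal ((norm_potential_mulVec_le u v w _ k).trans ?_)
      rw [mul_comm]
      exact mul_le_mul_of_nonneg_right (norm_jostMinus_le hP hz w) (wt_nonneg u v w)
  -- As σ has only two eigenvalues, σ_k ≠ σ_j forces σ_k = σ_i, and the entry of U vanishes.
  · have h0 : sigR i = sigR k := by
      fin_cases i <;> fin_cases k <;> fin_cases j <;> simp_all [sigR]
    simp_rw [potential_eq_zero u v _ h0, zero_mul, mul_zero]
    simp

theorem enorm_ker_mulVec_le_oscBound (hP : Pot u v) (hz : Good j z) {K : ℝ → ℂ} (hK : Continuous K)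
    {C : ℝ} (hC : ∀ t, 0 ≤ t → ‖K t‖ ≤ C) {i : Fin 3} (hi : sigR i ≠ sigR j) (x : ℝ) :
    ‖∫ y in Iic x, K (x - y) * (potential u v y).mulVec (jostMinus u v j y z) i‖ₑ ≤
      oscBound u v K x :=
  (enorm_ker_mulVec_le hP hz hK hC hi x).trans
    (Finset.single_le_sum (f := fun i => ∑ k, (‖∫ y in Iic x, K (x - y) * potential u v y i k‖ₑ +
        ∫⁻ w, ENNReal.ofReal (Real.exp (∫ y, wt u v y) * wt u v w) *
          ‖∫ y in Iic x, K (x - y) * (Ici w).indicator (fun y => potential u v y i k) y‖ₑ))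
      (fun _ _ => zero_le) (Finset.mem_univ i))

/-! ### Bounds in `L²` with respect to the spectral parameter -/

theorem measurable_ker_integral {α : Type*} [MeasurableSpace α] {K : ℝ → ℝ → ℂ}
    (hK : Measurable fun p : ℝ × ℝ => K p.1 p.2) {s x : α → ℝ} (hs : Measurable s)
    (hx : Measurable x) {Φ : α × ℝ → ℂ} (hΦ : Measurable Φ) :
    Measurable fun a => ∫ y in Iic (x a), K (s a) (x a - y) * Φ (a, y) := by
  simp_rw [← integral_indicator measurableSet_Iic]
  have hm : Measurable fun p : α × ℝ => (Iic (x p.1)).indicator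
      (fun y => K (s p.1) (x p.1 - y) * Φ (p.1, y)) p.2 := by
    have hset : MeasurableSet {p : α × ℝ | p.2 ≤ x p.1} :=
      measurableSet_le measurable_snd (hx.comp measurable_fst)
    have hk : Measurable fun p : α × ℝ => K (s p.1) (x p.1 - p.2) * Φ p :=
      (hK.comp ((hs.comp measurable_fst).prodMk ((hx.comp measurable_fst).sub measurable_snd))).mul hΦ
    exact hk.indicator hset
  exact hm.stronglyMeasurable.integral_prod_right'.measurable

theorem measurable_indicator_Ici {α : Type*} [MeasurableSpace α] {w : α → ℝ} (hw : Measurable w)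
    {φ : ℝ → ℂ} (hφ : Measurable φ) : Measurable fun p : α × ℝ => (Ici (w p.1)).indicator φ p.2 := by
  have hset : MeasurableSet {p : α × ℝ | w p.1 ≤ p.2} :=
    measurableSet_le (hw.comp measurable_fst) measurable_snd
  exact (hφ.comp measurable_snd).indicator hset

theorem measurable_oscBound (hP : Pot u v) {K : ℝ → ℝ → ℂ}
    (hK : Measurable fun p : ℝ × ℝ => K p.1 p.2) :
    Measurable fun p : ℝ × ℝ => oscBound u v (K p.1) p.2 := by
  unfold oscBound
  refine Finset.measurable_sum _ fun i _ => Finset.measurable_sum _ fun k _ => Measurable.fun_add ?_ ?_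
  · exact (measurable_ker_integral hK measurable_fst measurable_snd
      ((measurable_potential hP i k).comp measurable_snd)).enorm
  · refine Measurable.lintegral_prod_right' (f := fun p : (ℝ × ℝ) × ℝ =>
      ENNReal.ofReal (Real.exp (∫ y, wt u v y) * wt u v p.2) *
      ‖∫ y in Iic p.1.2, K p.1.1 (p.1.2 - y) *
        (Ici p.2).indicator (fun y => potential u v y i k) y‖ₑ) (Measurable.fun_mul ?_ ?_)
    · exact ((hP.wt_meas.comp measurable_snd).const_mul _).ennreal_ofReal
    · exact (measurable_ker_integral hK (measurable_fst.comp measurable_fst)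
        (measurable_snd.comp measurable_fst)
        (measurable_indicator_Ici measurable_snd (measurable_potential hP i k))).enorm

/-- The norm of the map from kernel bounds to bounds of `oscBound`. -/
def oscConst (u v : ℝ → ℂ) : ℝ≥0∞ :=
  9 * (1 + ∫⁻ w, ENNReal.ofReal (Real.exp (∫ y, wt u v y) * wt u v w))

theorem Pot.lintegral_ne_top (hP : Pot u v) (c : ℝ) :
    ∫⁻ w, ENNReal.ofReal (c * wt u v w) ≠ ∞ :=
  (hP.wt_int.const_mul c).lintegral_lt_top.ne

theorem oscConst_ne_top (hP : Pot u v) : oscConst u v ≠ ∞ :=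
  ENNReal.mul_ne_top (by norm_num) (ENNReal.add_ne_top.2 ⟨by norm_num, hP.lintegral_ne_top _⟩)

/-- Minkowski's inequality in w. The truncated entries of U are dominated by `wt` as well, which is
why `KerBound` is required for all dominated functions; the 9 in `oscConst` counts the entries. -/
theorem sqLe_oscBound (hP : Pot u v) {J : Set ℝ} {K : ℝ → ℝ → ℂ}
    (hK : Measurable fun p : ℝ × ℝ => K p.1 p.2) {X : ℝ} {R : ℝ≥0∞}
    (hB : KerBound J K (wt u v) X R) {x : ℝ} (hx : x ≤ X) :
    SqLe (volume.restrict J) (fun s => oscBound u v (K s) x) (oscConst u v * R) := by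
  have hterm : ∀ i k : Fin 3, SqLe (volume.restrict J)
      (fun s => ‖∫ y in Iic x, K s (x - y) * potential u v y i k‖ₑ +
        ∫⁻ w, ENNReal.ofReal (Real.exp (∫ y, wt u v y) * wt u v w) *
          ‖∫ y in Iic x, K s (x - y) * (Ici w).indicator (fun y => potential u v y i k) y‖ₑ)
      (R + (∫⁻ w, ENNReal.ofReal (Real.exp (∫ y, wt u v y) * wt u v w)) * R) := by
    intro i k
    refine (hB _ (measurable_potential hP i k) (norm_potential_le u v · i k) x hx).add ?_
    refine SqLe.lintegral (k := fun p : ℝ × ℝ => ‖∫ y in Iic x, K p.1 (x - y) *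
        (Ici p.2).indicator (fun y => potential u v y i k) y‖ₑ)
      (hP.wt_meas.const_mul _).ennreal_ofReal.aemeasurable ?_ (Eventually.of_forall fun w => ?_)
    · exact (measurable_ker_integral hK measurable_fst measurable_const
        (measurable_indicator_Ici measurable_snd (measurable_potential hP i k))).enorm
    · exact hB _ ((measurable_potential hP i k).indicator measurableSet_Ici)
        (fun y => (norm_indicator_le_norm_self _ _).trans (norm_potential_le u v y i k)) x hx
  have h := SqLe.sum Finset.univ fun i _ => SqLe.sum Finset.univ fun k _ => hterm i k
  refine h.mono h.meas (Eventually.of_forall fun _ => le_rfl) (le_of_eq ?_)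
  simp only [Finset.sum_const, Finset.card_univ, Fintype.card_fin, nsmul_eq_mul, oscConst]
  push_cast
  ring

/-- Square integrable bounds for the increments of a column of the Jost function. -/
theorem sqLe_jostMinus_diff (hP : Pot u v) {J : Set ℝ} (hJ : MeasurableSet J) {ζ ζ' : ℝ → ℂ}
    (hm : Measurable fun p : ℝ × ℝ => kerE (osc j * ζ' p.1) p.2 - kerE (osc j * ζ p.1) p.2)
    (hζ : ∀ s ∈ J, Good j (ζ s)) (hζ' : ∀ s ∈ J, Good j (ζ' s)) {X : ℝ} {R : ℝ≥0∞}
    (hB : KerBound J (fun s t => kerE (osc j * ζ' s) t - kerE (osc j * ζ s) t) (wt u v) X R)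
    {i : Fin 3} (hmi : AEMeasurable (fun s => ‖jostMinus u v j X (ζ' s) i - jostMinus u v j X (ζ s) i‖ₑ)
      (volume.restrict J)) :
    SqLe (volume.restrict J)
      (fun s => ‖jostMinus u v j X (ζ' s) i - jostMinus u v j X (ζ s) i‖ₑ)
      ((3 * oscConst u v) * (1 + ENNReal.ofReal (Real.exp (∫ y, wt u v y)) *
        ∫⁻ y, ENNReal.ofReal (wt u v y)) * R) := by
  set K : ℝ → ℝ → ℂ := fun s t => kerE (osc j * ζ' s) t - kerE (osc j * ζ s) t with hKd
  set B := Real.exp (∫ y, wt u v y) with hBd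
  have hkc : ∀ γ : ℂ, Continuous (kerE γ) := fun γ => by unfold kerE; fun_prop
  have hpt : ∀ s ∈ J, ‖jostMinus u v j X (ζ' s) i - jostMinus u v j X (ζ s) i‖ₑ ≤
      3 * oscBound u v (K s) X + ENNReal.ofReal B *
        ∫⁻ y, ENNReal.ofReal (wt u v y) * (Iic X).indicator (fun y => 3 * oscBound u v (K s) y) y := by
    intro s hs
    have gz := hζ s hs
    have gz' := hζ' s hs
    have hf := (isJostMinus_iff _).1 (jostMinus_spec hP gz)
    have hf' := (isJostMinus_iff _).1 (jostMinus_spec hP gz')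
    have hmx : Measurable fun x => 3 * oscBound u v (K s) x :=
      ((measurable_oscBound hP hm).comp measurable_prodMk_left).const_mul 3
    refine (enorm_apply_le (jostMinus u v j X (ζ' s) - jostMinus u v j X (ζ s)) i).trans ?_
    have hg := gronwall hP.wt_int (wt_nonneg u v)
      (d := fun x => ‖jostMinus u v j x (ζ' s) - jostMinus u v j x (ζ s)‖ₑ)
      (α := fun x => 3 * oscBound u v (K s) x) (M := ENNReal.ofReal (B + B)) (X := X)
      ENNReal.ofReal_ne_top hmx.aemeasurable (fun x _ => ?_) (fun x _ => ?_)
    · refine hg.trans (add_le_add le_rfl (mul_le_mul_right (le_of_eq ?_) _))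
      rw [← lintegral_indicator measurableSet_Iic]
      refine lintegral_congr fun y => ?_
      by_cases hy : y ∈ Iic X
      · simp only [indicator_of_mem hy]
      · simp only [indicator_of_notMem hy, mul_zero]
    · have i1 := integrableOn_vker hP (continuous_jE j (ζ' s)) (norm_jE_le gz') hf'.1
        (norm_jostMinus_le hP gz') x
      have i2 := integrableOn_vker hP (continuous_jE j (ζ s)) (norm_jE_le gz) hf'.1
        (norm_jostMinus_le hP gz') x
      -- The increment splits into two kernels acting on one column, which is the inhomogeneity α,
      -- and one kernel acting on the difference of columns, which Gronwall absorbs.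
      have e : jostMinus u v j x (ζ' s) - jostMinus u v j x (ζ s) =
          (∫ y in Iic x, (vker u v (jE j (ζ' s)) (fun y => jostMinus u v j y (ζ' s)) x y -
            vker u v (jE j (ζ s)) (fun y => jostMinus u v j y (ζ' s)) x y)) +
          ((∫ y in Iic x, vker u v (jE j (ζ s)) (fun y => jostMinus u v j y (ζ' s)) x y) -
            ∫ y in Iic x, vker u v (jE j (ζ s)) (fun y => jostMinus u v j y (ζ s)) x y) := by
        rw [integral_sub i1 i2, hf'.2.2 x, hf.2.2 x]
        abel
      rw [e]
      refine (enorm_add_le _ _).trans (add_le_add ?_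
        (enorm_integral_vker_sub_le hP (continuous_jE j (ζ s)) (norm_jE_le gz) hf'.1 hf.1
          (norm_jostMinus_le hP gz') (norm_jostMinus_le hP gz) x))
      refine (enorm_pi_le _).trans ?_
      have hle : ∀ i : Fin 3, ‖(∫ y in Iic x,
          (vker u v (jE j (ζ' s)) (fun y => jostMinus u v j y (ζ' s)) x y -
            vker u v (jE j (ζ s)) (fun y => jostMinus u v j y (ζ' s)) x y)) i‖ₑ ≤
          oscBound u v (K s) x := by
        intro i
        have i3 : Integrable (fun y => vker u v (jE j (ζ' s)) (fun y => jostMinus u v j y (ζ' s)) x y -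
            vker u v (jE j (ζ s)) (fun y => jostMinus u v j y (ζ' s)) x y) (volume.restrict (Iic x)) :=
          i1.sub i2
        rw [eval_integral fun i => i3.eval i]
        have e3 : ∀ y, (vker u v (jE j (ζ' s)) (fun y => jostMinus u v j y (ζ' s)) x y -
            vker u v (jE j (ζ s)) (fun y => jostMinus u v j y (ζ' s)) x y) i =
            (jE j (ζ' s) (x - y) i - jE j (ζ s) (x - y) i) *
              (potential u v y).mulVec (jostMinus u v j y (ζ' s)) i := fun y => by
          simp only [Pi.sub_apply, vker]; ring
        simp_rw [e3]
        by_cases hi : sigR i = sigR j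
        · simp [jE_not_osc hi]
        · simp_rw [jE_osc hi]
          refine enorm_ker_mulVec_le_oscBound hP gz' (K := K s) ((hkc _).sub (hkc _)) (C := 2)
            (fun t ht => ?_) hi x
          have h1 := norm_jE_le gz' t ht i
          have h2 := norm_jE_le gz t ht i
          rw [jE_osc hi] at h1 h2
          exact (norm_sub_le _ _).trans (by linarith)
      refine (Finset.sum_le_sum fun i _ => hle i).trans (le_of_eq ?_)
      simp
    · rw [← ofReal_norm]
      exact ENNReal.ofReal_le_ofReal ((norm_sub_le _ _).trans
        (add_le_add (norm_jostMinus_le hP gz' x) (norm_jostMinus_le hP gz x)))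
  have h3 : ∀ x ≤ X, SqLe (volume.restrict J) (fun s => 3 * oscBound u v (K s) x)
      (3 * (oscConst u v * R)) := fun x hx => (sqLe_oscBound hP hm hB hx).const_mul 3
  have h4 := SqLe.lintegral (μ := volume.restrict J) (ν := volume)
    (q := fun y => ENNReal.ofReal (wt u v y)) (R := 3 * (oscConst u v * R))
    (k := fun p : ℝ × ℝ => (Iic X).indicator (fun y => 3 * oscBound u v (K p.1) y) p.2)
    hP.wt_meas.ennreal_ofReal.aemeasurable ?_ (Eventually.of_forall fun y => ?_)
  · refine ((h3 X le_rfl).add (h4.const_mul (ENNReal.ofReal B))).mono hmi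
      ((ae_restrict_mem hJ).mono hpt) (le_of_eq ?_)
    ring
  · exact ((measurable_oscBound hP hm).const_mul 3).indicator
      (measurableSet_Iic.preimage measurable_snd)
  · by_cases hy : y ∈ Iic X
    · simp only [indicator_of_mem hy]
      exact h3 y hy
    · simp only [indicator_of_notMem hy]
      exact SqLe.zero.mono aemeasurable_const (Eventually.of_forall fun _ => le_rfl) zero_le

end AKNS
end

/-! ### Regularity of the Jost columns on the line and on the arc. -/

noncomputable section
namespace AKNS

open scoped ENNReal NNReal

/-! ### Regularity of the Jost functions in the spectral parameter -/

variable {u v : ℝ → ℂ} {j : Fin 3} {S : ℝ}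

/-- A measurable potential with `U ∈ L¹ ∩ L²` and `x U ∈ L²`. -/
structure Adm (u v : ℝ → ℂ) : Prop where
  pot : Pot u v
  l2 : MemLp (wt u v) 2
  wl2 : MemLp (fun y => y * wt u v y) 2

theorem Adm.weight (H : Adm u v) (X : ℝ) : MemLp (fun y => (|X| + |y|) * wt u v y) 2 := by
  have h1 := (H.l2.const_mul |X|).add H.wl2.abs
  refine h1.ae_eq (Eventually.of_forall fun y => ?_)
  simp only [Pi.add_apply, Pi.abs_apply, abs_mul, abs_of_nonneg (wt_nonneg u v y)]
  ring

theorem Adm.refl (H : Adm u v) : Adm (refl u) (refl v) := by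
  have h : wt (AKNS.refl u) (AKNS.refl v) = fun y => wt u v (-y) := funext fun y => wt_refl u v y
  refine ⟨H.pot.refl, ?_, ?_⟩
  · rw [h]
    exact H.l2.comp_measurePreserving (Measure.measurePreserving_neg volume)
  · rw [h]
    have := (H.wl2.comp_measurePreserving (Measure.measurePreserving_neg volume)).neg
    refine this.ae_eq (Eventually.of_forall fun y => ?_)
    simp

theorem wt_cutRight_le (u v : ℝ → ℂ) (a y : ℝ) : wt (cutRight a u) (cutRight a v) y ≤ wt u v y :=
  add_le_add (norm_indicator_le_norm_self _ _) (norm_indicator_le_norm_self _ _)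

theorem Adm.cutRight (H : Adm u v) (a : ℝ) : Adm (cutRight a u) (cutRight a v) := by
  have hP := H.pot.cutRight a
  refine ⟨hP, H.l2.mono hP.wt_meas.aestronglyMeasurable (Eventually.of_forall fun y => ?_),
    H.wl2.mono (measurable_id.mul hP.wt_meas).aestronglyMeasurable
      (Eventually.of_forall fun y => ?_)⟩
  · rw [Real.norm_of_nonneg (wt_nonneg _ _ _), Real.norm_of_nonneg (wt_nonneg _ _ _)]
    exact wt_cutRight_le u v a y
  · rw [norm_mul, norm_mul, Real.norm_of_nonneg (wt_nonneg _ _ _),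
      Real.norm_of_nonneg (wt_nonneg _ _ _)]
    exact mul_le_mul_of_nonneg_left (wt_cutRight_le u v a y) (norm_nonneg _)

theorem continuous_jostMinus_real (hP : Pot u v) (j : Fin 3) :
    Continuous fun p : ℝ × ℝ => jostMinus u v j p.1 (p.2 : ℂ) := by
  have h := continuous_jostMinus hP j
  exact h.comp (f := fun p : ℝ × ℝ => ((p.1, ⟨(p.2 : ℂ), good_real j p.2⟩) : ℝ × {z // Good j z}))
    (by fun_prop)

theorem continuous_kerE_uncurry {f : ℝ → ℂ} (hf : Continuous f) :
    Continuous fun p : ℝ × ℝ => kerE (f p.1) p.2 := by unfold kerE; fun_prop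

/-- The constant in the bound of the increments of the Jost functions. -/
def diffConst (u v : ℝ → ℂ) : ℝ≥0∞ := (3 * oscConst u v) *
  (1 + ENNReal.ofReal (Real.exp (∫ y, wt u v y)) * ∫⁻ y, ENNReal.ofReal (wt u v y))

theorem Pot.lintegral_wt_ne_top (hP : Pot u v) : ∫⁻ y, ENNReal.ofReal (wt u v y) ≠ ∞ :=
  hP.wt_int.lintegral_lt_top.ne

theorem diffConst_ne_top (hP : Pot u v) : diffConst u v ≠ ∞ :=
  ENNReal.mul_ne_top (ENNReal.mul_ne_top (by norm_num) (oscConst_ne_top hP))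
    (ENNReal.add_ne_top.2 ⟨by norm_num,
      ENNReal.mul_ne_top ENNReal.ofReal_ne_top hP.lintegral_wt_ne_top⟩)

/-- The bound `kerBound_line_diff` is fed into `sqLe_jostMinus_diff`; its weight |x| + |y| is where
xU ∈ L² enters. -/
theorem Adm.blip_line (H : Adm u v) (j : Fin 3) (x : ℝ) (i : Fin 3) :
    BLip univ fun s : ℝ => jostMinus u v j x s i := by
  have hc : Continuous fun s : ℝ => jostMinus u v j x s i := (continuous_apply i).comp
    ((continuous_jostMinus_real H.pot j).comp (f := fun s : ℝ => (x, s)) (by fun_prop))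
  have hC : diffConst u v * (4 * eLpNorm (fun y => (|x| + |y|) * wt u v y) 2) ≠ ∞ :=
    ENNReal.mul_ne_top (diffConst_ne_top H.pot) (ENNReal.mul_ne_top (by norm_num) (H.weight x).2.ne)
  refine ⟨hc.continuousOn, ⟨_, fun s _ => (norm_le_pi_norm _ i).trans
    (norm_jostMinus_le H.pot (good_real j s) x)⟩,
    (diffConst u v * (4 * eLpNorm (fun y => (|x| + |y|) * wt u v y) 2)).toNNReal, fun h hh => ?_⟩
  · have hB := kerBound_line_diff (c := osc j) (abs_osc j) H.pot.wt_int (H.weight x) hh.le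
    simp only [Complex.ofReal_mul] at hB
    have hm : Measurable fun p : ℝ × ℝ =>
        kerE (osc j * ((p.1 + h : ℝ) : ℂ)) p.2 - kerE (osc j * (p.1 : ℂ)) p.2 :=
      (Continuous.sub (by unfold kerE; fun_prop) (by unfold kerE; fun_prop)).measurable
    have := sqLe_jostMinus_diff (j := j) H.pot MeasurableSet.univ (ζ := fun s => (s : ℂ))
      (ζ' := fun s => ((s + h : ℝ) : ℂ)) (X := x) (i := i)
      hm
      (fun s _ => good_real j s) (fun s _ => good_real j _) hB
      ((hc.comp (continuous_add_const h)).sub hc).enorm.measurable.aemeasurable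
    rw [preimage_univ, inter_univ]
    refine this.mono this.meas (Eventually.of_forall fun _ => le_rfl) (le_of_eq ?_)
    rw [ENNReal.coe_toNNReal hC, diffConst]
    ring

/-- The sign `osc j` is 1 for j = 0 and -1 otherwise, so it moves the upper arc into the half plane
where the j-th column of m⁻ lives. -/
theorem good_arc (hS : 0 < S) (j : Fin 3) {θ : ℝ} (hθ : θ ∈ Icc 0 Real.pi) :
    Good j (osc j * arcMap S θ) := by
  intro i
  have h : 0 ≤ S * Real.sin θ := mul_nonneg hS.le (Real.sin_nonneg_of_mem_Icc hθ)
  rw [Complex.im_ofReal_mul, arcMap_im]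
  fin_cases i <;> fin_cases j <;> simp [osc, sigR] <;> linarith

/-- Since `osc j` squares to 1, the kernel in the j-th column is `kerE (arcMap S θ)` for every j,
and `kerBound_arc_diff` covers all cases. -/
theorem Adm.blip_arc (H : Adm u v) (hS : 0 < S) (j : Fin 3) (x : ℝ) (i : Fin 3) :
    BLip (Ioo 0 Real.pi) fun θ : ℝ => jostMinus u v j x (osc j * arcMap S θ) i := by
  have hg : ∀ θ ∈ Ioo 0 Real.pi, Good j (osc j * arcMap S θ) := fun θ hθ =>
    good_arc hS j (Ioo_subset_Icc_self hθ)
  have hcm := continuous_arcMap S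
  have hc : ContinuousOn (fun θ : ℝ => jostMinus u v j x (osc j * arcMap S θ) i)
      (Ioo 0 Real.pi) :=
    (continuous_apply i).comp_continuousOn ((continuousOn_jostMinus H.pot j x).comp
      (by fun_prop) hg)
  have hC : diffConst u v * (ENNReal.ofReal (4 * S * √(Real.pi / (4 * S / Real.pi))) *
      eLpNorm (fun y => (|x| + |y|) * wt u v y) 2) ≠ ∞ :=
    ENNReal.mul_ne_top (diffConst_ne_top H.pot)
      (ENNReal.mul_ne_top ENNReal.ofReal_ne_top (H.weight x).2.ne)
  have hosc : ((osc j : ℝ) : ℂ) * osc j = 1 := by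
    rw [← Complex.ofReal_mul, ← abs_mul_abs_self, abs_osc]; simp
  refine ⟨hc, ⟨_, fun s hs => (norm_le_pi_norm _ i).trans
    (norm_jostMinus_le H.pot (hg s hs) x)⟩,
    (diffConst u v * (ENNReal.ofReal (4 * S * √(Real.pi / (4 * S / Real.pi))) *
      eLpNorm (fun y => (|x| + |y|) * wt u v y) 2)).toNNReal, fun h hh => ?_⟩
  · have hset : Ioo 0 Real.pi ∩ (fun t => t + h) ⁻¹' Ioo 0 Real.pi = Ioo 0 (Real.pi - h) := by
      ext t
      simp only [mem_inter_iff, mem_Ioo, mem_preimage]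
      constructor
      · rintro ⟨⟨h1, h2⟩, h3, h4⟩; exact ⟨h1, by linarith⟩
      · rintro ⟨h1, h2⟩; exact ⟨⟨h1, by linarith⟩, by linarith, by linarith⟩
    have hm := aemeasurable_diff measurableSet_Ioo hc h
    rw [hset] at hm ⊢
    have hB := kerBound_arc_diff hS (X := x) H.pot.wt_meas hh.le
    have e : ∀ w : ℂ, ((osc j : ℝ) : ℂ) * (osc j * w) = w := fun w => by
      rw [← mul_assoc, hosc, one_mul]
    have hm' : Measurable fun p : ℝ × ℝ =>
        kerE (osc j * (osc j * arcMap S (p.1 + h))) p.2 - kerE (osc j * (osc j * arcMap S p.1)) p.2 :=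
      (Continuous.sub (by unfold kerE; fun_prop) (by unfold kerE; fun_prop)).measurable
    have := sqLe_jostMinus_diff (j := j) H.pot measurableSet_Ioo (J := Ioo 0 (Real.pi - h))
      (ζ := fun s => osc j * arcMap S s)
      (ζ' := fun s => osc j * arcMap S (s + h)) (X := x) (i := i)
      hm'
      (fun s hs => hg s ⟨hs.1, by linarith [hs.2]⟩)
      (fun s hs => hg _ ⟨by linarith [hs.1], by linarith [hs.2]⟩) (by simpa only [e] using hB) hm
    refine this.mono this.meas (Eventually.of_forall fun _ => le_rfl) (le_of_eq ?_)
    rw [ENNReal.coe_toNNReal hC, diffConst]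
    ring

/-- The size of the oscillating components of a column. -/
def oscPart (u v : ℝ → ℂ) (j : Fin 3) (x s : ℝ) : ℝ≥0∞ :=
  ∑ l, if sigR l = sigR j then 0 else ‖jostMinus u v j x s l‖ₑ

theorem measurable_oscPart (hP : Pot u v) (j : Fin 3) :
    Measurable fun p : ℝ × ℝ => oscPart u v j p.2 p.1 := by
  unfold oscPart
  refine Finset.measurable_sum _ fun l _ => ?_
  split_ifs
  · exact measurable_const
  · exact ((continuous_apply l).comp ((continuous_jostMinus_real hP j).comp
      continuous_swap)).enorm.measurable

theorem enorm_mulVec_le_oscPart (u v : ℝ → ℂ) {k : Fin 3} (hk : sigR k = sigR j) (y s : ℝ) :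
    ‖(potential u v y).mulVec (jostMinus u v j y s) k‖ₑ ≤
      ENNReal.ofReal (wt u v y) * oscPart u v j y s := by
  simp only [Matrix.mulVec, dotProduct]
  rw [oscPart, Finset.mul_sum]
  refine (enorm_sum_le _ _).trans (Finset.sum_le_sum fun l _ => ?_)
  split_ifs with h
  · rw [potential_eq_zero u v y (hk.trans h.symm), zero_mul, enorm_zero, mul_zero]
  · rw [enorm_mul]
    refine mul_le_mul_left ?_ _
    rw [← ofReal_norm]
    exact ENNReal.ofReal_le_ofReal (norm_potential_le u v y k l)

/-- An oscillating component has no constant term, so it is itself an oscillatory integral, bounded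
through `oscBound` by Plancherel. -/
theorem Adm.sqLe_osc (H : Adm u v) {i : Fin 3} (hi : sigR i ≠ sigR j) (x : ℝ) :
    SqLe volume (fun s : ℝ => ‖jostMinus u v j x s i‖ₑ)
      (oscConst u v * (2 * eLpNorm (wt u v) 2)) := by
  have hB := kerBound_line (c := osc j) (abs_osc j) H.pot.wt_int H.l2 x
  have hKm : Measurable fun p : ℝ × ℝ => kerE (osc j * p.1 : ℝ) p.2 :=
    (continuous_kerE_uncurry (f := fun s => ((osc j * s : ℝ) : ℂ)) (by fun_prop)).measurable
  have h := sqLe_oscBound H.pot hKm hB le_rfl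
  rw [Measure.restrict_univ] at h
  have hc : Continuous fun s : ℝ => jostMinus u v j x s i := (continuous_apply i).comp
    ((continuous_jostMinus_real H.pot j).comp (f := fun s : ℝ => (x, s)) (by fun_prop))
  refine h.mono hc.enorm.measurable.aemeasurable (Eventually.of_forall fun s => ?_) le_rfl
  have hij : i ≠ j := fun h => hi (by rw [h])
  rw [jostMinus_apply H.pot (good_real j s), Pi.single_eq_of_ne hij, zero_add]
  simp_rw [jE_osc hi]
  have := enorm_ker_mulVec_le_oscBound H.pot (good_real j s) (K := kerE (osc j * s : ℝ)) (C := 1)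
    (by unfold kerE; fun_prop) (fun t _ => (norm_kerE_ofReal _ t).le) hi x
  rw [Complex.ofReal_mul] at this ⊢
  exact this

theorem Adm.sqLe_oscPart (H : Adm u v) (j : Fin 3) (x : ℝ) :
    SqLe volume (fun s : ℝ => oscPart u v j x s)
      (3 * (oscConst u v * (2 * eLpNorm (wt u v) 2))) := by
  have h := SqLe.sum (μ := volume) Finset.univ (f := fun l (s : ℝ) =>
    if sigR l = sigR j then 0 else ‖jostMinus u v j x s l‖ₑ)
    (R := fun _ => oscConst u v * (2 * eLpNorm (wt u v) 2)) fun l _ => by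
      split_ifs with hl
      · exact SqLe.zero.mono aemeasurable_const (Eventually.of_forall fun _ => le_rfl) zero_le
      · exact H.sqLe_osc hl x
  refine h.mono h.meas (Eventually.of_forall fun _ => le_rfl) (le_of_eq ?_)
  simp

/-- Oscillating components are covered by `Adm.sqLe_osc`. The others, minus their constant term, are
integrals of U against oscillating components, and Minkowski in y with weight `wt` transfers the
bound. -/
theorem Adm.memLp_line (H : Adm u v) (j : Fin 3) (x : ℝ) (i : Fin 3) :
    MemLp (fun s : ℝ => jostMinus u v j x s i - (Pi.single j 1 : Fin 3 → ℂ) i) 2 := by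
  have hc : Continuous fun s : ℝ => jostMinus u v j x s i := (continuous_apply i).comp
    ((continuous_jostMinus_real H.pot j).comp (f := fun s : ℝ => (x, s)) (by fun_prop))
  have hR : oscConst u v * (2 * eLpNorm (wt u v) 2) ≠ ∞ :=
    ENNReal.mul_ne_top (oscConst_ne_top H.pot) (ENNReal.mul_ne_top (by norm_num) H.l2.2.ne)
  by_cases hi : sigR i = sigR j
  · have h : SqLe volume (fun s => ∫⁻ y in Iic x, ENNReal.ofReal (wt u v y) * oscPart u v j y s) _ :=
      SqLe.lintegral (ν := volume.restrict (Iic x)) (k := fun p => oscPart u v j p.2 p.1)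
      H.pot.wt_meas.ennreal_ofReal.aemeasurable
      (measurable_oscPart H.pot j) (Eventually.of_forall fun y => H.sqLe_oscPart j y)
    refine SqLe.memLp (h.mono ?_ (Eventually.of_forall fun s => ?_) le_rfl) ?_ ?_
    · exact (hc.sub continuous_const).enorm.measurable.aemeasurable
    · rw [jostMinus_apply H.pot (good_real j s), add_sub_cancel_left]
      simp_rw [jE_not_osc hi, one_mul]
      exact (enorm_integral_le_lintegral_enorm _).trans
        (lintegral_mono fun y => enorm_mulVec_le_oscPart u v hi y s)
    · refine ENNReal.mul_ne_top (ne_top_of_le_ne_top ?_ (setLIntegral_le_lintegral _ _))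
        (ENNReal.mul_ne_top (by norm_num) hR)
      simpa using H.pot.lintegral_ne_top 1
    · exact (hc.sub continuous_const).aestronglyMeasurable
  · have hij : i ≠ j := fun h => hi (by rw [h])
    simp only [Pi.single_eq_of_ne hij, sub_zero]
    exact (H.sqLe_osc hi x).memLp hR hc.aestronglyMeasurable

/-! ### The Jost functions normalized at `+∞` -/

theorem BLip.congr {I : Set ℝ} {f g : ℝ → ℂ} (hf : BLip I f) (hI : MeasurableSet I)
    (h : ∀ t ∈ I, g t = f t) : BLip I g := by
  obtain ⟨B, hB⟩ := hf.bdd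
  refine BLip.of_le hI hf hf (hf.cont.congr h) ⟨B, fun t ht => by rw [h t ht]; exact hB t ht⟩ 1 0
    fun s hs t ht => ?_
  rw [h t ht, h s hs]
  simp

theorem BLip.comp_neg {f : ℝ → ℂ} (hf : BLip univ f) : BLip univ fun s => f (-s) := by
  obtain ⟨B, hB⟩ := hf.bdd
  obtain ⟨C, hC⟩ := hf.lip
  have hc := continuousOn_univ.1 hf.cont
  refine ⟨(hc.comp continuous_neg).continuousOn, ⟨B, fun t _ => hB _ trivial⟩, C, fun h hh => ?_⟩
  have h1 := hC h hh
  rw [preimage_univ, inter_univ, Measure.restrict_univ] at h1 ⊢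
  -- The increment of the reflected function at t is minus that of f at -h - t.
  have hmp : MeasurePreserving (fun t : ℝ => -h - t) := volume.measurePreserving_sub_left (-h)
  refine ⟨by fun_prop, le_trans (le_of_eq ?_) h1.le⟩
  rw [← hmp.lintegral_comp (f := fun t => ‖f (t + h) - f t‖ₑ ^ 2) (by fun_prop)]
  refine lintegral_congr fun t => ?_
  rw [show -h - t + h = -t by ring, show -h - t = -(t + h) by ring, ← enorm_neg, neg_sub]

theorem good_neg_real (j : Fin 3) (s : ℝ) : Good j (-(s : ℂ)) := by
  simpa using good_real j (-s)

theorem Adm.blip_line' (H : Adm u v) (j : Fin 3) (x : ℝ) (i : Fin 3) :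
    BLip univ fun s : ℝ => jostPlus u v j x s i := by
  have := (H.refl.blip_line j (-x) i).comp_neg
  simp only [Complex.ofReal_neg] at this
  simpa only [jostPlus_eq H.pot (good_neg_real j _)] using this

theorem Adm.memLp_line' (H : Adm u v) (j : Fin 3) (x : ℝ) (i : Fin 3) :
    MemLp (fun s : ℝ => jostPlus u v j x s i - (Pi.single j 1 : Fin 3 → ℂ) i) 2 := by
  have := (H.refl.memLp_line j (-x) i).comp_measurePreserving (Measure.measurePreserving_neg volume)
  simp only [Function.comp_def, Complex.ofReal_neg] at this
  simpa only [jostPlus_eq H.pot (good_neg_real j _)] using this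

theorem Adm.blip_arc_zero (H : Adm u v) (hS : 0 < S) (x : ℝ) (i : Fin 3) :
    BLip (Ioo 0 Real.pi) fun θ : ℝ => jostMinus u v 0 x (arcMap S θ) i := by
  have := H.blip_arc hS 0 x i
  simpa [osc, sigR] using this

theorem Adm.blip_arc' (H : Adm u v) (hS : 0 < S) {k : Fin 3} (hk : k ≠ 0) (x : ℝ) (i : Fin 3) :
    BLip (Ioo 0 Real.pi) fun θ : ℝ => jostPlus u v k x (arcMap S θ) i := by
  have h := H.refl.blip_arc hS k (-x) i
  have ho : osc k = -1 := by fin_cases k <;> simp_all [osc, sigR]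
  have e : ∀ θ ∈ Ioo 0 Real.pi, jostPlus u v k x (arcMap S θ) i =
      jostMinus (AKNS.refl u) (AKNS.refl v) k (-x) (osc k * arcMap S θ) i := fun θ hθ => by
    have hg := good_arc hS k (Ioo_subset_Icc_self hθ)
    rw [ho, Complex.ofReal_neg, Complex.ofReal_one, neg_one_mul] at hg ⊢
    rw [jostPlus_eq H.pot hg]
  exact h.congr measurableSet_Ioo e

end AKNS
end

/-! ### Large real spectral parameter, lower bounds for s₁₁, regularity of the scattering
coefficients. -/

noncomputable section
namespace AKNS

open scoped ENNReal NNReal FourierTransform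

variable {u v : ℝ → ℂ} {j : Fin 3} {S : ℝ} {z : ℂ}

/-! ### The behaviour for large real spectral parameter -/

theorem isCountablyGenerated_cocompact_real : (cocompact ℝ).IsCountablyGenerated := by
  rw [cocompact_eq_atBot_atTop]; infer_instance

theorem tendsto_ker_integral {c : ℝ} (hc : c ≠ 0) (φ : ℝ → ℂ) (x : ℝ) :
    Tendsto (fun s : ℝ => ‖∫ y in Iic x, kerE (c * s : ℝ) (x - y) * φ y‖ₑ) (cocompact ℝ) (𝓝 0) := by
  simp_rw [enorm_integral_Iic_kerE, integral_kerE_eq_fourier]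
  have h0 : c / Real.pi ≠ 0 := div_ne_zero hc Real.pi_ne_zero
  have h := (Real.zero_at_infty_fourier ((Iic x).indicator φ)).comp
    (Homeomorph.mulLeft₀ (c / Real.pi) h0).isClosedEmbedding.tendsto_cocompact
  simpa using h.enorm

/-- Riemann-Lebesgue for each fixed truncation w, then dominated convergence in w. -/
theorem tendsto_oscBound (hP : Pot u v) {c : ℝ} (hc : c ≠ 0) (x : ℝ) :
    Tendsto (fun s : ℝ => oscBound u v (kerE (c * s : ℝ)) x) (cocompact ℝ) (𝓝 0) := by
  have := isCountablyGenerated_cocompact_real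
  have hKm : Measurable fun p : ℝ × ℝ => kerE (c * p.1 : ℝ) p.2 :=
    (continuous_kerE_uncurry (f := fun s => ((c * s : ℝ) : ℂ)) (by fun_prop)).measurable
  unfold oscBound
  have h0 : (0 : ℝ≥0∞) = ∑ _i : Fin 3, ∑ _k : Fin 3, (0 + ∫⁻ _w : ℝ, 0) := by simp
  rw [h0]
  refine tendsto_finsetSum _ fun i _ => tendsto_finsetSum _ fun k _ =>
    (tendsto_ker_integral hc _ x).add ?_
  refine tendsto_lintegral_filter_of_dominated_convergence
    (fun w => ENNReal.ofReal (Real.exp (∫ y, wt u v y) * wt u v w) *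
      ENNReal.ofReal (∫ y, wt u v y)) ?_ ?_ ?_ ?_
  · refine Eventually.of_forall fun s => ?_
    refine Measurable.mul ((hP.wt_meas.const_mul _).ennreal_ofReal) ?_
    have := measurable_ker_integral (α := ℝ) (K := fun s => kerE (c * s : ℝ)) hKm (s := fun _ => s) (x := fun _ => x)
      measurable_const measurable_const
      (measurable_indicator_Ici measurable_id (measurable_potential hP i k))
    exact this.enorm
  · refine Eventually.of_forall fun s => Eventually.of_forall fun w => mul_le_mul_right ?_ _
    rw [← ofReal_norm]
    have hle : ∀ y, ‖kerE (c * s : ℝ) (x - y) *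
        (Ici w).indicator (fun y => potential u v y i k) y‖ ≤ wt u v y := fun y => by
      rw [norm_mul, norm_kerE_ofReal, one_mul]
      exact (norm_indicator_le_norm_self _ _).trans (norm_potential_le u v y i k)
    exact ENNReal.ofReal_le_ofReal ((norm_integral_le_of_norm_le hP.wt_int.integrableOn
      (Eventually.of_forall hle)).trans
      (setIntegral_le_integral hP.wt_int (Eventually.of_forall (wt_nonneg u v))))
  · rw [lintegral_mul_const' _ _ ENNReal.ofReal_ne_top]
    exact ENNReal.mul_ne_top (hP.lintegral_ne_top _) ENNReal.ofReal_ne_top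
  · refine Eventually.of_forall fun w => ?_
    have := ENNReal.Tendsto.const_mul (a := ENNReal.ofReal (Real.exp (∫ y, wt u v y) * wt u v w))
      (tendsto_ker_integral hc ((Ici w).indicator fun y => potential u v y i k) x)
      (Or.inr ENNReal.ofReal_ne_top)
    simpa using this

theorem enorm_osc_le (hP : Pot u v) {i : Fin 3} (hi : sigR i ≠ sigR j) (x s : ℝ) :
    ‖jostMinus u v j x s i‖ₑ ≤ oscBound u v (kerE (osc j * s : ℝ)) x := by
  have hij : i ≠ j := fun h => hi (by rw [h])
  rw [jostMinus_apply hP (good_real j s), Pi.single_eq_of_ne hij, zero_add]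
  simp_rw [jE_osc hi]
  have := enorm_ker_mulVec_le_oscBound hP (good_real j s) (K := kerE (osc j * s : ℝ)) (C := 1)
    (by unfold kerE; fun_prop) (fun t _ => (norm_kerE_ofReal _ t).le) hi x
  rw [Complex.ofReal_mul] at this ⊢
  exact this

theorem osc_ne_zero (j : Fin 3) : osc j ≠ 0 := fun h => by simpa [h] using abs_osc j

theorem tendsto_oscPart (hP : Pot u v) (j : Fin 3) (x : ℝ) :
    Tendsto (fun s : ℝ => oscPart u v j x s) (cocompact ℝ) (𝓝 0) := by
  have key := tendsto_finsetSum (x := cocompact ℝ) (f := fun l (s : ℝ) =>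
    if sigR l = sigR j then 0 else ‖jostMinus u v j x s l‖ₑ) (a := fun _ => 0) Finset.univ
    fun l _ => ?_
  · simpa [oscPart] using key
  split_ifs with h
  · exact tendsto_const_nhds
  · exact tendsto_of_tendsto_of_tendsto_of_le_of_le tendsto_const_nhds
      (tendsto_oscBound hP (osc_ne_zero j) x) (fun _ => zero_le) fun s => enorm_osc_le hP h x s

theorem oscPart_le (hP : Pot u v) (j : Fin 3) (x s : ℝ) :
    oscPart u v j x s ≤ 3 * ENNReal.ofReal (Real.exp (∫ y, wt u v y)) := by
  unfold oscPart
  calc _ ≤ ∑ _l : Fin 3, ENNReal.ofReal (Real.exp (∫ y, wt u v y)) := by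
        refine Finset.sum_le_sum fun l _ => ?_
        split_ifs
        · exact zero_le
        · refine (enorm_apply_le _ l).trans ?_
          rw [← ofReal_norm]
          exact ENNReal.ofReal_le_ofReal (norm_jostMinus_le hP (good_real j s) x)
    _ = _ := by simp

theorem tendsto_lintegral_oscPart (hP : Pot u v) (j : Fin 3) (x : ℝ) :
    Tendsto (fun s => ∫⁻ y in Iic x, ENNReal.ofReal (wt u v y) * oscPart u v j y s)
      (cocompact ℝ) (𝓝 0) := by
  have := isCountablyGenerated_cocompact_real
  set B : ℝ≥0∞ := 3 * ENNReal.ofReal (Real.exp (∫ y, wt u v y)) with hB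
  have hBt : B ≠ ∞ := ENNReal.mul_ne_top (by norm_num) ENNReal.ofReal_ne_top
  have hm : ∀ s, Measurable fun y => ENNReal.ofReal (wt u v y) * oscPart u v j y s := fun s => by
    have hmo := (measurable_oscPart hP j).comp (measurable_prodMk_left (x := s))
    simp only [Function.comp_def] at hmo
    have hmw : Measurable fun y => ENNReal.ofReal (wt u v y) := hP.wt_meas.ennreal_ofReal
    exact hmw.fun_mul hmo
  have hb : ∫⁻ y in Iic x, ENNReal.ofReal (wt u v y) * B ≠ ∞ := by
    rw [lintegral_mul_const' _ _ hBt]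
    exact ENNReal.mul_ne_top (ne_top_of_le_ne_top hP.lintegral_wt_ne_top
      (setLIntegral_le_lintegral _ _)) hBt
  have hl : ∀ y, Tendsto (fun s => ENNReal.ofReal (wt u v y) * oscPart u v j y s) (cocompact ℝ)
      (𝓝 0) := fun y => by
    have := ENNReal.Tendsto.const_mul (a := ENNReal.ofReal (wt u v y))
      (tendsto_oscPart hP j y) (Or.inr ENNReal.ofReal_ne_top)
    simpa only [mul_zero] using this
  have key := tendsto_lintegral_filter_of_dominated_convergence (μ := volume.restrict (Iic x))
    (l := cocompact ℝ) (F := fun s y => ENNReal.ofReal (wt u v y) * oscPart u v j y s)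
    (f := fun _ => 0) (fun y => ENNReal.ofReal (wt u v y) * B)
    (Eventually.of_forall hm) (Eventually.of_forall fun s =>
      Eventually.of_forall fun y => mul_le_mul_right (oscPart_le hP j y s) _) hb
    (Eventually.of_forall hl)
  simpa only [lintegral_zero] using key

/-- The oscillating components vanish in the limit by `tendsto_oscBound`; the others differ from
their constant term by an integral of U against oscillating ones, which vanishes by dominated
convergence. -/
theorem tendsto_jostMinus_cocompact (hP : Pot u v) (j : Fin 3) (x : ℝ) (i : Fin 3) :
    Tendsto (fun s : ℝ => jostMinus u v j x s i) (cocompact ℝ)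
      (𝓝 ((Pi.single j 1 : Fin 3 → ℂ) i)) := by
  have key : Tendsto (fun s : ℝ => ‖jostMinus u v j x s i - (Pi.single j 1 : Fin 3 → ℂ) i‖ₑ)
      (cocompact ℝ) (𝓝 0) := by
    by_cases hi : sigR i = sigR j
    · have h := tendsto_lintegral_oscPart hP j x
      refine tendsto_of_tendsto_of_tendsto_of_le_of_le tendsto_const_nhds h (fun _ => zero_le)
        fun s => ?_
      simp only
      rw [jostMinus_apply hP (good_real j s), add_sub_cancel_left]
      simp_rw [jE_not_osc hi, one_mul]
      exact (enorm_integral_le_lintegral_enorm _).trans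
        (lintegral_mono fun y => enorm_mulVec_le_oscPart u v hi y s)
    · have hij : i ≠ j := fun h => hi (by rw [h])
      simp only [Pi.single_eq_of_ne hij, sub_zero]
      exact tendsto_of_tendsto_of_tendsto_of_le_of_le tendsto_const_nhds
        (tendsto_oscBound hP (osc_ne_zero j) x) (fun _ => zero_le) fun s => enorm_osc_le hP hi x s
  rw [tendsto_iff_edist_tendsto_0]
  simpa only [edist_eq_enorm_sub] using key

theorem tendsto_jostPlus_cocompact (hP : Pot u v) (j : Fin 3) (x : ℝ) (i : Fin 3) :
    Tendsto (fun s : ℝ => jostPlus u v j x s i) (cocompact ℝ)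
      (𝓝 ((Pi.single j 1 : Fin 3 → ℂ) i)) := by
  have := (tendsto_jostMinus_cocompact hP.refl j (-x) i).comp
    (Homeomorph.neg ℝ).isClosedEmbedding.tendsto_cocompact
  refine this.congr fun s => ?_
  simp [jostPlus_eq hP (good_neg_real j s)]

theorem scatMat_eq_sum (hP : Pot u v) (t : ℝ) (k : Fin 3) : scatMat u v t k 0 =
    ∑ i, star (jostPlus u v k 0 t i) * jostMinus u v 0 0 t i := scatMat_apply hP t k 0

theorem tendsto_s₁₁ (hP : Pot u v) : Tendsto (fun t : ℝ => s₁₁ u v t) (cocompact ℝ) (𝓝 1) := by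
  simp_rw [← scatMat_zero_zero hP, scatMat_eq_sum hP]
  have h := tendsto_finsetSum Finset.univ fun i _ =>
    (((continuous_star.tendsto _).comp (tendsto_jostPlus_cocompact hP 0 0 i)).mul
      (tendsto_jostMinus_cocompact hP 0 0 i))
  simpa [Fin.sum_univ_three] using h

/-! ### Lower bounds for `s₁₁` -/

theorem continuousOn_s₁₁ (hP : Pot u v) : ContinuousOn (s₁₁ u v) {z | 0 ≤ z.im} := by
  have h0 : ContinuousOn (fun z => jostMinus u v 0 0 z) {z | 0 ≤ z.im} :=
    (continuousOn_jostMinus hP 0 0).mono fun z hz => good_zero.2 hz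
  have h1 : ContinuousOn (fun z => jostPlus u v 1 0 z) {z | 0 ≤ z.im} :=
    (continuousOn_jostPlus hP 1 0).mono fun z hz => (good_neg_of_ne (by decide)).2 hz
  have h2 : ContinuousOn (fun z => jostPlus u v 2 0 z) {z | 0 ≤ z.im} :=
    (continuousOn_jostPlus hP 2 0).mono fun z hz => (good_neg_of_ne (by decide)).2 hz
  rw [continuousOn_pi] at h0 h1 h2
  have e : s₁₁ u v = fun z => (ofCols (jostMinus u v 0 0 z) (jostPlus u v 1 0 z)
    (jostPlus u v 2 0 z)).det := rfl
  simp_rw [e, ofCols_det, cross_eq]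
  have a0 := h0 0; have a1 := h0 1; have a2 := h0 2
  have b0 := h1 0; have b1 := h1 1; have b2 := h1 2
  have c0 := h2 0; have c1 := h2 1; have c2 := h2 2
  simp only [Matrix.cons_val_zero, Matrix.cons_val_one, Matrix.cons_val]
  fun_prop

/-- Off a compact set |s₁₁| > 1/2 because s₁₁ → 1; on the compact remainder continuity gives a
positive minimum. A uniform bound is what `BLip.inv` requires. -/
theorem exists_lower_bound_line (hP : Pot u v) {T : Set ℝ} (hT : IsClosed T)
    (h : ∀ t ∈ T, s₁₁ u v (t : ℂ) ≠ 0) : ∃ c : ℝ, 0 < c ∧ ∀ t ∈ T, c ≤ ‖s₁₁ u v t‖ := by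
  have hc : Continuous fun t : ℝ => ‖s₁₁ u v t‖ := by
    have := (continuousOn_s₁₁ hP).comp_continuous Complex.continuous_ofReal (fun t => by simp)
    exact this.norm
  have h1 : ∀ᶠ t in cocompact ℝ, 1 / 2 < ‖s₁₁ u v (t : ℝ)‖ := by
    have := (tendsto_s₁₁ hP).norm
    rw [norm_one] at this
    exact this.eventually_const_lt (by norm_num)
  obtain ⟨K, hK, hK'⟩ := mem_cocompact.1 h1
  rcases (T ∩ K).eq_empty_or_nonempty with he | hne
  · refine ⟨1 / 2, by norm_num, fun t ht => ?_⟩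
    have : t ∉ K := fun hk => (he ▸ (⟨ht, hk⟩ : t ∈ T ∩ K) : t ∈ (∅ : Set ℝ))
    exact (hK' this).le
  · obtain ⟨t₀, ht₀, hmin⟩ := (hK.inter_left hT).exists_isMinOn hne hc.continuousOn
    refine ⟨min (1 / 2) ‖s₁₁ u v t₀‖, lt_min (by norm_num) (norm_pos_iff.2 (h t₀ ht₀.1)),
      fun t ht => ?_⟩
    by_cases hk : t ∈ K
    · exact (min_le_right _ _).trans (hmin ⟨ht, hk⟩)
    · exact (min_le_left _ _).trans (hK' hk).le

theorem exists_lower_bound_arc (hP : Pot u v) (hS : 0 < S)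
    (h : ∀ z : ℂ, 0 ≤ z.im → ‖z‖ = S → s₁₁ u v z ≠ 0) :
    ∃ c : ℝ, 0 < c ∧ ∀ θ ∈ Ioo 0 Real.pi, c ≤ ‖s₁₁ u v (arcMap S θ)‖ := by
  have him : ∀ θ ∈ Icc 0 Real.pi, 0 ≤ (arcMap S θ).im := fun θ hθ => by
    rw [arcMap_im]; exact mul_nonneg hS.le (Real.sin_nonneg_of_mem_Icc hθ)
  have hc : ContinuousOn (fun θ => ‖s₁₁ u v (arcMap S θ)‖) (Icc 0 Real.pi) :=
    ((continuousOn_s₁₁ hP).comp (continuous_arcMap S).continuousOn him).norm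
  obtain ⟨θ₀, hθ₀, hmin⟩ := isCompact_Icc.exists_isMinOn ⟨0, by simp [Real.pi_pos.le]⟩ hc
  exact ⟨_, norm_pos_iff.2 (h _ (him θ₀ hθ₀) (norm_arcMap hS θ₀)),
    fun θ hθ => hmin (Ioo_subset_Icc_self hθ)⟩

/-! ### Regularity of the scattering coefficients -/

theorem BLip.sum {ι : Type*} {I : Set ℝ} (hI : MeasurableSet I) (t : Finset ι) {f : ι → ℝ → ℂ}
    (h : ∀ i ∈ t, BLip I (f i)) : BLip I (fun s => ∑ i ∈ t, f i s) := by
  classical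
  induction t using Finset.induction_on with
  | empty => simpa using BLip.const I 0
  | insert a t ha ih =>
    simp only [Finset.sum_insert ha]
    exact (h a (Finset.mem_insert_self _ _)).add hI (ih fun i hi => h i (Finset.mem_insert_of_mem hi))

theorem Adm.blip_scatMat (H : Adm u v) (k : Fin 3) : BLip univ fun t => scatMat u v t k 0 := by
  simp_rw [scatMat_eq_sum H.pot]
  exact BLip.sum MeasurableSet.univ _ fun i _ =>
    ((H.blip_line' k 0 i).star MeasurableSet.univ).mul MeasurableSet.univ (H.blip_line 0 0 i)

/-- In each product one factor has no constant term and lies in L²: the entry of m⁺ for i = 0, the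
entry of m⁻ for i ≠ 0. The other factor is bounded. -/
theorem Adm.memLp_scatMat (H : Adm u v) {k : Fin 3} (hk : k ≠ 0) :
    MemLp (fun t => scatMat u v t k 0) 2 := by
  simp_rw [scatMat_eq_sum H.pot]
  refine memLp_finsetSum _ fun i _ => ?_
  have hb : ∀ t : ℝ, ‖jostMinus u v 0 0 t i‖ ≤ Real.exp (∫ y, wt u v y) := fun t =>
    (norm_le_pi_norm _ i).trans (norm_jostMinus_le H.pot (good_real 0 t) 0)
  have hb' : ∀ t : ℝ, ‖jostPlus u v k 0 t i‖ ≤ Real.exp (∫ y, wt u v y) := fun t =>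
    (norm_le_pi_norm _ i).trans (norm_jostPlus_le H.pot (good_neg_real k t) 0)
  have hc := (H.blip_line 0 0 i).cont
  have hc' := (H.blip_line' k 0 i).cont
  rw [continuousOn_univ] at hc hc'
  have hm : AEStronglyMeasurable (fun t : ℝ => star (jostPlus u v k 0 t i) * jostMinus u v 0 0 t i)
      volume := ((continuous_star.comp hc').mul hc).aestronglyMeasurable
  have hB := (Real.exp_pos (∫ y, wt u v y)).le
  by_cases hi : i = 0
  · have h := H.memLp_line' k 0 i
    have h0 : (Pi.single k 1 : Fin 3 → ℂ) i = 0 := Pi.single_eq_of_ne (by rw [hi]; exact hk.symm) _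
    simp only [h0, sub_zero] at h
    refine (h.norm.const_mul (Real.exp (∫ y, wt u v y))).mono' hm (Eventually.of_forall fun t => ?_)
    rw [norm_mul, norm_star, mul_comm]
    exact mul_le_mul_of_nonneg_right (hb t) (norm_nonneg _)
  · have h := H.memLp_line 0 0 i
    have h0 : (Pi.single 0 1 : Fin 3 → ℂ) i = 0 := Pi.single_eq_of_ne hi _
    simp only [h0, sub_zero] at h
    refine (h.norm.const_mul (Real.exp (∫ y, wt u v y))).mono' hm (Eventually.of_forall fun t => ?_)
    rw [norm_mul, norm_star]
    exact mul_le_mul_of_nonneg_right (hb' t) (norm_nonneg _)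

theorem Adm.blip_s₁₁_arc (H : Adm u v) (hS : 0 < S) :
    BLip (Ioo 0 Real.pi) fun θ => s₁₁ u v (arcMap S θ) := by
  have e : (fun θ => s₁₁ u v (arcMap S θ)) = fun θ => (ofCols (jostMinus u v 0 0 (arcMap S θ))
    (jostPlus u v 1 0 (arcMap S θ)) (jostPlus u v 2 0 (arcMap S θ))).det := rfl
  rw [e]
  simp_rw [ofCols_det, cross_eq]
  have a := H.blip_arc_zero hS 0
  have b := H.blip_arc' hS (k := 1) (by decide) 0
  have c := H.blip_arc' hS (k := 2) (by decide) 0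
  have m : MeasurableSet (Ioo 0 Real.pi) := measurableSet_Ioo
  simp only [Matrix.cons_val_zero, Matrix.cons_val_one, Matrix.cons_val]
  exact (((a 0).mul m (((b 1).mul m (c 2)).sub m ((b 2).mul m (c 1)))).add m
    ((a 1).mul m (((b 2).mul m (c 0)).sub m ((b 0).mul m (c 2))))).add m
    ((a 2).mul m (((b 0).mul m (c 1)).sub m ((b 1).mul m (c 0))))

end AKNS
end

/-! ### Weighted decay of the scattering coefficients. -/

noncomputable section
namespace AKNS

open scoped ENNReal NNReal

variable {u v : ℝ → ℂ} {j k : Fin 3}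

/-! ### Decay of the scattering coefficients -/

/-- An admissible potential with a square integrable derivative. -/
structure AdmD (u v : ℝ → ℂ) : Prop extends Adm u v where
  du : ∃ g : ℝ → ℂ, Measurable g ∧ MemLp g 2 ∧ Prim u g
  dv : ∃ g : ℝ → ℂ, Measurable g ∧ MemLp g 2 ∧ Prim v g

theorem prim_refl {g : ℝ → ℂ} (h : Prim u g) : Prim (refl u) (fun x => g (-x)) := by
  refine ⟨fun a b => ?_, fun a b => ?_⟩
  · simpa using (h.int (-a) (-b)).comp_sub_left 0
  · rw [intervalIntegral.integral_comp_neg, ← h.sub]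
    simp only [refl]; ring

theorem AdmD.refl (H : AdmD u v) : AdmD (refl u) (refl v) := by
  have key : ∀ {w : ℝ → ℂ}, (∃ g : ℝ → ℂ, Measurable g ∧ MemLp g 2 ∧ Prim w g) →
      ∃ g : ℝ → ℂ, Measurable g ∧ MemLp g 2 ∧ Prim (AKNS.refl w) g := by
    rintro w ⟨g, h1, h2, h3⟩
    exact ⟨_, h1.comp measurable_neg,
      h2.comp_measurePreserving (Measure.measurePreserving_neg volume), prim_refl h3⟩
  exact ⟨H.toAdm.refl, key H.du, key H.dv⟩

theorem AdmD.prim_potential (H : AdmD u v) (hk : k ≠ 0) :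
    ∃ g : ℝ → ℂ, Measurable g ∧ MemLp g 2 ∧ Prim (fun y => potential u v y k 0) g := by
  have key : ∀ {w : ℝ → ℂ}, (∃ g : ℝ → ℂ, Measurable g ∧ MemLp g 2 ∧ Prim w g) →
      ∃ g : ℝ → ℂ, Measurable g ∧ MemLp g 2 ∧ Prim (fun y => -star (w y)) g := by
    rintro w ⟨g, h1, h2, h3⟩
    refine ⟨fun y => -1 * star (g y), (continuous_star.measurable.comp h1).const_mul (-1),
      h2.star.const_mul (-1), (h3.star'.const_mul (-1)).congr_fun fun y => by ring⟩
  fin_cases k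
  · exact absurd rfl hk
  · simpa [potential] using key H.du
  · simpa [potential] using key H.dv

/-- Otherwise ‖f‖ ≥ ε on a half line. Decay along a sequence is enough to kill the boundary terms of
the integration by parts. -/
theorem exists_norm_lt_of_integrable {f : ℝ → ℂ} (hf : Integrable f) (a : ℝ) {ε : ℝ} (hε : 0 < ε) :
    ∃ x, a ≤ x ∧ ‖f x‖ < ε := by
  by_contra! h
  have h1 : IntegrableOn (fun _ : ℝ => ε) (Ici a) :=
    Integrable.mono' hf.norm.integrableOn (by fun_prop)
      ((ae_restrict_mem measurableSet_Ici).mono fun x hx => by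
        rw [Real.norm_of_nonneg hε.le]; exact h x hx)
  rw [integrableOn_const_iff] at h1
  simp [hε.ne'] at h1

theorem exists_seq_tendsto_zero {f : ℝ → ℂ} (hf : Integrable f) :
    ∃ b : ℕ → ℝ, Tendsto b atTop atTop ∧ Tendsto (fun n => f (b n)) atTop (𝓝 0) := by
  choose b hb hb' using fun n : ℕ => exists_norm_lt_of_integrable hf n
    (Nat.one_div_pos_of_nat (α := ℝ) (n := n))
  exact ⟨b, tendsto_atTop_mono hb tendsto_natCast_atTop_atTop,
    squeeze_zero_norm (fun n => (hb' n).le) tendsto_one_div_add_atTop_nhds_zero_nat⟩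

theorem mulVec_of_ne (hk : k ≠ 0) (y : ℝ) (w : Fin 3 → ℂ) :
    (potential u v y).mulVec w k = potential u v y k 0 * w 0 := by
  fin_cases k
  · exact absurd rfl hk
  all_goals simp [Matrix.mulVec, dotProduct, Fin.sum_univ_three, potential]

theorem sigR_ne_zero (hk : k ≠ 0) : sigR k ≠ sigR 0 := by
  fin_cases k <;> simp_all [sigR] <;> norm_num

theorem osc_zero : osc 0 = 1 := by simp [osc, sigR]

theorem kerE_neg_mul (s x y : ℝ) : kerE s (-x) * kerE s (x - y) = kerE s (-y) := by
  rw [kerE, kerE, kerE, ← Complex.exp_add]; congr 1; push_cast; ring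

/-- The scattering coefficients as oscillatory integrals. -/
theorem scatMat_eq_integral (hP : Pot u v) (hk : k ≠ 0) (t : ℝ) :
    scatMat u v t k 0 = ∫ y, kerE t (-y) * (potential u v y k 0 * jostMinus u v 0 y t 0) := by
  have hg0 := good_real 0 t
  have hgk := good_neg_real k t
  have hB := (Real.exp_pos (∫ y, wt u v y)).le
  have hint : Integrable fun y => kerE t (-y) * (potential u v y k 0 * jostMinus u v 0 y t 0) := by
    have h1 := integrable_mulVec_jost hP hg0 k
    simp only [mulVec_of_ne hk] at h1
    exact h1.bdd_mul (c := 1) (by unfold kerE; fun_prop)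
      (Eventually.of_forall fun y => (norm_kerE_ofReal _ _).le)
  have hm : ∀ x : ℝ, kerE t (-x) * jostMinus u v 0 x t k =
      ∫ y in Iic x, kerE t (-y) * (potential u v y k 0 * jostMinus u v 0 y t 0) := fun x => by
    rw [jostMinus_apply hP hg0, Pi.single_eq_of_ne hk, zero_add, ← integral_const_mul]
    refine integral_congr_ae (Eventually.of_forall fun y => ?_)
    simp only
    rw [jE_osc (sigR_ne_zero hk), osc_zero, Complex.ofReal_one, one_mul, mulVec_of_ne hk, ← mul_assoc,
      kerE_neg_mul]
  have l1 : Tendsto (fun x : ℝ => kerE t (-x) * jostMinus u v 0 x t k) atTop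
      (𝓝 (∫ y, kerE t (-y) * (potential u v y k 0 * jostMinus u v 0 y t 0))) := by
    simp_rw [hm]
    exact (aecover_Iic tendsto_id).integral_tendsto_of_countably_generated hint
  have hs : ∀ x : ℝ, scatMat u v t k 0 =
      kerE t (-x) * pr (jostPlus u v k x t) (jostMinus u v 0 x t) := fun x => by
    rw [pr_jostPlus_jostMinus hP]
    have : Complex.exp (Complex.I * t * (sig k - sig 0) * x) = kerE t x := by
      have := jE_osc (sigR_ne_zero hk) (t : ℂ) x
      rw [jE, osc_zero, Complex.ofReal_one, one_mul] at this
      rw [← this]; congr 1; ring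
    rw [this, ← mul_assoc, kerE, kerE, ← Complex.exp_add]
    have : 2 * Complex.I * (t : ℂ) * ((-x : ℝ) : ℂ) + 2 * Complex.I * t * x = 0 := by
      push_cast; ring
    rw [this, Complex.exp_zero, one_mul]
  -- In the limit the pairing with m⁺_k may be replaced by the k-th component, as m⁺_k → e_k while
  -- m⁻₁ stays bounded.
  have l2 : Tendsto (fun x : ℝ => kerE t (-x) *
      (pr (jostPlus u v k x t) (jostMinus u v 0 x t) - jostMinus u v 0 x t k)) atTop (𝓝 0) := by
    have l3 : ∀ i, Tendsto (fun x => star (jostPlus u v k x t i - (Pi.single k 1 : Fin 3 → ℂ) i))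
        atTop (𝓝 0) := fun i => by
      have := ((tendsto_pi_nhds.1 (tendsto_jostPlus hP hgk)) i).sub_const
        ((Pi.single k 1 : Fin 3 → ℂ) i)
      rw [sub_self] at this
      have h := (continuous_star.tendsto (0 : ℂ)).comp this
      rw [star_zero] at h
      exact h
    have l4 : Tendsto (fun x : ℝ => ∑ i, star (jostPlus u v k x t i - (Pi.single k 1 : Fin 3 → ℂ) i) *
        (kerE t (-x) * jostMinus u v 0 x t i)) atTop (𝓝 (∑ _i : Fin 3, 0)) := by
      refine tendsto_finsetSum _ fun i _ => ?_
      refine (l3 i).zero_mul_isBoundedUnder_le ⟨Real.exp (∫ y, wt u v y), ?_⟩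
      refine eventually_map.2 (Eventually.of_forall fun x => ?_)
      simp only [Function.comp_apply, norm_mul, norm_kerE_ofReal, one_mul]
      exact (norm_le_pi_norm _ i).trans (norm_jostMinus_le hP hg0 x)
    simp only [Finset.sum_const_zero] at l4
    refine l4.congr fun x => ?_
    simp only [pr, star_sub, sub_mul, Finset.sum_sub_distrib, mul_sub, Finset.mul_sum]
    congr 1
    · exact Finset.sum_congr rfl fun i _ => by ring
    · rw [Finset.sum_eq_single k (fun i _ hi => by simp [Pi.single_eq_of_ne hi]) (by simp)]
      simp
  have l5 := l1.add l2
  rw [add_zero] at l5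
  refine tendsto_nhds_unique (tendsto_const_nhds.congr fun x => ?_) l5
  rw [hs x]; ring

theorem prim_jostMinus_zero (hP : Pot u v) (t : ℝ) :
    Prim (fun y => jostMinus u v 0 y t 0)
      (fun y => (potential u v y).mulVec (jostMinus u v 0 y t) 0) := by
  have hi := integrable_mulVec_jost hP (good_real 0 t) 0
  refine ⟨fun a b => hi.intervalIntegrable, fun a b => ?_⟩
  rw [jostMinus_apply hP (good_real 0 t), jostMinus_apply hP (good_real 0 t), add_sub_add_left_eq_sub]
  simp_rw [jE_not_osc (rfl : sigR 0 = sigR 0), one_mul]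
  exact intervalIntegral.integral_Iic_sub_Iic hi.integrableOn hi.integrableOn

theorem continuous_kerE_jost (hP : Pot u v) {φ : ℝ → ℂ} (hφ : Continuous φ) :
    Continuous (Function.uncurry fun t y : ℝ =>
      kerE t (-y) * (φ y * jostMinus u v 0 y t 0)) := by
  have hk2 : Continuous fun p : ℝ × ℝ => kerE p.1 (-p.2) := by unfold kerE; fun_prop
  have hs : Continuous fun p : ℝ × ℝ => jostMinus u v 0 p.2 (p.1 : ℂ) 0 := by
    have h := (continuous_jostMinus_real hP 0).comp (f := fun p : ℝ × ℝ => (p.2, p.1)) (by fun_prop)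
    simp only [Function.comp_def] at h
    exact continuous_pi_iff.1 h 0
  exact hk2.mul ((hφ.comp continuous_snd).mul hs)

/-- Integration by parts in `scatMat_eq_integral`: 2it s_{k1} is the limit of ∫ e^{-2ity}(g m + φ G)
over (a_n, b_n), with m the first component of m⁻₁, φ the entry of U, g = φ' and G = m'; boundary
terms vanish along sequences where φ → 0. The g term is treated by `enorm_iterated_le`, with g in
place of the potential. G involves only oscillating components, so the φG term is controlled by wt²
∈ L¹ and `Adm.sqLe_oscPart`. Fatou passes the uniform L² bound to the limit. -/
theorem AdmD.memLp_mul_scatMat (H : AdmD u v) (hk : k ≠ 0) :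
    MemLp (fun t : ℝ => (t : ℂ) * scatMat u v t k 0) 2 := by
  obtain ⟨g, hgm, hg2, hg⟩ := H.prim_potential hk
  have hP := H.pot
  set φ : ℝ → ℂ := fun y => potential u v y k 0 with hφ
  have hφi : Integrable φ := hP.integrable_potential k 0
  obtain ⟨b, hb, hb0⟩ := exists_seq_tendsto_zero hφi
  obtain ⟨a', ha', ha0⟩ := exists_seq_tendsto_zero hφi.comp_neg
  set a : ℕ → ℝ := fun n => -a' n with had
  have ha : Tendsto a atTop atBot := tendsto_neg_atTop_atBot.comp ha'
  set B := Real.exp (∫ y, wt u v y) with hB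
  have hmB : ∀ y t : ℝ, ‖jostMinus u v 0 y t 0‖ ≤ B := fun y t =>
    (norm_le_pi_norm _ 0).trans (norm_jostMinus_le hP (good_real 0 t) y)
  let G : ℝ → ℝ → ℂ := fun t y => (potential u v y).mulVec (jostMinus u v 0 y t) 0
  let F : ℕ → ℝ → ℂ := fun n t => ∫ y in a n..b n, kerE t (-y) *
    (g y * jostMinus u v 0 y t 0 + φ y * G t y)
  -- the limit of `F`
  have hparts : ∀ n t, F n t = kerE t (-b n) * (φ (b n) * jostMinus u v 0 (b n) t 0) -
      kerE t (-a n) * (φ (a n) * jostMinus u v 0 (a n) t 0) +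
      2 * Complex.I * t * ∫ y in a n..b n, kerE t (-y) * (φ y * jostMinus u v 0 y t 0) := by
    intro n t
    have h1 : Prim (fun y => kerE t (-y)) (fun y => -(2 * Complex.I * t) * kerE t (-y)) := by
      have := Prim.cexp (-(2 * Complex.I * t))
      have e : ∀ y : ℝ, Complex.exp (-(2 * Complex.I * t) * y) = kerE t (-y) := fun y => by
        rw [kerE]; congr 1; push_cast; ring
      exact (this.congr_fun e).congr_deriv fun y => by rw [e]
    have h2 := h1.mul (hg.mul (prim_jostMinus_zero hP t))
    have h3 := h2.sub (a n) (b n)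
    have hc : Continuous fun y => kerE t (-y) * (φ y * jostMinus u v 0 y t 0) :=
      h1.cont.mul (hg.cont.mul (prim_jostMinus_zero hP t).cont)
    have h4 : ∀ y, -(2 * Complex.I * t) * kerE t (-y) * (φ y * jostMinus u v 0 y t 0) +
        kerE t (-y) * (g y * jostMinus u v 0 y t 0 + φ y * G t y) =
        kerE t (-y) * (g y * jostMinus u v 0 y t 0 + φ y * G t y) -
        (2 * Complex.I * t) * (kerE t (-y) * (φ y * jostMinus u v 0 y t 0)) := fun y => by ring
    have hi1 : IntervalIntegrable (fun y => kerE t (-y) *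
        (g y * jostMinus u v 0 y t 0 + φ y * G t y)) volume (a n) (b n) :=
      ((hg.mul (prim_jostMinus_zero hP t)).int _ _).continuousOn_mul h1.cont.continuousOn
    rw [intervalIntegral.integral_congr (fun y _ => h4 y), intervalIntegral.integral_sub hi1
      ((hc.intervalIntegrable _ _).const_mul _), intervalIntegral.integral_const_mul] at h3
    rw [h3]; ring
  have hlim : ∀ t : ℝ, Tendsto (fun n => F n t) atTop
      (𝓝 (2 * Complex.I * t * scatMat u v t k 0)) := by
    intro t
    have hbd : ∀ (c : ℕ → ℝ), Tendsto (fun n => φ (c n)) atTop (𝓝 0) →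
        Tendsto (fun n => kerE t (-c n) * (φ (c n) * jostMinus u v 0 (c n) t 0)) atTop (𝓝 0) := by
      intro c hc
      refine squeeze_zero_norm (a := fun n => ‖φ (c n)‖ * B) (fun n => ?_) (by simpa using hc.norm.mul_const B)
      rw [norm_mul, norm_kerE_ofReal, one_mul, norm_mul]
      exact mul_le_mul_of_nonneg_left (hmB _ _) (norm_nonneg _)
    have hint : Integrable fun y => kerE t (-y) * (φ y * jostMinus u v 0 y t 0) := by
      have h1 := integrable_mulVec_jost hP (good_real 0 t) k
      simp only [mulVec_of_ne hk] at h1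
      exact h1.bdd_mul (c := 1) (by unfold kerE; fun_prop)
        (Eventually.of_forall fun y => (norm_kerE_ofReal _ _).le)
    have l := intervalIntegral_tendsto_integral hint ha hb
    rw [← scatMat_eq_integral hP hk] at l
    have := ((hbd b hb0).sub (hbd a ha0)).add (l.const_mul (2 * Complex.I * t))
    simp only [sub_zero, zero_add] at this
    simp_rw [hparts]
    exact this
  -- uniform bounds
  set D : ℝ≥0∞ := 3 * (oscConst u v * (2 * eLpNorm (wt u v) 2)) with hD
  set R₁ : ℝ≥0∞ := 2 * eLpNorm g 2 + (∫⁻ w, ENNReal.ofReal (B * wt u v w)) * (2 * eLpNorm g 2) with hR₁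
  set R₂ : ℝ≥0∞ := (∫⁻ w, ENNReal.ofReal (wt u v w * wt u v w)) * D with hR₂
  have hFm : ∀ n, Continuous fun t => F n t := by
    intro n
    have hu := continuous_kerE_jost hP hg.cont
    have hb' : ∀ c : ℝ, Continuous fun t : ℝ => kerE t (-c) * (φ c * jostMinus u v 0 c t 0) :=
      fun c => hu.comp (f := fun t : ℝ => (t, c)) (by fun_prop)
    have hi : Continuous fun t : ℝ => ∫ y in a n..b n, kerE t (-y) *
        (φ y * jostMinus u v 0 y t 0) :=
      intervalIntegral.continuous_parametric_intervalIntegral_of_continuous'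
        (f := fun t y : ℝ => kerE t (-y) * (φ y * jostMinus u v 0 y t 0)) hu (a n) (b n)
    have hc : Continuous fun t : ℝ => (2 * Complex.I * t : ℂ) :=
      continuous_const.mul Complex.continuous_ofReal
    exact (((hb' (b n)).sub (hb' (a n))).add (hc.mul hi)).congr fun t => (hparts n t).symm
  have hFb : ∀ᶠ n in atTop, SqLe volume (fun t => ‖F n t‖ₑ) (R₁ + R₂) := by
    filter_upwards [(hb.eventually_ge_atTop 0), ha.eventually_le_atBot 0] with n hbn han
    have hab := han.trans hbn
    -- g is only in L², but its truncation is integrable, with L² norm bounded independently of n.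
    let gn : ℝ → ℂ := (Ioc (a n) (b n)).indicator g
    have hgnm : Measurable gn := hgm.indicator measurableSet_Ioc
    have hgn2 : MemLp gn 2 := hg2.indicator measurableSet_Ioc
    have hgn1 : Integrable gn :=
      (integrable_indicator_iff measurableSet_Ioc).2 ((hg.int (a n) (b n)).1)
    have hgnle : eLpNorm gn 2 ≤ eLpNorm g 2 := eLpNorm_indicator_le g
    have hker : ∀ f : ℝ → ℂ, Integrable f → MemLp f 2 → eLpNorm f 2 ≤ eLpNorm g 2 →
        SqLe volume (fun t : ℝ => ‖∫ y in Iic (b n), kerE t (b n - y) * f y‖ₑ)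
          (2 * eLpNorm g 2) := fun f h1 h2 h3 => by
      have := kerBound_line_aux (c := 1) (by simp) h1 h2 (b n)
      simp only [one_mul] at this
      exact this.mono this.meas (Eventually.of_forall fun _ => le_rfl) (mul_le_mul_right h3 2)
    have s1 : SqLe volume (fun t : ℝ => ‖∫ y in Iic (b n), kerE t (b n - y) * gn y‖ₑ +
        ∫⁻ w, ENNReal.ofReal (B * wt u v w) *
          ‖∫ y in Iic (b n), kerE t (b n - y) * (Ici w).indicator gn y‖ₑ) R₁ := by
      refine (hker gn hgn1 hgn2 hgnle).add ?_
      refine SqLe.lintegral (k := fun p : ℝ × ℝ =>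
        ‖∫ y in Iic (b n), kerE p.1 (b n - y) * (Ici p.2).indicator gn y‖ₑ)
        (hP.wt_meas.const_mul _).ennreal_ofReal.aemeasurable ?_ (Eventually.of_forall fun w => ?_)
      · exact (measurable_ker_integral (K := fun s => kerE s)
          (continuous_kerE_uncurry Complex.continuous_ofReal).measurable measurable_fst measurable_const
          (measurable_indicator_Ici measurable_snd hgnm)).enorm
      · exact hker _ (hgn1.indicator measurableSet_Ici) (hgn2.indicator measurableSet_Ici)
          ((eLpNorm_indicator_le gn).trans hgnle)
    have s2 : SqLe volume (fun t => ∫⁻ y, ENNReal.ofReal (wt u v y * wt u v y) * oscPart u v 0 y t)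
        R₂ :=
      SqLe.lintegral (k := fun p => oscPart u v 0 p.2 p.1)
        (hP.wt_meas.mul hP.wt_meas).ennreal_ofReal.aemeasurable
        (measurable_oscPart hP 0) (Eventually.of_forall fun y => H.sqLe_oscPart 0 y)
    refine (s1.add s2).mono (hFm n).enorm.measurable.aemeasurable
      (Eventually.of_forall fun t => ?_) le_rfl
    have hkc : Continuous fun y => kerE t (-y) := by unfold kerE; fun_prop
    have hi1 : IntervalIntegrable (fun y => kerE t (-y) * (g y * jostMinus u v 0 y t 0)) volume (a n) (b n) :=
      ((hg.int _ _).mul_continuousOn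
        (prim_jostMinus_zero hP t).cont.continuousOn).continuousOn_mul hkc.continuousOn
    have hi2 : IntervalIntegrable (fun y => kerE t (-y) * (φ y * G t y)) volume (a n) (b n) :=
      (((prim_jostMinus_zero hP t).int _ _).continuousOn_mul
        hg.cont.continuousOn).continuousOn_mul hkc.continuousOn
    have e1 : F n t = (∫ y in a n..b n, kerE t (-y) * (g y * jostMinus u v 0 y t 0)) +
        ∫ y in a n..b n, kerE t (-y) * (φ y * G t y) := by
      rw [← intervalIntegral.integral_add hi1 hi2]
      simp only [F, mul_add]
    rw [e1]
    refine (enorm_add_le _ _).trans (add_le_add ?_ ?_)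
    · have e2 : ∫ y in a n..b n, kerE t (-y) * (g y * jostMinus u v 0 y t 0) =
          kerE t (-b n) * ∫ y in Iic (b n), kerE t (b n - y) * (gn y * (1 + ∫ w in Iic y, G t w)) := by
        rw [intervalIntegral.integral_of_le hab, ← integral_const_mul,
          ← integral_indicator measurableSet_Ioc, ← integral_indicator measurableSet_Iic]
        refine integral_congr_ae (Eventually.of_forall fun y => ?_)
        have hj : jostMinus u v 0 y t 0 = 1 + ∫ w in Iic y, G t w := by
          rw [jostMinus_apply hP (good_real 0 t)]
          simp_rw [jE_not_osc (rfl : sigR 0 = sigR 0), one_mul]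
          simp [G]
        by_cases hy : y ∈ Ioc (a n) (b n)
        · have hy' : y ∈ Iic (b n) := hy.2
          simp only [gn, indicator_of_mem hy, indicator_of_mem hy']
          rw [hj, ← kerE_neg_mul t (b n) y]; ring
        · by_cases hy' : y ∈ Iic (b n)
          · simp only [gn, indicator_of_notMem hy, indicator_of_mem hy']; ring
          · simp only [indicator_of_notMem hy, indicator_of_notMem hy']
      rw [e2, enorm_mul, ← ofReal_norm (kerE _ _), norm_kerE_ofReal, ENNReal.ofReal_one, one_mul]
      refine (enorm_iterated_le 1 (integrableOn_ker (K := kerE t) (by unfold kerE; fun_prop) (C := 1)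
        (fun s _ => (norm_kerE_ofReal t s).le) hgn1 (b n))
        (integrable_mulVec_jost hP (good_real 0 t) 0)).trans (add_le_add ?_ (lintegral_mono fun w =>
          mul_le_mul_left ?_ _))
      · rw [enorm_one, one_mul]
      · rw [← ofReal_norm]
        refine ENNReal.ofReal_le_ofReal ((norm_potential_mulVec_le u v w _ 0).trans ?_)
        rw [mul_comm]
        exact mul_le_mul_of_nonneg_right (norm_jostMinus_le hP (good_real 0 t) w) (wt_nonneg u v w)
    · rw [intervalIntegral.integral_of_le hab]
      refine (enorm_integral_le_lintegral_enorm _).trans ((setLIntegral_le_lintegral _ _).trans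
        (lintegral_mono fun y => ?_))
      rw [enorm_mul, enorm_mul, ← ofReal_norm (kerE _ _), norm_kerE_ofReal, ENNReal.ofReal_one, one_mul,
        ENNReal.ofReal_mul (wt_nonneg u v y), mul_assoc]
      refine mul_le_mul' ?_ (enorm_mulVec_le_oscPart u v rfl y t)
      rw [← ofReal_norm]
      exact ENNReal.ofReal_le_ofReal (norm_potential_le u v y k 0)
  -- The bounds hold once a_n ≤ 0 ≤ b_n, so the sequence is shifted before Fatou is applied.
  obtain ⟨N, hN⟩ := eventually_atTop.1 hFb
  have hS := SqLe.of_tendsto (μ := volume) (F := fun n t => ‖F (n + N) t‖ₑ)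
    (f := fun t : ℝ => ‖2 * Complex.I * t * scatMat u v t k 0‖ₑ)
    (fun n => hN (n + N) (Nat.le_add_left N n))
    (Eventually.of_forall fun t => ((hlim t).comp (tendsto_add_atTop_nat N)).enorm)
  have hcs := continuousOn_univ.1 (H.toAdm.blip_scatMat k).cont
  have hR : R₁ + R₂ ≠ ∞ := by
    have hgt := hg2.2.ne
    have hw : ∫⁻ w, ENNReal.ofReal (wt u v w * wt u v w) ≠ ∞ :=
      (H.l2.integrable_mul H.l2).lintegral_lt_top.ne
    refine ENNReal.add_ne_top.2 ⟨ENNReal.add_ne_top.2 ⟨ENNReal.mul_ne_top (by norm_num) hgt,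
      ENNReal.mul_ne_top (hP.lintegral_ne_top B) (ENNReal.mul_ne_top (by norm_num) hgt)⟩,
      ENNReal.mul_ne_top hw (ENNReal.mul_ne_top (by norm_num) (ENNReal.mul_ne_top
        (oscConst_ne_top hP) (ENNReal.mul_ne_top (by norm_num) H.l2.2.ne)))⟩
  have hfin := (hS.memLp hR ((continuous_const.mul Complex.continuous_ofReal).mul
    hcs).aestronglyMeasurable).const_mul (2 * Complex.I)⁻¹
  refine hfin.ae_eq (Eventually.of_forall fun t => ?_)
  have : (2 * Complex.I : ℂ) ≠ 0 := by simp
  field_simp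

end AKNS
end

/-! ### Reflection coefficients and the scalar functions on ∂Ω₁ and ∂Ω₃. -/

noncomputable section
namespace AKNS

open scoped ENNReal NNReal
open Region

variable {u v : ℝ → ℂ} {k : Fin 3} {S x₀ : ℝ}

/-! ### The reflection coefficients -/

theorem BLip.of_contDiff {f : ℝ → ℂ} (hf : ContDiff ℝ 1 f) (a b : ℝ) : BLip (Ioo a b) f := by
  obtain ⟨K, hK⟩ := hf.contDiffOn.exists_lipschitzOnWith (by norm_num) (convex_Icc a b) isCompact_Icc
  obtain ⟨B, hB⟩ := isCompact_Icc.exists_bound_of_continuousOn (hf.continuous.continuousOn (s := Icc a b))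
  exact BLip.of_lipschitz measurableSet_Ioo (by simp) ⟨B, fun t ht => hB t (Ioo_subset_Icc_self ht)⟩
    (hK.mono Ioo_subset_Icc_self)

/-- The quotient `s_{k1} / s₁₁`. -/
def rho (u v : ℝ → ℂ) (k : Fin 3) (t : ℝ) : ℂ := scatMat u v t k 0 / scatMat u v t 0 0

theorem rho_eq_mul (hP : Pot u v) (k : Fin 3) (t : ℝ) :
    rho u v k t = (s₁₁ u v t)⁻¹ * scatMat u v t k 0 := by
  rw [rho, scatMat_zero_zero hP, div_eq_mul_inv, mul_comm]

theorem Adm.blip_rho (H : Adm u v) {T : Set ℝ} (hT : IsClosed T) (h : ∀ t ∈ T, s₁₁ u v (t : ℂ) ≠ 0)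
    (k : Fin 3) : BLip T (rho u v k) := by
  obtain ⟨c, hc, hc'⟩ := exists_lower_bound_line H.pot hT h
  have e : rho u v k = fun t : ℝ => (s₁₁ u v t)⁻¹ * scatMat u v t k 0 := funext (rho_eq_mul H.pot k)
  have h0 := (H.blip_scatMat 0).mono (subset_univ T) hT.measurableSet
  simp_rw [scatMat_zero_zero H.pot] at h0
  rw [e]
  exact (h0.inv hT.measurableSet hc hc').mul hT.measurableSet
    ((H.blip_scatMat k).mono (subset_univ T) hT.measurableSet)

/-- The zeros of s₁₁ are excluded on the closed set T, corners included, so that |s₁₁| is bounded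
below uniformly; the L² bounds for the numerators then pass to the open piece J. -/
theorem AdmD.memH11On_rho (H : AdmD u v) {T J : Set ℝ} (hT : IsClosed T)
    (h : ∀ t ∈ T, s₁₁ u v (t : ℂ) ≠ 0) (hJ : IsOpen J) (hJT : J ⊆ T) (hk : k ≠ 0) :
    MemH11On J (fun t => (t : ℂ)) (rho u v k) := by
  obtain ⟨c, hc, hc'⟩ := exists_lower_bound_line H.pot hT h
  have hb := (H.blip_rho hT h k).mono hJT hJ.measurableSet
  have hle : ∀ t ∈ J, ‖rho u v k t‖ ≤ c⁻¹ * ‖scatMat u v t k 0‖ := fun t ht => by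
    rw [rho_eq_mul H.pot, norm_mul, norm_inv]
    gcongr
    exact hc' t (hJT ht)
  refine ⟨hb.memH1On hJ ?_, ?_⟩
  · exact ((H.memLp_scatMat hk).restrict J).of_le_mul (hb.cont.aestronglyMeasurable hJ.measurableSet)
      ((ae_restrict_mem hJ.measurableSet).mono hle)
  · refine ((H.memLp_mul_scatMat hk).restrict J).of_le_mul (c := c⁻¹)
      ((Complex.continuous_ofReal.continuousOn.mul hb.cont).aestronglyMeasurable hJ.measurableSet)
      ((ae_restrict_mem hJ.measurableSet).mono fun t ht => ?_)
    rw [norm_mul, norm_mul]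
    calc _ ≤ ‖(t : ℂ)‖ * (c⁻¹ * ‖scatMat u v t k 0‖) := by gcongr; exact hle t ht
      _ = _ := by ring

theorem Adm.memH11On_rho_inner (H : Adm u v) (h : ∀ t : ℝ, s₁₁ u v (t : ℂ) ≠ 0) (S : ℝ) (k : Fin 3) :
    MemH11On {t | |t| < S} (fun t => (t : ℂ)) (rho u v k) := by
  have hJ : IsOpen {t : ℝ | |t| < S} := isOpen_lt continuous_abs continuous_const
  have hv : volume {t : ℝ | |t| < S} ≠ ∞ := by
    have : {t : ℝ | |t| < S} = Ioo (-S) S := by ext t; simp [abs_lt]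
    rw [this]; simp
  have hb := (H.blip_rho isClosed_univ (fun t _ => h t) k).mono (subset_univ _) hJ.measurableSet
  have h2 := hb.memLp hJ.measurableSet hv
  refine ⟨hb.memH1On hJ h2, h2.of_le_mul (c := S)
    ((Complex.continuous_ofReal.continuousOn.mul hb.cont).aestronglyMeasurable hJ.measurableSet)
    ((ae_restrict_mem hJ.measurableSet).mono fun t ht => ?_)⟩
  rw [norm_mul, Complex.norm_real]
  exact mul_le_mul_of_nonneg_right (le_of_lt ht) (norm_nonneg _)

theorem BLip.memH11On_arc {f : ℝ → ℂ} (hS : 0 < S) (hf : BLip (Ioo 0 Real.pi) f) :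
    MemH11On (Ioo 0 Real.pi) (arcMap S) f := by
  have h2 := hf.memLp measurableSet_Ioo (by simp)
  refine ⟨hf.memH1On isOpen_Ioo h2, h2.of_le_mul (c := S)
    (((continuous_arcMap S).continuousOn.mul hf.cont).aestronglyMeasurable measurableSet_Ioo)
    (Eventually.of_forall fun t => ?_)⟩
  rw [norm_mul, norm_arcMap hS]

/-! ### The entries of the jump on the arc -/

theorem contDiff_arcMap (S : ℝ) : ContDiff ℝ 1 (arcMap S) := by
  unfold arcMap
  exact contDiff_const.mul (contDiff_const.mul Complex.ofRealCLM.contDiff).cexp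

/-- The entry of the jump matrix on the upper arc. -/
def arcV (u v : ℝ → ℂ) (x₀ : ℝ) (k : Fin 3) (z : ℂ) : ℂ :=
  if k = 1 then arcV₁ u v x₀ z else arcV₂ u v x₀ z

theorem Zeros.blip_arcV (Z : Zeros u v S x₀) (H : Adm u v) (k : Fin 3) :
    BLip (Ioo 0 Real.pi) fun θ => arcV u v x₀ k (arcMap S θ) := by
  have m : MeasurableSet (Ioo 0 Real.pi) := measurableSet_Ioo
  obtain ⟨c, hc, hc'⟩ := exists_lower_bound_arc H.pot Z.pos fun z h1 h2 => Z.s_ne z h1 h2.ge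
  obtain ⟨d, hd, hd'⟩ := exists_lower_bound_arc (H.pot.cutRight x₀) Z.pos fun z h1 _ => Z.s0_ne z h1
  have hi : BLip (Ioo 0 Real.pi) fun θ => (s₁₁ u v (arcMap S θ) *
      s₁₁ (AKNS.cutRight x₀ u) (AKNS.cutRight x₀ v) (arcMap S θ))⁻¹ := by
    refine ((H.blip_s₁₁_arc Z.pos).mul m ((H.cutRight x₀).blip_s₁₁_arc Z.pos)).inv m
      (mul_pos hc hd) fun θ hθ => ?_
    rw [norm_mul]
    exact mul_le_mul (hc' θ hθ) (hd' θ hθ) hd.le (norm_nonneg _)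
  have he : BLip (Ioo 0 Real.pi) fun θ => Complex.exp (-(2 * (Complex.I * arcMap S θ * x₀))) :=
    BLip.of_contDiff (contDiff_const.mul
      ((contDiff_const.mul (contDiff_arcMap S)).mul contDiff_const)).neg.cexp _ _
  have a := H.blip_arc_zero Z.pos x₀
  have b := H.blip_arc' Z.pos (k := 1) (by decide) x₀
  have c' := H.blip_arc' Z.pos (k := 2) (by decide) x₀
  unfold arcV
  split_ifs
  · simp_rw [arcV₁, div_eq_mul_inv]
    exact he.mul m ((((a 1).mul m (c' 2)).sub m ((a 2).mul m (c' 1))).mul m hi)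
  · simp_rw [arcV₂, div_eq_mul_inv]
    exact he.mul m ((((b 1).mul m (a 2)).sub m ((b 2).mul m (a 1))).mul m hi)

/-- The corners belong to this closed arc: the matching conditions need limits there, which the L²
theory on the open arc does not record. -/
theorem Zeros.continuousOn_arcV (Z : Zeros u v S x₀) (k : Fin 3) :
    ContinuousOn (arcV u v x₀ k) {z | 0 ≤ z.im ∧ ‖z‖ = S} := by
  have hP := Z.pot
  have hsub : {z : ℂ | 0 ≤ z.im ∧ ‖z‖ = S} ⊆ {z | 0 ≤ z.im} := fun z hz => hz.1
  have a : ContinuousOn (fun z => jostMinus u v 0 x₀ z) {z | 0 ≤ z.im ∧ ‖z‖ = S} :=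
    (continuousOn_jostMinus hP 0 x₀).mono fun z hz => good_zero.2 hz.1
  have b : ContinuousOn (fun z => jostPlus u v 1 x₀ z) {z | 0 ≤ z.im ∧ ‖z‖ = S} :=
    (continuousOn_jostPlus hP 1 x₀).mono fun z hz => (good_neg_of_ne (by decide)).2 hz.1
  have c : ContinuousOn (fun z => jostPlus u v 2 x₀ z) {z | 0 ≤ z.im ∧ ‖z‖ = S} :=
    (continuousOn_jostPlus hP 2 x₀).mono fun z hz => (good_neg_of_ne (by decide)).2 hz.1
  rw [continuousOn_pi] at a b c
  have a1 := a 1; have a2 := a 2; have b1 := b 1; have b2 := b 2; have c1 := c 1; have c2 := c 2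
  have s := (continuousOn_s₁₁ hP).mono hsub
  have s' := (continuousOn_s₁₁ (hP.cutRight x₀)).mono hsub
  have hi := (s.mul s').inv₀ fun z hz => mul_ne_zero (Z.s_ne z hz.1 hz.2.ge) (Z.s0_ne z hz.1)
  have he : Continuous fun z => Complex.exp (-(2 * (Complex.I * z * x₀))) := by fun_prop
  unfold arcV
  split_ifs
  · refine (he.continuousOn.mul (((a1.mul c2).sub (a2.mul c1)).mul hi)).congr fun z _ => ?_
    rw [arcV₁, div_eq_mul_inv]; rfl
  · refine (he.continuousOn.mul (((b1.mul a2).sub (b2.mul a1)).mul hi)).congr fun z _ => ?_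
    rw [arcV₂, div_eq_mul_inv]; rfl

theorem Zeros.arcV_eq (Z : Zeros u v S x₀) (hk : k ≠ 0) {t : ℝ} (ht : S ≤ |t|) :
    arcV u v x₀ k t = rho u v k t - rho (cutRight x₀ u) (cutRight x₀ v) k t := by
  fin_cases k
  · exact absurd rfl hk
  · exact (Z.arcV_real ht).1
  · exact (Z.arcV_real ht).2

/-! ### Functions on the boundary of a region -/

open Classical in
/-- The function that is `w` on the upper arc and `g` on the line. -/
def glue (S : ℝ) (w : ℂ → ℂ) (g : ℝ → ℂ) (z : ℂ) : ℂ := if z ∈ upperArc S then w z else g z.re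

theorem glue_of_mem {z : ℂ} (w : ℂ → ℂ) (g : ℝ → ℂ) (h : z ∈ upperArc S) : glue S w g z = w z :=
  if_pos h

theorem glue_of_im {z : ℂ} (w : ℂ → ℂ) (g : ℝ → ℂ) (h : z.im = 0) : glue S w g z = g z.re :=
  if_neg fun h' => h'.2.ne' h

/-- Within ∂R the neighbourhoods of a corner split into a line part and an arc part. Each function
is continuous up to the corner on its part, and `hwg` makes the two limits equal. -/
theorem memH11Bdry_glue (hS : 0 < S) {R : Region} (hR : R = Ω₁ ∨ R = Ω₃) {w : ℂ → ℂ} {g : ℝ → ℂ}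
    (hline : MemH11On (lineParam S R) (fun t => (t : ℂ)) g)
    (harc : MemH11On (Ioo 0 Real.pi) (arcMap S) fun θ => w (arcMap S θ))
    (hw : ContinuousOn w {z | 0 ≤ z.im ∧ ‖z‖ = S})
    (hg : ∀ a : ℝ, |a| = S → ContinuousWithinAt g (lineParam S R) a)
    (hwg : ∀ a : ℝ, |a| = S → w a = g a) : MemH11Bdry S R (glue S w g) := by
  have hp : arcParam R = Ioo 0 Real.pi := by rcases hR with rfl | rfl <;> rfl
  have hsub : smoothBdry S R ⊆ {z | z.im = 0 ∧ z.re ∈ lineParam S R} ∪ upperArc S := by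
    rcases hR with rfl | rfl <;> exact fun z hz => hz
  have hlim : ∀ a : ℝ, |a| = S →
      Tendsto (glue S w g) (𝓝[smoothBdry S R] (a : ℂ)) (𝓝 (g a)) := fun a ha => by
    refine Tendsto.mono_left ?_ (nhdsWithin_mono _ hsub)
    rw [nhdsWithin_union]
    refine Tendsto.sup ?_ ?_
    · have h1 : Tendsto Complex.re (𝓝[{z | z.im = 0 ∧ z.re ∈ lineParam S R}] (a : ℂ))
          (𝓝[lineParam S R] a) :=
        tendsto_nhdsWithin_iff.2 ⟨(Complex.continuous_re.tendsto' (a : ℂ) a (by simp)).mono_left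
          nhdsWithin_le_nhds, eventually_mem_nhdsWithin.mono fun z hz => hz.2⟩
      refine ((hg a ha).tendsto.comp h1).congr' (eventually_mem_nhdsWithin.mono fun z hz => ?_)
      rw [glue_of_im w g hz.1]; rfl
    · have h1 := (hw (a : ℂ) ⟨by simp, by simpa using ha⟩).mono
        (show upperArc S ⊆ {z | 0 ≤ z.im ∧ ‖z‖ = S} from fun z hz => ⟨hz.2.le, hz.1⟩)
      rw [← hwg a ha]
      exact h1.tendsto.congr' (eventually_mem_nhdsWithin.mono fun z hz => (glue_of_mem w g hz).symm)
  refine ⟨?_, ?_, ⟨_, hlim S (abs_of_pos hS)⟩, ⟨g (-S), ?_⟩⟩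
  · refine hline.congr (measurableSet_lineParam S R) fun t _ => ?_
    rw [glue_of_im w g (by simp), Complex.ofReal_re]
  · rw [hp]
    exact harc.congr measurableSet_Ioo fun θ hθ => (glue_of_mem w g (arcMap_mem_upperArc hS hθ)).symm
  · have := hlim (-S) (by rw [abs_neg, abs_of_pos hS])
    simpa using this

/-- The affine function of `Re z` with the values of `g` at `± S`. -/
def interp (S : ℝ) (g : ℝ → ℂ) (z : ℂ) : ℂ :=
  g (-S) + ((z.re + S) / (2 * S) : ℝ) * (g S - g (-S))

theorem interp_of_abs (hS : 0 < S) (g : ℝ → ℂ) {a : ℝ} (ha : |a| = S) : interp S g a = g a := by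
  rcases eq_or_eq_neg_of_abs_eq ha with rfl | rfl
  · simp only [interp, Complex.ofReal_re]
    rw [show (a + a) / (2 * a) = 1 by field_simp; ring]
    simp
  · simp [interp]

theorem continuous_interp (S : ℝ) (g : ℝ → ℂ) : Continuous (interp S g) := by
  unfold interp; fun_prop

theorem blip_interp (S : ℝ) (g : ℝ → ℂ) : BLip (Ioo 0 Real.pi) fun θ => interp S g (arcMap S θ) := by
  refine BLip.of_contDiff ?_ _ _
  have h : ContDiff ℝ 1 fun θ => (((arcMap S θ).re + S) / (2 * S) : ℝ) := by
    simp_rw [arcMap_re]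
    exact ((contDiff_const.mul Real.contDiff_cos).add contDiff_const).div_const _
  exact contDiff_const.add ((Complex.ofRealCLM.contDiff.comp h).mul contDiff_const)

/-- The scalar function on the boundary of `Ω₃`. -/
def innerFun (u v : ℝ → ℂ) (S x₀ : ℝ) (k : Fin 3) : ℂ → ℂ :=
  glue S (interp S (rho (cutRight x₀ u) (cutRight x₀ v) k)) (rho (cutRight x₀ u) (cutRight x₀ v) k)

/-- The scalar function on the boundary of `Ω₁`. -/
def outerFun (u v : ℝ → ℂ) (S x₀ : ℝ) (k : Fin 3) : ℂ → ℂ :=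
  glue S (fun z => interp S (rho (cutRight x₀ u) (cutRight x₀ v) k) z + arcV u v x₀ k z) (rho u v k)

theorem Zeros.memH11Bdry_innerFun (Z : Zeros u v S x₀) (H : Adm u v) (k : Fin 3) :
    MemH11Bdry S Ω₃ (innerFun u v S x₀ k) := by
  have h0 : ∀ t : ℝ, s₁₁ (cutRight x₀ u) (cutRight x₀ v) (t : ℂ) ≠ 0 := fun t => Z.s0_ne _ (by simp)
  have hb := (H.cutRight x₀).blip_rho isClosed_univ (fun t _ => h0 t) k
  refine memH11Bdry_glue Z.pos (Or.inr rfl) ((H.cutRight x₀).memH11On_rho_inner h0 S k)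
    ((blip_interp S _).memH11On_arc Z.pos) (continuous_interp S _).continuousOn
    (fun a _ => (continuousOn_univ.1 hb.cont).continuousWithinAt) fun a ha => interp_of_abs Z.pos _ ha

theorem Zeros.memH11Bdry_outerFun (Z : Zeros u v S x₀) (H : AdmD u v) (hk : k ≠ 0) :
    MemH11Bdry S Ω₁ (outerFun u v S x₀ k) := by
  have hT : IsClosed {t : ℝ | S ≤ |t|} := isClosed_le continuous_const continuous_abs
  have hJ : IsOpen {t : ℝ | S < |t|} := isOpen_lt continuous_const continuous_abs
  have hsub : {t : ℝ | S < |t|} ⊆ {t : ℝ | S ≤ |t|} := fun t (ht : S < |t|) => ht.le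
  have h0 : ∀ t ∈ {t : ℝ | S ≤ |t|}, s₁₁ u v (t : ℂ) ≠ 0 := fun t ht =>
    Z.s_ne _ (by simp) (by simpa using ht)
  have hb := H.blip_rho hT h0 k
  refine memH11Bdry_glue Z.pos (Or.inl rfl) (H.memH11On_rho hT h0 hJ hsub hk)
    (((blip_interp S _).add measurableSet_Ioo (Z.blip_arcV H.toAdm k)).memH11On_arc Z.pos)
    ((continuous_interp S _).continuousOn.add (Z.continuousOn_arcV k))
    (fun a ha => (hb.cont a ha.ge).mono hsub) fun a ha => ?_
  rw [interp_of_abs Z.pos _ ha, Z.arcV_eq hk ha.ge]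
  ring

/-- The arc relation holds by construction, because the same interpolant is used in `innerFun` and
`outerFun`; the corner values of the interpolant serve the matching conditions alone. -/
theorem Zeros.scalarData (Z : Zeros u v S x₀) (H : AdmD u v) :
    ScalarData u v S x₀ (outerFun u v S x₀ 1) (outerFun u v S x₀ 2)
      (innerFun u v S x₀ 1) (innerFun u v S x₀ 2) where
  outer z hz := ⟨glue_of_im _ _ hz.1, glue_of_im _ _ hz.1⟩
  inner z hz := ⟨glue_of_im _ _ hz.1, glue_of_im _ _ hz.1⟩
  arc z hz := ⟨by rw [outerFun, innerFun, glue_of_mem _ _ hz, glue_of_mem _ _ hz]; rfl,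
    by rw [outerFun, innerFun, glue_of_mem _ _ hz, glue_of_mem _ _ hz]; rfl⟩
  sob₁ := Z.memH11Bdry_outerFun H (by decide)
  sob₂ := Z.memH11Bdry_outerFun H (by decide)
  sob₃ := Z.memH11Bdry_innerFun H.toAdm 1
  sob₄ := Z.memH11Bdry_innerFun H.toAdm 2

end AKNS
end

/-! ### Absolutely continuous representatives of H^{1,1} functions. -/

noncomputable section
namespace AKNS

open scoped ENNReal NNReal ContDiff

variable {u v : ℝ → ℂ}

/-! ### Absolutely continuous representatives -/

/-- Vanishing of the total integral makes the primitive from -∞ vanish to the right of the support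
too. -/
theorem exists_contDiff_antideriv {ψ : ℝ → ℝ} (hψ : ContDiff ℝ ∞ ψ) (hc : HasCompactSupport ψ)
    (h0 : ∫ x, ψ x = 0) : ∃ φ : ℝ → ℝ, ContDiff ℝ ∞ φ ∧ HasCompactSupport φ ∧ deriv φ = ψ := by
  have hi : Integrable ψ := hψ.continuous.integrable_of_hasCompactSupport hc
  have hd : ∀ x, HasDerivAt (fun x => ∫ t in Iic x, ψ t) (ψ x) x := fun x => by
    have h1 := (intervalIntegral.integral_hasDerivAt_right (hψ.continuous.intervalIntegrable 0 x)
      (hψ.continuous.stronglyMeasurableAtFilter _ _) hψ.continuous.continuousAt).const_add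
      (∫ t in Iic 0, ψ t)
    refine h1.congr_of_eventuallyEq (Eventually.of_forall fun y => ?_)
    simp only
    rw [← intervalIntegral.integral_Iic_sub_Iic hi.integrableOn hi.integrableOn]
    ring
  have hder : deriv (fun x => ∫ t in Iic x, ψ t) = ψ := funext fun x => (hd x).deriv
  refine ⟨fun x => ∫ t in Iic x, ψ t, contDiff_infty_iff_deriv.2
    ⟨fun x => (hd x).differentiableAt, by rwa [hder]⟩, ?_, hder⟩
  obtain ⟨R, hR⟩ := hc.isCompact.isBounded.subset_closedBall 0
  have hz : ∀ t, R < |t| → ψ t = 0 := fun t ht => by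
    by_contra h
    have := hR (subset_tsupport ψ h)
    rw [mem_closedBall_zero_iff, Real.norm_eq_abs] at this
    linarith
  refine HasCompactSupport.intro (isCompact_closedBall (0 : ℝ) R) fun x hx => ?_
  rw [mem_closedBall_zero_iff, Real.norm_eq_abs, not_le] at hx
  rcases lt_abs.1 hx with h | h
  · rw [setIntegral_eq_integral_of_forall_compl_eq_zero, h0]
    intro t ht
    rw [mem_Iic, not_le] at ht
    exact hz t (lt_abs.2 (Or.inl (h.trans ht)))
  · refine setIntegral_eq_zero_of_forall_eq_zero fun t ht => hz t (lt_abs.2 (Or.inr ?_))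
    rw [mem_Iic] at ht
    linarith

/-- The lemma of du Bois-Reymond. -/
theorem exists_ae_eq_const {f : ℝ → ℂ} (hf : LocallyIntegrable f)
    (h : ∀ φ : ℝ → ℝ, ContDiff ℝ ∞ φ → HasCompactSupport φ → ∫ x, deriv φ x • f x = 0) :
    ∃ c : ℂ, f =ᵐ[volume] fun _ => c := by
  let b : ContDiffBump (0 : ℝ) := ⟨1, 2, by norm_num, by norm_num⟩
  let ψ₀ : ℝ → ℝ := b.normed volume
  have hψ₀ : ContDiff ℝ ∞ ψ₀ := b.contDiff_normed
  have hc₀ : HasCompactSupport ψ₀ := b.hasCompactSupport_normed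
  have hint : ∀ {g : ℝ → ℝ} {f' : ℝ → ℂ}, LocallyIntegrable f' → ContDiff ℝ ∞ g →
      HasCompactSupport g → Integrable fun x => g x • f' x :=
    fun hf' hg hgc => hf'.integrable_smul_left_of_hasCompactSupport hg.continuous hgc
  refine ⟨∫ x, ψ₀ x • f x, ae_eq_of_integral_contDiff_smul_eq hf
    continuous_const.locallyIntegrable fun ψ hψ hc => ?_⟩
  have hi₀ : Integrable ψ₀ := hψ₀.continuous.integrable_of_hasCompactSupport hc₀
  have hi : Integrable ψ := hψ.continuous.integrable_of_hasCompactSupport hc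
  -- Subtracting the mean of ψ times a normalized bump leaves a function of zero integral, hence the
  -- derivative of a test function.
  obtain ⟨φ, h1, h2, h3⟩ := exists_contDiff_antideriv
    (ψ := fun x => ψ x - (∫ y, ψ y) • ψ₀ x) (hψ.sub (hψ₀.const_smul _))
    (hc.sub (hc₀.smul_left (f := fun _ => ∫ y, ψ y))) (by
      rw [integral_sub hi (hi₀.fun_smul _), integral_smul, b.integral_normed]; simp)
  have h4 := h φ h1 h2
  simp only [h3, sub_smul, smul_assoc] at h4
  rw [integral_sub (hint hf hψ hc) ((hint hf hψ₀ hc₀).fun_smul _), integral_smul, sub_eq_zero] at h4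
  rw [h4, integral_smul_const]

theorem Prim.integral_deriv_smul {F g : ℝ → ℂ} (h : Prim F g) {φ : ℝ → ℝ} (hφ : ContDiff ℝ ∞ φ)
    (hc : HasCompactSupport φ) : ∫ x, deriv φ x • F x = -∫ x, φ x • g x := by
  obtain ⟨R, hR⟩ := hc.isCompact.isBounded.subset_closedBall 0
  have hsub : tsupport φ ⊆ Ioc (-(R + 1)) (R + 1) := fun t ht => by
    have := hR ht
    rw [mem_closedBall_zero_iff, Real.norm_eq_abs, abs_le] at this
    constructor <;> linarith
  have hs1 : Function.support (fun x => deriv φ x • F x) ⊆ Ioc (-(R + 1)) (R + 1) :=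
    (Function.support_smul_subset_left _ _).trans ((support_deriv_subset).trans hsub)
  have hs2 : Function.support (fun x => φ x • g x) ⊆ Ioc (-(R + 1)) (R + 1) :=
    (Function.support_smul_subset_left _ _).trans ((subset_tsupport φ).trans hsub)
  have hout : ∀ t, R < |t| → φ t = 0 := fun t ht => by
    by_contra h
    have := hR (subset_tsupport φ h)
    rw [mem_closedBall_zero_iff, Real.norm_eq_abs] at this
    linarith
  have hd : Prim (fun x => (φ x : ℂ)) (fun x => ((deriv φ x : ℝ) : ℂ)) :=
    Prim.of_hasDerivAt (fun x => ((hφ.differentiable (by simp)).differentiableAt.hasDerivAt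
      (x := x)).ofReal_comp) (Complex.continuous_ofReal.comp (contDiff_infty_iff_deriv.1 hφ).2.continuous)
  have hm := (hd.mul h).sub (-(R + 1)) (R + 1)
  have e1 : φ (R + 1) = 0 := hout _ (lt_of_lt_of_le (by linarith) (le_abs_self _))
  have e2 : φ (-(R + 1)) = 0 := hout _ (by rw [abs_neg]; exact lt_of_lt_of_le (by linarith) (le_abs_self _))
  rw [e1, e2, intervalIntegral.integral_add ((hd.int _ _).mul_continuousOn h.cont.continuousOn)
    ((h.int _ _).continuousOn_mul hd.cont.continuousOn)] at hm
  rw [← intervalIntegral.integral_eq_integral_of_support_subset hs1,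
    ← intervalIntegral.integral_eq_integral_of_support_subset hs2]
  simp only [Complex.real_smul]
  simp only [Complex.ofReal_zero, zero_mul, sub_zero] at hm
  linear_combination -hm

/-- Subtracting from f the primitive of its weak derivative leaves a function with zero weak
derivative, which is almost everywhere constant. -/
theorem MemH1On.exists_prim {f : ℝ → ℂ} (h : MemH1On univ f) :
    ∃ F g : ℝ → ℂ, f =ᵐ[volume] F ∧ Measurable g ∧ MemLp g 2 ∧ Prim F g := by
  obtain ⟨hf, g₀, hg₀, hw⟩ := h
  rw [Measure.restrict_univ] at hf hg₀
  have hgm := hg₀.1.stronglyMeasurable_mk.measurable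
  have hge := hg₀.1.ae_eq_mk
  set g := hg₀.1.mk g₀
  have hg : MemLp g 2 := hg₀.ae_eq hge
  have hgl : LocallyIntegrable g := hg.locallyIntegrable (by norm_num)
  have hgi : ∀ a b, IntervalIntegrable g volume a b := fun a b =>
    (hgl.integrableOn_isCompact isCompact_uIcc).intervalIntegrable
  let G : ℝ → ℂ := fun x => ∫ t in (0 : ℝ)..x, g t
  have hG : Prim G g := ⟨hgi, fun a b => intervalIntegral.integral_interval_sub_left (hgi _ _) (hgi _ _)⟩
  have hfl : LocallyIntegrable f := hf.locallyIntegrable (by norm_num)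
  have hGl : LocallyIntegrable G := hG.cont.locallyIntegrable
  obtain ⟨c, hc⟩ := exists_ae_eq_const (f := fun x => f x - G x) (hfl.sub hGl) fun φ hφ hc => by
    have hφ' := (contDiff_infty_iff_deriv.1 hφ).2
    simp only [smul_sub]
    rw [integral_sub (hfl.integrable_smul_left_of_hasCompactSupport hφ'.continuous hc.deriv)
      (hGl.integrable_smul_left_of_hasCompactSupport hφ'.continuous hc.deriv),
      hG.integral_deriv_smul hφ hc]
    have h1 := hw φ hφ hc (subset_univ _)
    simp only [Measure.restrict_univ] at h1
    simp only [Complex.real_smul]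
    rw [h1, sub_neg_eq_add, neg_add_eq_zero]
    exact integral_congr_ae (hge.mono fun x hx => by simp only; rw [hx])
  refine ⟨fun x => G x + c, g, hc.mono fun x hx => ?_, hgm, hg, ?_⟩
  · simp only at hx ⊢
    rw [← hx]; ring
  · exact (hG.add (Prim.const c)).congr_deriv fun x => add_zero _

/-- Pointwise |f| ≤ (1+x²)⁻¹ + (1+x²)|f|², by completing the square. -/
theorem integrable_of_memLp_weight {f : ℝ → ℂ} (h1 : MemLp f 2) (h2 : MemLp (fun x : ℝ => (x : ℂ) * f x) 2) :
    Integrable f := by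
  have i1 : Integrable fun x => ‖f x‖ ^ 2 := h1.integrable_norm_pow (by norm_num)
  have i2 : Integrable fun x : ℝ => ‖(x : ℂ) * f x‖ ^ 2 := h2.integrable_norm_pow (by norm_num)
  refine (integrable_inv_one_add_sq.add (i1.add i2)).mono' h1.1 (Eventually.of_forall fun x => ?_)
  simp only [Pi.add_apply, norm_mul, Complex.norm_real, Real.norm_eq_abs, mul_pow, sq_abs]
  have hw : 0 < 1 + x ^ 2 := by positivity
  set t := ‖f x‖
  have key : (1 + x ^ 2)⁻¹ + (t ^ 2 + x ^ 2 * t ^ 2) - t =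
      (1 + x ^ 2)⁻¹ * (((1 + x ^ 2) * t - 1 / 2) ^ 2 + 3 / 4) := by
    field_simp; ring
  have : 0 ≤ (1 + x ^ 2)⁻¹ + (t ^ 2 + x ^ 2 * t ^ 2) - t := by rw [key]; positivity
  linarith

theorem MemH11.exists_admissible (hu : MemH11 u) (hv : MemH11 v) :
    ∃ u' v' : ℝ → ℂ, u =ᵐ[volume] u' ∧ v =ᵐ[volume] v' ∧ AdmD u' v' := by
  have key : ∀ {f : ℝ → ℂ}, MemH11 f → ∃ F g : ℝ → ℂ, f =ᵐ[volume] F ∧ Measurable g ∧ MemLp g 2 ∧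
      Prim F g ∧ MemLp F 2 ∧ MemLp (fun x : ℝ => (x : ℂ) * F x) 2 := fun {f} hf => by
    obtain ⟨F, g, h1, h2, h3, h4⟩ := hf.1.exists_prim
    have hf1 := hf.1.1
    have hf2 := hf.2
    rw [Measure.restrict_univ] at hf1 hf2
    exact ⟨F, g, h1, h2, h3, h4, hf1.ae_eq h1, hf2.ae_eq (h1.mono fun x hx => by simp only; rw [hx])⟩
  obtain ⟨U, g, h1, h2, h3, h4, h5, h6⟩ := key hu
  obtain ⟨V, k, k1, k2, k3, k4, k5, k6⟩ := key hv
  refine ⟨U, V, h1, k1, ⟨⟨h4.cont.measurable, k4.cont.measurable, integrable_of_memLp_weight h5 h6,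
    integrable_of_memLp_weight k5 k6⟩, h5.norm.add k5.norm, ?_⟩, ⟨g, h2, h3, h4⟩, ⟨k, k2, k3, k4⟩⟩
  have e : ∀ f : ℝ → ℂ, Continuous f → MemLp (fun x : ℝ => (x : ℂ) * f x) 2 →
      MemLp (fun x : ℝ => x * ‖f x‖) 2 := fun f hc hf => by
    refine hf.of_le (continuous_id.mul hc.norm).aestronglyMeasurable (Eventually.of_forall fun x => ?_)
    simp
  refine ((e U h4.cont h6).add (e V k4.cont k6)).ae_eq (Eventually.of_forall fun x => ?_)
  simp only [Pi.add_apply, wt]; ring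

end AKNS
end

/-! ### Invariance under changes on null sets, small potentials, and the theorem for good
representatives. -/

noncomputable section
namespace AKNS

variable {u v u' v' : ℝ → ℂ} {S x₀ : ℝ} {z : ℂ}

/-! ### Dependence on the almost everywhere class of the potential -/

theorem potential_congr_ae (hu : u =ᵐ[volume] u') (hv : v =ᵐ[volume] v') :
    ∀ᵐ y, potential u v y = potential u' v' y := by
  filter_upwards [hu, hv] with y h1 h2
  simp only [potential, h1, h2]

/-- The predicates are equal as functions, so `Classical.epsilon` makes the same choice for both
potentials, whether or not solutions exist; all derived objects then coincide. -/
theorem isJostMinus_congr_ae (hu : u =ᵐ[volume] u') (hv : v =ᵐ[volume] v') :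
    IsJostMinus u v = IsJostMinus u' v' := by
  funext j z f
  unfold IsJostMinus
  have : ∀ x : ℝ, ∫ y in Iic x, expAdCol j (Complex.I * z * (x - y)) ((potential u v y).mulVec (f y)) =
      ∫ y in Iic x, expAdCol j (Complex.I * z * (x - y)) ((potential u' v' y).mulVec (f y)) := fun x =>
    integral_congr_ae (ae_restrict_of_ae ((potential_congr_ae hu hv).mono fun y hy => by
      simp only; rw [hy]))
  simp_rw [this]

theorem isJostPlus_congr_ae (hu : u =ᵐ[volume] u') (hv : v =ᵐ[volume] v') :
    IsJostPlus u v = IsJostPlus u' v' := by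
  funext j z f
  unfold IsJostPlus
  have : ∀ x : ℝ, ∫ y in Ioi x, expAdCol j (Complex.I * z * (x - y)) ((potential u v y).mulVec (f y)) =
      ∫ y in Ioi x, expAdCol j (Complex.I * z * (x - y)) ((potential u' v' y).mulVec (f y)) := fun x =>
    integral_congr_ae (ae_restrict_of_ae ((potential_congr_ae hu hv).mono fun y hy => by
      simp only; rw [hy]))
  simp_rw [this]

theorem isVolterra_congr_ae (hu : u =ᵐ[volume] u') (hv : v =ᵐ[volume] v') :
    IsVolterra u v = IsVolterra u' v' := by
  funext a j z f
  unfold IsVolterra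
  have : ∀ x : ℝ, ∫ y in a..x, expAdCol j (Complex.I * z * (x - y)) ((potential u v y).mulVec (f y)) =
      ∫ y in a..x, expAdCol j (Complex.I * z * (x - y)) ((potential u' v' y).mulVec (f y)) := fun x =>
    intervalIntegral.integral_congr_ae ((potential_congr_ae hu hv).mono fun y hy _ => by rw [hy])
  simp_rw [this]

theorem jostMinus_congr_ae (hu : u =ᵐ[volume] u') (hv : v =ᵐ[volume] v') :
    jostMinus u v = jostMinus u' v' := by
  funext j x z
  rw [jostMinus, jostMinus, isJostMinus_congr_ae hu hv]

theorem jostPlus_congr_ae (hu : u =ᵐ[volume] u') (hv : v =ᵐ[volume] v') :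
    jostPlus u v = jostPlus u' v' := by
  funext j x z
  rw [jostPlus, jostPlus, isJostPlus_congr_ae hu hv]

theorem s₁₁_congr_ae (hu : u =ᵐ[volume] u') (hv : v =ᵐ[volume] v') : s₁₁ u v = s₁₁ u' v' := by
  funext z
  rw [s₁₁, s₁₁, jostMinus_congr_ae hu hv, jostPlus_congr_ae hu hv]

theorem cutRight_congr_ae (a : ℝ) (hu : u =ᵐ[volume] u') : cutRight a u =ᵐ[volume] cutRight a u' :=
  hu.mono fun x hx => by by_cases h : x ∈ Ioi a <;> simp [cutRight, h, hx]

theorem cutLeft_congr_ae (a : ℝ) (hu : u =ᵐ[volume] u') : cutLeft a u =ᵐ[volume] cutLeft a u' :=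
  hu.mono fun x hx => by by_cases h : x ∈ Iio a <;> simp [cutLeft, h, hx]

theorem scatMat_congr_ae (hu : u =ᵐ[volume] u') (hv : v =ᵐ[volume] v') :
    scatMat u v = scatMat u' v' := by
  funext t
  simp only [scatMat, mPlus, mMinus, jostMinus_congr_ae hu hv, jostPlus_congr_ae hu hv]

theorem rho₁_congr_ae (hu : u =ᵐ[volume] u') (hv : v =ᵐ[volume] v') : rho₁ u v = rho₁ u' v' := by
  funext t
  simp only [rho₁, scatMat_congr_ae hu hv]

theorem rho₂_congr_ae (hu : u =ᵐ[volume] u') (hv : v =ᵐ[volume] v') : rho₂ u v = rho₂ u' v' := by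
  funext t
  simp only [rho₂, scatMat_congr_ae hu hv]

theorem bc_congr_ae (hu : u =ᵐ[volume] u') (hv : v =ᵐ[volume] v') :
    bcUpper u v = bcUpper u' v' ∧ bcLower u v = bcLower u' v' ∧
      bcUpper' u v = bcUpper' u' v' ∧ bcLower' u v = bcLower' u' v' := by
  refine ⟨?_, ?_, ?_, ?_⟩ <;> funext x z <;>
    simp only [bcUpper, bcLower, bcUpper', bcLower', t₁₁, s₁₁_congr_ae hu hv,
      jostMinus_congr_ae hu hv, jostPlus_congr_ae hu hv]

theorem volterra_congr_ae (hu : u =ᵐ[volume] u') (hv : v =ᵐ[volume] v') :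
    volterra u v = volterra u' v' := by
  funext a x z
  simp only [volterra, isVolterra_congr_ae hu hv]

theorem bigM_congr_ae (hu : u =ᵐ[volume] u') (hv : v =ᵐ[volume] v') :
    bigM u v = bigM u' v' := by
  funext x₀ R x z
  have h := bc_congr_ae hu hv
  have h0 := bc_congr_ae (cutRight_congr_ae x₀ hu) (cutRight_congr_ae x₀ hv)
  cases R <;> simp only [bigM, h.1, h.2.1, h0.1, h0.2.1, volterra_congr_ae hu hv]

theorem bigM'_congr_ae (hu : u =ᵐ[volume] u') (hv : v =ᵐ[volume] v') :
    bigM' u v = bigM' u' v' := by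
  funext x₀ R x z
  have h := bc_congr_ae hu hv
  have h0 := bc_congr_ae (cutLeft_congr_ae (-x₀) hu) (cutLeft_congr_ae (-x₀) hv)
  cases R <;> simp only [bigM', h.2.2.1, h.2.2.2, h0.2.2.1, h0.2.2.2, volterra_congr_ae hu hv]

theorem jumpV_congr_ae (hu : u =ᵐ[volume] u') (hv : v =ᵐ[volume] v') :
    jumpV u v = jumpV u' v' := by
  funext S x₀ z
  have hu0 := cutRight_congr_ae x₀ hu
  have hv0 := cutRight_congr_ae x₀ hv
  simp only [jumpV, bigM_congr_ae hu hv, rho₁_congr_ae hu hv, rho₂_congr_ae hu hv,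
    rho₁_congr_ae hu0 hv0, rho₂_congr_ae hu0 hv0]

theorem jumpV'_congr_ae (hu : u =ᵐ[volume] u') (hv : v =ᵐ[volume] v') :
    jumpV' u v = jumpV' u' v' := by
  funext S x₀ z
  simp only [jumpV', auxA, jumpV_congr_ae hu hv, bigM_congr_ae hu hv, bigM'_congr_ae hu hv]

/-! ### Small potentials -/

/-- By `s₁₁_eq_pr`, s₁₁ pairs two columns whose entries are within (1/5) e^{1/5} ≤ (1/5)(5/4) = 1/4
of those of e₁. -/
theorem s₁₁_ne_zero_of_small (hP : Pot u v) (h : ∫ y, wt u v y ≤ 1 / 5) (hz : 0 ≤ z.im) :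
    s₁₁ u v z ≠ 0 := by
  have hw0 : 0 ≤ ∫ y, wt u v y := integral_nonneg (wt_nonneg u v)
  have hexp : Real.exp (∫ y, wt u v y) ≤ 5 / 4 := by
    refine (Real.exp_le_exp.2 h).trans ?_
    have := Real.exp_bound_div_one_sub_of_interval (x := 1 / 5) (by norm_num) (by norm_num)
    norm_num at this ⊢
    exact this
  have hm : ∀ {u v : ℝ → ℂ} {j : Fin 3} {w : ℂ} (_ : Pot u v) (_ : ∫ y, wt u v y ≤ 1 / 5)
      (_ : Real.exp (∫ y, wt u v y) ≤ 5 / 4) (_ : Good j w) (x : ℝ) (i : Fin 3),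
      ‖jostMinus u v j x w i - (Pi.single j 1 : Fin 3 → ℂ) i‖ ≤ 1 / 4 := by
    intro u v j w hP h he hg x i
    have h1 := norm_jostMinus_sub_le hP hg x
    have h2 := norm_le_pi_norm (jostMinus u v j x w - Pi.single j 1) i
    have h3 := cumul_le hP.wt_int (wt_nonneg u v) x
    have h4 := mul_le_mul (h3.trans h) he (Real.exp_pos _).le (by norm_num)
    rw [Pi.sub_apply] at h2
    exact (h2.trans (h1.trans h4)).trans (by norm_num)
  have hg : Good 0 (-star z) := good_neg_zero.2 (by rw [im_star]; linarith)
  have hp : ∀ i, ‖jostPlus u v 0 0 (star z) i - (Pi.single 0 1 : Fin 3 → ℂ) i‖ ≤ 1 / 4 := fun i => by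
    rw [jostPlus_eq hP hg]
    exact hm hP.refl (by rwa [integral_wt_refl]) (by rwa [integral_wt_refl]) hg _ i
  have hm' := hm hP h hexp (good_zero.2 hz) 0
  intro h0
  rw [s₁₁_eq_pr hP hz 0, pr_eq] at h0
  have p0 := hp 0; have p1 := hp 1; have p2 := hp 2
  have m0 := hm' 0; have m1 := hm' 1; have m2 := hm' 2
  simp only [Pi.single_eq_same, Pi.single_eq_of_ne (show (1 : Fin 3) ≠ 0 by decide),
    Pi.single_eq_of_ne (show (2 : Fin 3) ≠ 0 by decide), sub_zero] at p0 p1 p2 m0 m1 m2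
  generalize jostPlus u v 0 0 (star z) = p at *
  generalize jostMinus u v 0 0 z = m at *
  -- If s₁₁ vanished, -1 would be a sum of terms of total modulus at most 1/4 + 1/4 + 3/16 < 1.
  have e : (-1 : ℂ) = star (p 0 - 1) + (m 0 - 1) + star (p 0 - 1) * (m 0 - 1) + star (p 1) * m 1 +
      star (p 2) * m 2 := by
    rw [star_sub, star_one]; linear_combination -h0
  have hmul : ∀ a b : ℂ, ‖a‖ ≤ 1 / 4 → ‖b‖ ≤ 1 / 4 → ‖star a * b‖ ≤ 1 / 16 := fun a b ha hb => by
    rw [norm_mul, norm_star]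
    exact (mul_le_mul ha hb (norm_nonneg _) (by norm_num)).trans (by norm_num)
  have e1 : ‖(-1 : ℂ)‖ = 1 := by simp
  rw [e] at e1
  have t1 := norm_add_le (star (p 0 - 1) + (m 0 - 1) + star (p 0 - 1) * (m 0 - 1) + star (p 1) * m 1)
    (star (p 2) * m 2)
  have t2 := norm_add_le (star (p 0 - 1) + (m 0 - 1) + star (p 0 - 1) * (m 0 - 1)) (star (p 1) * m 1)
  have t3 := norm_add_le (star (p 0 - 1) + (m 0 - 1)) (star (p 0 - 1) * (m 0 - 1))
  have t4 := norm_add_le (star (p 0 - 1)) (m 0 - 1)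
  rw [norm_star] at t4
  have := hmul _ _ p0 m0
  have := hmul _ _ p1 m1
  have := hmul _ _ p2 m2
  linarith

theorem integral_wt_cutRight (a : ℝ) (u v : ℝ → ℂ) :
    ∫ y, wt (cutRight a u) (cutRight a v) y = ∫ y in Ioi a, (‖u y‖ + ‖v y‖) := by
  rw [← integral_indicator measurableSet_Ioi]
  refine integral_congr_ae (Eventually.of_forall fun y => ?_)
  by_cases h : y ∈ Ioi a <;> simp [wt, cutRight, h]

theorem integral_wt_cutLeft (a : ℝ) (u v : ℝ → ℂ) :
    ∫ y, wt (cutLeft a u) (cutLeft a v) y = ∫ y in Iio a, (‖u y‖ + ‖v y‖) := by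
  rw [← integral_indicator measurableSet_Iio]
  refine integral_congr_ae (Eventually.of_forall fun y => ?_)
  by_cases h : y ∈ Iio a <;> simp [wt, cutLeft, h]

theorem AdmD.scattering_factorization (H : AdmD u v) (hS : 0 < S)
    (hs : ∀ z : ℂ, 0 ≤ z.im → S ≤ ‖z‖ → s₁₁ u v z ≠ 0)
    (hx : ∫ x in Ioi x₀, (‖u x‖ + ‖v x‖) < 1 / 5) :
    (∀ z : ℂ, 0 ≤ z.im → s₁₁ (AKNS.cutRight x₀ u) (AKNS.cutRight x₀ v) z ≠ 0) ∧
    (∃ Vm Vp : ℂ → Mat,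
      IsTriangularFactorization S StrictLower StrictUpper (jumpV u v S x₀) Vm Vp) ∧
    ((∫ x in Iio (-x₀), (‖u x‖ + ‖v x‖)) < 1 / 5 →
      (∀ z : ℂ, 0 ≤ z.im → s₁₁ (cutLeft (-x₀) u) (cutLeft (-x₀) v) z ≠ 0) ∧
      ∃ Vm Vp : ℂ → Mat,
        IsTriangularFactorization S StrictUpper StrictLower (jumpV' u v S x₀) Vm Vp) := by
  have hP := H.pot
  have h0 : ∀ z : ℂ, 0 ≤ z.im → s₁₁ (AKNS.cutRight x₀ u) (AKNS.cutRight x₀ v) z ≠ 0 := fun z hz =>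
    s₁₁_ne_zero_of_small (hP.cutRight x₀) (by rw [integral_wt_cutRight]; exact hx.le) hz
  have Z : Zeros u v S x₀ := ⟨hP, hS, hs, h0⟩
  refine ⟨h0, ⟨_, _, Z.isTriangularFactorization (Z.scalarData H)⟩, fun hx' => ?_⟩
  have hl : ∫ y, wt (cutLeft (-x₀) u) (cutLeft (-x₀) v) y ≤ 1 / 5 := by
    rw [integral_wt_cutLeft]; exact hx'.le
  -- The exterior condition is invariant under z ↦ -z*, and the cut-off of the reflected potential
  -- to (x₀, ∞) is the reflection of the cut-off to (-∞, -x₀).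
  have Z' : Zeros (AKNS.refl u) (AKNS.refl v) S x₀ := by
    refine ⟨hP.refl, hS, fun z hz hSz => s₁₁_refl_ne hP hz (hs _ ?_ ?_), fun z hz => ?_⟩
    · rw [Complex.neg_im, im_star, neg_neg]; exact hz
    · rwa [norm_neg, norm_star]
    · have hc := (hP.cutLeft (-x₀)).refl
      rw [← refl_cutLeft, ← refl_cutLeft]
      exact s₁₁_ne_zero_of_small hc (by rwa [integral_wt_refl]) hz
  exact ⟨fun z hz => s₁₁_ne_zero_of_small (hP.cutLeft (-x₀)) hl hz,
    _, _, Z.isTriangularFactorization' Z' (Z'.scalarData H.refl)⟩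

end AKNS
end

/-! ### The theorem, by passage to absolutely continuous representatives. -/

open AKNS
theorem proposition5p4 :
    ∃ δ : ℝ, 0 < δ ∧
      ∀ u v : ℝ → ℂ, MemH11 u → MemH11 v →
      ∀ S : ℝ, 0 < S → (∀ z : ℂ, 0 ≤ z.im → S ≤ ‖z‖ → s₁₁ u v z ≠ 0) →
      ∀ x₀ : ℝ, (∫ x in Set.Ioi x₀, (‖u x‖ + ‖v x‖)) < δ →
        (∀ z : ℂ, 0 ≤ z.im → s₁₁ (cutRight x₀ u) (cutRight x₀ v) z ≠ 0) ∧
        (∃ Vm Vp : ℂ → Mat,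
          IsTriangularFactorization S StrictLower StrictUpper (jumpV u v S x₀) Vm Vp) ∧
        ((∫ x in Set.Iio (-x₀), (‖u x‖ + ‖v x‖)) < δ →
          (∀ z : ℂ, 0 ≤ z.im → s₁₁ (cutLeft (-x₀) u) (cutLeft (-x₀) v) z ≠ 0) ∧
          ∃ Vm' Vp' : ℂ → Mat,
            IsTriangularFactorization S StrictUpper StrictLower (jumpV' u v S x₀) Vm' Vp') := by
  -- The constant is the smallness threshold of `s₁₁_ne_zero_of_small`.
  refine ⟨1 / 5, by norm_num, fun u v hu hv S hS hs x₀ hx => ?_⟩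
  obtain ⟨u', v', eu, ev, H⟩ := MemH11.exists_admissible hu hv
  have hi : ∀ s : Set ℝ, ∫ x in s, (‖u x‖ + ‖v x‖) = ∫ x in s, (‖u' x‖ + ‖v' x‖) := fun s =>
    MeasureTheory.integral_congr_ae (MeasureTheory.ae_restrict_of_ae (by
      filter_upwards [eu, ev] with x h1 h2
      rw [h1, h2]))
  rw [s₁₁_congr_ae eu ev] at hs
  rw [hi] at hx
  rw [hi, s₁₁_congr_ae (cutRight_congr_ae x₀ eu) (cutRight_congr_ae x₀ ev),
    s₁₁_congr_ae (cutLeft_congr_ae (-x₀) eu) (cutLeft_congr_ae (-x₀) ev),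
    jumpV_congr_ae eu ev, jumpV'_congr_ae eu ev]
  exact H.scattering_factorization hS hs hx
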